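/- **Setting.** Let $N\ge 3$, $I=\mathbb Z/N\mathbb Z$, and let $q,\kappa,u\in\mathbb C^\times$ with $q,\kappa$ generic in the sense that $q^m\kappa^n=1$ with $m,n\in\mathbb Z$ only for $m=n=0$. Let $p$ be a formal variable. Put $a_{ij}=2\delta_{i,j}-\delta_{i,j+1}-\delta_{i+1,j}$ and $m_{ij}=\delta_{i,j+1}-\delta_{i+1,j}$ for $i,j\in I$ (indices modulo $N$), and $[n]=\frac{q^n-q^{-n}}{q-q^{-1}}$. Let $H=\mathfrak h\oplus H_P$, where $\mathfrak h$ has basis $h_i$ $(i\in I)$, $d$ and $H_P$ has basis $P_i$ $(i\in I)$; let $\alpha_j,Q_j\in H^*$ be given by $\langle\alpha_j,h_i\rangle=a_{ij}$, $\langle\alpha_j,d\rangle=\delta_{j,0}$, $\langle\alpha_j,P_i\rangle=0$ and $\langle Q_j,P_i\rangle=a_{ji}$, $\langle Q_j,h_i\rangle=\langle Q_j,d\rangle=0$. Let $\mathbb F$ be the field of meromorphic functions $g=g(h,P)$ on $H^*$; for $\beta\in H^*$ put $(\tau_\beta g)(\mu)=g(\mu+\beta)$, and let $\tau_\beta$ act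 coefficientwise on $\mathbb F[[p]]$. **The algebra.** $U'_{q,\kappa,p}(\mathfrak{gl}_{N,tor})$ is the topological algebra over $\mathbb F[[p]]$ generated by $\alpha^\vee_{i,l}$ $(l\ne0)$, $x^\pm_{i,n}$ $(n\in\mathbb Z)$, invertible $K_i^\pm$, and central $q^{\pm c/2}$ $(i\in I)$. With $p^*=pq^{-2c}$, $x_i^\pm(z)=\sum_n x^\pm_{i,n}z^{-n}$, $\delta(z)=\sum_{n\in\mathbb Z}z^n$, define $\phi_i^\pm(z)$ by $$\phi^+_i(q^{c/2}z)=K_i^+\exp\Big(-(q-q^{-1})\sum_{n>0}\tfrac{p^n\alpha^\vee_{i,-n}}{1-p^n}z^n\Big)\exp\Big((q-q^{-1})\sum_{n>0}\tfrac{\alpha^\vee_{i,n}}{1-p^n}z^{-n}\Big),$$ $$\phi^-_i(q^{-c/2}z)=K_i^-\exp\Big(-(q-q^{-1})\sum_{n>0}\tfrac{\alpha^\vee_{i,-n}}{1-p^n}z^n\Big)\exp\Big((q-q^{-1})\sum_{n>0}\tfrac{p^n\alpha^\vee_{i,n}}{1-p^n}z^{-n}\Big),$$ and $g_{ij}(z;s)=\exp\big(-\sum_{m>0}\frac1m\frac{q^{a_{ij}m}-q^{-a_{ij}m}}{1-s^m}(sz)^m\big)\in\mathbb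 C[[s]][[z]]$. The defining relations, between formal Laurent series whose coefficients are well defined in the $p$-adic topology, are: $\prod_iK_i^\pm$ is central; for $g\in\mathbb F[[p]]$, $$g\,x_j^+(z)=x_j^+(z)\,\tau_{\alpha_j-Q_j}g,\quad g\,x_j^-(z)=x_j^-(z)\,\tau_{-\alpha_j}g,\quad g\,K_j^\pm=K_j^\pm\,\tau_{-Q_j}g,\quad [g,\alpha^\vee_{j,l}]=0;$$ $$[K_i^\pm,K_j^\pm]=[K_i^+,K_j^-]=[K_i^\pm,\alpha^\vee_{j,l}]=0,\quad K_i^\pm x_j^+(z)=q^{\pm a_{ij}}x_j^+(z)K_i^\pm,\quad K_i^\pm x_j^-(z)=q^{\mp a_{ij}}x_j^-(z)K_i^\pm;$$ $$[\alpha^\vee_{i,l},\alpha^\vee_{j,m}]=\delta_{l+m,0}\tfrac{[a_{ij}l]}{l}\tfrac{q^{lc}-q^{-lc}}{q-q^{-1}}\tfrac{1-p^l}{1-p^{*l}}\kappa^{-lm_{ij}}q^{-lc},$$ $$[\alpha^\vee_{i,l},x_j^+(z)]=\tfrac{[a_{ij}l]}{l}\tfrac{1-p^l}{1-p^{*l}}q^{-lc}\kappa^{-lm_{ij}}z^lx_j^+(z),\qquad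 [\alpha^\vee_{i,l},x_j^-(z)]=-\tfrac{[a_{ij}l]}{l}\kappa^{-lm_{ij}}z^lx_j^-(z);$$ $$(\kappa^{m_{ij}}z-q^{a_{ij}}w)\,g_{ij}(\kappa^{-m_{ij}}\tfrac wz;p^*)\,x_i^+(z)x_j^+(w)=(\kappa^{m_{ij}}q^{a_{ij}}z-w)\,g_{ij}(\kappa^{m_{ij}}\tfrac zw;p^*)\,x_j^+(w)x_i^+(z),$$ $$(\kappa^{m_{ij}}z-q^{-a_{ij}}w)\,g_{ij}(\kappa^{-m_{ij}}\tfrac wz;p)^{-1}x_i^-(z)x_j^-(w)=(\kappa^{m_{ij}}q^{-a_{ij}}z-w)\,g_{ij}(\kappa^{m_{ij}}\tfrac zw;p)^{-1}x_j^-(w)x_i^-(z);$$ $$[x_i^+(z),x_j^-(w)]=\tfrac{\delta_{ij}}{q-q^{-1}}\big(\delta(q^c\tfrac wz)\phi_i^+(q^{c/2}w)-\delta(q^{-c}\tfrac wz)\phi_i^-(q^{c/2}z)\big);$$ $[x_i^\pm(z),x_j^\pm(w)]=0$ if $a_{ij}=0$; and, if $a_{ij}=-1$, with $(\gamma_{ab}(t))=(g_{ab}(t;p^*))$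 for the sign $+$ and $(\gamma_{ab}(t))=(g_{ab}(t;p)^{-1})$ for the sign $-$, $$\sum_{\sigma\in\mathfrak S_2}\gamma_{ii}\big(\tfrac{z_{\sigma(2)}}{z_{\sigma(1)}}\big)\Big\{\gamma_{ij}(\kappa^{m_{ij}}\tfrac{z_{\sigma(1)}}w)\gamma_{ij}(\kappa^{m_{ij}}\tfrac{z_{\sigma(2)}}w)\,x_j^\pm(w)x_i^\pm(z_{\sigma(1)})x_i^\pm(z_{\sigma(2)})-[2]\,\gamma_{ij}(\kappa^{-m_{ij}}\tfrac w{z_{\sigma(1)}})\gamma_{ij}(\kappa^{m_{ij}}\tfrac{z_{\sigma(2)}}w)\,x_i^\pm(z_{\sigma(1)})x_j^\pm(w)x_i^\pm(z_{\sigma(2)})$$ $$\qquad+\gamma_{ij}(\kappa^{-m_{ij}}\tfrac w{z_{\sigma(1)}})\gamma_{ij}(\kappa^{-m_{ij}}\tfrac w{z_{\sigma(2)}})\,x_i^\pm(z_{\sigma(1)})x_i^\pm(z_{\sigma(2)})x_j^\pm(w)\Big\}=0.$$ A module has level $(0,1)$ if $q^{c/2}$ acts as $1$ and $\prod_iK_i^+$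 acts as $q^{-1}$. **The $q$-Fock space.** Put $(a;p)_\infty=\prod_{n\ge0}(1-ap^n)$, $\theta(x)=(x;p)_\infty(p/x;p)_\infty$ (formal power series in $p$), $C_\pm=(pq^{\pm2};p)_\infty/(p;p)_\infty$, $q_1=\kappa q^{-1}$, $q_3=\kappa^{-1}q^{-1}$. Fix $k\in I$. Let $\mathfrak F^{(k)}(u)$ be the free $\mathbb F[[p]]$-module with basis $|\lambda\rangle$ indexed by all partitions $\lambda=(\lambda_1\ge\lambda_2\ge\cdots)$; let $l(\lambda)$ be the length, $u_s=q_1^{\lambda_s}q_3^{s-1}u$ for $s\ge1$, and $\lambda\pm\mathbf 1_i=(\dots,\lambda_i\pm1,\dots)$. Set $|\lambda\pm\mathbf 1_i\rangle=0$ if $\lambda\pm\mathbf 1_i$ is not a partition. Let $e^{-Q_j}$ be the shift operator on $\mathfrak F^{(k)}(u)$ that fixes every $|\lambda\rangle$ and satisfies $g\,e^{-Q_j}=e^{-Q_j}\,\tau_{-Q_j}g$. With $\equiv$ denoting congruence modulo $N$, consider $$\phi_j^\pm(z)|\lambda\rangle=\prod_{\substack{1\le s\le l(\lambda)\\ \lambda_s+j\equiv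 s+k}}q\,\frac{\theta(q_3u_s/z)}{\theta(q_1^{-1}u_s/z)}\Big|_\pm\ \prod_{\substack{1\le s\le l(\lambda)+1\\ \lambda_s+j+1\equiv s+k}}q^{-1}\frac{\theta(q_1^{-1}q_3^{-1}u_s/z)}{\theta(u_s/z)}\Big|_\pm\ e^{-Q_j}|\lambda\rangle,\tag{1}$$ $$x_j^+(z)|\lambda\rangle=C_+\sum_{\substack{1\le i\le l(\lambda)+1\\ \lambda_i+j+1\equiv i+k}}\delta(u_i/z)\,A^+_{\lambda,i}\,e^{-Q_j}|\lambda+\mathbf 1_i\rangle,\tag{2}$$ $$x_j^-(z)|\lambda\rangle=C_-\sum_{\substack{1\le i\le l(\lambda)\\ \lambda_i+j\equiv i+k}}\delta(q_1^{-1}u_i/z)\,A^-_{\lambda,i}\,|\lambda-\mathbf 1_i\rangle,\tag{3}$$ $$A^+_{\lambda,i}=\prod_{\substack{1\le s\le i-1\\ \lambda_s+j\equiv s+k}}q^{-1}\frac{\theta(q_3^{-1}u_i/u_s)}{\theta(q_1u_i/u_s)}\prod_{\substack{1\le s\le i-1\\ \lambda_s+j+1\equiv s+k}}q\,\frac{\theta(q_1q_3u_i/u_s)}{\theta(u_i/u_s)},$$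 $$A^-_{\lambda,i}=\prod_{\substack{i<s\le l(\lambda)\\ \lambda_s+j\equiv s+k}}q\,\frac{\theta(q_1q_3u_s/u_i)}{\theta(u_s/u_i)}\prod_{\substack{i<s\le l(\lambda)+1\\ \lambda_s+j+1\equiv s+k}}q^{-1}\frac{\theta(q_3^{-1}u_s/u_i)}{\theta(q_1u_s/u_i)}.$$ Here $|_+$ (resp. $|_-$) denotes the expansion of each factor, with denominator $\theta(a/z)$, in the region $|p|<|a/z|<1$ (resp. $1<|a/z|<|p^{-1}|$), i.e. in $\mathbb C((z^{-1}))[[p]]$ (resp. $\mathbb C((z))[[p]]$). **Theorem.** There are operators $\alpha^\vee_{j,l}$, $K_j^\pm$, $x_{j,n}^\pm$ and $\phi_{j,n}^\pm$ $(j\in I,\ l\in\mathbb Z\setminus\{0\},\ n\in\mathbb Z)$ on $\mathfrak F^{(k)}(u)$ such that 1. with $q^{c/2}=1$ they satisfy all the above relations, including the expressions of $\phi_j^\pm(z)$ through $K_j^\pm$ and $\alpha^\vee_{j,l}$, so that $\mathfrak F^{(k)}(u)$ is a representation of $U'_{q,\kappa,p}(\mathfrak{gl}_{N,tor})$; 2.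 $\phi_j^\pm(z)$ and $x_j^\pm(z)$ act on the basis vectors by (1), (2), (3); 3. the representation has level $(0,1)$; 4. it is irreducible over $\mathbb F((p))$: for every nonzero $\mathbb F[[p]]$-submodule $W\subseteq\mathfrak F^{(k)}(u)$ that is stable under all $\alpha^\vee_{j,l}$, $x^\pm_{j,n}$, $K^\pm_j$, every $v\in\mathfrak F^{(k)}(u)$ satisfies $p^nv\in W$ for some $n\ge0$; 5. it is a lowest weight representation with lowest weight vector $|\emptyset\rangle$: $x_j^-(z)|\emptyset\rangle=0$ for all $j\in I$, $|\emptyset\rangle$ generates $\mathfrak F^{(k)}(u)$ (the only $\mathbb F[[p]]$-submodule stable under all $\alpha^\vee_{j,l},x^\pm_{j,n},K^\pm_j$ and containing $|\emptyset\rangle$ is the whole space), and $$\phi_j^\pm(z)|\emptyset\rangle=\left(q^{-1}\frac{\theta(q^2u/z)}{\theta(u/z)}\right)^{\delta_{j,k}}\Big|_\pm\,|\emptyset\rangle\qquad(j\in I).$$ -/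

import Mathlib

open scoped PowerSeries

namespace EllTor

noncomputable section

/-! ### The field of meromorphic functions on `H^*` and its shifts -/

/-- The space `H^* = 𝔥^* ⊕ H_P^*` for the affine Cartan matrix of type `A_{N-1}^{(1)}`.
A point `μ` is given by its pairings `⟨μ, h_i⟩` (`i ∈ I = ℤ/N`), `⟨μ, d⟩` and `⟨μ, P_i⟩`
(`i ∈ I`) with the basis `h_i, d` of `𝔥` and the basis `P_i` of `H_P`. -/
abbrev HStar (N : ℕ) : Type := (ZMod N → ℂ) × ℂ × (ZMod N → ℂ)

/-- The generalized Cartan matrix `a_{ij} = b_{ij}` of type `A_{N-1}^{(1)}`. -/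
def cartan (N : ℕ) (i j : ZMod N) : ℤ :=
  (if i = j then 2 else 0) - (if i = j + 1 then 1 else 0) - (if j = i + 1 then 1 else 0)

/-- The matrix `m_{ij} = δ_{i,j+1} - δ_{i+1,j}` (indices modulo `N`). -/
def mMat (N : ℕ) (i j : ZMod N) : ℤ :=
  (if i = j + 1 then 1 else 0) - (if i + 1 = j then 1 else 0)

/-- The simple root `α_j ∈ 𝔥^* ⊆ H^*`: `⟨α_j, h_i⟩ = a_{ij}`, `⟨α_j, d⟩ = δ_{j,0}`. -/
def rootA (N : ℕ) (j : ZMod N) : HStar N :=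
  (fun i => (cartan N i j : ℂ), if j = 0 then 1 else 0, 0)

/-- The element `Q_j ∈ H_P^* ⊆ H^*`: `⟨Q_j, P_i⟩ = a_{ji}`. -/
def rootQ (N : ℕ) (j : ZMod N) : HStar N :=
  (0, 0, fun i => (cartan N j i : ℂ))

/-- The ring of entire functions on `H^*`. -/
def Entire (N : ℕ) [NeZero N] : Subalgebra ℂ (HStar N → ℂ) where
  carrier := {f | AnalyticOnNhd ℂ f Set.univ}
  mul_mem' hf hg := hf.mul hg
  add_mem' hf hg := hf.add hg
  algebraMap_mem' _ := analyticOnNhd_const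

instance (N : ℕ) [NeZero N] : IsDomain (Entire N) := by
  have : NoZeroDivisors (Entire N) := by
    refine ⟨?_⟩
    intro f g hfg
    by_contra! hne
    obtain ⟨hf, hg⟩ := hne
    have hx : ∃ x, f.1 x ≠ 0 := by
      by_contra! h
      exact hf (Subtype.ext (funext h))
    obtain ⟨x, hx⟩ := hx
    apply hg
    have hev : g.1 =ᶠ[nhds x] 0 := by
      have hc : ContinuousAt f.1 x := (f.2 x (Set.mem_univ x)).continuousAt
      filter_upwards [hc.eventually_ne hx] with y hy
      have h0 : f.1 y * g.1 y = 0 := congrFun (congrArg Subtype.val hfg) y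
      exact (mul_eq_zero.mp h0).resolve_left hy
    have hz := AnalyticOnNhd.eqOn_zero_of_preconnected_of_eventuallyEq_zero (𝕜 := ℂ)
      g.2 isPreconnected_univ (Set.mem_univ x) hev
    exact Subtype.ext (funext fun y => hz (Set.mem_univ y))
  exact NoZeroDivisors.to_isDomain _

/-- The field `𝔽 = ℳ_{H^*}` of meromorphic functions on the complex vector space `H^*`
(on a complex vector space these are exactly the quotients of entire functions). -/
abbrev MerField (N : ℕ) [NeZero N] : Type := FractionRing (Entire N)

/-- Translation `f ↦ (μ ↦ f (μ + β))` of entire functions. -/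
def shiftEntire (N : ℕ) [NeZero N] (β : HStar N) : Entire N →+* Entire N where
  toFun f := ⟨fun μ => f.1 (μ + β), fun μ _ =>
    AnalyticAt.fun_comp (f.2 (μ + β) (Set.mem_univ _)) (analyticAt_id.add analyticAt_const)⟩
  map_one' := rfl
  map_mul' _ _ := rfl
  map_zero' := rfl
  map_add' _ _ := rfl

theorem shiftEntire_injective (N : ℕ) [NeZero N] (β : HStar N) :
    Function.Injective (shiftEntire N β) := by
  intro f g h
  apply Subtype.ext
  funext μ
  have := congrFun (congrArg Subtype.val h) (μ - β)
  simpa [shiftEntire] using this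

/-- Translation `g ↦ (μ ↦ g (μ + β))` of meromorphic functions. In terms of `g = g(h, P)` this
is `g(h + ⟨β, h⟩, P + ⟨β, P⟩)`. -/
def shift (N : ℕ) [NeZero N] (β : HStar N) : MerField N →+* MerField N :=
  IsFractionRing.map (shiftEntire_injective N β)

/-- Translation acting coefficientwise on `𝔽[[p]]`. -/
def shiftP (N : ℕ) [NeZero N] (β : HStar N) : (MerField N)⟦X⟧ →+* (MerField N)⟦X⟧ :=
  PowerSeries.map (shift N β)

/-! ### Formal series.  The variable of `ℂ⟦X⟧`, `𝔽⟦X⟧`, … is the elliptic nome `p`. -/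

/-- The formal nome `p ∈ ℂ[[p]]`. -/
def nome : ℂ⟦X⟧ := PowerSeries.X

/-- A complex constant in `ℂ[[p]]`. -/
def cst (a : ℂ) : ℂ⟦X⟧ := PowerSeries.C a

/-- The `q`-number `[n] = (q^n - q^{-n}) / (q - q^{-1})`. -/
def qnum (q : ℂ) (n : ℤ) : ℂ := (q ^ n - q ^ (-n)) / (q - q⁻¹)

/-- `exp S = ∑_k S^k / k!` for a power series `S` without constant term over a (not necessarily
commutative) `ℂ[[p]]`-algebra `R`; only `k ≤ d` contributes to the coefficient of degree `d`. -/
def formalExp {R : Type*} [Ring R] [Algebra ℂ⟦X⟧ R] (S : R⟦X⟧) : R⟦X⟧ :=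
  PowerSeries.mk fun d =>
    ∑ k ∈ Finset.range (d + 1), cst ((k.factorial : ℂ)⁻¹) • PowerSeries.coeff d (S ^ k)

/-- The formal infinite product `(a; p)_∞ = ∏_{n ≥ 0} (1 - a p^n)` in `L[[p]]`; the factors with
`n > d` do not contribute to the coefficient of `p^d`. -/
def qPoch {L : Type*} [Field L] (a : L⟦X⟧) : L⟦X⟧ :=
  PowerSeries.mk fun d =>
    PowerSeries.coeff d (∏ n ∈ Finset.range (d + 1), (1 - a * PowerSeries.X ^ n))

/-- The theta function `θ_p(x) = (x; p)_∞ (p/x; p)_∞` as an element of `L[[p]]`, for a nonzero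
element `x` of a field `L`. -/
def theta {L : Type*} [Field L] (x : L) : L⟦X⟧ :=
  qPoch (PowerSeries.C x) * qPoch (PowerSeries.C x⁻¹ * PowerSeries.X)

/-- `g(z; s) = exp(- ∑_{m>0} (1/m) (q^{bm} - q^{-bm}) / (1 - s^m) (s z)^m)`, a power series in `z`
over `ℂ[[p]]`, where `s ∈ ℂ[[p]]` has no constant term. -/
def gSeries (q : ℂ) (b : ℤ) (s : ℂ⟦X⟧) : (ℂ⟦X⟧)⟦X⟧ :=
  formalExp (PowerSeries.mk fun m =>
    if m = 0 then 0
    else -(cst ((q ^ (b * m) - q ^ (-(b * m))) / m) * s ^ m * (1 - s ^ m)⁻¹))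

/-- The inverse `g(z; s)^{-1}` as a power series in `z` (the constant term of `g` is `1`). -/
def gSeriesInv (q : ℂ) (b : ℤ) (s : ℂ⟦X⟧) : (ℂ⟦X⟧)⟦X⟧ :=
  PowerSeries.invOfUnit (gSeries q b s) 1

/-- The nome `p^* = p q^{-2c}`, where `γ` is the value of `q^{c/2}`. -/
def pStar (γ : ℂ) : ℂ⟦X⟧ := cst (γ ^ (-4 : ℤ)) * nome

/-- The ratio `(1 - p^l) / (1 - p^{*l})` in `ℂ[[p]]` for `l ≠ 0`, where `γ` is the value of
`q^{c/2}`. For `l = -n < 0` it equals `(p^*/p)^n (1 - p^n) / (1 - p^{*n})`, `p^*/p = γ^{-4}`. -/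
def nomeRatio (γ : ℂ) (l : ℤ) : ℂ⟦X⟧ :=
  (if 0 ≤ l then 1 else cst (γ ^ (4 * l))) *
    ((1 - nome ^ l.natAbs) * (1 - pStar γ ^ l.natAbs)⁻¹)

/-! ### Representations of the elliptic quantum toroidal algebra -/

/-- The `ℂ[[p]]`-linear operators on `V`. -/
abbrev Op (V : Type*) [AddCommGroup V] [Module ℂ⟦X⟧ V] : Type _ := Module.End ℂ⟦X⟧ V

/-- Congruence of operators modulo `p^n`, pointwise on `V`. -/
def CongMod {V : Type*} [AddCommGroup V] [Module ℂ⟦X⟧ V] (n : ℕ) (S T : Op V) : Prop :=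
  ∀ v, ∃ w, S v = T v + nome ^ n • w

/-- Operators on `V` for the generators `α^∨_{i,l}` (`l ≠ 0`), `x^±_{i,n}`, `K^±_i` and for the
coefficients `φ^±_{i,n}` of the elliptic currents `φ^±_i(z) = ∑_n φ^±_{i,n} z^{-n}`. -/
structure ToroidalOps (N : ℕ) (V : Type*) [AddCommGroup V] [Module ℂ⟦X⟧ V] where
  alpha : ZMod N → ℤ → Op V
  xPlus : ZMod N → ℤ → Op V
  xMinus : ZMod N → ℤ → Op V
  KPlus : ZMod N → Op V
  KMinus : ZMod N → Op V
  phiPlus : ZMod N → ℤ → Op V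
  phiMinus : ZMod N → ℤ → Op V

section Relations

variable {V : Type*} [AddCommGroup V] [Module ℂ⟦X⟧ V]

/-- The product `T_0 T_1 ⋯ T_{N-1}`. -/
def prodI (N : ℕ) (T : ZMod N → Op V) : Op V :=
  ((List.range N).map fun i => T (i : ZMod N)).prod

/-- `exp(∑_{n>0} a_n β_n t^n)` as a power series in `t` with operator coefficients. -/
def expOp (a : ℕ → ℂ⟦X⟧) (β : ℕ → Op V) : (Op V)⟦X⟧ :=
  formalExp (PowerSeries.mk fun n => if n = 0 then 0 else a n • β n)

/-- The coefficient of degree `n ∈ ℤ` of a power series. -/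
def coeffZ {R : Type*} [Semiring R] (n : ℤ) (F : R⟦X⟧) : R :=
  if 0 ≤ n then PowerSeries.coeff n.toNat F else 0

/-- The defining formula
`φ^+(q^{c/2} z) = K^+ exp(-(q-q⁻¹) ∑_{n>0} p^n α_{-n} z^n / (1-p^n))
  exp((q-q⁻¹) ∑_{n>0} α_n z^{-n} / (1-p^n))`,
coefficient of `z^{-n}`. The coefficient of `z^a` in the first exponential is divisible by `p^a`,
so modulo `p^M` only the terms with `a < M` contribute. -/
def PhiPlusRel (q γ : ℂ) (α : ℤ → Op V) (K : Op V) (φ : ℤ → Op V) : Prop :=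
  ∀ (n : ℤ) (M : ℕ), CongMod M (cst (γ ^ (-n)) • φ n)
    (K * ∑ a ∈ Finset.range M,
      PowerSeries.coeff a
        (expOp (fun n => -(cst (q - q⁻¹) * nome ^ n * (1 - nome ^ n)⁻¹)) fun n => α (-n)) *
      coeffZ (a + n) (expOp (fun n => cst (q - q⁻¹) * (1 - nome ^ n)⁻¹) fun n => α n))

/-- The defining formula
`φ^-(q^{-c/2} z) = K^- exp(-(q-q⁻¹) ∑_{n>0} α_{-n} z^n / (1-p^n))
  exp((q-q⁻¹) ∑_{n>0} p^n α_n z^{-n} / (1-p^n))`,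
coefficient of `z^{-n}`. The coefficient of `z^{-b}` in the second exponential is divisible by
`p^b`, so modulo `p^M` only the terms with `b < M` contribute. -/
def PhiMinusRel (q γ : ℂ) (α : ℤ → Op V) (K : Op V) (φ : ℤ → Op V) : Prop :=
  ∀ (n : ℤ) (M : ℕ), CongMod M (cst (γ ^ n) • φ n)
    (K * ∑ b ∈ Finset.range M,
      coeffZ (b - n) (expOp (fun n => -(cst (q - q⁻¹) * (1 - nome ^ n)⁻¹)) fun n => α (-n)) *
      PowerSeries.coeff b
        (expOp (fun n => cst (q - q⁻¹) * nome ^ n * (1 - nome ^ n)⁻¹) fun n => α n))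

/-- The exchange relation
`(κ^m z - q^b w) G(κ^{-m} w/z) x(z) y(w) = (κ^m q^b z - w) G(κ^m z/w) y(w) x(z)`,
coefficient of `z^{-a} w^{-c}`. The coefficient `G_r` of a series `G(t) = ∑_r G_r t^r` to which
this is applied is divisible by `p^r`, so modulo `p^M` only the terms with `r < M` contribute. -/
def ExchangeRel (q κ : ℂ) (m b : ℤ) (G : (ℂ⟦X⟧)⟦X⟧) (x y : ℤ → Op V) : Prop :=
  ∀ (a c : ℤ) (M : ℕ), CongMod M
    (∑ r ∈ Finset.range M, (PowerSeries.coeff r G * cst (κ ^ (-m * r))) •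
      (cst (κ ^ m) • (x (a + 1 - r) * y (c + r)) - cst (q ^ b) • (x (a - r) * y (c + 1 + r))))
    (∑ r ∈ Finset.range M, (PowerSeries.coeff r G * cst (κ ^ (m * r))) •
      (cst (κ ^ m * q ^ b) • (y (c - r) * x (a + 1 + r)) - y (c + 1 - r) * x (a + r)))

/-- The coefficient of `z₁^{-a₁} z₂^{-a₂} w^{-c}`, truncated modulo `p^M`, of
`G(z₂/z₁) { G'(κ^m z₁/w) G'(κ^m z₂/w) y(w) x(z₁) x(z₂)
  - [2] G'(κ^{-m} w/z₁) G'(κ^m z₂/w) x(z₁) y(w) x(z₂)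
  + G'(κ^{-m} w/z₁) G'(κ^{-m} w/z₂) x(z₁) x(z₂) y(w) }`. -/
def serreTerm (q κ : ℂ) (m : ℤ) (G G' : (ℂ⟦X⟧)⟦X⟧) (x y : ℤ → Op V) (M : ℕ) (a₁ a₂ c : ℤ) :
    Op V :=
  ∑ r ∈ Finset.range M, ∑ s ∈ Finset.range M, ∑ t ∈ Finset.range M,
    (PowerSeries.coeff r G * PowerSeries.coeff s G' * PowerSeries.coeff t G') •
      (cst (κ ^ (m * (s + t))) • (y (c - s - t) * x (a₁ - r + s) * x (a₂ + r + t))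
        - cst (qnum q 2 * κ ^ (m * (t - s))) • (x (a₁ - r - s) * y (c + s - t) * x (a₂ + r + t))
        + cst (κ ^ (-(m * (s + t)))) • (x (a₁ - r - s) * x (a₂ + r - t) * y (c + s + t)))

/-- The Serre relation for `a_{ij} = -1`: the sum of the above expression over the two
permutations of `z₁, z₂` vanishes. -/
def SerreRel (q κ : ℂ) (m : ℤ) (G G' : (ℂ⟦X⟧)⟦X⟧) (x y : ℤ → Op V) : Prop :=
  ∀ (a₁ a₂ c : ℤ) (M : ℕ), CongMod M
    (serreTerm q κ m G G' x y M a₁ a₂ c + serreTerm q κ m G G' x y M a₂ a₁ c) 0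

variable {N : ℕ} [NeZero N] [Module (MerField N)⟦X⟧ V]

/-- The defining relations of the elliptic quantum toroidal algebra
`U'_{q,κ,p}(𝔤𝔩_{N,tor})` (without the grading element `q^d`), `N ≥ 3`, on a module `V` over
`𝔽[[p]]`, on which the central element `q^{c/2}` acts as the nonzero scalar `γ`.
Identities between infinite sums are understood in the `p`-adic topology. -/
structure IsRep [IsScalarTower ℂ⟦X⟧ (MerField N)⟦X⟧ V] (q κ γ : ℂ) (ρ : ToroidalOps N V) :
    Prop where
  /- invertibility of `K^±_i` -/
  KPlus_bij : ∀ i, Function.Bijective (ρ.KPlus i)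
  KMinus_bij : ∀ i, Function.Bijective (ρ.KMinus i)
  /- `∏_i K^±_i` is central -/
  prod_smul : ∀ (g : (MerField N)⟦X⟧) (v : V),
    prodI N ρ.KPlus (g • v) = g • prodI N ρ.KPlus v ∧
    prodI N ρ.KMinus (g • v) = g • prodI N ρ.KMinus v
  prod_x : ∀ i n,
    Commute (prodI N ρ.KPlus) (ρ.xPlus i n) ∧ Commute (prodI N ρ.KPlus) (ρ.xMinus i n) ∧
    Commute (prodI N ρ.KMinus) (ρ.xPlus i n) ∧ Commute (prodI N ρ.KMinus) (ρ.xMinus i n)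
  /- `g(h,P) x^+_j = x^+_j g(h + ⟨α_j,h⟩, P - ⟨Q_j,P⟩)`, and so on -/
  g_xPlus : ∀ (g : (MerField N)⟦X⟧) j n v,
    g • ρ.xPlus j n v = ρ.xPlus j n (shiftP N (rootA N j - rootQ N j) g • v)
  g_xMinus : ∀ (g : (MerField N)⟦X⟧) j n v,
    g • ρ.xMinus j n v = ρ.xMinus j n (shiftP N (-rootA N j) g • v)
  g_KPlus : ∀ (g : (MerField N)⟦X⟧) j v,
    g • ρ.KPlus j v = ρ.KPlus j (shiftP N (-rootQ N j) g • v)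
  g_KMinus : ∀ (g : (MerField N)⟦X⟧) j v,
    g • ρ.KMinus j v = ρ.KMinus j (shiftP N (-rootQ N j) g • v)
  g_alpha : ∀ (g : (MerField N)⟦X⟧) j l v, l ≠ 0 → g • ρ.alpha j l v = ρ.alpha j l (g • v)
  /- relations involving `K^±_i` -/
  K_K : ∀ i j, Commute (ρ.KPlus i) (ρ.KPlus j) ∧ Commute (ρ.KMinus i) (ρ.KMinus j) ∧
    Commute (ρ.KPlus i) (ρ.KMinus j)
  K_alpha : ∀ i j l, l ≠ 0 →
    Commute (ρ.KPlus i) (ρ.alpha j l) ∧ Commute (ρ.KMinus i) (ρ.alpha j l)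
  K_xPlus : ∀ i j n,
    ρ.KPlus i * ρ.xPlus j n = cst (q ^ cartan N i j) • (ρ.xPlus j n * ρ.KPlus i) ∧
    ρ.KMinus i * ρ.xPlus j n = cst (q ^ (-cartan N i j)) • (ρ.xPlus j n * ρ.KMinus i)
  K_xMinus : ∀ i j n,
    ρ.KPlus i * ρ.xMinus j n = cst (q ^ (-cartan N i j)) • (ρ.xMinus j n * ρ.KPlus i) ∧
    ρ.KMinus i * ρ.xMinus j n = cst (q ^ cartan N i j) • (ρ.xMinus j n * ρ.KMinus i)
  /- relations involving `α^∨_{i,l}`; here `q^{lc} = γ^{2l}` -/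
  alpha_alpha : ∀ i j l m, l ≠ 0 → m ≠ 0 →
    ρ.alpha i l * ρ.alpha j m - ρ.alpha j m * ρ.alpha i l =
      (if l + m = 0 then
        cst (qnum q (cartan N i j * l) / l * ((γ ^ (2 * l) - γ ^ (-(2 * l))) / (q - q⁻¹)) *
          κ ^ (-(l * mMat N i j)) * γ ^ (-(2 * l))) * nomeRatio γ l
      else 0) • (1 : Op V)
  alpha_xPlus : ∀ i j l n, l ≠ 0 →
    ρ.alpha i l * ρ.xPlus j n - ρ.xPlus j n * ρ.alpha i l =
      (cst (qnum q (cartan N i j * l) / l * γ ^ (-(2 * l)) * κ ^ (-(l * mMat N i j))) *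
        nomeRatio γ l) • ρ.xPlus j (n + l)
  alpha_xMinus : ∀ i j l n, l ≠ 0 →
    ρ.alpha i l * ρ.xMinus j n - ρ.xMinus j n * ρ.alpha i l =
      -(cst (qnum q (cartan N i j * l) / l * κ ^ (-(l * mMat N i j)))) • ρ.xMinus j (n + l)
  /- the currents `φ^±_i` -/
  phiPlus_def : ∀ i, PhiPlusRel q γ (ρ.alpha i) (ρ.KPlus i) (ρ.phiPlus i)
  phiMinus_def : ∀ i, PhiMinusRel q γ (ρ.alpha i) (ρ.KMinus i) (ρ.phiMinus i)
  /- quadratic relations -/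
  xPlus_xPlus : ∀ i j, ExchangeRel q κ (mMat N i j) (cartan N i j)
    (gSeries q (cartan N i j) (pStar γ)) (ρ.xPlus i) (ρ.xPlus j)
  xMinus_xMinus : ∀ i j, ExchangeRel q κ (mMat N i j) (-cartan N i j)
    (gSeriesInv q (cartan N i j) nome) (ρ.xMinus i) (ρ.xMinus j)
  /- `[x^+_i(z), x^-_j(w)] = δ_{ij}/(q-q⁻¹)
    (δ(q^c w/z) φ^+_i(q^{c/2} w) - δ(q^{-c} w/z) φ^-_i(q^{c/2} z))`, coefficient of
    `z^{-m} w^{-n}` -/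
  xPlus_xMinus : ∀ i j m n,
    ρ.xPlus i m * ρ.xMinus j n - ρ.xMinus j n * ρ.xPlus i m =
      if i = j then cst ((q - q⁻¹)⁻¹) •
        (cst (γ ^ (m - n)) • ρ.phiPlus i (m + n) - cst (γ ^ (n - m)) • ρ.phiMinus i (m + n))
      else 0
  /- Serre relations -/
  serre_zero : ∀ i j m n, i ≠ j → cartan N i j = 0 →
    Commute (ρ.xPlus i m) (ρ.xPlus j n) ∧ Commute (ρ.xMinus i m) (ρ.xMinus j n)
  serre_xPlus : ∀ i j, cartan N i j = -1 → SerreRel q κ (mMat N i j)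
    (gSeries q (cartan N i i) (pStar γ)) (gSeries q (cartan N i j) (pStar γ))
    (ρ.xPlus i) (ρ.xPlus j)
  serre_xMinus : ∀ i j, cartan N i j = -1 → SerreRel q κ (mMat N i j)
    (gSeriesInv q (cartan N i i) nome) (gSeriesInv q (cartan N i j) nome)
    (ρ.xMinus i) (ρ.xMinus j)

/-- Level `(0, l)`: the central elements `q^{c/2}` (with value `γ`) and `∏_i K^+_i` act as
`q^{0/2} = 1` and `q^{-l}`, respectively. -/
def HasLevelZero (q : ℂ) (l : ℤ) (γ : ℂ) (ρ : ToroidalOps N V) : Prop :=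
  γ = 1 ∧ prodI N ρ.KPlus = cst (q ^ (-l)) • (1 : Op V)

/-- An `𝔽[[p]]`-submodule stable under all generators. -/
def Invariant (ρ : ToroidalOps N V) (W : Submodule (MerField N)⟦X⟧ V) : Prop :=
  ∀ v ∈ W, ∀ i,
    (∀ l, l ≠ 0 → ρ.alpha i l v ∈ W) ∧
    (∀ n, ρ.xPlus i n v ∈ W ∧ ρ.xMinus i n v ∈ W) ∧
    ρ.KPlus i v ∈ W ∧ ρ.KMinus i v ∈ W

/-- Irreducibility over `𝔽((p))`, i.e. after inverting the nome: every nonzero invariant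
`𝔽[[p]]`-submodule `W` satisfies `W[1/p] = V[1/p]`. -/
def IsIrreducible (ρ : ToroidalOps N V) : Prop :=
  Nontrivial V ∧ ∀ W : Submodule (MerField N)⟦X⟧ V, Invariant ρ W → W ≠ ⊥ →
    ∀ v : V, ∃ n : ℕ, nome ^ n • v ∈ W

/-- `V` is a lowest weight module with lowest weight vector `v` and lowest weight
`Φ^±_j(z) = ∑_n Φ^±_{j,n} z^{-n}`: `x^-_j(z) v = 0`, `φ^±_j(z) v = Φ^±_j(z) v`, and `v`
generates `V`. -/
structure IsLowestWeight (ρ : ToroidalOps N V) (v : V) (Φp Φm : ZMod N → ℤ → ℂ⟦X⟧) : Prop where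
  ne_zero : v ≠ 0
  xMinus_eq_zero : ∀ j n, ρ.xMinus j n v = 0
  phiPlus_eq : ∀ j n, ρ.phiPlus j n v = Φp j n • v
  phiMinus_eq : ∀ j n, ρ.phiMinus j n v = Φm j n • v
  generates : ∀ W : Submodule (MerField N)⟦X⟧ V, Invariant ρ W → v ∈ W → W = ⊤

end Relations

/-! ### The `q`-Fock space.  Partitions are Young diagrams; rows are numbered from `0`, so that
the part `λ_s` (`s ≥ 1`) is `lam.rowLen (s - 1)`. -/

/-- The `q`-Fock space, with basis `|λ⟩` over `𝔽[[p]]`. -/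
abbrev Fock (N : ℕ) [NeZero N] : Type := YoungDiagram →₀ (MerField N)⟦X⟧

/-- The basis vector `|λ⟩`. -/
def ket (N : ℕ) [NeZero N] (lam : YoungDiagram) : Fock N := Finsupp.single lam 1

open Classical in
/-- The vector `|λ + 1_i⟩`, which is `0` if `λ + 1_i` is not a partition. -/
def ketAdd (N : ℕ) [NeZero N] (lam : YoungDiagram) (i : ℕ) : Fock N :=
  if h : IsLowerSet (insert (i, lam.rowLen i) lam.cells : Set (ℕ × ℕ)) then
    ket N ⟨insert (i, lam.rowLen i) lam.cells, by simpa using h⟩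
  else 0

open Classical in
/-- The vector `|λ - 1_i⟩`, which is `0` if `λ - 1_i` is not a partition. -/
def ketSub (N : ℕ) [NeZero N] (lam : YoungDiagram) (i : ℕ) : Fock N :=
  if h : 0 < lam.rowLen i ∧
      IsLowerSet (lam.cells \ {(i, lam.rowLen i - 1)} : Set (ℕ × ℕ)) then
    ket N ⟨lam.cells.erase (i, lam.rowLen i - 1), by simpa using h.2⟩
  else 0

/-- `q_1 = κ q^{-1}`. -/
def q1 (q κ : ℂ) : ℂ := κ * q⁻¹

/-- `q_3 = κ^{-1} q^{-1}`. -/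
def q3 (q κ : ℂ) : ℂ := κ⁻¹ * q⁻¹

/-- `u_s = q_1^{λ_s} q_3^{s-1} u`. -/
def rowU (q κ u : ℂ) (lam : YoungDiagram) (s : ℕ) : ℂ :=
  q1 q κ ^ lam.rowLen s * q3 q κ ^ s * u

/-- The condition `λ_s + j ≡ s + k` modulo `N`. -/
def condR {N : ℕ} (k j : ZMod N) (lam : YoungDiagram) (s : ℕ) : Prop :=
  (lam.rowLen s : ZMod N) + j = (s : ZMod N) + 1 + k

/-- The condition `λ_s + j + 1 ≡ s + k` modulo `N`. -/
def condA {N : ℕ} (k j : ZMod N) (lam : YoungDiagram) (s : ℕ) : Prop :=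
  (lam.rowLen s : ZMod N) + j + 1 = (s : ZMod N) + 1 + k

/-- `C_± = (p q^{±2}; p)_∞ / (p; p)_∞`, for `ε = ±1`. -/
def constC (q : ℂ) (ε : ℤ) : ℂ⟦X⟧ :=
  qPoch (cst (q ^ (2 * ε)) * nome) * (qPoch nome)⁻¹

open Classical in
/-- `A^+_{λ,i}`. -/
def coeffAPlus {N : ℕ} (q κ u : ℂ) (k j : ZMod N) (lam : YoungDiagram) (i : ℕ) : ℂ⟦X⟧ :=
  (∏ s ∈ (Finset.range i).filter (condR k j lam),
    cst q⁻¹ * theta ((q3 q κ)⁻¹ * (rowU q κ u lam i / rowU q κ u lam s)) *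
      (theta (q1 q κ * (rowU q κ u lam i / rowU q κ u lam s)))⁻¹) *
  ∏ s ∈ (Finset.range i).filter (condA k j lam),
    cst q * theta (q1 q κ * q3 q κ * (rowU q κ u lam i / rowU q κ u lam s)) *
      (theta (rowU q κ u lam i / rowU q κ u lam s))⁻¹

open Classical in
/-- `A^-_{λ,i}`. In the two infinite products over the rows below the row `i`, the factor of a row
`s > l(λ)` in the first product cancels the factor of the row `s + 1` in the second one, so the
first product extends over the rows up to `l(λ)` and the second one up to `l(λ) + 1`. -/
def coeffAMinus {N : ℕ} (q κ u : ℂ) (k j : ZMod N) (lam : YoungDiagram) (i : ℕ) : ℂ⟦X⟧ :=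
  (∏ s ∈ (Finset.Ico (i + 1) (lam.colLen 0)).filter (condR k j lam),
    cst q * theta (q1 q κ * q3 q κ * (rowU q κ u lam s / rowU q κ u lam i)) *
      (theta (rowU q κ u lam s / rowU q κ u lam i))⁻¹) *
  ∏ s ∈ (Finset.Ico (i + 1) (lam.colLen 0 + 1)).filter (condA k j lam),
    cst q⁻¹ * theta ((q3 q κ)⁻¹ * (rowU q κ u lam s / rowU q κ u lam i)) *
      (theta (q1 q κ * (rowU q κ u lam s / rowU q κ u lam i)))⁻¹

open Classical in
/-- The eigenvalue of `φ_j(z)` on `|λ⟩` as an element of `L[[p]]`, for a field `L ⊇ ℂ` (with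
inclusion `ι`) and a given element `T` playing the role of `1/z`. As in `coeffAMinus`, the
products extend over the rows up to `l(λ)` and up to `l(λ) + 1`. -/
def phiEigen {L : Type*} [Field L] (ι : ℂ →+* L) {N : ℕ} (q κ u : ℂ) (k j : ZMod N)
    (lam : YoungDiagram) (T : L) : L⟦X⟧ :=
  (∏ s ∈ (Finset.range (lam.colLen 0)).filter (condR k j lam),
    PowerSeries.C (ι q) *
      theta (ι (q3 q κ * rowU q κ u lam s) * T) *
      (theta (ι ((q1 q κ)⁻¹ * rowU q κ u lam s) * T))⁻¹) *
  ∏ s ∈ (Finset.range (lam.colLen 0 + 1)).filter (condA k j lam),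
    PowerSeries.C (ι q⁻¹) *
      theta (ι ((q1 q κ)⁻¹ * (q3 q κ)⁻¹ * rowU q κ u lam s) * T) *
      (theta (ι (rowU q κ u lam s) * T))⁻¹

open Classical in
/-- The `j`-th component `(q^{-1} θ(q² u/z) / θ(u/z))^{δ_{jk}}` of the lowest weight, with `T` in
the role of `1/z`. -/
def lowestEigen {L : Type*} [Field L] (ι : ℂ →+* L) {N : ℕ} (q u : ℂ) (k j : ZMod N) (T : L) :
    L⟦X⟧ :=
  if j = k then
    PowerSeries.C (ι q⁻¹) * theta (ι (q ^ 2 * u) * T) *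
      (theta (ι u * T))⁻¹
  else 1

/-- The inclusion of the constants into the field of formal Laurent series. -/
def laurentC : ℂ →+* LaurentSeries ℂ := HahnSeries.C

/-- The expansion `|_+` in the region `|p| < |a/z| < 1` (for a denominator `θ(a/z)`): the argument `1/z`
is the variable of the field `ℂ((z^{-1}))`; this is the coefficient of `z^{-n}`. -/
def expandPlus (f : LaurentSeries ℂ → (LaurentSeries ℂ)⟦X⟧) (n : ℤ) : ℂ⟦X⟧ :=
  PowerSeries.mk fun d =>
    HahnSeries.coeff (PowerSeries.coeff d (f (HahnSeries.single (1 : ℤ) (1 : ℂ)))) n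

/-- The expansion `|_-` in the region `1 < |a/z| < |p^{-1}|` (for a denominator `θ(a/z)`): the
argument `1/z` is the inverse of the variable of the field `ℂ((z))`; this is the coefficient of
`z^{-n}`. -/
def expandMinus (f : LaurentSeries ℂ → (LaurentSeries ℂ)⟦X⟧) (n : ℤ) : ℂ⟦X⟧ :=
  PowerSeries.mk fun d =>
    HahnSeries.coeff (PowerSeries.coeff d (f (HahnSeries.single (-1 : ℤ) (1 : ℂ)))) (-n)

open Classical in
/-- The formulas for the action on the basis vectors of the `q`-Fock space; the shift operator
`e^{-Q_j}` fixes the basis vectors. -/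
structure FockFormulas {N : ℕ} [NeZero N] (q κ u : ℂ) (k : ZMod N)
    (ρ : ToroidalOps N (Fock N)) : Prop where
  phiPlus_ket : ∀ j n lam,
    ρ.phiPlus j n (ket N lam) = expandPlus (phiEigen laurentC q κ u k j lam) n • ket N lam
  phiMinus_ket : ∀ j n lam,
    ρ.phiMinus j n (ket N lam) = expandMinus (phiEigen laurentC q κ u k j lam) n • ket N lam
  /- `x^+_j(z)|λ⟩ = C_+ ∑_i δ(u_i/z) A^+_{λ,i} e^{-Q_j} |λ + 1_i⟩` -/
  xPlus_ket : ∀ j n lam,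
    ρ.xPlus j n (ket N lam) =
      ∑ i ∈ (Finset.range (lam.colLen 0 + 1)).filter (condA k j lam),
        (constC q 1 * cst (rowU q κ u lam i ^ n) * coeffAPlus q κ u k j lam i) • ketAdd N lam i
  /- `x^-_j(z)|λ⟩ = C_- ∑_i δ(q_1^{-1} u_i/z) A^-_{λ,i} |λ - 1_i⟩` -/
  xMinus_ket : ∀ j n lam,
    ρ.xMinus j n (ket N lam) =
      ∑ i ∈ (Finset.range (lam.colLen 0)).filter (condR k j lam),
        (constC q (-1) * cst (((q1 q κ)⁻¹ * rowU q κ u lam i) ^ n) *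
          coeffAMinus q κ u k j lam i) • ketSub N lam i

end

end EllTor

namespace EllTor

noncomputable section

/-! ### Formal exponentials -/

section FormalExp

open PowerSeries

/-! All operators are additive maps twisted by a translation of 𝔽[[p]] that fixes ℂ[[p]]. A relation
therefore only has to be checked on the vectors |λ⟩ (`IsSemi.ext`, `IsSemi.congMod`), where it
becomes an identity of matrix coefficients in ℂ[[p]]. The operators α^∨, K^±, φ^± are diagonal. The
current x^±_j(z) adds or removes a box b of colour j, and the mode n enters only through the factor
pos(b)^n, where pos(b) = q₁^c q₃^r u for the box in row r and column c. So a relation between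
currents holds as soon as it holds for coefficients, with every formal variable replaced by the
position of a box and every structure function by its value (`gVal`).

At q^{c/2} = 1 the nomes p and p^* agree, and g is a quotient of two infinite products. The
quadratic relation is then equivalent to θ(q^b y) F = q^b θ(q^{-b} y) G, where F and G are the
products of coefficients for the two orders of the boxes (`gVal_exchange`). A coefficient of x^+
(x^-) is a product of row factors over the rows above (below) the box. Adding a box changes one row
factor, by exactly this ratio of thetas (`psi_succ`). When only one order of two boxes is possible,
they are neighbours and the theta in front is θ(1) = 0 (`covers_theta`). The Serre relations follow
algebraically from the quadratic ones (`serre_of_quadratic`) unless two boxes have positions with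
ratio q²; this would need a 2×2 square of boxes among the three that are changed
(`not_diagonal_of_three`).

In [x^+, x^-] the contributions of two different boxes cancel, again by the change of one row factor
(`remCoeff_mul_addCoeff`). The diagonal part is a residue theorem: the two expansions of a quotient
of thetas with simple poles differ by delta functions at the poles, weighted by residues
(`coeffT_thetaQuot_sub`, which is a partial fraction decomposition in each degree of p). The poles
of the eigenvalue of φ_j sit at the ends of rows. At a box that can really be removed or added, the
residue is the product of the coefficients of x^+ and x^-; at any other row end a numerator θ(1)
kills it (`residue_inl`, `residue_inr`). The expression of φ^± through α^∨ is the expansion log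
(t;p)_∞ = -∑ t^m / (m(1-p^m)), which makes the eigenvalues of α^∨ power sums of the zeros and poles
of φ.

For irreducibility, the sum over j of the eigenvalues of α^∨_{j,l} is, up to a constant, a nonzero
multiple of ∑ pos(b)^l over the boxes of λ. Power sums determine the set of boxes, so the α^∨
separate the |λ⟩ (`exists_alphaEig_ne`) and a stable submodule contains the components of its
elements (`single_mem_of_diagOp`). The coefficients of adding and removing a box are units of
ℂ[[p]], so one can walk from any diagram to the empty one and back. The only loss is the power of p
that divides the chosen component; for |∅⟩ itself there is none. -/

theorem coeff_pow_eq_zero_of_lt {R : Type*} [Ring R] {S : R⟦X⟧} (hS : constantCoeff S = 0)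
    {d k : ℕ} (h : d < k) : coeff d (S ^ k) = 0 := by
  have hX : (X : R⟦X⟧) ∣ S := X_dvd_iff.mpr hS
  have : ∀ k, (X : R⟦X⟧) ^ k ∣ S ^ k := by
    intro k
    induction k with
    | zero => simp
    | succ k ih =>
      obtain ⟨A, hA⟩ := hX
      obtain ⟨B, hB⟩ := ih
      refine ⟨B * A, ?_⟩
      rw [pow_succ, hB, hA, pow_succ, mul_assoc, mul_assoc, ← mul_assoc B, ← mul_assoc X B,
        (commute_X B).eq]
  exact X_pow_dvd_iff.mp (this k) d h

/-- Higher powers do not reach degree `d`, so any bound `M` beyond the degree gives the same sum.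
One bound can then serve several degrees at once, which allows interchanging the sum over `k` with a
convolution. -/
theorem coeff_formalExp {R : Type*} [Ring R] [Algebra ℂ⟦X⟧ R] {S : R⟦X⟧}
    (hS : constantCoeff S = 0) {d M : ℕ} (h : d < M) :
    coeff d (formalExp S) =
      ∑ k ∈ Finset.range M, cst ((k.factorial : ℂ)⁻¹) • coeff d (S ^ k) := by
  rw [formalExp, coeff_mk]
  refine Finset.sum_subset (Finset.range_mono h) fun k _ hk => ?_
  rw [coeff_pow_eq_zero_of_lt hS (by simpa using hk), smul_zero]

theorem constantCoeff_formalExp {R : Type*} [Ring R] [Algebra ℂ⟦X⟧ R] (S : R⟦X⟧) :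
    constantCoeff (formalExp S) = 1 := by
  rw [← coeff_zero_eq_constantCoeff_apply, formalExp, coeff_mk]
  simp [cst]

/-- This and the next instance provide the torsion-freeness needed in `derivative.ext`: a series is
determined by its derivative and its constant term. -/
instance : CharZero ℂ⟦X⟧ := charZero_of_injective_ringHom (C_injective (R := ℂ))

instance : IsAddTorsionFree ℂ⟦X⟧ := IsDomain.instIsAddTorsionFreeOfCharZero _

theorem derivative_mul' {R : Type*} [CommRing R] (F G : R⟦X⟧) :
    d⁄dX R (F * G) = F * d⁄dX R G + G * d⁄dX R F := by
  rw [Derivation.leibniz, smul_eq_mul, smul_eq_mul]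

theorem derivative_formalExp {S : ℂ⟦X⟧⟦X⟧} (hS : constantCoeff S = 0) :
    d⁄dX _ (formalExp S) = d⁄dX _ S * formalExp S := by
  ext1 d
  rw [coeff_derivative, coeff_formalExp hS (Nat.lt_succ_self (d + 1)), Finset.sum_mul]
  have key : ∀ k : ℕ, cst ((k.factorial : ℂ)⁻¹) • coeff (d + 1) (S ^ k) * ((d : ℂ⟦X⟧) + 1) =
      cst ((k.factorial : ℂ)⁻¹) * (k * coeff d (S ^ (k - 1) * d⁄dX _ S)) := by
    intro k
    rw [smul_eq_mul, mul_assoc, ← coeff_derivative, derivative_pow, mul_assoc,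
      ← map_natCast (C : ℂ⟦X⟧ →+* _) k, coeff_C_mul]
  rw [Finset.sum_congr rfl fun k _ => key k, Finset.sum_range_succ']
  -- The factor `k + 1` from the derivative of the power turns 1/(k+1)! into 1/k!, which shifts the
  -- exponential sum by one.
  have key2 : ∀ k : ℕ, cst (((k + 1).factorial : ℂ)⁻¹) *
      (((k + 1 : ℕ) : ℂ⟦X⟧) * coeff d (S ^ (k + 1 - 1) * d⁄dX _ S)) =
      coeff d (C (cst ((k.factorial : ℂ)⁻¹)) * S ^ k * d⁄dX _ S) := by
    intro k
    have : cst (((k + 1).factorial : ℂ)⁻¹) * ((k + 1 : ℕ) : ℂ⟦X⟧) = cst ((k.factorial : ℂ)⁻¹) := by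
      have h1 : ((k + 1 : ℕ) : ℂ⟦X⟧) = cst ((k + 1 : ℕ) : ℂ) := by simp [cst]
      rw [h1, cst, cst, ← map_mul, cst]
      congr 1
      rw [Nat.factorial_succ]
      have : ((k : ℂ) + 1) ≠ 0 := by exact_mod_cast Nat.succ_ne_zero k
      have h3 : (k.factorial : ℂ) ≠ 0 := by exact_mod_cast Nat.factorial_ne_zero k
      push_cast
      field_simp
    rw [← mul_assoc, this, Nat.add_sub_cancel, mul_assoc, coeff_C_mul]
  rw [Finset.sum_congr rfl fun k _ => key2 k]
  simp only [Nat.cast_zero, zero_mul, mul_zero, add_zero]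
  rw [← map_sum, ← Finset.sum_mul, mul_comm (d⁄dX _ S), coeff_mul, coeff_mul]
  refine Finset.sum_congr rfl fun x hx => ?_
  congr 1
  have hx' : x.1 < d + 1 := by
    have := Finset.HasAntidiagonal.mem_antidiagonal.mp hx
    omega
  rw [coeff_formalExp hS hx', map_sum]
  refine Finset.sum_congr rfl fun k _ => ?_
  rw [coeff_C_mul, smul_eq_mul]

theorem formalExp_mul_neg {S : ℂ⟦X⟧⟦X⟧} (hS : constantCoeff S = 0) :
    formalExp S * formalExp (-S) = 1 := by
  have hS' : constantCoeff (-S) = 0 := by simp [hS]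
  apply derivative.ext
  · rw [derivative_mul', derivative_formalExp hS, derivative_formalExp hS', map_neg,
      derivative_one]
    ring
  · simp [constantCoeff_formalExp]

/-- The exponential is the only solution of F' = S'F with F(0) = 1, because F·exp(-S) has derivative
zero. This is the way every formal exponential below is recognized. -/
theorem eq_formalExp {F S : ℂ⟦X⟧⟦X⟧} (hS : constantCoeff S = 0) (h0 : constantCoeff F = 1)
    (hF : d⁄dX _ F = d⁄dX _ S * F) : F = formalExp S := by
  have hS' : constantCoeff (-S) = 0 := by simp [hS]
  have h : F * formalExp (-S) = 1 := by
    apply derivative.ext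
    · rw [derivative_mul', hF, derivative_formalExp hS', map_neg, derivative_one]
      ring
    · simp [constantCoeff_formalExp, h0]
  calc F = F * (formalExp S * formalExp (-S)) := by rw [formalExp_mul_neg hS, mul_one]
    _ = F * formalExp (-S) * formalExp S := by ring
    _ = formalExp S := by rw [h, one_mul]

theorem formalExp_zero : formalExp (0 : ℂ⟦X⟧⟦X⟧) = 1 :=
  (eq_formalExp (by simp) (by simp) (by simp)).symm

theorem formalExp_add {S T : ℂ⟦X⟧⟦X⟧} (hS : constantCoeff S = 0) (hT : constantCoeff T = 0) :
    formalExp (S + T) = formalExp S * formalExp T := by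
  refine (eq_formalExp (by simp [hS, hT]) (by simp [constantCoeff_formalExp]) ?_).symm
  rw [derivative_mul', derivative_formalExp hS, derivative_formalExp hT, map_add]
  ring

theorem formalExp_sum {ι : Type*} (I : Finset ι) (S : ι → ℂ⟦X⟧⟦X⟧)
    (hS : ∀ i ∈ I, constantCoeff (S i) = 0) :
    formalExp (∑ i ∈ I, S i) = ∏ i ∈ I, formalExp (S i) := by
  classical
  induction I using Finset.induction_on with
  | empty => simp [formalExp_zero]
  | insert a s ha ih =>
    rw [Finset.sum_insert ha, Finset.prod_insert ha, formalExp_add (hS a (by simp)), ih]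
    · intro i hi; exact hS i (by simp [hi])
    · rw [map_sum]
      exact Finset.sum_eq_zero fun i hi => hS i (by simp [hi])

theorem rescale_formalExp (a : ℂ⟦X⟧) (S : ℂ⟦X⟧⟦X⟧) :
    rescale a (formalExp S) = formalExp (rescale a S) := by
  ext1 d
  rw [coeff_rescale, formalExp, formalExp, coeff_mk, coeff_mk, Finset.mul_sum]
  refine Finset.sum_congr rfl fun k _ => ?_
  rw [← map_pow, coeff_rescale, smul_eq_mul, smul_eq_mul]
  ring

/-- `∑_{m>0} a_m t^m`. -/
def posSeries (a : ℕ → ℂ⟦X⟧) : ℂ⟦X⟧⟦X⟧ := PowerSeries.mk fun m => if m = 0 then 0 else a m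

theorem constantCoeff_posSeries (a : ℕ → ℂ⟦X⟧) : constantCoeff (posSeries a) = 0 := by
  rw [← coeff_zero_eq_constantCoeff_apply, posSeries, coeff_mk, if_pos rfl]

theorem rescale_posSeries (c : ℂ⟦X⟧) (a : ℕ → ℂ⟦X⟧) :
    rescale c (posSeries a) = posSeries fun m => c ^ m * a m := by
  ext1 m
  rw [coeff_rescale, posSeries, posSeries, coeff_mk, coeff_mk]
  split_ifs <;> simp

end FormalExp

/-! ### The infinite product `(t; p)_∞` as a formal exponential in `t` -/

section QExp

open PowerSeries

theorem cst_mul (a b : ℂ) : cst (a * b) = cst a * cst b := map_mul _ _ _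
theorem cst_add (a b : ℂ) : cst (a + b) = cst a + cst b := map_add _ _ _
theorem cst_sub (a b : ℂ) : cst (a - b) = cst a - cst b := map_sub _ _ _
theorem cst_neg (a : ℂ) : cst (-a) = -cst a := map_neg _ _
theorem cst_pow (a : ℂ) (n : ℕ) : cst (a ^ n) = cst a ^ n := map_pow _ _ _
theorem cst_one : cst 1 = 1 := map_one _
theorem cst_zero : cst 0 = 0 := map_zero _

theorem cst_prod {ι : Type*} (I : Finset ι) (f : ι → ℂ) :
    cst (∏ i ∈ I, f i) = ∏ i ∈ I, cst (f i) := map_prod (C : ℂ →+* _) _ _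

theorem cst_sum {ι : Type*} (I : Finset ι) (f : ι → ℂ) :
    cst (∑ i ∈ I, f i) = ∑ i ∈ I, cst (f i) := map_sum (C : ℂ →+* _) _ _

theorem cst_ne_zero {a : ℂ} (h : a ≠ 0) : cst a ≠ 0 := by
  rw [← cst_zero]
  exact fun h' => h (C_injective h')

theorem one_sub_nome_pow_mul_inv {m : ℕ} (hm : m ≠ 0) : (1 - nome ^ m) * (1 - nome ^ m)⁻¹ = 1 := by
  apply PowerSeries.mul_inv_cancel
  simp [nome, hm]

/-- The logarithm `-∑_{m>0} t^m / (m (1 - p^m))` of `(t; p)_∞`. -/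
def logQ : ℂ⟦X⟧⟦X⟧ := posSeries fun m => -(cst (1 / m) * (1 - nome ^ m)⁻¹)

/-- `(c t; p)_∞` as a power series in `t` over `ℂ[[p]]`. -/
def qE (c : ℂ) : ℂ⟦X⟧⟦X⟧ := formalExp (rescale (cst c) logQ)

/-- `1 / (c t; p)_∞` as a power series in `t` over `ℂ[[p]]`. -/
def qEInv (c : ℂ) : ℂ⟦X⟧⟦X⟧ := formalExp (-rescale (cst c) logQ)

theorem constantCoeff_rescale_logQ (c : ℂ⟦X⟧) : constantCoeff (rescale c logQ) = 0 := by
  rw [logQ, rescale_posSeries, constantCoeff_posSeries]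

theorem qE_mul_qEInv (c : ℂ) : qE c * qEInv c = 1 :=
  formalExp_mul_neg (constantCoeff_rescale_logQ _)

/-- Subtracting the series at pt multiplies the m-th coefficient by 1 - p^m and so cancels its
denominator. What remains is log(1 - t), whose derivative is -1/(1 - t). -/
theorem derivative_logQ_sub :
    (1 - X) * (d⁄dX _ logQ - d⁄dX _ (rescale nome logQ)) = (-1 : ℂ⟦X⟧⟦X⟧) := by
  have h : d⁄dX _ logQ - d⁄dX _ (rescale nome logQ) = -PowerSeries.mk (1 : ℕ → ℂ⟦X⟧) := by
    ext1 d
    rw [map_sub, coeff_derivative, coeff_derivative, coeff_rescale, logQ, posSeries, coeff_mk,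
      if_neg (Nat.succ_ne_zero d), map_neg, coeff_mk]
    have h1 : (1 - nome ^ (d + 1)) * (1 - nome ^ (d + 1))⁻¹ = 1 :=
      one_sub_nome_pow_mul_inv (Nat.succ_ne_zero d)
    have h2 : cst (1 / ((d + 1 : ℕ) : ℂ)) * ((d : ℂ⟦X⟧) + 1) = 1 := by
      have : ((d : ℂ⟦X⟧) + 1) = cst ((d + 1 : ℕ) : ℂ) := by simp [cst]
      rw [this, ← cst_mul, one_div, inv_mul_cancel₀ (by exact_mod_cast Nat.succ_ne_zero d), cst_one]
    simp only [Pi.one_apply]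
    linear_combination (-(cst (1 / ((d + 1 : ℕ) : ℂ)) * ((d : ℂ⟦X⟧) + 1))) * h1 - h2
  rw [h, mul_neg, mul_comm, mk_one_mul_one_sub_eq_one]

/-- The functional equation (t;p)_∞ = (1-t)(pt;p)_∞, obtained from the differential equation. Its
iteration splits off the factors of the infinite product one by one. -/
theorem formalExp_logQ : formalExp logQ = (1 - X) * formalExp (rescale nome logQ) := by
  have h0 : constantCoeff logQ = 0 := constantCoeff_posSeries _
  refine (eq_formalExp h0 (by simp [constantCoeff_formalExp]) ?_).symm
  rw [derivative_mul', derivative_formalExp (constantCoeff_rescale_logQ _), map_sub,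
    derivative_one, derivative_X]
  linear_combination (-formalExp (rescale nome logQ)) * derivative_logQ_sub

theorem rescale_rescale_logQ (a b : ℂ⟦X⟧) :
    rescale a (rescale b logQ) = rescale (b * a) logQ := by
  rw [rescale_rescale]

/-- `(c t; p)_∞ = ∏_{n<M} (1 - c p^n t) · (c p^M t; p)_∞`. -/
theorem qE_eq_prod (c : ℂ) (M : ℕ) :
    qE c = (∏ n ∈ Finset.range M, (1 - C (cst c * nome ^ n) * X)) *
      formalExp (rescale (cst c * nome ^ M) logQ) := by
  induction M with
  | zero => simp [qE]
  | succ M ih =>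
    rw [ih, Finset.prod_range_succ, mul_assoc]
    congr 1
    have h := congrArg (rescale (cst c * nome ^ M)) formalExp_logQ
    rw [map_mul, rescale_formalExp, rescale_formalExp, rescale_rescale_logQ, map_sub, map_one,
      rescale_X] at h
    rw [h]
    congr 4
    rw [pow_succ]
    ring

/-- Rescaling multiplies the coefficient of degree r by the r-th power of the factor. Hence the last
factor in `qE_eq_prod` is 1 modulo p^M. -/
theorem nome_pow_dvd_coeff_formalExp_rescale {c : ℂ⟦X⟧} {S : ℂ⟦X⟧⟦X⟧} {M r : ℕ}
    (h : nome ^ M ∣ c) (hr : r ≠ 0) : nome ^ M ∣ coeff r (formalExp (rescale c S)) := by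
  rw [← rescale_formalExp, coeff_rescale]
  exact Dvd.dvd.mul_right (h.trans (dvd_pow_self c hr)) _

end QExp

/-! ### The infinite product `(a; p)_∞` over commutative rings -/

section QPoch

open PowerSeries

variable {B : Type*} [CommRing B]

theorem eq_of_forall_X_pow_dvd {F G : B⟦X⟧} (h : ∀ M, X ^ M ∣ F - G) : F = G := by
  ext1 d
  have := X_pow_dvd_iff.mp (h (d + 1)) d (Nat.lt_succ_self d)
  rwa [map_sub, sub_eq_zero] at this

theorem dvd_sub_trans {R : Type*} [CommRing R] {a x y z : R} (h1 : a ∣ x - y) (h2 : a ∣ y - z) :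
    a ∣ x - z := by
  have := dvd_add h1 h2
  rwa [sub_add_sub_cancel] at this

theorem dvd_mul_sub_mul' {R : Type*} [CommRing R] {a x y z w : R} (h1 : a ∣ x - y)
    (h2 : a ∣ z - w) : a ∣ x * z - y * w := by
  have : x * z - y * w = (x - y) * z + y * (z - w) := by ring
  rw [this]
  exact dvd_add (h1.mul_right _) (h2.mul_left _)

/-- A series defined by stabilizing truncations agrees with its truncations. -/
theorem X_pow_dvd_mk_sub {P : ℕ → B⟦X⟧} (hP : ∀ M, X ^ M ∣ P (M + 1) - P M) (M : ℕ) :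
    X ^ M ∣ PowerSeries.mk (fun d => coeff d (P (d + 1))) - P M := by
  have key : ∀ M' M, M ≤ M' → X ^ M ∣ P M' - P M := by
    intro M' M h
    induction M', h using Nat.le_induction with
    | base => simp
    | succ m hm ih => exact dvd_sub_trans ((pow_dvd_pow X hm).trans (hP m)) ih
  rw [X_pow_dvd_iff]
  intro d hd
  have := X_pow_dvd_iff.mp (key M (d + 1) hd) d (Nat.lt_succ_self d)
  rw [map_sub, sub_eq_zero] at this ⊢
  rw [coeff_mk, this]

/-- `(a; p)_∞` over a commutative ring. -/
def qPochR (a : B⟦X⟧) : B⟦X⟧ :=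
  PowerSeries.mk fun d =>
    PowerSeries.coeff d (∏ n ∈ Finset.range (d + 1), (1 - a * PowerSeries.X ^ n))

/-- The product is needed over rings that are not fields: power series in t, and Laurent
polynomials, where coefficients are computed before passing to Laurent series or to complex values.
-/
theorem qPoch_eq_qPochR {L : Type*} [Field L] (a : L⟦X⟧) : qPoch a = qPochR a := rfl

theorem X_pow_dvd_qPochR_sub (a : B⟦X⟧) (M : ℕ) :
    X ^ M ∣ qPochR a - ∏ n ∈ Finset.range M, (1 - a * X ^ n) := by
  refine X_pow_dvd_mk_sub (P := fun M => ∏ n ∈ Finset.range M, (1 - a * X ^ n)) (fun M => ?_) M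
  rw [Finset.prod_range_succ]
  exact ⟨-(∏ n ∈ Finset.range M, (1 - a * X ^ n)) * a, by ring⟩

/-- Since B[[p]] is separated, agreement with the finite products modulo every p^M characterizes the
infinite product. -/
theorem eq_qPochR {F a : B⟦X⟧}
    (h : ∀ M, X ^ M ∣ F - ∏ n ∈ Finset.range M, (1 - a * X ^ n)) : F = qPochR a :=
  eq_of_forall_X_pow_dvd fun M => by
    have := dvd_sub (h M) (X_pow_dvd_qPochR_sub a M)
    rwa [sub_sub_sub_cancel_right] at this

theorem qPochR_succ (a : B⟦X⟧) : qPochR a = (1 - a) * qPochR (a * X) := by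
  refine (eq_qPochR fun M => ?_).symm
  refine dvd_sub_trans (dvd_mul_sub_mul' (y := 1 - a) (by simp) (X_pow_dvd_qPochR_sub (a * X) M)) ?_
  have : (1 - a) * ∏ n ∈ Finset.range M, (1 - a * X * X ^ n) =
      ∏ n ∈ Finset.range (M + 1), (1 - a * X ^ n) := by
    rw [Finset.prod_range_succ', mul_comm]
    congr 1
    · exact Finset.prod_congr rfl fun n _ => by ring
    · simp
  rw [this, Finset.prod_range_succ]
  exact ⟨-(∏ n ∈ Finset.range M, (1 - a * X ^ n)) * a, by ring⟩

theorem map_qPochR {B' : Type*} [CommRing B'] (f : B →+* B') (a : B⟦X⟧) :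
    PowerSeries.map f (qPochR a) = qPochR (PowerSeries.map f a) := by
  ext1 d
  rw [coeff_map, qPochR, qPochR, coeff_mk, coeff_mk, ← coeff_map, map_prod]
  simp

theorem constantCoeff_qPochR (a : B⟦X⟧) : constantCoeff (qPochR a) = 1 - constantCoeff a := by
  rw [← coeff_zero_eq_constantCoeff_apply, qPochR, coeff_mk]
  simp

end QPoch

/-! ### Evaluation of double series -/

section Evaluation

open PowerSeries

variable {B : Type*} [CommRing B] (f : ℂ →+* B) (x : B)

/-- The truncated value `∑_{r<M} H_r (x p)^r`. -/
def evTrunc (M : ℕ) (H : ℂ⟦X⟧⟦X⟧) : B⟦X⟧ :=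
  ∑ r ∈ Finset.range M, PowerSeries.map f (coeff r H) * (C x * X) ^ r

theorem evTrunc_eq (M : ℕ) (H : ℂ⟦X⟧⟦X⟧) :
    evTrunc f x M H = (trunc M H).eval₂ (PowerSeries.map f) (C x * X) :=
  (eval₂_trunc_eq_sum_range _ _ _ _).symm

/-- The value `∑_r H_r (x p)^r`. -/
def evFun (H : ℂ⟦X⟧⟦X⟧) : B⟦X⟧ := PowerSeries.mk fun d => coeff d (evTrunc f x (d + 1) H)

theorem X_pow_dvd_evFun_sub (M : ℕ) (H : ℂ⟦X⟧⟦X⟧) :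
    X ^ M ∣ evFun f x H - evTrunc f x M H := by
  refine X_pow_dvd_mk_sub (P := fun M => evTrunc f x M H) (fun M => ?_) M
  rw [evTrunc, Finset.sum_range_succ, ← evTrunc, add_sub_cancel_left, mul_pow]
  exact Dvd.intro_left (PowerSeries.map f (coeff M H) * C x ^ M) (by ring)

/-- The truncation of a product and the product of truncations differ by a multiple of t^M, and t
takes the value xp. -/
theorem X_pow_dvd_evTrunc_mul (M : ℕ) (H K : ℂ⟦X⟧⟦X⟧) :
    X ^ M ∣ evTrunc f x M (H * K) - evTrunc f x M H * evTrunc f x M K := by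
  rw [evTrunc_eq, evTrunc_eq, evTrunc_eq, ← Polynomial.eval₂_mul, ← Polynomial.eval₂_sub]
  have h : (Polynomial.X : Polynomial ℂ⟦X⟧) ^ M ∣ trunc M (H * K) - trunc M H * trunc M K := by
    rw [Polynomial.X_pow_dvd_iff]
    intro d hd
    rw [Polynomial.coeff_sub, sub_eq_zero, ← trunc_trunc_mul_trunc, coeff_trunc, if_pos hd,
      ← Polynomial.coe_mul, Polynomial.coeff_coe]
  obtain ⟨P, hP⟩ := h
  rw [hP, Polynomial.eval₂_mul, Polynomial.eval₂_pow, Polynomial.eval₂_X, mul_pow]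
  exact Dvd.intro_left (C x ^ M * P.eval₂ (PowerSeries.map f) (C x * X)) (by ring)

/-- Evaluation `t ↦ x p` of series over `ℂ[[p]]`. -/
def evIn : ℂ⟦X⟧⟦X⟧ →+* B⟦X⟧ where
  toFun := evFun f x
  map_zero' := by
    refine eq_of_forall_X_pow_dvd fun M => ?_
    simpa [evTrunc] using X_pow_dvd_evFun_sub f x M 0
  map_one' := by
    refine eq_of_forall_X_pow_dvd fun M => ?_
    refine dvd_sub_trans ((pow_dvd_pow X (Nat.le_succ M)).trans
      (X_pow_dvd_evFun_sub f x (M + 1) 1)) ?_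
    rw [evTrunc_eq, trunc_one]
    simp
  map_add' H K := by
    refine eq_of_forall_X_pow_dvd fun M => ?_
    refine dvd_sub_trans (X_pow_dvd_evFun_sub f x M (H + K)) ?_
    have h : evTrunc f x M (H + K) = evTrunc f x M H + evTrunc f x M K := by
      rw [evTrunc_eq, evTrunc_eq, evTrunc_eq, map_add, Polynomial.eval₂_add]
    rw [h, add_sub_add_comm]
    exact dvd_add ((dvd_sub_comm).mp (X_pow_dvd_evFun_sub f x M H))
      ((dvd_sub_comm).mp (X_pow_dvd_evFun_sub f x M K))
  map_mul' H K := by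
    refine eq_of_forall_X_pow_dvd fun M => ?_
    refine dvd_sub_trans (X_pow_dvd_evFun_sub f x M (H * K)) ?_
    refine dvd_sub_trans (X_pow_dvd_evTrunc_mul f x M H K) ?_
    exact dvd_mul_sub_mul' ((dvd_sub_comm).mp (X_pow_dvd_evFun_sub f x M H))
      ((dvd_sub_comm).mp (X_pow_dvd_evFun_sub f x M K))

theorem X_pow_dvd_evIn_sub (M : ℕ) (H : ℂ⟦X⟧⟦X⟧) :
    X ^ M ∣ evIn f x H - evTrunc f x M H := X_pow_dvd_evFun_sub f x M H

theorem evIn_C (a : ℂ⟦X⟧) : evIn f x (C a) = PowerSeries.map f a := by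
  refine eq_of_forall_X_pow_dvd fun M => ?_
  refine dvd_sub_trans ((pow_dvd_pow X (Nat.le_succ M)).trans
    (X_pow_dvd_evIn_sub f x (M + 1) _)) ?_
  rw [evTrunc_eq, trunc_C]
  simp

theorem evIn_X : evIn f x X = C x * X := by
  refine eq_of_forall_X_pow_dvd fun M => ?_
  refine dvd_sub_trans ((pow_dvd_pow X (by omega : M ≤ M + 2)).trans
    (X_pow_dvd_evIn_sub f x (M + 2) _)) ?_
  rw [evTrunc_eq, trunc_X]
  simp

theorem map_cst (a : ℂ) : PowerSeries.map f (cst a) = C (f a) := map_C _ _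

theorem map_nome : PowerSeries.map f nome = X := map_X _

theorem X_pow_dvd_evIn_sub_one {F : ℂ⟦X⟧⟦X⟧} {M : ℕ} (h0 : constantCoeff F = 1)
    (h : ∀ r, r ≠ 0 → nome ^ M ∣ coeff r F) : X ^ M ∣ evIn f x F - 1 := by
  refine dvd_sub_trans (y := evTrunc f x (M + 1) F)
    ((pow_dvd_pow X (Nat.le_succ M)).trans (X_pow_dvd_evIn_sub f x (M + 1) F)) ?_
  rw [evTrunc, Finset.sum_range_succ', coeff_zero_eq_constantCoeff_apply, h0, map_one, pow_zero,
    mul_one, add_sub_cancel_right]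
  refine Finset.dvd_sum fun r _ => Dvd.dvd.mul_right ?_ _
  have := map_dvd (PowerSeries.map f) (h (r + 1) (Nat.succ_ne_zero r))
  rwa [map_pow, map_nome] at this

/-- Evaluate the finite factorization of `qE`; the remaining factor is 1 modulo p^M. -/
theorem evIn_qE (c : ℂ) : evIn f x (qE c) = qPochR (C (f c * x) * X) := by
  refine eq_qPochR fun M => ?_
  rw [qE_eq_prod c M, map_mul, map_prod]
  have h1 : ∏ n ∈ Finset.range M, evIn f x (1 - C (cst c * nome ^ n) * X) =
      ∏ n ∈ Finset.range M, (1 - C (f c * x) * X * X ^ n) := by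
    refine Finset.prod_congr rfl fun n _ => ?_
    rw [map_sub, map_one, map_mul, evIn_C, evIn_X, map_mul, map_pow, map_cst, map_nome, map_mul]
    ring
  rw [h1]
  have h2 : X ^ M ∣ evIn f x (formalExp (rescale (cst c * nome ^ M) logQ)) - 1 :=
    X_pow_dvd_evIn_sub_one f x (constantCoeff_formalExp _) fun r hr =>
      nome_pow_dvd_coeff_formalExp_rescale (dvd_mul_left _ _) hr
  have := h2.mul_left (∏ n ∈ Finset.range M, (1 - C (f c * x) * X * X ^ n))
  rwa [mul_sub, mul_one] at this

end Evaluation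

/-! ### Series in a Laurent variable that carries no power of p -/

section Swap

open PowerSeries

/-- Exchange of the two variables of a double series. -/
def swapVar : ℂ⟦X⟧⟦X⟧ →+* ℂ⟦X⟧⟦X⟧ where
  toFun H := PowerSeries.mk fun d => PowerSeries.mk fun r => coeff d (coeff r H)
  map_zero' := by ext; simp
  map_one' := by
    ext d r
    rw [coeff_mk, coeff_mk, coeff_one, coeff_one]
    by_cases hr : r = 0 <;> by_cases hd : d = 0 <;> simp [hr, hd, coeff_one]
  map_add' H K := by ext; simp
  map_mul' H K := by
    ext d r
    simp only [coeff_mk, coeff_mul, map_sum]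
    rw [Finset.sum_comm]

theorem coeff_coeff_swapVar (H : ℂ⟦X⟧⟦X⟧) (d r : ℕ) :
    coeff r (coeff d (swapVar H)) = coeff d (coeff r H) := by
  simp [swapVar]

theorem swapVar_C (a : ℂ⟦X⟧) : swapVar (C a) = PowerSeries.map C a := by
  ext d r
  rw [coeff_coeff_swapVar, coeff_map, coeff_C, coeff_C]
  split_ifs <;> simp

theorem swapVar_X : swapVar X = C X := by
  ext d r
  rw [coeff_coeff_swapVar, coeff_X, coeff_C]
  by_cases hr : r = 1 <;> by_cases hd : d = 0 <;> simp [hr, hd, coeff_X, coeff_one]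

/-- The argument t is not p-adically small here, so it cannot be evaluated as in `evIn`. Instead the
double series is reordered by powers of p, with power series in t as coefficients. -/
theorem swapVar_qE (c : ℂ) : swapVar (qE c) = qPochR (C (C c * X)) := by
  refine eq_qPochR fun M => ?_
  rw [qE_eq_prod c M, map_mul, map_prod]
  have h1 : ∏ n ∈ Finset.range M, swapVar (1 - C (cst c * nome ^ n) * X) =
      ∏ n ∈ Finset.range M, (1 - C (C c * X) * X ^ n) := by
    refine Finset.prod_congr rfl fun n _ => ?_
    rw [map_sub, map_one, map_mul, swapVar_C, swapVar_X, map_mul, map_pow, map_cst, map_nome,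
      map_mul]
    ring
  rw [h1]
  have h2 : X ^ M ∣ swapVar (formalExp (rescale (cst c * nome ^ M) logQ)) - 1 := by
    rw [X_pow_dvd_iff]
    intro d hd
    ext r
    rw [map_sub, map_sub, coeff_coeff_swapVar, map_zero, sub_eq_zero]
    by_cases hr : r = 0
    · subst hr
      rw [coeff_zero_eq_constantCoeff_apply, constantCoeff_formalExp, coeff_one, coeff_one]
      split_ifs <;> simp
    · have := nome_pow_dvd_coeff_formalExp_rescale (c := cst c * nome ^ M) (S := logQ)
        (dvd_mul_left _ _) hr
      rw [X_pow_dvd_iff.mp this d hd, coeff_one]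
      split_ifs <;> simp [coeff_one, hr]
  have := h2.mul_left (∏ n ∈ Finset.range M, (1 - C (C c * X) * X ^ n))
  rwa [mul_sub, mul_one] at this

/-- The substitution of the Laurent variable for `t`. -/
def toLaurent : ℂ⟦X⟧⟦X⟧ →+* (LaurentSeries ℂ)⟦X⟧ :=
  (PowerSeries.map (HahnSeries.ofPowerSeries ℤ ℂ)).comp swapVar

theorem toLaurent_qE (c : ℂ) :
    toLaurent (qE c) = qPochR (C (laurentC c * HahnSeries.single (1 : ℤ) (1 : ℂ))) := by
  rw [toLaurent, RingHom.comp_apply, swapVar_qE, map_qPochR, map_C, map_mul,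
    HahnSeries.ofPowerSeries_C, HahnSeries.ofPowerSeries_X]
  rfl

/-- The coefficient of `T^n`. -/
def coeffT (n : ℤ) (F : (LaurentSeries ℂ)⟦X⟧) : ℂ⟦X⟧ :=
  PowerSeries.mk fun d => HahnSeries.coeff (coeff d F) n

theorem coeffT_sub (n : ℤ) (F G : (LaurentSeries ℂ)⟦X⟧) :
    coeffT n (F - G) = coeffT n F - coeffT n G := by
  ext; simp [coeffT]

theorem coeffT_sum {ι : Type*} (n : ℤ) (I : Finset ι) (F : ι → (LaurentSeries ℂ)⟦X⟧) :
    coeffT n (∑ i ∈ I, F i) = ∑ i ∈ I, coeffT n (F i) := by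
  ext; simp [coeffT, HahnSeries.coeff_sum]

theorem coeffT_map_mul (n : ℤ) (c : ℂ⟦X⟧) (F : (LaurentSeries ℂ)⟦X⟧) :
    coeffT n (PowerSeries.map laurentC c * F) = c * coeffT n F := by
  ext d
  simp [coeffT, coeff_mul, HahnSeries.coeff_sum, laurentC]

theorem coeffT_C_mul (n : ℤ) (c : ℂ) (F : (LaurentSeries ℂ)⟦X⟧) :
    coeffT n (C (laurentC c) * F) = cst c * coeffT n F := by
  rw [← coeffT_map_mul, map_cst]

theorem coeffT_single_mul (n m : ℤ) (F : (LaurentSeries ℂ)⟦X⟧) :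
    coeffT n (C (HahnSeries.single m (1 : ℂ)) * F) = coeffT (n - m) F := by
  ext d
  have := HahnSeries.coeff_single_mul_add (r := (1 : ℂ)) (x := coeff d F) (a := n - m) (b := m)
  simp only [coeffT, coeff_mk, coeff_C_mul]
  rw [sub_add_cancel, one_mul] at this
  exact this

theorem X_pow_dvd_coeffT {M : ℕ} {F : (LaurentSeries ℂ)⟦X⟧} (h : X ^ M ∣ F) (n : ℤ) :
    X ^ M ∣ coeffT n F := by
  rw [X_pow_dvd_iff] at h ⊢
  intro d hd
  simp [coeffT, h d hd]

theorem coeffT_toLaurent (n : ℤ) (F : ℂ⟦X⟧⟦X⟧) : coeffT n (toLaurent F) = coeffZ n F := by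
  ext d
  simp only [coeffT, toLaurent, coeff_mk, RingHom.comp_apply, coeff_map, coeffZ]
  split_ifs with h
  · obtain ⟨m, rfl⟩ := Int.eq_ofNat_of_zero_le h
    simp [coeff_coeff_swapVar]
  · rw [HahnSeries.ofPowerSeries_apply, HahnSeries.embDomain_of_notMem_range]
    · simp
    · rintro ⟨m, hm⟩
      simp at hm
      omega

end Swap

/-! ### Theta functions -/

section Theta

open PowerSeries

/-- The unit part `(p x; p)_∞ (p y; p)_∞` of `θ(x)`, where `y = 1/x`. -/
def thetaR {B : Type*} [CommRing B] (x y : B) : B⟦X⟧ := qPochR (C x * X) * qPochR (C y * X)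

theorem thetaR_comm {B : Type*} [CommRing B] (x y : B) : thetaR x y = thetaR y x := mul_comm _ _

theorem map_thetaR {B B' : Type*} [CommRing B] [CommRing B'] (f : B →+* B') (x y : B) :
    PowerSeries.map f (thetaR x y) = thetaR (f x) (f y) := by
  simp [thetaR, map_qPochR]

theorem constantCoeff_thetaR {B : Type*} [CommRing B] (x y : B) :
    constantCoeff (thetaR x y) = 1 := by
  simp [thetaR, constantCoeff_qPochR]

variable {L : Type*} [Field L]

theorem theta_eq (x : L) : theta x = C (1 - x) * thetaR x x⁻¹ := by
  rw [theta, thetaR, qPoch_eq_qPochR, qPoch_eq_qPochR, qPochR_succ (C x), map_sub, map_one,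
    mul_assoc]

theorem constantCoeff_theta (x : L) : constantCoeff (theta x) = 1 - x := by
  simp [theta_eq, constantCoeff_thetaR]

theorem theta_one : theta (1 : L) = 0 := by simp [theta_eq]

theorem theta_inv {x : L} (hx : x ≠ 0) : theta x⁻¹ = -C x⁻¹ * theta x := by
  rw [theta_eq, theta_eq, inv_inv, thetaR_comm, ← map_neg, ← mul_assoc, ← map_mul]
  congr 2
  field_simp
  ring

theorem theta_ne_zero {x : L} (hx : x ≠ 1) : theta x ≠ 0 := by
  intro h
  have := constantCoeff_theta x
  rw [h, map_zero] at this
  exact hx (sub_eq_zero.mp this.symm).symm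

theorem theta_mul_inv {x : L} (hx : x ≠ 1) : theta x * (theta x)⁻¹ = 1 := by
  apply PowerSeries.mul_inv_cancel
  rw [constantCoeff_theta, sub_ne_zero]
  exact hx.symm

theorem inv_mul' {F G : L⟦X⟧} : (F * G)⁻¹ = F⁻¹ * G⁻¹ := by
  rw [PowerSeries.mul_inv_rev, mul_comm]

/-- In θ(cT) = (cT;p)_∞ (p c⁻¹T⁻¹;p)_∞ the first product is a power series in T, read by
`toLaurent`. In the second one every T⁻¹ comes with a p, so it is a p-adic evaluation. -/
theorem theta_laurent (c : ℂ) :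
    theta (laurentC c * HahnSeries.single (1 : ℤ) (1 : ℂ)) =
      toLaurent (qE c) * evIn laurentC (HahnSeries.single (1 : ℤ) (1 : ℂ))⁻¹ (qE c⁻¹) := by
  rw [theta, toLaurent_qE, evIn_qE, qPoch_eq_qPochR, qPoch_eq_qPochR, mul_inv, map_inv₀]

/-- Both factors are invertible as power series in t already, so the inverse in ℂ((T))[[p]] is given
by the expansions of the two inverses. -/
theorem theta_laurent_inv (c : ℂ) :
    (theta (laurentC c * HahnSeries.single (1 : ℤ) (1 : ℂ)))⁻¹ =
      toLaurent (qEInv c) * evIn laurentC (HahnSeries.single (1 : ℤ) (1 : ℂ))⁻¹ (qEInv c⁻¹) := by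
  have h1 := congrArg toLaurent (qE_mul_qEInv c)
  have h2 := congrArg (evIn laurentC (HahnSeries.single (1 : ℤ) (1 : ℂ))⁻¹) (qE_mul_qEInv c⁻¹)
  rw [map_mul, map_one toLaurent] at h1
  rw [map_mul, map_one (evIn _ _)] at h2
  have h : theta (laurentC c * HahnSeries.single (1 : ℤ) (1 : ℂ)) *
      (toLaurent (qEInv c) * evIn laurentC (HahnSeries.single (1 : ℤ) (1 : ℂ))⁻¹ (qEInv c⁻¹)) =
      1 := by
    rw [theta_laurent c, mul_mul_mul_comm, h1, h2, one_mul]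
  refine ((PowerSeries.eq_inv_iff_mul_eq_one ?_).mpr ?_).symm
  · intro h0
    have := congrArg constantCoeff h
    rw [map_mul, h0, zero_mul, map_one] at this
    exact zero_ne_one this
  · rw [mul_comm, h]

/-- `∏ θ(a_i T) / θ(b_i T)`. -/
def thetaQuot {ι : Type*} (I : Finset ι) (a b : ι → ℂ) (T : LaurentSeries ℂ) :
    (LaurentSeries ℂ)⟦X⟧ :=
  ∏ i ∈ I, theta (laurentC (a i) * T) * (theta (laurentC (b i) * T))⁻¹

/-- `∏ (a_i t; p)_∞ / (b_i t; p)_∞`. -/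
def qQuot {ι : Type*} (I : Finset ι) (a b : ι → ℂ) : ℂ⟦X⟧⟦X⟧ :=
  ∏ i ∈ I, qE (a i) * qEInv (b i)

theorem thetaQuot_eq {ι : Type*} (I : Finset ι) (a b : ι → ℂ) :
    thetaQuot I a b (HahnSeries.single (1 : ℤ) (1 : ℂ)) =
      evIn laurentC (HahnSeries.single (1 : ℤ) (1 : ℂ))⁻¹
        (qQuot I (fun i => (a i)⁻¹) fun i => (b i)⁻¹) * toLaurent (qQuot I a b) := by
  rw [thetaQuot, qQuot, qQuot, map_prod, map_prod, ← Finset.prod_mul_distrib]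
  refine Finset.prod_congr rfl fun i _ => ?_
  rw [theta_laurent, theta_laurent_inv, map_mul, map_mul]
  ring

/-- The negative power T^{-r} is accompanied by p^r, so modulo p^M only r < M matters. The truncated
sum has the shape of the sums in the definition of φ^±. -/
theorem X_pow_dvd_coeffT_thetaQuot {ι : Type*} (I : Finset ι) (a b : ι → ℂ) (n : ℤ) (M : ℕ) :
    nome ^ M ∣ coeffT n (thetaQuot I a b (HahnSeries.single (1 : ℤ) (1 : ℂ))) -
      ∑ r ∈ Finset.range M,
        coeff r (rescale nome (qQuot I (fun i => (a i)⁻¹) fun i => (b i)⁻¹)) *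
          coeffZ (r + n) (qQuot I a b) := by
  rw [thetaQuot_eq]
  set H := qQuot I (fun i => (a i)⁻¹) fun i => (b i)⁻¹
  set K := qQuot I a b
  have h1 := X_pow_dvd_evIn_sub laurentC (HahnSeries.single (1 : ℤ) (1 : ℂ))⁻¹ M H
  have h2 := X_pow_dvd_coeffT (h1.mul_right (toLaurent K)) n
  rw [sub_mul, coeffT_sub] at h2
  have h4 : coeffT n (evTrunc laurentC (HahnSeries.single (1 : ℤ) (1 : ℂ))⁻¹ M H * toLaurent K) =
      ∑ r ∈ Finset.range M, coeff r (rescale nome H) * coeffZ (r + n) K := by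
    rw [evTrunc, Finset.sum_mul, coeffT_sum]
    refine Finset.sum_congr rfl fun r _ => ?_
    have h3 : (C (HahnSeries.single (1 : ℤ) (1 : ℂ))⁻¹ * X : (LaurentSeries ℂ)⟦X⟧) ^ r =
        PowerSeries.map laurentC (nome ^ r) * C (HahnSeries.single (-(r : ℤ)) (1 : ℂ)) := by
      rw [mul_pow, ← map_pow, HahnSeries.inv_single, HahnSeries.single_pow,
        map_pow (PowerSeries.map laurentC), map_nome, mul_comm]
      simp
    rw [h3, ← mul_assoc, ← map_mul, mul_assoc, coeffT_map_mul, coeffT_single_mul,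
      coeffT_toLaurent, coeff_rescale, sub_neg_eq_add, add_comm n]
    ring
  rw [h4] at h2
  exact h2

end Theta

/-! ### The structure functions `g_{ij}` -/

section GSeries

open PowerSeries

theorem pStar_one : pStar 1 = nome := by simp [pStar, cst]

/-- `(q^b t; p)_∞ / (q^{-b} t; p)_∞`. -/
def gQuot (q : ℂ) (b : ℤ) : ℂ⟦X⟧⟦X⟧ := qE (q ^ b) * qEInv (q ^ (-b))

/-- Splitting q^{bm} - q^{-bm} in the exponent exhibits g(z;p) as (q^b pz;p)_∞ / (q^{-b} pz;p)_∞. -/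
theorem gSeries_nome (q : ℂ) (b : ℤ) : gSeries q b nome = rescale nome (gQuot q b) := by
  rw [gQuot, qE, qEInv, ← formalExp_add (constantCoeff_rescale_logQ _)
    (by rw [map_neg, constantCoeff_rescale_logQ, neg_zero]), rescale_formalExp, gSeries]
  congr 1
  ext1 m
  rw [coeff_mk, coeff_rescale, map_add, map_neg, coeff_rescale, coeff_rescale, logQ, posSeries,
    coeff_mk]
  split_ifs
  · simp
  · rw [← cst_pow, ← cst_pow, div_eq_mul_one_div, cst_mul, cst_sub, zpow_mul, zpow_natCast,
      ← neg_mul b, zpow_mul, zpow_natCast]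
    ring

theorem gQuot_mul_neg (q : ℂ) (b : ℤ) : gQuot q b * gQuot q (-b) = 1 := by
  have h1 := qE_mul_qEInv (q ^ b)
  have h2 := qE_mul_qEInv (q ^ (-b))
  rw [gQuot, gQuot, neg_neg]
  linear_combination h1 * (qE (q ^ (-b)) * qEInv (q ^ (-b))) + h2

theorem constantCoeff_gSeries (q : ℂ) (b : ℤ) (s : ℂ⟦X⟧) :
    constantCoeff (gSeries q b s) = 1 := constantCoeff_formalExp _

/-- Inversion exchanges q^b and q^{-b}. Hence the relations of x^- are those of x^+ with the sign of
the Cartan matrix reversed, which is the role of `ε = ±1` below. -/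
theorem gSeriesInv_nome (q : ℂ) (b : ℤ) : gSeriesInv q b nome = gSeries q (-b) nome := by
  have h1 : gSeries q b nome * gSeriesInv q b nome = 1 :=
    mul_invOfUnit _ 1 (constantCoeff_gSeries _ _ _)
  have h2 : gSeries q b nome * gSeries q (-b) nome = 1 := by
    rw [gSeries_nome, gSeries_nome, ← map_mul, gQuot_mul_neg, map_one]
  linear_combination gSeries q (-b) nome * h1 - gSeriesInv q b nome * h2

/-- The value `∑_r g_r y^r` of `g(z; p)` at `z = y`. -/
def gVal (q : ℂ) (b : ℤ) (y : ℂ) : ℂ⟦X⟧ := evIn (RingHom.id ℂ) y (gQuot q b)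

/-- The bridge between the truncated sums in the relations and the exact value, for which theta
identities are available. -/
theorem nome_pow_dvd_gVal_sub (q : ℂ) (b : ℤ) (y : ℂ) (M : ℕ) :
    nome ^ M ∣ ∑ r ∈ Finset.range M, coeff r (gSeries q b nome) * cst (y ^ r) - gVal q b y := by
  have h := X_pow_dvd_evIn_sub (RingHom.id ℂ) y M (gQuot q b)
  rw [dvd_sub_comm] at h
  have h2 : ∑ r ∈ Finset.range M, coeff r (gSeries q b nome) * cst (y ^ r) =
      evTrunc (RingHom.id ℂ) y M (gQuot q b) := by
    refine Finset.sum_congr rfl fun r _ => ?_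
    rw [gSeries_nome, coeff_rescale, mul_pow, cst_pow, map_id, id, cst, nome]
    ring
  rw [h2]
  exact h

theorem gVal_mul (q : ℂ) (b : ℤ) (y : ℂ) :
    gVal q b y * qPochR (C (q ^ (-b) * y) * X) = qPochR (C (q ^ b * y) * X) := by
  have h2 := congrArg (evIn (RingHom.id ℂ) y) (qE_mul_qEInv (q ^ (-b)))
  have h3 := evIn_qE (RingHom.id ℂ) y (q ^ b)
  have h4 := evIn_qE (RingHom.id ℂ) y (q ^ (-b))
  simp only [RingHom.id_apply] at h3 h4
  rw [map_mul, h4, map_one] at h2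
  rw [gVal, gQuot, map_mul, h3, mul_assoc, mul_comm (evIn _ _ _), h2, mul_one]

theorem constantCoeff_qPochR_mul_X (y : ℂ) : constantCoeff (qPochR (C y * X)) = 1 := by
  simp [constantCoeff_qPochR]

theorem ne_zero_of_constantCoeff {F : ℂ⟦X⟧} (h : constantCoeff F ≠ 0) : F ≠ 0 := by
  rintro rfl; simp at h

/-- The relation between theta functions and the structure function `g`. -/
theorem gVal_exchange {q : ℂ} (hq : q ≠ 0) (b : ℤ) {x : ℂ} {F G : ℂ⟦X⟧}
    (h : theta (q ^ b * x) * F = cst (q ^ b) * theta (q ^ (-b) * x) * G) :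
    cst (1 - q ^ b * x) * gVal q b x * F = cst (q ^ b - x) * gVal q b x⁻¹ * G := by
  have hqb : q ^ b ≠ 0 := zpow_ne_zero _ hq
  have e1 : (q ^ b * x)⁻¹ = q ^ (-b) * x⁻¹ := by rw [mul_inv, zpow_neg]
  have e2 : (q ^ (-b) * x)⁻¹ = q ^ b * x⁻¹ := by rw [mul_inv, ← zpow_neg, neg_neg]
  rw [theta_eq, theta_eq, thetaR, thetaR, e1, e2] at h
  have g1 := gVal_mul q b x
  have g2 := gVal_mul q b x⁻¹
  have hD : qPochR (C (q ^ (-b) * x) * X) * qPochR (C (q ^ (-b) * x⁻¹) * X) ≠ 0 :=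
    mul_ne_zero (ne_zero_of_constantCoeff (by rw [constantCoeff_qPochR_mul_X]; exact one_ne_zero))
      (ne_zero_of_constantCoeff (by rw [constantCoeff_qPochR_mul_X]; exact one_ne_zero))
  have hc : cst (q ^ b - x) = cst (q ^ b) * C (1 - q ^ (-b) * x) := by
    rw [cst, cst, ← map_mul, mul_sub, ← mul_assoc, ← zpow_add₀ hq]
    simp
  -- `hD` is the product of the denominators of the two values of g; after multiplication by it,
  -- only the four factors of the thetas in the hypothesis remain.
  apply mul_left_cancel₀ hD
  rw [hc]
  rw [← g1, ← g2] at h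
  rw [cst]
  linear_combination h

end GSeries

/-! ### Difference of the two expansions of a quotient of theta functions -/

section Residue

open PowerSeries LaurentPolynomial

/-- The Laurent variable as a unit. -/
def varT : (LaurentSeries ℂ)ˣ where
  val := HahnSeries.single (1 : ℤ) (1 : ℂ)
  inv := HahnSeries.single (-1 : ℤ) (1 : ℂ)
  val_inv := by simp
  inv_val := by simp

theorem varT_zpow (k : ℤ) :
    ((varT ^ k : (LaurentSeries ℂ)ˣ) : LaurentSeries ℂ) = HahnSeries.single k (1 : ℂ) := by
  rw [Units.val_zpow_eq_zpow_val]
  exact (RatFunc.single_zpow (F := ℂ) k).symm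

theorem coeff_laurentC_mul (a : ℂ) (F : LaurentSeries ℂ) (n : ℤ) :
    HahnSeries.coeff (laurentC a * F) n = a * HahnSeries.coeff F n := by
  rw [laurentC, HahnSeries.C_mul_eq_smul, HahnSeries.coeff_smul, smul_eq_mul]

theorem one_sub_mul_single_ne_zero (b : ℂ) {e : ℤ} (he : e ≠ 0) :
    1 - laurentC b * HahnSeries.single e (1 : ℂ) ≠ 0 := by
  intro h
  have := congrArg (fun x => HahnSeries.coeff x 0) h
  simp [laurentC, he.symm] at this

theorem inv_one_sub_mul_single (b : ℂ) :
    (1 - laurentC b * HahnSeries.single (1 : ℤ) (1 : ℂ))⁻¹ =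
      HahnSeries.ofPowerSeries ℤ ℂ (PowerSeries.mk fun m => b ^ m) := by
  refine inv_eq_of_mul_eq_one_right ?_
  have h : (1 - PowerSeries.C b * X) * PowerSeries.mk (fun m => b ^ m) = (1 : ℂ⟦X⟧) := by
    have := congrArg (rescale b) (mk_one_mul_one_sub_eq_one ℂ)
    rw [map_mul, map_sub, map_one, rescale_X, mul_comm] at this
    have h : PowerSeries.mk (fun m => b ^ m) = rescale b (PowerSeries.mk 1) := by
      ext1
      simp
    rw [h, this]
  have := congrArg (HahnSeries.ofPowerSeries ℤ ℂ) h
  rwa [map_mul, map_sub, map_one, map_mul, HahnSeries.ofPowerSeries_C,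
    HahnSeries.ofPowerSeries_X] at this

theorem coeff_ofPowerSeries (F : ℂ⟦X⟧) (n : ℤ) :
    HahnSeries.coeff (HahnSeries.ofPowerSeries ℤ ℂ F) n = coeffZ n F := by
  rw [coeffZ]
  split_ifs with h
  · obtain ⟨m, rfl⟩ := Int.eq_ofNat_of_zero_le h
    simp
  · rw [HahnSeries.ofPowerSeries_apply, HahnSeries.embDomain_of_notMem_range]
    rintro ⟨m, hm⟩
    simp at hm
    omega

theorem coeff_single_mul_inv_one_sub (b : ℂ) (k n : ℤ) :
    HahnSeries.coeff (HahnSeries.single k (1 : ℂ) *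
      (1 - laurentC b * HahnSeries.single (1 : ℤ) (1 : ℂ))⁻¹) n =
      if k ≤ n then b ^ (n - k) else 0 := by
  have := HahnSeries.coeff_single_mul_add (r := (1 : ℂ)) (x := (1 - laurentC b *
    HahnSeries.single (1 : ℤ) (1 : ℂ))⁻¹) (a := n - k) (b := k)
  rw [sub_add_cancel, one_mul] at this
  rw [this, inv_one_sub_mul_single, coeff_ofPowerSeries, coeffZ]
  simp only [sub_nonneg]
  split_ifs with h
  · rw [coeff_mk, ← zpow_natCast, Int.toNat_of_nonneg (by omega)]
  · rfl

/-- In the other region, 1/(1-bT) is expanded as -∑_{m<0} b^m T^m. Together with the previous lemma: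
the two expansions are complementary halves of one two-sided geometric series. -/
theorem coeff_single_mul_inv_one_sub' {b : ℂ} (hb : b ≠ 0) (k n : ℤ) :
    HahnSeries.coeff (HahnSeries.single (-k) (1 : ℂ) *
      (1 - laurentC b * HahnSeries.single (-1 : ℤ) (1 : ℂ))⁻¹) (-n) =
      if k ≤ n then 0 else -b ^ (n - k) := by
  have h1 : (1 - laurentC b * HahnSeries.single (-1 : ℤ) (1 : ℂ))⁻¹ =
      HahnSeries.C (-b⁻¹) * (HahnSeries.single (1 : ℤ) (1 : ℂ) *
        (1 - laurentC b⁻¹ * HahnSeries.single (1 : ℤ) (1 : ℂ))⁻¹) := by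
    refine inv_eq_of_mul_eq_one_right ?_
    have h2 := mul_inv_cancel₀ (one_sub_mul_single_ne_zero b⁻¹ one_ne_zero)
    have h3 : laurentC b * laurentC b⁻¹ = 1 := by
      rw [← map_mul, mul_inv_cancel₀ hb, map_one]
    have h4 : HahnSeries.single (-1 : ℤ) (1 : ℂ) * HahnSeries.single (1 : ℤ) (1 : ℂ) = 1 :=
      varT.inv_val
    have h5 : HahnSeries.C (-b⁻¹) = -laurentC b⁻¹ := map_neg _ _
    rw [h5]
    linear_combination h2 + (1 - laurentC b⁻¹ * HahnSeries.single (1 : ℤ) (1 : ℂ))⁻¹ *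
      (h3 + laurentC b * laurentC b⁻¹ * h4)
  rw [h1, mul_left_comm, HahnSeries.C_mul_eq_smul, ← mul_assoc, HahnSeries.single_mul_single,
    one_mul, HahnSeries.coeff_smul, coeff_single_mul_inv_one_sub]
  by_cases h : k ≤ n
  · rw [if_pos h, if_neg (by omega), smul_zero]
  · rw [if_neg h, if_pos (by omega), smul_eq_mul, inv_zpow', neg_mul]
    congr 1
    rw [← zpow_neg_one, ← zpow_add₀ hb]
    congr 1
    ring

/-- `N(x) / ∏_{i ∈ S} (1 - b_i x)`. -/
def ratExp {ι : Type*} (b : ι → ℂ) (S : Finset ι) (P : ℂ[T;T⁻¹]) (x : (LaurentSeries ℂ)ˣ) :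
    LaurentSeries ℂ :=
  eval₂ laurentC x P * ∏ i ∈ S, (1 - laurentC (b i) * x)⁻¹

/-- The difference of the coefficients of the two expansions. -/
def expDiff {ι : Type*} (b : ι → ℂ) (S : Finset ι) (P : ℂ[T;T⁻¹]) (n : ℤ) : ℂ :=
  HahnSeries.coeff (ratExp b S P varT) n - HahnSeries.coeff (ratExp b S P varT⁻¹) (-n)

theorem expDiff_add {ι : Type*} (b : ι → ℂ) (S : Finset ι) (P Q : ℂ[T;T⁻¹]) (n : ℤ) :
    expDiff b S (P + Q) n = expDiff b S P n + expDiff b S Q n := by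
  simp only [expDiff, ratExp, map_add, add_mul, HahnSeries.coeff_add]
  ring

/-- Without poles there is only one expansion. -/
theorem expDiff_empty {ι : Type*} (b : ι → ℂ) (P : ℂ[T;T⁻¹]) (n : ℤ) : expDiff b ∅ P n = 0 := by
  induction P using LaurentPolynomial.induction_on' with
  | add P Q hP hQ => rw [expDiff_add, hP, hQ, add_zero]
  | C_mul_T k a =>
    simp only [expDiff, ratExp, Finset.prod_empty, mul_one, eval₂_C_mul_T, inv_zpow', varT_zpow,
      laurentC, HahnSeries.C_mul_eq_smul, HahnSeries.coeff_smul, HahnSeries.coeff_single]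
    by_cases h : n = k <;> simp [h]

/-- The two half series add up to ∑_n b^n T^n, the delta function at T = 1/b; multiplying it by the
numerator evaluates the numerator there. -/
theorem expDiff_singleton {ι : Type*} {b : ι → ℂ} {i : ι} (hb : b i ≠ 0) (P : ℂ[T;T⁻¹]) (n : ℤ) :
    expDiff b {i} P n = b i ^ n * eval₂ (RingHom.id ℂ) (Units.mk0 (b i) hb)⁻¹ P := by
  induction P using LaurentPolynomial.induction_on' with
  | add P Q hP hQ => rw [expDiff_add, hP, hQ, map_add, mul_add]
  | C_mul_T k a =>
    have h1 := coeff_single_mul_inv_one_sub (b i) k n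
    have h2 := coeff_single_mul_inv_one_sub' hb k n
    have h3 : ((varT : (LaurentSeries ℂ)ˣ) : LaurentSeries ℂ) = HahnSeries.single 1 1 := rfl
    have h4 : ((varT⁻¹ : (LaurentSeries ℂ)ˣ) : LaurentSeries ℂ) = HahnSeries.single (-1) 1 := rfl
    rw [expDiff, ratExp, ratExp, Finset.prod_singleton, Finset.prod_singleton, eval₂_C_mul_T,
      eval₂_C_mul_T, eval₂_C_mul_T, inv_zpow', inv_zpow', varT_zpow, varT_zpow, mul_assoc,
      mul_assoc, h3, h4, coeff_laurentC_mul, coeff_laurentC_mul, h1, h2,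
      Units.val_zpow_eq_zpow_val, Units.val_mk0, RingHom.id_apply]
    have h5 : b i ^ (n - k) = b i ^ n * b i ^ (-k) := by rw [← zpow_add₀ hb, sub_eq_add_neg]
    split_ifs <;> rw [h5] <;> ring

/-- Partial fractions for two poles: (b_i - b_j)/((1 - b_i x)(1 - b_j x)) = b_i/(1 - b_i x) - b_j/(1
- b_j x). -/
theorem ratExp_insert_insert {ι : Type*} [DecidableEq ι] {b : ι → ℂ} {S : Finset ι} {i j : ι}
    (hij : i ≠ j) (hi : i ∉ S) (hj : j ∉ S) (P : ℂ[T;T⁻¹]) {x : (LaurentSeries ℂ)ˣ}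
    (hx : ∀ c, 1 - laurentC c * x ≠ 0) :
    laurentC (b i - b j) * ratExp b (insert i (insert j S)) P x =
      laurentC (b i) * ratExp b (insert i S) P x -
        laurentC (b j) * ratExp b (insert j S) P x := by
  have h1 := mul_inv_cancel₀ (hx (b i))
  have h2 := mul_inv_cancel₀ (hx (b j))
  rw [ratExp, ratExp, ratExp, Finset.prod_insert (by simp [hij, hi]), Finset.prod_insert hj,
    Finset.prod_insert hi, map_sub]
  linear_combination eval₂ laurentC x P * (∏ i ∈ S, (1 - laurentC (b i) * x)⁻¹) *
    (laurentC (b i) * (1 - laurentC (b i) * x)⁻¹ * h2 -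
      laurentC (b j) * (1 - laurentC (b j) * x)⁻¹ * h1)

theorem expDiff_insert_insert {ι : Type*} [DecidableEq ι] {b : ι → ℂ} {S : Finset ι} {i j : ι}
    (hij : i ≠ j) (hi : i ∉ S) (hj : j ∉ S) (P : ℂ[T;T⁻¹]) (n : ℤ) :
    (b i - b j) * expDiff b (insert i (insert j S)) P n =
      b i * expDiff b (insert i S) P n - b j * expDiff b (insert j S) P n := by
  have h1 := congrArg (fun F => HahnSeries.coeff F n) (ratExp_insert_insert (b := b) hij hi hj P
    (x := varT) fun c => one_sub_mul_single_ne_zero c one_ne_zero)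
  have h2 := congrArg (fun F => HahnSeries.coeff F (-n)) (ratExp_insert_insert (b := b) hij hi hj P
    (x := varT⁻¹) fun c => one_sub_mul_single_ne_zero c (by norm_num))
  simp only [laurentC, HahnSeries.C_mul_eq_smul, HahnSeries.coeff_smul, HahnSeries.coeff_sub,
    smul_eq_mul] at h1 h2
  rw [expDiff, expDiff, expDiff]
  linear_combination h1 - h2

/-- For distinct simple poles, each pole contributes a delta function times the value of the other
factors at the pole. The proof reduces the number of poles by partial fractions for two of them. -/
theorem expDiff_eq_sum {ι : Type*} [DecidableEq ι] {b : ι → ℂ} (hb : ∀ i, b i ≠ 0)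
    (P : ℂ[T;T⁻¹]) (n : ℤ) (S : Finset ι) (hinj : Set.InjOn b S) :
    expDiff b S P n = ∑ i ∈ S, b i ^ n * eval₂ (RingHom.id ℂ) (Units.mk0 (b i) (hb i))⁻¹ P *
      ∏ l ∈ S.erase i, (1 - b l / b i)⁻¹ := by
  induction hm : S.card using Nat.strong_induction_on generalizing S with
  | _ m ih =>
  obtain rfl | ⟨i, hi⟩ := S.eq_empty_or_nonempty
  · rw [expDiff_empty, Finset.sum_empty]
  obtain ⟨S, hiS, rfl⟩ : ∃ S', i ∉ S' ∧ insert i S' = S :=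
    ⟨S.erase i, by simp, Finset.insert_erase hi⟩
  obtain rfl | ⟨j, hj⟩ := S.eq_empty_or_nonempty
  · simp [expDiff_singleton (hb i)]
  obtain ⟨S, hjS, rfl⟩ : ∃ S', j ∉ S' ∧ insert j S' = S :=
    ⟨S.erase j, by simp, Finset.insert_erase hj⟩
  have hij : i ≠ j := fun h => hiS (by simp [h])
  have hiS' : i ∉ S := fun h => hiS (by simp [h])
  have hbij : b i - b j ≠ 0 := sub_ne_zero.mpr fun h => hij (hinj (by simp) (by simp) h)
  have hc : (insert i (insert j S)).card = S.card + 2 := by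
    rw [Finset.card_insert_of_notMem hiS, Finset.card_insert_of_notMem hjS]
  have e1 := ih _ (by rw [← hm, hc, Finset.card_insert_of_notMem hiS']; omega) (insert i S)
    (hinj.mono (by intro x; simp; tauto)) rfl
  have e2 := ih _ (by rw [← hm, hc, Finset.card_insert_of_notMem hjS]; omega) (insert j S)
    (hinj.mono (by intro x; simp; tauto)) rfl
  have key := expDiff_insert_insert (b := b) hij hiS' hjS P n
  apply mul_left_cancel₀ hbij
  rw [key, e1, e2, Finset.sum_insert hiS', Finset.sum_insert hjS, Finset.sum_insert hiS,
    Finset.sum_insert hjS, Finset.erase_insert hiS', Finset.erase_insert hjS,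
    Finset.erase_insert hiS, Finset.erase_insert_of_ne hij, Finset.erase_insert hjS,
    Finset.prod_insert hjS, Finset.prod_insert hiS']
  have hbi := hb i
  have hbj := hb j
  have hbji : b j - b i ≠ 0 := by rwa [← neg_sub, neg_ne_zero]
  have hi1 : (b i - b j) * (1 - b j / b i)⁻¹ = b i := by
    rw [one_sub_div hbi, inv_div, mul_div_cancel₀ _ hbij]
  have hj1 : (b i - b j) * (1 - b i / b j)⁻¹ = -b j := by
    rw [one_sub_div hbj, inv_div, ← neg_sub, neg_mul, mul_div_cancel₀ _ hbji]
  -- For a pole other than the two chosen ones, the same partial fraction identity is applied at the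
  -- value x = 1/b_x.
  have hsum : (b i - b j) * ∑ x ∈ S, b x ^ n *
      eval₂ (RingHom.id ℂ) (Units.mk0 (b x) (hb x))⁻¹ P *
        ∏ l ∈ (insert i (insert j S)).erase x, (1 - b l / b x)⁻¹ =
      b i * ∑ x ∈ S, b x ^ n * eval₂ (RingHom.id ℂ) (Units.mk0 (b x) (hb x))⁻¹ P *
        ∏ l ∈ (insert i S).erase x, (1 - b l / b x)⁻¹ -
      b j * ∑ x ∈ S, b x ^ n * eval₂ (RingHom.id ℂ) (Units.mk0 (b x) (hb x))⁻¹ P *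
        ∏ l ∈ (insert j S).erase x, (1 - b l / b x)⁻¹ := by
    rw [Finset.mul_sum, Finset.mul_sum, Finset.mul_sum, ← Finset.sum_sub_distrib]
    refine Finset.sum_congr rfl fun x hx => ?_
    have hxi : i ≠ x := fun h => hiS' (h ▸ hx)
    have hxj : j ≠ x := fun h => hjS (h ▸ hx)
    rw [Finset.erase_insert_of_ne hxi, Finset.erase_insert_of_ne hxj,
      Finset.erase_insert_of_ne hxi, Finset.prod_insert (by simp [hij, hiS']),
      Finset.prod_insert (by simp [hjS]), Finset.prod_insert (by simp [hiS'])]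
    have hbx := hb x
    have n1 : 1 - b i / b x ≠ 0 := by
      rw [one_sub_div hbx]
      exact div_ne_zero (sub_ne_zero.mpr fun h => hxi (hinj (by simp) (by simp [hx]) h.symm)) hbx
    have n2 : 1 - b j / b x ≠ 0 := by
      rw [one_sub_div hbx]
      exact div_ne_zero (sub_ne_zero.mpr fun h => hxj (hinj (by simp) (by simp [hx]) h.symm)) hbx
    have h1 := mul_inv_cancel₀ n1
    have h2 := mul_inv_cancel₀ n2
    have key2 : (b i - b j) * ((1 - b i / b x)⁻¹ * (1 - b j / b x)⁻¹) =
        b i * (1 - b i / b x)⁻¹ - b j * (1 - b j / b x)⁻¹ := by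
      linear_combination b i * (1 - b i / b x)⁻¹ * h2 - b j * (1 - b j / b x)⁻¹ * h1
    linear_combination b x ^ n * eval₂ (RingHom.id ℂ) (Units.mk0 (b x) (hb x))⁻¹ P *
      (∏ l ∈ S.erase x, (1 - b l / b x)⁻¹) * key2
  rw [mul_add, mul_add, mul_add, mul_add (b i - b j), hsum]
  linear_combination
    -(b i ^ n * eval₂ (RingHom.id ℂ) (Units.mk0 (b i) (hb i))⁻¹ P *
      ∏ l ∈ S, (1 - b l / b i)⁻¹) * hi1 -
    (b j ^ n * eval₂ (RingHom.id ℂ) (Units.mk0 (b j) (hb j))⁻¹ P *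
      ∏ l ∈ S, (1 - b l / b j)⁻¹) * hj1

/-- The inverse of the unit part of `θ(x)`. -/
def thetaRInv {B : Type*} [CommRing B] (x y : B) : B⟦X⟧ := invOfUnit (thetaR x y) 1

theorem thetaR_mul_inv {B : Type*} [CommRing B] (x y : B) : thetaR x y * thetaRInv x y = 1 :=
  mul_invOfUnit _ 1 (constantCoeff_thetaR x y)

theorem map_thetaRInv {B B' : Type*} [CommRing B] [CommRing B'] (f : B →+* B') (x y : B) :
    PowerSeries.map f (thetaRInv x y) = thetaRInv (f x) (f y) := by
  have h1 := congrArg (PowerSeries.map f) (thetaR_mul_inv x y)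
  rw [map_mul, map_thetaR, map_one] at h1
  have h2 := thetaR_mul_inv (f x) (f y)
  linear_combination thetaRInv (f x) (f y) * h1 - PowerSeries.map f (thetaRInv x y) * h2

/-- The whole pole of 1/θ is in the factor 1/(1-x). The rest has constant term 1 in p and can be
inverted over Laurent polynomials. -/
theorem theta_inv_eq {L : Type*} [Field L] {x : L} (hx : x ≠ 1) :
    (theta x)⁻¹ = PowerSeries.C (1 - x)⁻¹ * thetaRInv x x⁻¹ := by
  have h1 := theta_mul_inv hx
  have h2 := thetaR_mul_inv x x⁻¹
  have h3 : PowerSeries.C (1 - x) * PowerSeries.C (1 - x)⁻¹ = 1 := by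
    rw [← map_mul, mul_inv_cancel₀ (sub_ne_zero.mpr hx.symm), map_one]
  rw [theta_eq] at h1 ⊢
  linear_combination PowerSeries.C (1 - x)⁻¹ * thetaRInv x x⁻¹ * h1 -
    (PowerSeries.C (1 - x) * thetaR x x⁻¹)⁻¹ *
      (h3 + PowerSeries.C (1 - x) * PowerSeries.C (1 - x)⁻¹ * h2)

/-- The part `∏ θ(a_i t) / θ'(b_i t)` of the quotient of theta functions that has Laurent
polynomials in `t` as coefficients. -/
def thetaNum {ι : Type*} (I : Finset ι) (a b : ι → ℂ) : ℂ[T;T⁻¹]⟦X⟧ :=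
  ∏ i ∈ I, PowerSeries.C (1 - LaurentPolynomial.C (a i) * T 1) *
    thetaR (LaurentPolynomial.C (a i) * T 1) (LaurentPolynomial.C (a i)⁻¹ * T (-1)) *
    thetaRInv (LaurentPolynomial.C (b i) * T 1) (LaurentPolynomial.C (b i)⁻¹ * T (-1))

theorem map_thetaNum {ι L : Type*} [Field L] (I : Finset ι) (a b : ι → ℂ) (f : ℂ →+* L)
    (x : Lˣ) :
    PowerSeries.map (eval₂ f x) (thetaNum I a b) =
      ∏ i ∈ I, theta (f (a i) * x) * thetaRInv (f (b i) * x) (f (b i) * x)⁻¹ := by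
  rw [thetaNum, map_prod]
  refine Finset.prod_congr rfl fun i _ => ?_
  have h (c : ℂ) : eval₂ f x (LaurentPolynomial.C c * T 1) = f c * x := by
    rw [eval₂_C_mul_T, zpow_one]
  have h' (c : ℂ) : eval₂ f x (LaurentPolynomial.C c⁻¹ * T (-1)) = (f c * x)⁻¹ := by
    rw [eval₂_C_mul_T, zpow_neg_one, Units.val_inv_eq_inv_val, mul_inv, map_inv₀]
  rw [map_mul, map_mul, map_thetaR, map_thetaRInv, PowerSeries.map_C, map_sub, map_one, h, h, h',
    h', theta_eq]

theorem thetaQuot_eq_map {ι : Type*} (I : Finset ι) (a b : ι → ℂ) {x : (LaurentSeries ℂ)ˣ}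
    (hx : ∀ c, 1 - laurentC c * x ≠ 0) :
    thetaQuot I a b x = PowerSeries.map (eval₂ laurentC x) (thetaNum I a b) *
      PowerSeries.C (∏ i ∈ I, (1 - laurentC (b i) * x)⁻¹) := by
  rw [map_thetaNum, map_prod, ← Finset.prod_mul_distrib, thetaQuot]
  refine Finset.prod_congr rfl fun i _ => ?_
  rw [theta_inv_eq fun h => hx (b i) (by rw [h, sub_self])]
  ring

/-- The coefficient at `δ(b_i / z)` of the difference of the two expansions of
`∏ θ(a_l / z) / θ(b_l / z)`. -/
def thetaRes {ι : Type*} [DecidableEq ι] (I : Finset ι) (a b : ι → ℂ) (i : ι) : ℂ⟦X⟧ :=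
  theta (a i / b i) * thetaRInv 1 1 * ∏ l ∈ I.erase i, theta (a l / b i) * (theta (b l / b i))⁻¹

theorem coeffT_thetaQuot_sub {ι : Type*} [DecidableEq ι] (I : Finset ι) (a : ι → ℂ) {b : ι → ℂ}
    (hb : ∀ i, b i ≠ 0) (hinj : Set.InjOn b I) (n : ℤ) :
    coeffT n (thetaQuot I a b (HahnSeries.single (1 : ℤ) (1 : ℂ))) -
      coeffT (-n) (thetaQuot I a b (HahnSeries.single (-1 : ℤ) (1 : ℂ))) =
      ∑ i ∈ I, cst (b i ^ n) * thetaRes I a b i := by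
  have hres : ∀ i ∈ I, thetaRes I a b i =
      PowerSeries.map (eval₂ (RingHom.id ℂ) (Units.mk0 (b i) (hb i))⁻¹) (thetaNum I a b) *
        cst (∏ l ∈ I.erase i, (1 - b l / b i)⁻¹) := by
    intro i hi
    rw [map_thetaNum, ← Finset.mul_prod_erase _ _ hi, mul_assoc, cst, map_prod,
      ← Finset.prod_mul_distrib, thetaRes]
    simp only [RingHom.id_apply, Units.val_inv_eq_inv_val, Units.val_mk0]
    rw [mul_inv_cancel₀ (hb i), inv_one, div_eq_mul_inv (a i)]
    congr 1
    refine Finset.prod_congr rfl fun l hl => ?_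
    have hl' := Finset.mem_erase.mp hl
    have hne : b l / b i ≠ 1 := fun h => hl'.1 (hinj (by simpa using hl'.2) (by simpa using hi)
      ((div_eq_one_iff_eq (hb i)).mp h))
    rw [theta_inv_eq hne, div_eq_mul_inv (a l), div_eq_mul_inv (b l)]
    ring
  rw [Finset.sum_congr rfl fun i hi => by rw [hres i hi]]
  have h1 := thetaQuot_eq_map I a b (x := varT) fun c => one_sub_mul_single_ne_zero c one_ne_zero
  have h2 := thetaQuot_eq_map I a b (x := varT⁻¹)
    fun c => one_sub_mul_single_ne_zero c (by norm_num)
  have h3 : ((varT : (LaurentSeries ℂ)ˣ) : LaurentSeries ℂ) = HahnSeries.single 1 1 := rfl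
  have h4 : ((varT⁻¹ : (LaurentSeries ℂ)ˣ) : LaurentSeries ℂ) = HahnSeries.single (-1) 1 := rfl
  rw [← h3, ← h4, h1, h2]
  -- In each degree of p the numerator is one Laurent polynomial, common to both expansions, so the
  -- result for rational functions applies.
  ext d
  have key := expDiff_eq_sum hb (PowerSeries.coeff d (thetaNum I a b)) n I hinj
  simp only [coeffT, map_sub, coeff_mk, PowerSeries.coeff_mul_C, PowerSeries.coeff_map, map_sum,
    cst, PowerSeries.coeff_C_mul]
  rw [expDiff, ratExp, ratExp] at key
  rw [key]
  exact Finset.sum_congr rfl fun i _ => mul_assoc _ _ _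

end Residue

/-! ### Semilinear operators on free modules -/

section Semilinear

variable {A : Type*} [CommRing A] [Algebra ℂ⟦X⟧ A] {Y : Type*}

/-- `T (g v) = σ(g) T v`. -/
def IsSemi (σ : A →ₐ[ℂ⟦X⟧] A) (T : Op (Y →₀ A)) : Prop := ∀ (g : A) v, T (g • v) = σ g • T v

theorem IsSemi.zero (σ : A →ₐ[ℂ⟦X⟧] A) : IsSemi σ (0 : Op (Y →₀ A)) := fun g v => by simp

theorem IsSemi.add {σ : A →ₐ[ℂ⟦X⟧] A} {S T : Op (Y →₀ A)} (hS : IsSemi σ S) (hT : IsSemi σ T) :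
    IsSemi σ (S + T) := fun g v => by
  rw [LinearMap.add_apply, LinearMap.add_apply, hS, hT, smul_add]

theorem IsSemi.sub {σ : A →ₐ[ℂ⟦X⟧] A} {S T : Op (Y →₀ A)} (hS : IsSemi σ S) (hT : IsSemi σ T) :
    IsSemi σ (S - T) := fun g v => by
  rw [LinearMap.sub_apply, LinearMap.sub_apply, hS, hT, smul_sub]

theorem IsSemi.smul {σ : A →ₐ[ℂ⟦X⟧] A} {T : Op (Y →₀ A)} (c : ℂ⟦X⟧) (hT : IsSemi σ T) :
    IsSemi σ (c • T) := fun g v => by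
  rw [LinearMap.smul_apply, LinearMap.smul_apply, hT, smul_comm]

theorem IsSemi.sum {ι : Type*} {σ : A →ₐ[ℂ⟦X⟧] A} (I : Finset ι) {T : ι → Op (Y →₀ A)}
    (hT : ∀ i ∈ I, IsSemi σ (T i)) : IsSemi σ (∑ i ∈ I, T i) := fun g v => by
  rw [LinearMap.sum_apply, LinearMap.sum_apply, Finset.smul_sum]
  exact Finset.sum_congr rfl fun i hi => hT i hi g v

theorem IsSemi.mul {σ τ : A →ₐ[ℂ⟦X⟧] A} {S T : Op (Y →₀ A)} (hS : IsSemi σ S) (hT : IsSemi τ T) :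
    IsSemi (σ.comp τ) (S * T) := fun g v => by
  rw [Module.End.mul_apply, Module.End.mul_apply, hT, hS, AlgHom.comp_apply]

theorem IsSemi.one : IsSemi (AlgHom.id _ _) (1 : Op (Y →₀ A)) := fun _ _ => rfl

theorem IsSemi.apply_eq {σ : A →ₐ[ℂ⟦X⟧] A} {T : Op (Y →₀ A)} (hT : IsSemi σ T) (v : Y →₀ A) :
    T v = v.sum fun y g => σ g • T (Finsupp.single y 1) := by
  conv_lhs => rw [← Finsupp.sum_single v]
  rw [Finsupp.sum, map_sum]
  refine Finset.sum_congr rfl fun y _ => ?_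
  simp only
  rw [← hT, Finsupp.smul_single, smul_eq_mul, mul_one]

theorem IsSemi.ext {σ : A →ₐ[ℂ⟦X⟧] A} {S T : Op (Y →₀ A)} (hS : IsSemi σ S) (hT : IsSemi σ T)
    (h : ∀ y, S (Finsupp.single y 1) = T (Finsupp.single y 1)) : S = T := by
  refine LinearMap.ext fun v => ?_
  rw [hS.apply_eq, hT.apply_eq]
  simp only [h]

/-- The error terms on the basis extend semilinearly to all vectors, and p^n passes through the
twist because it lies in ℂ[[p]]. -/
theorem IsSemi.congMod {σ : A →ₐ[ℂ⟦X⟧] A} {S T : Op (Y →₀ A)} {n : ℕ} (hS : IsSemi σ S)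
    (hT : IsSemi σ T)
    (h : ∀ y, ∃ w, S (Finsupp.single y 1) = T (Finsupp.single y 1) + nome ^ n • w) :
    CongMod n S T := by
  choose w hw using h
  intro v
  refine ⟨v.sum fun y g => σ g • w y, ?_⟩
  rw [hS.apply_eq, hT.apply_eq, Finsupp.sum, Finsupp.sum, Finsupp.sum, Finset.smul_sum,
    ← Finset.sum_add_distrib]
  refine Finset.sum_congr rfl fun y _ => ?_
  rw [hw, smul_add, smul_comm]

/-- The semilinear operator with given values on the basis. -/
def semiOp (σ : A →ₐ[ℂ⟦X⟧] A) (F : Y → (Y →₀ A)) : Op (Y →₀ A) where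
  toFun v := v.sum fun y g => σ g • F y
  map_add' v w := by
    classical
    exact Finsupp.sum_add_index' (fun y => by simp) (fun y a b => by rw [map_add, add_smul])
  map_smul' c v := by
    rw [Finsupp.sum_of_support_subset _ Finsupp.support_smul _ (fun y _ => by simp), Finsupp.sum,
      RingHom.id_apply, Finset.smul_sum]
    refine Finset.sum_congr rfl fun y _ => ?_
    rw [Finsupp.smul_apply, map_smul, smul_assoc]

theorem semiOp_apply (σ : A →ₐ[ℂ⟦X⟧] A) (F : Y → (Y →₀ A)) (v : Y →₀ A) :
    semiOp σ F v = v.sum fun y g => σ g • F y := rfl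

theorem semiOp_single (σ : A →ₐ[ℂ⟦X⟧] A) (F : Y → (Y →₀ A)) (y : Y) (g : A) :
    semiOp σ F (Finsupp.single y g) = σ g • F y := by
  rw [semiOp_apply, Finsupp.sum_single_index (by simp)]

theorem semiOp_single_one (σ : A →ₐ[ℂ⟦X⟧] A) (F : Y → (Y →₀ A)) (y : Y) :
    semiOp σ F (Finsupp.single y 1) = F y := by
  rw [semiOp_single, map_one, one_smul]

theorem isSemi_semiOp (σ : A →ₐ[ℂ⟦X⟧] A) (F : Y → (Y →₀ A)) : IsSemi σ (semiOp σ F) := by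
  intro g v
  rw [semiOp_apply, semiOp_apply,
    Finsupp.sum_of_support_subset _ Finsupp.support_smul _ (fun y _ => by simp), Finsupp.sum,
    Finset.smul_sum]
  refine Finset.sum_congr rfl fun y _ => ?_
  rw [Finsupp.smul_apply, smul_eq_mul, map_mul, mul_smul]

/-- The diagonal semilinear operator with given eigenvalues on the basis. -/
def diagOp (σ : A →ₐ[ℂ⟦X⟧] A) (e : Y → ℂ⟦X⟧) : Op (Y →₀ A) :=
  semiOp σ fun y => e y • Finsupp.single y 1

theorem isSemi_diagOp (σ : A →ₐ[ℂ⟦X⟧] A) (e : Y → ℂ⟦X⟧) : IsSemi σ (diagOp σ e) :=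
  isSemi_semiOp σ _

theorem diagOp_single_one (σ : A →ₐ[ℂ⟦X⟧] A) (e : Y → ℂ⟦X⟧) (y : Y) :
    diagOp σ e (Finsupp.single y 1) = e y • Finsupp.single y (1 : A) := semiOp_single_one _ _ _

theorem diagOp_mul (σ τ : A →ₐ[ℂ⟦X⟧] A) (e e' : Y → ℂ⟦X⟧) :
    diagOp σ e * diagOp τ e' = diagOp (σ.comp τ) fun y => e y * e' y := by
  refine ((isSemi_diagOp σ e).mul (isSemi_diagOp τ e')).ext (isSemi_diagOp _ _) fun y => ?_
  rw [Module.End.mul_apply, diagOp_single_one, map_smul, diagOp_single_one, diagOp_single_one,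
    smul_smul, mul_comm]

theorem diagOp_id_const (c : ℂ⟦X⟧) :
    diagOp (AlgHom.id _ _) (fun _ => c) = c • (1 : Op (Y →₀ A)) := by
  refine (isSemi_diagOp _ _).ext (IsSemi.one.smul c) fun y => ?_
  rw [diagOp_single_one, LinearMap.smul_apply, Module.End.one_apply]

/-- Diagonal operators that commute with `A`. -/
def IsDiag (T : Op (Y →₀ A)) (e : Y → ℂ⟦X⟧) : Prop :=
  ∀ y g, T (Finsupp.single y g) = e y • Finsupp.single y g

theorem isDiag_diagOp (e : Y → ℂ⟦X⟧) : IsDiag (diagOp (AlgHom.id ℂ⟦X⟧ A) e) e := by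
  intro y g
  rw [diagOp, semiOp_single, AlgHom.id_apply, smul_comm, Finsupp.smul_single, smul_eq_mul, mul_one]

theorem IsDiag.mul {S T : Op (Y →₀ A)} {e f : Y → ℂ⟦X⟧} (hS : IsDiag S e) (hT : IsDiag T f) :
    IsDiag (S * T) fun y => e y * f y := fun y g => by
  rw [Module.End.mul_apply, hT, map_smul, hS, smul_smul, mul_comm]

theorem IsDiag.smul {T : Op (Y →₀ A)} {e : Y → ℂ⟦X⟧} (c : ℂ⟦X⟧) (hT : IsDiag T e) :
    IsDiag (c • T) fun y => c * e y := fun y g => by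
  rw [LinearMap.smul_apply, hT, smul_smul]

theorem IsDiag.sum {ι : Type*} (I : Finset ι) {T : ι → Op (Y →₀ A)} {e : ι → Y → ℂ⟦X⟧}
    (hT : ∀ i ∈ I, IsDiag (T i) (e i)) : IsDiag (∑ i ∈ I, T i) fun y => ∑ i ∈ I, e i y :=
  fun y g => by
  rw [LinearMap.sum_apply, Finset.sum_smul]
  exact Finset.sum_congr rfl fun i hi => hT i hi y g

theorem IsDiag.zero : IsDiag (0 : Op (Y →₀ A)) fun _ => 0 := fun y g => by simp

theorem IsDiag.isSemi {T : Op (Y →₀ A)} {e : Y → ℂ⟦X⟧} (hT : IsDiag T e) :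
    IsSemi (AlgHom.id _ _) T := by
  intro g v
  induction v using Finsupp.induction_linear with
  | zero => simp
  | add v w hv hw => rw [smul_add, map_add, map_add, smul_add, hv, hw]
  | single y a => rw [Finsupp.smul_single, hT, hT, AlgHom.id_apply, smul_comm g,
      Finsupp.smul_single g]

/-- Coefficientwise diagonal series multiply eigenvalue by eigenvalue. Hence a formal exponential of
such operators acts by the exponential of the eigenvalues, and the formulas for φ^± become scalar
congruences. -/
theorem isDiag_coeff_pow {S : (Op (Y →₀ A))⟦X⟧} {s : Y → ℂ⟦X⟧⟦X⟧}
    (h : ∀ n, IsDiag (PowerSeries.coeff n S) fun y => PowerSeries.coeff n (s y)) (k n : ℕ) :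
    IsDiag (PowerSeries.coeff n (S ^ k)) fun y => PowerSeries.coeff n (s y ^ k) := by
  induction k generalizing n with
  | zero =>
    intro y g
    simp only [pow_zero, PowerSeries.coeff_one]
    split_ifs <;> simp
  | succ k ih =>
    simp only [pow_succ, PowerSeries.coeff_mul]
    exact IsDiag.sum _ fun x _ => (ih x.1).mul (h x.2)

theorem isDiag_coeff_formalExp {S : (Op (Y →₀ A))⟦X⟧} {s : Y → ℂ⟦X⟧⟦X⟧}
    (h : ∀ n, IsDiag (PowerSeries.coeff n S) fun y => PowerSeries.coeff n (s y)) (n : ℕ) :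
    IsDiag (PowerSeries.coeff n (formalExp S)) fun y => PowerSeries.coeff n (formalExp (s y)) := by
  simp only [formalExp, PowerSeries.coeff_mk, smul_eq_mul]
  exact IsDiag.sum _ fun k _ => (isDiag_coeff_pow h k n).smul _

theorem isDiag_coeff_expOp (a : ℕ → ℂ⟦X⟧) {β : ℕ → Op (Y →₀ A)} {e : ℕ → Y → ℂ⟦X⟧}
    (h : ∀ n, n ≠ 0 → IsDiag (β n) (e n)) (n : ℕ) :
    IsDiag (PowerSeries.coeff n (expOp a β)) fun y =>
      PowerSeries.coeff n (formalExp (posSeries fun m => a m * e m y)) := by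
  refine isDiag_coeff_formalExp (fun n => ?_) n
  simp only [posSeries, PowerSeries.coeff_mk]
  by_cases hn : n = 0
  · simp only [hn, if_true]; exact IsDiag.zero
  · simp only [hn, if_false]; exact (h n hn).smul _

theorem isDiag_coeffZ {S : (Op (Y →₀ A))⟦X⟧} {s : Y → ℂ⟦X⟧⟦X⟧}
    (h : ∀ n, IsDiag (PowerSeries.coeff n S) fun y => PowerSeries.coeff n (s y)) (n : ℤ) :
    IsDiag (coeffZ n S) fun y => coeffZ n (s y) := by
  simp only [coeffZ]
  split_ifs
  · exact h _
  · exact IsDiag.zero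

theorem congMod_diagOp {σ : A →ₐ[ℂ⟦X⟧] A} {M : ℕ} {T : Op (Y →₀ A)} {k f e : Y → ℂ⟦X⟧}
    (hT : IsDiag T e) (h : ∀ y, nome ^ M ∣ f y - k y * e y) :
    CongMod M (diagOp σ f) (diagOp σ k * T) := by
  refine (isSemi_diagOp σ f).congMod ((isSemi_diagOp σ k).mul hT.isSemi) fun y => ?_
  obtain ⟨c, hc⟩ := h y
  refine ⟨c • Finsupp.single y 1, ?_⟩
  rw [Module.End.mul_apply, hT, map_smul, diagOp_single_one, diagOp_single_one, smul_smul,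
    smul_smul, ← add_smul, ← hc]
  congr 1
  ring

theorem phiPlusRel_diagOp {q : ℂ} {σ : A →ₐ[ℂ⟦X⟧] A} {α : ℤ → Op (Y →₀ A)} {e : ℤ → Y → ℂ⟦X⟧}
    {k : Y → ℂ⟦X⟧} {f : ℤ → Y → ℂ⟦X⟧} (hα : ∀ n, n ≠ 0 → IsDiag (α n) (e n))
    (h : ∀ y n M, nome ^ M ∣ f n y - k y * ∑ a ∈ Finset.range M,
      PowerSeries.coeff a (formalExp (posSeries fun m =>
        -(cst (q - q⁻¹) * nome ^ m * (1 - nome ^ m)⁻¹) * e (-m) y)) *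
      coeffZ (a + n) (formalExp (posSeries fun m =>
        cst (q - q⁻¹) * (1 - nome ^ m)⁻¹ * e m y))) :
    PhiPlusRel q 1 α (diagOp σ k) fun n => diagOp σ (f n) := by
  intro n M
  rw [one_zpow, cst_one, one_smul]
  refine congMod_diagOp (e := fun y => _) (IsDiag.sum _ fun a _ =>
    (isDiag_coeff_expOp _ (e := fun m => e (-m)) (fun m hm => hα _ (by simpa using hm)) a).mul
    (isDiag_coeffZ (isDiag_coeff_expOp _ (e := fun m => e m) fun m hm => hα _ (by simpa using hm))
      (a + n))) fun y => h y n M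

theorem phiMinusRel_diagOp {q : ℂ} {σ : A →ₐ[ℂ⟦X⟧] A} {α : ℤ → Op (Y →₀ A)} {e : ℤ → Y → ℂ⟦X⟧}
    {k : Y → ℂ⟦X⟧} {f : ℤ → Y → ℂ⟦X⟧} (hα : ∀ n, n ≠ 0 → IsDiag (α n) (e n))
    (h : ∀ y n M, nome ^ M ∣ f n y - k y * ∑ b ∈ Finset.range M,
      coeffZ (b - n) (formalExp (posSeries fun m =>
        -(cst (q - q⁻¹) * (1 - nome ^ m)⁻¹) * e (-m) y)) *
      PowerSeries.coeff b (formalExp (posSeries fun m =>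
        cst (q - q⁻¹) * nome ^ m * (1 - nome ^ m)⁻¹ * e m y))) :
    PhiMinusRel q 1 α (diagOp σ k) fun n => diagOp σ (f n) := by
  intro n M
  rw [one_zpow, cst_one, one_smul]
  refine congMod_diagOp (e := fun y => _) (IsDiag.sum _ fun b _ =>
    (isDiag_coeffZ (isDiag_coeff_expOp _ (e := fun m => e (-m)) fun m hm =>
      hα _ (by simpa using hm)) (b - n)).mul
    (isDiag_coeff_expOp _ (e := fun m => e m) (fun m hm => hα _ (by simpa using hm)) b))
    fun y => h y n M

end Semilinear

/-! ### Operators that add or remove one box -/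

section Steps

open Classical in
/-- The basis vector of a finite set of boxes, `0` if it is not a Young diagram. -/
def ketS (A : Type*) [CommRing A] (S : Finset (ℕ × ℕ)) : YoungDiagram →₀ A :=
  if h : IsLowerSet (S : Set (ℕ × ℕ)) then Finsupp.single ⟨S, h⟩ 1 else 0

theorem ketS_cells {A : Type*} [CommRing A] (y : YoungDiagram) : ketS A y.cells = Finsupp.single y 1 :=
  dif_pos y.isLowerSet

theorem ketS_of_not {A : Type*} [CommRing A] {S : Finset (ℕ × ℕ)} (h : ¬IsLowerSet (S : Set (ℕ × ℕ))) : ketS A S = 0 :=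
  dif_neg h

variable {A : Type*} [CommRing A] [Algebra ℂ⟦X⟧ A]

/-- The square of boxes with both coordinates `< m`. -/
def boxes (m : ℕ) : Finset (ℕ × ℕ) := Finset.range m ×ˢ Finset.range m

/-- Data of a family of operators that change Young diagrams by one box: the new set of boxes,
and the matrix coefficient; boxes have a colour and a position. -/
structure StepData (N : ℕ) where
  col : ℕ × ℕ → ZMod N
  pos : ℕ × ℕ → ℂ
  st : Finset (ℕ × ℕ) → ℕ × ℕ → Finset (ℕ × ℕ)
  c : Finset (ℕ × ℕ) → ℕ × ℕ → ℂ⟦X⟧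
  pos_ne_zero : ∀ b, pos b ≠ 0
  st_comm : ∀ S b b', st (st S b) b' = st (st S b') b
  card_st : ∀ S b, (st S b).card ≤ S.card + 1
  lower : ∀ S b, c S b ≠ 0 → IsLowerSet (S : Set (ℕ × ℕ))
  lower_st : ∀ S b, c S b ≠ 0 → IsLowerSet (st S b : Set (ℕ × ℕ))
  mem_boxes : ∀ S b, c S b ≠ 0 → b ∈ boxes (S.card + 1)

namespace StepData

variable {N : ℕ} (D : StepData N)

/-- The matrix coefficient of the `n`-th mode of the current of colour `j`. -/
def wt (j : ZMod N) (n : ℤ) (S : Finset (ℕ × ℕ)) (b : ℕ × ℕ) : ℂ⟦X⟧ :=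
  if D.col b = j then cst (D.pos b ^ n) * D.c S b else 0

/-- The modes of the current of colour `j`. -/
def op (σ : A →ₐ[ℂ⟦X⟧] A) (j : ZMod N) (n : ℤ) : Op (YoungDiagram →₀ A) :=
  semiOp σ fun y => ∑ b ∈ boxes (y.cells.card + 1), D.wt j n y.cells b • ketS A (D.st y.cells b)

theorem boxes_mono {m m' : ℕ} (h : m ≤ m') : boxes m ⊆ boxes m' :=
  Finset.product_subset_product (Finset.range_mono h) (Finset.range_mono h)

theorem wt_eq_zero {j : ZMod N} {n : ℤ} {S : Finset (ℕ × ℕ)} {b : ℕ × ℕ} (h : D.c S b = 0) :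
    D.wt j n S b = 0 := by
  simp [wt, h]

/-- Every sufficiently large range of boxes gives the same sum, so compositions can be summed over
one common range. For `S` that is not a diagram both sides vanish, so intermediate sets need no case
distinction. -/
theorem op_ketS (σ : A →ₐ[ℂ⟦X⟧] A) (j : ZMod N) (n : ℤ) (S : Finset (ℕ × ℕ)) {m : ℕ}
    (hm : S.card < m) :
    D.op σ j n (ketS A S) = ∑ b ∈ boxes m, D.wt j n S b • ketS A (D.st S b) := by
  by_cases hS : IsLowerSet (S : Set (ℕ × ℕ))
  · rw [ketS, dif_pos hS, op, semiOp_single_one]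
    refine Finset.sum_subset (boxes_mono hm) fun b _ hb => ?_
    rw [D.wt_eq_zero, zero_smul]
    by_contra h
    exact hb (D.mem_boxes S b h)
  · rw [ketS_of_not hS, map_zero]
    refine (Finset.sum_eq_zero fun b _ => ?_).symm
    rw [D.wt_eq_zero, zero_smul]
    by_contra h
    exact hS (D.lower S b h)

theorem op_op_ketS (σ τ : A →ₐ[ℂ⟦X⟧] A) (i j : ZMod N) (a c : ℤ) (S : Finset (ℕ × ℕ)) {m : ℕ}
    (hm : S.card + 1 < m) :
    D.op σ i a (D.op τ j c (ketS A S)) = ∑ w ∈ boxes m, ∑ z ∈ boxes m,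
      (D.wt j c S w * D.wt i a (D.st S w) z) • ketS A (D.st (D.st S w) z) := by
  rw [D.op_ketS τ j c S (m := m) (by omega), map_sum]
  refine Finset.sum_congr rfl fun w _ => ?_
  rw [map_smul, D.op_ketS σ i a _ (m := m) (by have := D.card_st S w; omega), Finset.smul_sum]
  refine Finset.sum_congr rfl fun z _ => ?_
  rw [smul_smul]

theorem op_op_op_ketS (σ τ υ : A →ₐ[ℂ⟦X⟧] A) (h i j : ZMod N) (d a c : ℤ)
    (S : Finset (ℕ × ℕ)) {m : ℕ} (hm : S.card + 2 < m) :
    D.op σ h d (D.op τ i a (D.op υ j c (ketS A S))) =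
      ∑ x ∈ boxes m, ∑ y ∈ boxes m, ∑ z ∈ boxes m,
      (D.wt j c S x * D.wt i a (D.st S x) y * D.wt h d (D.st (D.st S x) y) z) •
        ketS A (D.st (D.st (D.st S x) y) z) := by
  rw [D.op_ketS υ j c S (m := m) (by omega), map_sum, map_sum]
  refine Finset.sum_congr rfl fun w _ => ?_
  rw [map_smul, map_smul, D.op_op_ketS σ τ h i d a _ (m := m)
    (by have := D.card_st S w; omega), Finset.smul_sum]
  refine Finset.sum_congr rfl fun z _ => ?_
  rw [Finset.smul_sum]
  refine Finset.sum_congr rfl fun z _ => ?_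
  rw [smul_smul, mul_assoc]

theorem isSemi_op (σ : A →ₐ[ℂ⟦X⟧] A) (j : ZMod N) (n : ℤ) : IsSemi σ (D.op (A := A) σ j n) :=
  isSemi_semiOp _ _

/-- The exchange relation of matrix coefficients. -/
def Exchange (q κ : ℂ) (ε : ℤ) : Prop :=
  ∀ S z w,
    cst (κ ^ mMat N (D.col z) (D.col w) * D.pos z -
        q ^ (ε * cartan N (D.col z) (D.col w)) * D.pos w) *
      gVal q (ε * cartan N (D.col z) (D.col w))
        (κ ^ (-mMat N (D.col z) (D.col w)) * D.pos w / D.pos z) *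
      (D.c S w * D.c (D.st S w) z) =
    cst (κ ^ mMat N (D.col z) (D.col w) * q ^ (ε * cartan N (D.col z) (D.col w)) * D.pos z -
        D.pos w) *
      gVal q (ε * cartan N (D.col z) (D.col w))
        (κ ^ mMat N (D.col z) (D.col w) * D.pos z / D.pos w) *
      (D.c S z * D.c (D.st S z) w)

theorem exists_nome_smul {V ι : Type*} [AddCommGroup V] [Module ℂ⟦X⟧ V] {M : ℕ} (I : Finset ι)
    (f : ι → ℂ⟦X⟧) (v : ι → V) (h : ∀ i ∈ I, nome ^ M ∣ f i) :
    ∃ w, ∑ i ∈ I, f i • v i = nome ^ M • w := by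
  classical
  induction I using Finset.induction_on with
  | empty => exact ⟨0, by simp⟩
  | insert a s ha ih =>
    obtain ⟨w, hw⟩ := ih fun i hi => h i (by simp [hi])
    obtain ⟨c, hc⟩ := h a (by simp)
    exact ⟨c • v a + w, by rw [Finset.sum_insert ha, hw, hc, smul_add, smul_smul]⟩

section ExchangeRel

variable {D} {q κ : ℂ} {ε : ℤ}

/-- Truncated value of `g`. -/
def gTrunc (q : ℂ) (b : ℤ) (y : ℂ) (M : ℕ) : ℂ⟦X⟧ :=
  ∑ r ∈ Finset.range M, PowerSeries.coeff r (gSeries q b nome) * cst (y ^ r)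

/-- The r-th coefficient of g shifts the modes by -r and +r, which multiplies the matrix coefficient
by (pos w / pos z)^r. The sum over r thus assembles into a truncated value of g. -/
theorem exchange_left_ket (hκ : κ ≠ 0) (σ τ : A →ₐ[ℂ⟦X⟧] A) (i j : ZMod N) (e b a c : ℤ) (M : ℕ)
    (S : Finset (ℕ × ℕ)) {m : ℕ} (hm : S.card + 1 < m) :
    (∑ r ∈ Finset.range M, (PowerSeries.coeff r (gSeries q b nome) * cst (κ ^ (-e * r))) •
      (cst (κ ^ e) • (D.op σ i (a + 1 - r) * D.op τ j (c + r)) -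
        cst (q ^ b) • (D.op σ i (a - r) * D.op τ j (c + 1 + r)))) (ketS A S) =
    ∑ w ∈ boxes m, ∑ z ∈ boxes m,
      (if D.col z = i ∧ D.col w = j then
        cst (D.pos z ^ a * D.pos w ^ c) * (cst (κ ^ e * D.pos z - q ^ b * D.pos w) *
          gTrunc q b (κ ^ (-e) * D.pos w / D.pos z) M * (D.c S w * D.c (D.st S w) z)) else 0) •
      ketS A (D.st (D.st S w) z) := by
  simp only [LinearMap.sum_apply, LinearMap.smul_apply, LinearMap.sub_apply, Module.End.mul_apply,
    D.op_op_ketS _ _ _ _ _ _ S hm, Finset.smul_sum, ← Finset.sum_sub_distrib, smul_smul,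
    ← sub_smul]
  rw [Finset.sum_comm]
  refine Finset.sum_congr rfl fun w _ => ?_
  rw [Finset.sum_comm]
  refine Finset.sum_congr rfl fun z _ => ?_
  rw [← Finset.sum_smul]
  congr 1
  have hz := D.pos_ne_zero z
  have hw := D.pos_ne_zero w
  by_cases h : D.col z = i ∧ D.col w = j
  · rw [if_pos h, gTrunc, Finset.mul_sum, Finset.sum_mul, Finset.mul_sum]
    refine Finset.sum_congr rfl fun r _ => ?_
    simp only [wt, h.1, h.2, if_true]
    have h1 : κ ^ (-e * r) * (κ ^ e * (D.pos w ^ (c + r) * D.pos z ^ (a + 1 - r)) -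
        q ^ b * (D.pos w ^ (c + 1 + r) * D.pos z ^ (a - r))) =
        D.pos z ^ a * D.pos w ^ c * ((κ ^ e * D.pos z - q ^ b * D.pos w) *
          (κ ^ (-e) * D.pos w / D.pos z) ^ r) := by
      rw [div_pow, mul_pow, zpow_mul, zpow_natCast, zpow_add₀ hw, zpow_add₀ hw, zpow_add₀ hw,
        zpow_sub₀ hz, zpow_sub₀ hz, zpow_add₀ hz]
      simp only [zpow_natCast, zpow_one]
      field_simp
    have h2 := congrArg cst h1
    simp only [cst_mul, cst_sub] at h2
    simp only [cst_mul, cst_sub]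
    linear_combination (PowerSeries.coeff r (gSeries q b nome) *
      (D.c S w * D.c (D.st S w) z)) * h2
  · rw [if_neg h]
    refine Finset.sum_eq_zero fun r _ => ?_
    rw [not_and_or] at h
    rcases h with h | h <;> simp [wt, h]

theorem exchange_right_ket (hκ : κ ≠ 0) (σ τ : A →ₐ[ℂ⟦X⟧] A) (i j : ZMod N) (e b a c : ℤ) (M : ℕ)
    (S : Finset (ℕ × ℕ)) {m : ℕ} (hm : S.card + 1 < m) :
    (∑ r ∈ Finset.range M, (PowerSeries.coeff r (gSeries q b nome) * cst (κ ^ (e * r))) •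
      (cst (κ ^ e * q ^ b) • (D.op τ j (c - r) * D.op σ i (a + 1 + r)) -
        (D.op τ j (c + 1 - r) * D.op σ i (a + r)))) (ketS A S) =
    ∑ w ∈ boxes m, ∑ z ∈ boxes m,
      (if D.col z = i ∧ D.col w = j then
        cst (D.pos z ^ a * D.pos w ^ c) * (cst (κ ^ e * q ^ b * D.pos z - D.pos w) *
          gTrunc q b (κ ^ e * D.pos z / D.pos w) M * (D.c S z * D.c (D.st S z) w)) else 0) •
      ketS A (D.st (D.st S w) z) := by
  simp only [LinearMap.sum_apply, LinearMap.smul_apply, LinearMap.sub_apply, Module.End.mul_apply,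
    D.op_op_ketS _ _ _ _ _ _ S hm, Finset.smul_sum, ← Finset.sum_sub_distrib, smul_smul,
    ← sub_smul]
  rw [Finset.sum_comm, Finset.sum_comm (s := boxes m) (t := boxes m)]
  refine Finset.sum_congr rfl fun z _ => ?_
  rw [Finset.sum_comm]
  refine Finset.sum_congr rfl fun w _ => ?_
  rw [← Finset.sum_smul, D.st_comm S z w]
  congr 1
  have hz := D.pos_ne_zero z
  have hw := D.pos_ne_zero w
  by_cases h : D.col z = i ∧ D.col w = j
  · rw [if_pos h, gTrunc, Finset.mul_sum, Finset.sum_mul, Finset.mul_sum]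
    refine Finset.sum_congr rfl fun r _ => ?_
    simp only [wt, h.1, h.2, if_true]
    have h1 : κ ^ (e * r) * (κ ^ e * q ^ b * (D.pos z ^ (a + 1 + r) * D.pos w ^ (c - r)) -
        (D.pos z ^ (a + r) * D.pos w ^ (c + 1 - r))) =
        D.pos z ^ a * D.pos w ^ c * ((κ ^ e * q ^ b * D.pos z - D.pos w) *
          (κ ^ e * D.pos z / D.pos w) ^ r) := by
      rw [div_pow, mul_pow, zpow_mul, zpow_natCast, zpow_add₀ hz, zpow_add₀ hz, zpow_add₀ hz,
        zpow_sub₀ hw, zpow_sub₀ hw, zpow_add₀ hw]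
      simp only [zpow_natCast, zpow_one]
      field_simp
    have h2 := congrArg cst h1
    simp only [cst_mul, cst_sub] at h2
    simp only [cst_mul, cst_sub]
    linear_combination (PowerSeries.coeff r (gSeries q b nome) *
      (D.c S z * D.c (D.st S z) w)) * h2
  · rw [if_neg h]
    refine Finset.sum_eq_zero fun r _ => ?_
    rw [not_and_or] at h
    rcases h with h | h <;> simp [wt, h]

/-- Both sides run over the same pairs of boxes with the same resulting diagram, by `st_comm`.
Truncated values of g agree with exact ones modulo p^M, so the exchange identity of coefficients
suffices. -/
theorem exchangeRel (hκ : κ ≠ 0) (hE : D.Exchange q κ ε) {σ : ZMod N → A →ₐ[ℂ⟦X⟧] A}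
    (hσ : ∀ i j, (σ i).comp (σ j) = (σ j).comp (σ i)) (i j : ZMod N) :
    ExchangeRel q κ (mMat N i j) (ε * cartan N i j) (gSeries q (ε * cartan N i j) nome)
      (D.op (σ i) i) (D.op (A := A) (σ j) j) := by
  intro a c M
  have hij : ∀ a c, IsSemi ((σ i).comp (σ j)) (D.op (A := A) (σ i) i a * D.op (σ j) j c) :=
    fun a c => (D.isSemi_op _ _ _).mul (D.isSemi_op _ _ _)
  have hji : ∀ a c, IsSemi ((σ i).comp (σ j)) (D.op (A := A) (σ j) j a * D.op (σ i) i c) :=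
    fun a c => by rw [hσ]; exact (D.isSemi_op _ _ _).mul (D.isSemi_op _ _ _)
  refine IsSemi.congMod (σ := (σ i).comp (σ j))
    (IsSemi.sum _ fun r _ => IsSemi.smul _ (IsSemi.sub (IsSemi.smul _ (hij _ _))
      (IsSemi.smul _ (hij _ _))))
    (IsSemi.sum _ fun r _ => IsSemi.smul _ (IsSemi.sub (IsSemi.smul _ (hji _ _)) (hji _ _)))
    fun y => ?_
  rw [← ketS_cells, exchange_left_ket hκ _ _ _ _ _ _ _ _ _ _ (Nat.lt_succ_self _),
    exchange_right_ket hκ _ _ _ _ _ _ _ _ _ _ (Nat.lt_succ_self _)]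
  simp only [← sub_eq_iff_eq_add', ← Finset.sum_sub_distrib, ← sub_smul]
  rw [← Finset.sum_product']
  refine exists_nome_smul _ _ _ fun x _ => ?_
  obtain ⟨w, z⟩ := x
  simp only
  by_cases h : D.col z = i ∧ D.col w = j
  · rw [if_pos h, if_pos h]
    obtain ⟨rfl, rfl⟩ := h
    obtain ⟨d1, h1⟩ := nome_pow_dvd_gVal_sub q (ε * cartan N (D.col z) (D.col w))
      (κ ^ (-mMat N (D.col z) (D.col w)) * D.pos w / D.pos z) M
    obtain ⟨d2, h2⟩ := nome_pow_dvd_gVal_sub q (ε * cartan N (D.col z) (D.col w))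
      (κ ^ mMat N (D.col z) (D.col w) * D.pos z / D.pos w) M
    rw [← gTrunc, sub_eq_iff_eq_add] at h1 h2
    rw [← mul_sub, h1, h2]
    refine Dvd.dvd.mul_left ⟨cst (κ ^ mMat N (D.col z) (D.col w) * D.pos z -
        q ^ (ε * cartan N (D.col z) (D.col w)) * D.pos w) * d1 *
        (D.c y.cells w * D.c (D.st y.cells w) z) -
      cst (κ ^ mMat N (D.col z) (D.col w) * q ^ (ε * cartan N (D.col z) (D.col w)) * D.pos z -
        D.pos w) * d2 * (D.c y.cells z * D.c (D.st y.cells z) w), ?_⟩ _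
    linear_combination hE y.cells z w
  · rw [if_neg h, if_neg h, sub_zero]
    exact dvd_zero _

/-- The case of commuting currents. -/
theorem commute_op (hE : D.Exchange q κ ε) (hinj : Function.Injective D.pos)
    {σ : ZMod N → A →ₐ[ℂ⟦X⟧] A} (hσ : ∀ i j, (σ i).comp (σ j) = (σ j).comp (σ i)) {i j : ZMod N}
    (hij : i ≠ j) (ha : cartan N i j = 0) (hm : mMat N i j = 0) (a c : ℤ) :
    Commute (D.op (A := A) (σ i) i a) (D.op (σ j) j c) := by
  refine ((D.isSemi_op _ _ _).mul (D.isSemi_op _ _ _)).ext (σ := (σ i).comp (σ j))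
    (by rw [hσ]; exact (D.isSemi_op _ _ _).mul (D.isSemi_op _ _ _)) fun y => ?_
  rw [← ketS_cells, Module.End.mul_apply, Module.End.mul_apply,
    D.op_op_ketS _ _ _ _ _ _ _ (Nat.lt_succ_self _),
    D.op_op_ketS _ _ _ _ _ _ _ (Nat.lt_succ_self _), Finset.sum_comm]
  refine Finset.sum_congr rfl fun z _ => Finset.sum_congr rfl fun w _ => ?_
  rw [D.st_comm y.cells z w]
  congr 1
  simp only [wt]
  by_cases h1 : D.col z = i
  · by_cases h2 : D.col w = j
    · have h := hE y.cells z w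
      have hg : ∀ x, gVal q 0 x = 1 := fun x => by
        have : gQuot q 0 = 1 := by
          have := qE_mul_qEInv 1
          simpa [gQuot] using this
        rw [gVal, this, map_one]
      rw [h1, h2, ha, hm, mul_zero, hg, hg] at h
      simp only [zpow_zero, one_mul, mul_one] at h
      -- With a = m = 0 both prefactors are pos z - pos w, which is nonzero because boxes of
      -- different colours are different.
      have hne : cst (D.pos z - D.pos w) ≠ 0 := by
        refine cst_ne_zero (sub_ne_zero.mpr fun h' => hij ?_)
        rw [← h1, ← h2, hinj h']
      have h' := mul_left_cancel₀ hne h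
      simp only [h1, h2, if_true]
      linear_combination (cst (D.pos w ^ c) * cst (D.pos z ^ a)) * h'
    · simp [h2]
  · simp [h1]

end ExchangeRel

end StepData

end Steps

/-! ### Serre relations -/

section SerreAlgebra

/-- The Serre relation for six elements satisfying the quadratic relations. -/
theorem serre_of_quadratic {Q w y₁ y₂ : ℂ} (hQ : Q ≠ 0) (hQ2 : Q ^ 2 ≠ 1) (hw : w ≠ 0)
    (h12 : y₁ ≠ Q ^ 2 * y₂) (h21 : y₂ ≠ Q ^ 2 * y₁) {A₁ A₂ A₃ B₁ B₂ B₃ : ℂ⟦X⟧}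
    (r1 : cst (y₂ - Q⁻¹ * w) * A₃ = cst (Q⁻¹ * y₂ - w) * A₂)
    (r2 : cst (y₁ - Q⁻¹ * w) * A₂ = cst (Q⁻¹ * y₁ - w) * A₁)
    (r3 : cst (y₁ - Q⁻¹ * w) * B₃ = cst (Q⁻¹ * y₁ - w) * B₂)
    (r4 : cst (y₂ - Q⁻¹ * w) * B₂ = cst (Q⁻¹ * y₂ - w) * B₁)
    (r5 : cst (y₁ - Q ^ 2 * y₂) * A₁ = cst (Q ^ 2 * y₁ - y₂) * B₁)
    (r6 : cst (y₁ - Q ^ 2 * y₂) * A₃ = cst (Q ^ 2 * y₁ - y₂) * B₃) :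
    A₁ - cst (Q + Q⁻¹) * A₂ + A₃ + (B₁ - cst (Q + Q⁻¹) * B₂ + B₃) = 0 := by
  -- The polynomial identity behind the Serre relation: the six terms after each of them has been
  -- expressed through `A₁` and denominators have been cleared.
  have hS : (y₁ - Q⁻¹ * w) * (y₂ - Q⁻¹ * w) * (Q ^ 2 * y₁ - y₂) -
      (Q + Q⁻¹) * ((Q⁻¹ * y₁ - w) * (y₂ - Q⁻¹ * w) * (Q ^ 2 * y₁ - y₂)) +
      (Q⁻¹ * y₁ - w) * (Q⁻¹ * y₂ - w) * (Q ^ 2 * y₁ - y₂) +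
      ((y₁ - Q⁻¹ * w) * (y₂ - Q⁻¹ * w) * (y₁ - Q ^ 2 * y₂) -
      (Q + Q⁻¹) * ((y₁ - Q⁻¹ * w) * (Q⁻¹ * y₂ - w) * (y₁ - Q ^ 2 * y₂)) +
      (Q⁻¹ * y₁ - w) * (Q⁻¹ * y₂ - w) * (y₁ - Q ^ 2 * y₂)) = 0 := by
    field_simp
    ring
  have hS' := congrArg cst hS
  simp only [cst_add, cst_sub, cst_mul, cst_zero] at hS'
  simp only [← cst_mul, ← cst_sub] at hS'
  have hR : cst (Q ^ 2 * y₁ - y₂) ≠ 0 := cst_ne_zero (sub_ne_zero.mpr h21.symm)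
  -- If the left coefficients do not vanish, all six elements are multiples of `A₁`. Otherwise the
  -- right coefficients do not vanish, and one solves in the opposite direction, starting from `A₃`.
  by_cases hp : y₁ - Q⁻¹ * w ≠ 0 ∧ y₂ - Q⁻¹ * w ≠ 0
  · refine mul_left_cancel₀ (mul_ne_zero (mul_ne_zero (cst_ne_zero hp.1) (cst_ne_zero hp.2)) hR) ?_
    simp only [cst_add, cst_sub, cst_mul] at r1 r2 r3 r4 r5 r6 hS' ⊢
    generalize cst y₁ - cst Q⁻¹ * cst w = p₁ at *
    generalize cst y₂ - cst Q⁻¹ * cst w = p₂ at *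
    generalize cst Q⁻¹ * cst y₁ - cst w = n₁ at *
    generalize cst Q⁻¹ * cst y₂ - cst w = n₂ at *
    generalize cst (Q ^ 2) * cst y₁ - cst y₂ = R at *
    generalize cst y₁ - cst (Q ^ 2) * cst y₂ = R' at *
    linear_combination p₁ * R * r1 + R * n₂ * r2 - (cst Q + cst Q⁻¹) * (p₂ * R * r2) -
      p₁ * p₂ * r5 - (cst Q + cst Q⁻¹) * (p₁ * R * r4 - p₁ * n₂ * r5) + p₂ * R * r3 +
      n₁ * R * r4 - n₁ * n₂ * r5 + A₁ * hS'
  · have hn : Q⁻¹ * y₁ - w ≠ 0 ∧ Q⁻¹ * y₂ - w ≠ 0 := by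
      have aux : ∀ y y' : ℂ, y' ≠ Q ^ 2 * y → y = Q⁻¹ * w →
          Q⁻¹ * y - w ≠ 0 ∧ Q⁻¹ * y' - w ≠ 0 := by
        intro y y' hy' hy
        constructor
        · intro h
          rw [hy, sub_eq_zero] at h
          apply hQ2
          field_simp at h
          exact h.symm
        · intro h
          apply hy'
          rw [hy]
          rw [sub_eq_zero] at h
          rw [← h]
          field_simp
      rw [not_and_or, not_ne_iff, not_ne_iff, sub_eq_zero, sub_eq_zero] at hp
      rcases hp with hp | hp
      · exact aux _ _ h21 hp
      · exact (aux _ _ h12 hp).symm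
    refine mul_left_cancel₀ (mul_ne_zero (mul_ne_zero (cst_ne_zero hn.1) (cst_ne_zero hn.2)) hR) ?_
    simp only [cst_add, cst_sub, cst_mul] at r1 r2 r3 r4 r5 r6 hS' ⊢
    generalize cst y₁ - cst Q⁻¹ * cst w = p₁ at *
    generalize cst y₂ - cst Q⁻¹ * cst w = p₂ at *
    generalize cst Q⁻¹ * cst y₁ - cst w = n₁ at *
    generalize cst Q⁻¹ * cst y₂ - cst w = n₂ at *
    generalize cst (Q ^ 2) * cst y₁ - cst y₂ = R at *
    generalize cst y₁ - cst (Q ^ 2) * cst y₂ = R' at *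
    linear_combination -n₂ * R * r2 - R * p₁ * r1 + (cst Q + cst Q⁻¹) * (n₁ * R * r1) -
      n₁ * n₂ * r6 + (cst Q + cst Q⁻¹) * (n₂ * R * r3 + n₂ * p₁ * r6) - n₁ * R * r4 -
      R * p₂ * r3 - p₁ * p₂ * r6 + A₃ * hS'

end SerreAlgebra

section SerreSum

theorem sum_reverse₃ {α β : Type*} [AddCommMonoid β] (B : Finset α) (f : α → α → α → β) :
    ∑ x ∈ B, ∑ y ∈ B, ∑ z ∈ B, f x y z = ∑ z ∈ B, ∑ y ∈ B, ∑ x ∈ B, f x y z := by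
  rw [Finset.sum_comm, Finset.sum_congr rfl fun y _ => Finset.sum_comm, Finset.sum_comm]

theorem sum_rotate₃ {α β : Type*} [AddCommMonoid β] (B : Finset α) (f : α → α → α → β) :
    ∑ x ∈ B, ∑ y ∈ B, ∑ z ∈ B, f x y z = ∑ y ∈ B, ∑ z ∈ B, ∑ x ∈ B, f x y z := by
  rw [Finset.sum_comm, Finset.sum_congr rfl fun y _ => Finset.sum_comm]

theorem sum_comm₃ {α γ β : Type*} [AddCommMonoid β] (R : Finset γ) (B : Finset α)
    (f : γ → α → α → α → β) :
    ∑ r ∈ R, ∑ x ∈ B, ∑ y ∈ B, ∑ z ∈ B, f r x y z =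
      ∑ x ∈ B, ∑ y ∈ B, ∑ z ∈ B, ∑ r ∈ R, f r x y z := by
  rw [Finset.sum_comm]
  refine Finset.sum_congr rfl fun x _ => ?_
  rw [Finset.sum_comm]
  exact Finset.sum_congr rfl fun y _ => Finset.sum_comm

end SerreSum

/-! ### Matrix coefficients of the Serre relation -/

namespace StepData

variable {A : Type*} [CommRing A] [Algebra ℂ⟦X⟧ A]

variable {N : ℕ} (D : StepData N)

theorem gTrunc_mul₃ (q : ℂ) (b b' : ℤ) (M : ℕ) (x y z : ℂ) :
    gTrunc q b x M * gTrunc q b' y M * gTrunc q b' z M =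
      ∑ r ∈ Finset.range M, ∑ s ∈ Finset.range M, ∑ t ∈ Finset.range M,
        PowerSeries.coeff r (gSeries q b nome) * PowerSeries.coeff s (gSeries q b' nome) *
          PowerSeries.coeff t (gSeries q b' nome) * cst (x ^ r * y ^ s * z ^ t) := by
  rw [gTrunc, gTrunc, gTrunc, Finset.sum_mul_sum, Finset.sum_mul]
  refine Finset.sum_congr rfl fun r _ => ?_
  rw [Finset.sum_mul]
  refine Finset.sum_congr rfl fun s _ => ?_
  rw [Finset.mul_sum]
  refine Finset.sum_congr rfl fun t _ => ?_
  rw [cst_mul, cst_mul]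
  ring

/-- The matrix coefficient of the Serre relation for one order of the first two boxes, in terms
of values `g`, `h` of the structure functions. -/
def serreCoeff (q κ : ℂ) (e : ℤ) (g h : ℂ → ℂ⟦X⟧) (S : Finset (ℕ × ℕ)) (z₁ z₂ w : ℕ × ℕ) :
    ℂ⟦X⟧ :=
  g (D.pos z₂ / D.pos z₁) * h (κ ^ e * D.pos z₁ / D.pos w) * h (κ ^ e * D.pos z₂ / D.pos w) *
      (D.c S z₂ * D.c (D.st S z₂) z₁ * D.c (D.st (D.st S z₂) z₁) w) -
    cst (qnum q 2) * (g (D.pos z₂ / D.pos z₁) * h (κ ^ (-e) * D.pos w / D.pos z₁) *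
      h (κ ^ e * D.pos z₂ / D.pos w) *
      (D.c S z₂ * D.c (D.st S z₂) w * D.c (D.st (D.st S z₂) w) z₁)) +
    g (D.pos z₂ / D.pos z₁) * h (κ ^ (-e) * D.pos w / D.pos z₁) *
      h (κ ^ (-e) * D.pos w / D.pos z₂) *
      (D.c S w * D.c (D.st S w) z₂ * D.c (D.st (D.st S w) z₂) z₁)

theorem serreTerm_ket {q κ : ℂ} (hκ : κ ≠ 0) (σ τ : A →ₐ[ℂ⟦X⟧] A) (i j : ZMod N) (e b b' : ℤ)
    (M : ℕ) (a₁ a₂ c : ℤ) (S : Finset (ℕ × ℕ)) {m : ℕ} (hm : S.card + 2 < m) :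
    serreTerm q κ e (gSeries q b nome) (gSeries q b' nome) (D.op σ i) (D.op τ j) M a₁ a₂ c
      (ketS A S) =
    ∑ w ∈ boxes m, ∑ z₁ ∈ boxes m, ∑ z₂ ∈ boxes m,
      (if D.col z₁ = i ∧ D.col z₂ = i ∧ D.col w = j then
        cst (D.pos z₁ ^ a₁ * D.pos z₂ ^ a₂ * D.pos w ^ c) *
          D.serreCoeff q κ e (fun x => gTrunc q b x M) (fun x => gTrunc q b' x M) S z₁ z₂ w
        else 0) • ketS A (D.st (D.st (D.st S w) z₁) z₂) := by
  -- The three products sum over boxes in their order of application; the summations are rearranged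
  -- to the common order w, z₁, z₂.
  have T1 := fun d a c => (D.op_op_op_ketS τ σ σ j i i d a c S hm).trans (sum_reverse₃ _ _)
  have T2 := fun d a c => (D.op_op_op_ketS σ τ σ i j i d a c S hm).trans (sum_rotate₃ _ _)
  have T3 := fun d a c => (D.op_op_op_ketS σ σ τ i i j d a c S hm).trans
    (Finset.sum_congr rfl fun _ _ => Finset.sum_comm)
  simp only [serreTerm, LinearMap.sum_apply, LinearMap.smul_apply, LinearMap.sub_apply,
    LinearMap.add_apply, Module.End.mul_apply, T1, T2, T3]
  simp only [Finset.smul_sum, ← Finset.sum_sub_distrib, ← Finset.sum_add_distrib]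
  rw [Finset.sum_congr rfl fun r _ => Finset.sum_congr rfl fun s _ => sum_comm₃ _ _ _,
    Finset.sum_congr rfl fun r _ => sum_comm₃ _ _ _, sum_comm₃]
  refine Finset.sum_congr rfl fun w _ => Finset.sum_congr rfl fun z₁ _ =>
    Finset.sum_congr rfl fun z₂ _ => ?_
  have e1 : D.st (D.st (D.st S z₂) z₁) w = D.st (D.st (D.st S w) z₁) z₂ := by
    rw [D.st_comm _ z₁ w, D.st_comm S z₂ w, D.st_comm _ z₂ z₁]
  have e2 : D.st (D.st (D.st S z₂) w) z₁ = D.st (D.st (D.st S w) z₁) z₂ := by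
    rw [D.st_comm S z₂ w, D.st_comm _ z₂ z₁]
  have e3 : D.st (D.st (D.st S w) z₂) z₁ = D.st (D.st (D.st S w) z₁) z₂ := D.st_comm _ _ _
  simp only [e1, e2, e3, smul_smul, ← sub_smul, ← add_smul, ← Finset.sum_smul]
  congr 1
  by_cases h : D.col z₁ = i ∧ D.col z₂ = i ∧ D.col w = j
  · obtain ⟨h1, h2, h3⟩ := h
    rw [if_pos ⟨h1, h2, h3⟩, serreCoeff, gTrunc_mul₃, gTrunc_mul₃, gTrunc_mul₃]
    simp only [Finset.mul_sum, Finset.sum_mul, ← Finset.sum_sub_distrib, ← Finset.sum_add_distrib]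
    refine Finset.sum_congr rfl fun r _ => Finset.sum_congr rfl fun s _ =>
      Finset.sum_congr rfl fun t _ => ?_
    simp only [wt, h1, h2, h3, if_true]
    have hz₁ := D.pos_ne_zero z₁
    have hz₂ := D.pos_ne_zero z₂
    have hw := D.pos_ne_zero w
    have k1 : κ ^ (e * (s + t)) * (D.pos z₂ ^ (a₂ + r + t) * D.pos z₁ ^ (a₁ - r + s) *
        D.pos w ^ (c - s - t)) = D.pos z₁ ^ a₁ * D.pos z₂ ^ a₂ * D.pos w ^ c *
        ((D.pos z₂ / D.pos z₁) ^ r * (κ ^ e * D.pos z₁ / D.pos w) ^ s *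
          (κ ^ e * D.pos z₂ / D.pos w) ^ t) := by
      simp only [div_pow, mul_pow, zpow_mul, mul_add, zpow_natCast, zpow_add₀ hz₁, zpow_add₀ hz₂,
        zpow_add₀ hκ, zpow_sub₀ hz₁, zpow_sub₀ hw]
      field_simp
    have k2 : κ ^ (e * (t - s)) * (D.pos z₂ ^ (a₂ + r + t) * D.pos w ^ (c + s - t) *
        D.pos z₁ ^ (a₁ - r - s)) = D.pos z₁ ^ a₁ * D.pos z₂ ^ a₂ * D.pos w ^ c *
        ((D.pos z₂ / D.pos z₁) ^ r * (κ ^ (-e) * D.pos w / D.pos z₁) ^ s *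
          (κ ^ e * D.pos z₂ / D.pos w) ^ t) := by
      simp only [div_pow, mul_pow, zpow_mul, mul_sub, zpow_natCast, zpow_add₀ hw, zpow_add₀ hz₂,
        zpow_sub₀ hκ, zpow_sub₀ hz₁, zpow_sub₀ hw, zpow_neg, inv_pow]
      field_simp
    have k3 : κ ^ (-(e * (s + t))) * (D.pos w ^ (c + s + t) * D.pos z₂ ^ (a₂ + r - t) *
        D.pos z₁ ^ (a₁ - r - s)) = D.pos z₁ ^ a₁ * D.pos z₂ ^ a₂ * D.pos w ^ c *
        ((D.pos z₂ / D.pos z₁) ^ r * (κ ^ (-e) * D.pos w / D.pos z₁) ^ s *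
          (κ ^ (-e) * D.pos w / D.pos z₂) ^ t) := by
      simp only [div_pow, mul_pow, zpow_mul, mul_add, zpow_natCast, zpow_add₀ hw, zpow_add₀ hz₂,
        zpow_add₀ hκ, zpow_sub₀ hz₁, zpow_sub₀ hz₂, zpow_neg, inv_pow, neg_add]
      field_simp
    have k1' := congrArg cst k1
    have k2' := congrArg cst k2
    have k3' := congrArg cst k3
    rw [cst_mul, cst_mul, cst_mul, cst_mul (D.pos z₁ ^ a₁ * D.pos z₂ ^ a₂ * D.pos w ^ c)]
      at k1' k2' k3'
    rw [cst_mul (qnum q 2)]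
    linear_combination (PowerSeries.coeff r (gSeries q b nome) *
      PowerSeries.coeff s (gSeries q b' nome) * PowerSeries.coeff t (gSeries q b' nome)) *
      ((D.c S z₂ * D.c (D.st S z₂) z₁ * D.c (D.st (D.st S z₂) z₁) w) * k1' -
      cst (qnum q 2) * (D.c S z₂ * D.c (D.st S z₂) w * D.c (D.st (D.st S z₂) w) z₁) * k2' +
      (D.c S w * D.c (D.st S w) z₂ * D.c (D.st (D.st S w) z₂) z₁) * k3')
  · rw [if_neg h]
    refine Finset.sum_eq_zero fun r _ => Finset.sum_eq_zero fun s _ =>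
      Finset.sum_eq_zero fun t _ => ?_
    rw [not_and_or, not_and_or] at h
    rcases h with h | h | h <;> simp [wt, h]

end StepData

/-! ### The Serre relation from the exchange relation -/

theorem qnum_two (hq : q ≠ 0) (hq2 : q ^ 2 ≠ 1) : qnum q 2 = q + q⁻¹ := by
  have h : q - q⁻¹ ≠ 0 := by
    intro h
    apply hq2
    field_simp at h
    linear_combination h
  rw [qnum, div_eq_iff h, zpow_neg]
  simp only [zpow_ofNat]
  field_simp
  ring

theorem mMat_self {N : ℕ} (i : ZMod N) : mMat N i i = 0 := by
  simp [mMat, eq_comm]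

namespace StepData

variable {A : Type*} [CommRing A] [Algebra ℂ⟦X⟧ A] {N : ℕ} {D : StepData N} {q κ : ℂ} {ε : ℤ}

/-- Three boxes that can be changed successively never have positions with ratio `q²`. -/
def Separated (D : StepData N) (q : ℂ) : Prop :=
  ∀ S x y z, D.c S x * D.c (D.st S x) y * D.c (D.st (D.st S x) y) z ≠ 0 →
    ∀ a ∈ ({x, y, z} : Set (ℕ × ℕ)), ∀ b ∈ ({x, y, z} : Set (ℕ × ℕ)), D.pos a ≠ q ^ 2 * D.pos b

/-- The coefficient is polynomial in the values of g and h, so it may be compared in the quotient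
ring by `d`. -/
theorem dvd_serreCoeff_sub (d : ℂ⟦X⟧) {e : ℤ} {g g' h h' : ℂ → ℂ⟦X⟧} (hg : ∀ x, d ∣ g x - g' x)
    (hh : ∀ x, d ∣ h x - h' x) (S : Finset (ℕ × ℕ)) (z₁ z₂ w : ℕ × ℕ) :
    d ∣ D.serreCoeff q κ e g h S z₁ z₂ w - D.serreCoeff q κ e g' h' S z₁ z₂ w := by
  simp only [← Ideal.mem_span_singleton, ← Ideal.Quotient.mk_eq_mk_iff_sub_mem] at hg hh ⊢
  simp only [serreCoeff, map_add, map_sub, map_mul, hg, hh]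

/-- The six orders of the three boxes are linked by exchanges of neighbours in the order, each an
instance of the quadratic identity. These are the hypotheses of `serre_of_quadratic`, with Q = q^ε
and y_i = κ^m pos z_i. -/
theorem serreCoeff_add_swap (hq : q ≠ 0) (hκ : κ ≠ 0) (hq2 : q ^ 2 ≠ 1) (hε : ε = 1 ∨ ε = -1)
    (hE : D.Exchange q κ ε) (hW : D.Separated q) {i j : ZMod N} (hi : cartan N i i = 2)
    (hij : cartan N i j = -1) (S : Finset (ℕ × ℕ)) {z₁ z₂ w : ℕ × ℕ} (h₁ : D.col z₁ = i)
    (h₂ : D.col z₂ = i) (hw : D.col w = j) :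
    D.serreCoeff q κ (mMat N i j) (gVal q (ε * 2)) (gVal q (ε * -1)) S z₁ z₂ w +
      D.serreCoeff q κ (mMat N i j) (gVal q (ε * 2)) (gVal q (ε * -1)) S z₂ z₁ w = 0 := by
  by_cases hb : D.pos z₁ ≠ q ^ 2 * D.pos z₂ ∧ D.pos z₂ ≠ q ^ 2 * D.pos z₁
  · have hQ : qnum q 2 = q ^ ε + (q ^ ε)⁻¹ := by
      rw [qnum_two hq hq2]
      rcases hε with rfl | rfl <;> simp [add_comm]
    have hy : κ ^ mMat N i j * D.pos z₁ ≠ (q ^ ε) ^ 2 * (κ ^ mMat N i j * D.pos z₂) ∧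
        κ ^ mMat N i j * D.pos z₂ ≠ (q ^ ε) ^ 2 * (κ ^ mMat N i j * D.pos z₁) := by
      have hk := zpow_ne_zero (mMat N i j) hκ
      have aux : ∀ x y : ℂ, x ≠ q ^ 2 * y → y ≠ q ^ 2 * x →
          κ ^ mMat N i j * x ≠ (q ^ ε) ^ 2 * (κ ^ mMat N i j * y) := by
        intro x y h h' h''
        rw [mul_left_comm] at h''
        have h3 := mul_left_cancel₀ hk h''
        rcases hε with rfl | rfl
        · exact h (by simpa using h3)
        · apply h'
          rw [h3]
          simp only [zpow_neg, zpow_one]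
          field_simp
      exact ⟨aux _ _ hb.1 hb.2, aux _ _ hb.2 hb.1⟩
    have q2 : (q ^ ε) ^ 2 = q ^ (ε * 2) := by rw [zpow_mul, zpow_ofNat]
    have q1 : (q ^ ε)⁻¹ = q ^ (ε * -1) := by rw [zpow_mul, zpow_neg_one]
    have hQ2 : (q ^ ε) ^ 2 ≠ 1 := by
      rcases hε with rfl | rfl
      · simpa using hq2
      · simpa [inv_pow] using hq2
    have E := fun S => hE S z₁ w
    have E' := fun S => hE S z₂ w
    have F := fun S => hE S z₁ z₂
    simp only [h₁, h₂, hw, hi, hij, mMat_self, neg_zero, zpow_zero, one_mul] at E E' F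
    have c12 : D.st (D.st S z₁) z₂ = D.st (D.st S z₂) z₁ := D.st_comm _ _ _
    have c1w : ∀ S, D.st (D.st S z₁) w = D.st (D.st S w) z₁ := fun S => D.st_comm _ _ _
    have c2w : ∀ S, D.st (D.st S z₂) w = D.st (D.st S w) z₂ := fun S => D.st_comm _ _ _
    have hfin := serre_of_quadratic (Q := q ^ ε) (w := D.pos w) (y₁ := κ ^ mMat N i j * D.pos z₁)
      (y₂ := κ ^ mMat N i j * D.pos z₂) (zpow_ne_zero _ hq) hQ2 (D.pos_ne_zero w) hy.1 hy.2
      (A₁ := gVal q (ε * 2) (D.pos z₂ / D.pos z₁) *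
        gVal q (ε * -1) (κ ^ mMat N i j * D.pos z₁ / D.pos w) *
        gVal q (ε * -1) (κ ^ mMat N i j * D.pos z₂ / D.pos w) *
        (D.c S z₂ * D.c (D.st S z₂) z₁ * D.c (D.st (D.st S z₂) z₁) w))
      (A₂ := gVal q (ε * 2) (D.pos z₂ / D.pos z₁) *
        gVal q (ε * -1) (κ ^ (-mMat N i j) * D.pos w / D.pos z₁) *
        gVal q (ε * -1) (κ ^ mMat N i j * D.pos z₂ / D.pos w) *
        (D.c S z₂ * D.c (D.st S z₂) w * D.c (D.st (D.st S z₂) w) z₁))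
      (A₃ := gVal q (ε * 2) (D.pos z₂ / D.pos z₁) *
        gVal q (ε * -1) (κ ^ (-mMat N i j) * D.pos w / D.pos z₁) *
        gVal q (ε * -1) (κ ^ (-mMat N i j) * D.pos w / D.pos z₂) *
        (D.c S w * D.c (D.st S w) z₂ * D.c (D.st (D.st S w) z₂) z₁))
      (B₁ := gVal q (ε * 2) (D.pos z₁ / D.pos z₂) *
        gVal q (ε * -1) (κ ^ mMat N i j * D.pos z₂ / D.pos w) *
        gVal q (ε * -1) (κ ^ mMat N i j * D.pos z₁ / D.pos w) *
        (D.c S z₁ * D.c (D.st S z₁) z₂ * D.c (D.st (D.st S z₁) z₂) w))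
      (B₂ := gVal q (ε * 2) (D.pos z₁ / D.pos z₂) *
        gVal q (ε * -1) (κ ^ (-mMat N i j) * D.pos w / D.pos z₂) *
        gVal q (ε * -1) (κ ^ mMat N i j * D.pos z₁ / D.pos w) *
        (D.c S z₁ * D.c (D.st S z₁) w * D.c (D.st (D.st S z₁) w) z₂))
      (B₃ := gVal q (ε * 2) (D.pos z₁ / D.pos z₂) *
        gVal q (ε * -1) (κ ^ (-mMat N i j) * D.pos w / D.pos z₂) *
        gVal q (ε * -1) (κ ^ (-mMat N i j) * D.pos w / D.pos z₁) *
        (D.c S w * D.c (D.st S w) z₁ * D.c (D.st (D.st S w) z₁) z₂))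
      ?_ ?_ ?_ ?_ ?_ ?_
    · rw [← hQ] at hfin
      simpa only [serreCoeff] using hfin
    · rw [q1, ← mul_assoc (q ^ (ε * -1)), mul_comm (q ^ (ε * -1)) (κ ^ mMat N i j), c2w]
      linear_combination (gVal q (ε * 2) (D.pos z₂ / D.pos z₁) *
        gVal q (ε * -1) (κ ^ (-mMat N i j) * D.pos w / D.pos z₁) *
        D.c (D.st (D.st S w) z₂) z₁) * E' S
    · rw [q1, ← mul_assoc (q ^ (ε * -1)), mul_comm (q ^ (ε * -1)) (κ ^ mMat N i j)]
      linear_combination (gVal q (ε * 2) (D.pos z₂ / D.pos z₁) *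
        gVal q (ε * -1) (κ ^ mMat N i j * D.pos z₂ / D.pos w) *
        D.c S z₂) * E (D.st S z₂)
    · rw [q1, ← mul_assoc (q ^ (ε * -1)), mul_comm (q ^ (ε * -1)) (κ ^ mMat N i j), c1w]
      linear_combination (gVal q (ε * 2) (D.pos z₁ / D.pos z₂) *
        gVal q (ε * -1) (κ ^ (-mMat N i j) * D.pos w / D.pos z₂) *
        D.c (D.st (D.st S w) z₁) z₂) * E S
    · rw [q1, ← mul_assoc (q ^ (ε * -1)), mul_comm (q ^ (ε * -1)) (κ ^ mMat N i j)]
      linear_combination (gVal q (ε * 2) (D.pos z₁ / D.pos z₂) *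
        gVal q (ε * -1) (κ ^ mMat N i j * D.pos z₁ / D.pos w) *
        D.c S z₁) * E' (D.st S z₁)
    · rw [q2, mul_left_comm (q ^ (ε * 2)), mul_left_comm (q ^ (ε * 2)), ← mul_sub, ← mul_sub, cst_mul,
        cst_mul (κ ^ mMat N i j), c12]
      linear_combination (cst (κ ^ mMat N i j) *
        gVal q (ε * -1) (κ ^ mMat N i j * D.pos z₁ / D.pos w) *
        gVal q (ε * -1) (κ ^ mMat N i j * D.pos z₂ / D.pos w) *
        D.c (D.st (D.st S z₂) z₁) w) * F S
    · rw [q2, mul_left_comm (q ^ (ε * 2)), mul_left_comm (q ^ (ε * 2)), ← mul_sub, ← mul_sub, cst_mul,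
        cst_mul (κ ^ mMat N i j)]
      linear_combination (cst (κ ^ mMat N i j) *
        gVal q (ε * -1) (κ ^ (-mMat N i j) * D.pos w / D.pos z₁) *
        gVal q (ε * -1) (κ ^ (-mMat N i j) * D.pos w / D.pos z₂) *
        D.c S w) * F (D.st S w)
  -- When the positions of z₁ and z₂ have ratio q^{±2} the division is not available, but then none
  -- of the six orders is possible.
  · have h0 : ∀ x y z, z₁ ∈ ({x, y, z} : Set (ℕ × ℕ)) → z₂ ∈ ({x, y, z} : Set (ℕ × ℕ)) →
        D.c S x * D.c (D.st S x) y * D.c (D.st (D.st S x) y) z = 0 := by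
      intro x y z m₁ m₂
      by_contra hne
      exact hb ⟨hW S x y z hne _ m₁ _ m₂, hW S x y z hne _ m₂ _ m₁⟩
    simp only [serreCoeff]
    rw [h0 z₂ z₁ w, h0 z₂ w z₁, h0 w z₂ z₁, h0 z₁ z₂ w, h0 z₁ w z₂, h0 w z₁ z₂]
    · ring
    all_goals simp

theorem serreRel (hq : q ≠ 0) (hκ : κ ≠ 0) (hq2 : q ^ 2 ≠ 1) (hε : ε = 1 ∨ ε = -1)
    (hE : D.Exchange q κ ε) (hW : D.Separated q) {σ : ZMod N → A →ₐ[ℂ⟦X⟧] A}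
    (hσ : ∀ i j, (σ i).comp (σ j) = (σ j).comp (σ i)) {i j : ZMod N} (hi : cartan N i i = 2)
    (hij : cartan N i j = -1) :
    SerreRel q κ (mMat N i j) (gSeries q (ε * cartan N i i) nome)
      (gSeries q (ε * cartan N i j) nome) (D.op (σ i) i) (D.op (A := A) (σ j) j) := by
  intro a₁ a₂ c M
  rw [hi, hij]
  have s := fun (a₁ a₂ c : ℤ) => (((D.isSemi_op (A := A) (σ i) i a₁).mul
    (D.isSemi_op (σ i) i a₂)).mul (D.isSemi_op (σ j) j c))
  have s' := fun (a₁ a₂ c : ℤ) => (((D.isSemi_op (A := A) (σ i) i a₁).mul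
    (D.isSemi_op (σ j) j c)).mul (D.isSemi_op (σ i) i a₂))
  have s'' := fun (a₁ a₂ c : ℤ) => (((D.isSemi_op (A := A) (σ j) j c).mul
    (D.isSemi_op (σ i) i a₁)).mul (D.isSemi_op (σ i) i a₂))
  have e' : ((σ i).comp (σ j)).comp (σ i) = ((σ i).comp (σ i)).comp (σ j) := by
    rw [AlgHom.comp_assoc, hσ j i, AlgHom.comp_assoc]
  have e'' : ((σ j).comp (σ i)).comp (σ i) = ((σ i).comp (σ i)).comp (σ j) := by
    rw [hσ j i, e']
  rw [e'] at s'
  rw [e''] at s''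
  have hT : ∀ a₁ a₂, IsSemi (((σ i).comp (σ i)).comp (σ j)) (serreTerm q κ (mMat N i j)
      (gSeries q (ε * 2) nome) (gSeries q (ε * -1) nome) (D.op (σ i) i) (D.op (A := A) (σ j) j)
      M a₁ a₂ c) := fun a₁ a₂ =>
    IsSemi.sum _ fun r _ => IsSemi.sum _ fun _ _ => IsSemi.sum _ fun _ _ =>
      IsSemi.smul _ (IsSemi.add (IsSemi.sub (IsSemi.smul _ (s'' _ _ _)) (IsSemi.smul _ (s' _ _ _)))
        (IsSemi.smul _ (s _ _ _)))
  refine IsSemi.congMod ((hT _ _).add (hT _ _)) (IsSemi.zero _) fun y => ?_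
  rw [← ketS_cells, LinearMap.add_apply,
    D.serreTerm_ket hκ _ _ _ _ _ _ _ _ _ _ _ _ (Nat.lt_succ_self _),
    D.serreTerm_ket hκ _ _ _ _ _ _ _ _ a₂ a₁ _ _ (Nat.lt_succ_self _)]
  simp only [LinearMap.zero_apply, zero_add]
  rw [← Finset.sum_add_distrib]
  -- In the term with a₁ and a₂ exchanged the names of z₁ and z₂ are swapped too, so that the two
  -- contributions meet at the same boxes.
  have hcomb : ∀ w ∈ boxes (y.cells.card + 2).succ, _ = _ := fun w _ => congrArg₂ (· + ·)
    (rfl : (∑ z₁ ∈ boxes (y.cells.card + 2).succ, ∑ z₂ ∈ boxes (y.cells.card + 2).succ,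
      (if D.col z₁ = i ∧ D.col z₂ = i ∧ D.col w = j then
        cst (D.pos z₁ ^ a₁ * D.pos z₂ ^ a₂ * D.pos w ^ c) *
          D.serreCoeff q κ (mMat N i j) (fun x => gTrunc q (ε * 2) x M)
            (fun x => gTrunc q (ε * -1) x M) y.cells z₁ z₂ w else 0) •
        ketS A (D.st (D.st (D.st y.cells w) z₁) z₂)) = _)
    (Finset.sum_comm (s := boxes (y.cells.card + 2).succ) (t := boxes (y.cells.card + 2).succ)
      (f := fun z₁ z₂ => (if D.col z₁ = i ∧ D.col z₂ = i ∧ D.col w = j then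
        cst (D.pos z₁ ^ a₂ * D.pos z₂ ^ a₁ * D.pos w ^ c) *
          D.serreCoeff q κ (mMat N i j) (fun x => gTrunc q (ε * 2) x M)
            (fun x => gTrunc q (ε * -1) x M) y.cells z₁ z₂ w else 0) •
        ketS A (D.st (D.st (D.st y.cells w) z₁) z₂)))
  rw [Finset.sum_congr rfl hcomb]
  simp only [← Finset.sum_add_distrib]
  simp only [← Finset.sum_product']
  have key : ∀ w z₁ z₂ : ℕ × ℕ, nome ^ M ∣
      (if D.col z₁ = i ∧ D.col z₂ = i ∧ D.col w = j then
        cst (D.pos z₁ ^ a₁ * D.pos z₂ ^ a₂ * D.pos w ^ c) *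
          D.serreCoeff q κ (mMat N i j) (fun x => gTrunc q (ε * 2) x M)
            (fun x => gTrunc q (ε * -1) x M) y.cells z₁ z₂ w else 0) +
      (if D.col z₂ = i ∧ D.col z₁ = i ∧ D.col w = j then
        cst (D.pos z₂ ^ a₂ * D.pos z₁ ^ a₁ * D.pos w ^ c) *
          D.serreCoeff q κ (mMat N i j) (fun x => gTrunc q (ε * 2) x M)
            (fun x => gTrunc q (ε * -1) x M) y.cells z₂ z₁ w else 0) := by
    intro w z₁ z₂
    by_cases h : D.col z₁ = i ∧ D.col z₂ = i ∧ D.col w = j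
    · rw [if_pos h, if_pos ⟨h.2.1, h.1, h.2.2⟩, mul_comm (D.pos z₂ ^ a₂), ← mul_add]
      refine Dvd.dvd.mul_left ?_ _
      have hd' : ∀ b x, nome ^ M ∣ gTrunc q b x M - gVal q b x := fun b x =>
        nome_pow_dvd_gVal_sub q b x M
      have h0 := serreCoeff_add_swap hq hκ hq2 hε hE hW hi hij y.cells h.1 h.2.1 h.2.2
      have h1 := dvd_add (dvd_serreCoeff_sub (D := D) (q := q) (κ := κ) (nome ^ M) (e := mMat N i j)
        (hd' (ε * 2)) (hd' (ε * -1)) y.cells z₁ z₂ w)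
        (dvd_serreCoeff_sub (D := D) (q := q) (κ := κ) (nome ^ M) (e := mMat N i j)
        (hd' (ε * 2)) (hd' (ε * -1)) y.cells z₂ z₁ w)
      rw [sub_add_sub_comm] at h1
      have h2 : ∀ a b : ℂ⟦X⟧, b = 0 → a - b = a := fun a b h => by rw [h, sub_zero]
      rwa [h2 _ _ h0] at h1
    · rw [if_neg h, if_neg fun h' => h ⟨h'.2.1, h'.1, h'.2.2⟩, zero_add]
      exact dvd_zero _
  have hfin : ∀ w z₁ z₂ : ℕ × ℕ, D.st (D.st (D.st y.cells w) z₂) z₁ =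
      D.st (D.st (D.st y.cells w) z₁) z₂ := fun w z₁ z₂ => D.st_comm _ _ _
  simp only [hfin, ← add_smul]
  exact exists_nome_smul _ _ _ fun x _ => key _ _ _

end StepData

/-! ### Boxes, their colours and positions -/

/-- The parameters of a Fock module, generic. -/
structure FockData (N : ℕ) where
  q : ℂ
  κ : ℂ
  u : ℂ
  k : ZMod N
  hN : 3 ≤ N
  hq : q ≠ 0
  hκ : κ ≠ 0
  hu : u ≠ 0
  hgen : ∀ m n : ℤ, q ^ m * κ ^ n = 1 → m = 0 ∧ n = 0

/-! ### The affine Cartan matrix and the matrix m -/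

section Cartan

variable {N : ℕ}

theorem natCast_ne_zero_of_lt (hN : 3 ≤ N) {m : ℕ} (h0 : m ≠ 0) (h : m < 3) : (m : ZMod N) ≠ 0 := by
  intro h'
  rw [ZMod.natCast_eq_zero_iff] at h'
  have := Nat.le_of_dvd (by omega) h'
  omega

theorem one_ne_zero_zmod (hN : 3 ≤ N) : (1 : ZMod N) ≠ 0 := by
  simpa using natCast_ne_zero_of_lt hN (m := 1) (by omega) (by omega)

theorem two_ne_zero_zmod (hN : 3 ≤ N) : (2 : ZMod N) ≠ 0 := by
  simpa using natCast_ne_zero_of_lt hN (m := 2) (by omega) (by omega)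

theorem add_one_ne (hN : 3 ≤ N) (i : ZMod N) : i + 1 ≠ i := by
  intro h; exact one_ne_zero_zmod hN (by linear_combination h)

/-- Here N ≥ 3 enters: i - 1, i and i + 1 are distinct, so the two off-diagonal deltas never
coincide. -/
theorem add_one_add_one_ne (hN : 3 ≤ N) (i : ZMod N) : i + 1 + 1 ≠ i := by
  intro h; exact two_ne_zero_zmod hN (by linear_combination h)

theorem cartan_self (hN : 3 ≤ N) (i : ZMod N) : cartan N i i = 2 := by
  simp [cartan, (add_one_ne hN i).symm]

theorem cartan_succ (hN : 3 ≤ N) (i : ZMod N) : cartan N (i + 1) i = -1 := by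
  simp [cartan, add_one_ne hN i, (add_one_add_one_ne hN i).symm]

theorem cartan_symm (i j : ZMod N) : cartan N i j = cartan N j i := by
  simp only [cartan, eq_comm (a := i) (b := j)]
  ring

theorem cartan_pred (hN : 3 ≤ N) (i : ZMod N) : cartan N i (i + 1) = -1 := by
  rw [cartan_symm, cartan_succ hN]

theorem cartan_of_ne {i j : ZMod N} (h : i ≠ j) (h1 : i ≠ j + 1) (h2 : j ≠ i + 1) :
    cartan N i j = 0 := by
  simp [cartan, h, h1, h2]

theorem mMat_succ (hN : 3 ≤ N) (i : ZMod N) : mMat N (i + 1) i = 1 := by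
  simp [mMat, add_one_add_one_ne hN i]

theorem mMat_symm (i j : ZMod N) : mMat N i j = -mMat N j i := by
  simp only [mMat, eq_comm (b := i), eq_comm (b := j)]
  ring

theorem mMat_pred (hN : 3 ≤ N) (i : ZMod N) : mMat N i (i + 1) = -1 := by
  rw [mMat_symm, mMat_succ hN]

theorem mMat_of_ne {i j : ZMod N} (h1 : i ≠ j + 1) (h2 : j ≠ i + 1) : mMat N i j = 0 := by
  simp [mMat, h1, Ne.symm h2]

theorem cartan_mMat_cases (hN : 3 ≤ N) (i j : ZMod N) :
    (cartan N i j = 2 ∧ mMat N i j = 0) ∨ (cartan N i j = -1 ∧ mMat N i j = 1) ∨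
    (cartan N i j = -1 ∧ mMat N i j = -1) ∨ (cartan N i j = 0 ∧ mMat N i j = 0) := by
  by_cases h : i = j
  · subst h
    exact Or.inl ⟨cartan_self hN _, mMat_self _⟩
  by_cases h1 : i = j + 1
  · subst h1
    exact Or.inr (Or.inl ⟨cartan_succ hN _, mMat_succ hN _⟩)
  by_cases h2 : j = i + 1
  · subst h2
    exact Or.inr (Or.inr (Or.inl ⟨cartan_pred hN _, mMat_pred hN _⟩))
  · exact Or.inr (Or.inr (Or.inr ⟨cartan_of_ne h h1 h2, mMat_of_ne h1 h2⟩))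

end Cartan

namespace FockData

variable {N : ℕ} (P : FockData N)

/-- The colour of a box. -/
def col (b : ℕ × ℕ) : ZMod N := P.k + b.1 - b.2

/-- The position `q₁^c q₃^r u` for integers `r`, `c`. -/
def posZ (r c : ℤ) : ℂ := q1 P.q P.κ ^ c * q3 P.q P.κ ^ r * P.u

/-- The position of a box. -/
def pos (b : ℕ × ℕ) : ℂ := P.posZ b.1 b.2

theorem q1_ne_zero : q1 P.q P.κ ≠ 0 := mul_ne_zero P.hκ (inv_ne_zero P.hq)

theorem q3_ne_zero : q3 P.q P.κ ≠ 0 := mul_ne_zero (inv_ne_zero P.hκ) (inv_ne_zero P.hq)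

theorem posZ_ne_zero (r c : ℤ) : P.posZ r c ≠ 0 :=
  mul_ne_zero (mul_ne_zero (zpow_ne_zero _ P.q1_ne_zero) (zpow_ne_zero _ P.q3_ne_zero)) P.hu

theorem pos_ne_zero (b : ℕ × ℕ) : P.pos b ≠ 0 := P.posZ_ne_zero _ _

theorem posZ_eq (r c : ℤ) : P.posZ r c = P.q ^ (-c - r) * P.κ ^ (c - r) * P.u := by
  rw [posZ, q1, q3, mul_zpow, mul_zpow, inv_zpow', inv_zpow', inv_zpow', zpow_sub₀ P.hq,
    zpow_sub₀ P.hκ, zpow_neg, zpow_neg, zpow_neg]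
  ring

/-- Genericity of q and κ turns equalities between positions into two linear equations over ℤ. All
questions whether a theta has argument 1 are decided this way. -/
theorem q_pow_mul_posZ (a m r c : ℤ) (r' c' : ℤ) :
    P.q ^ a * P.κ ^ m * P.posZ r c = P.posZ r' c' ↔ a - c - r = -c' - r' ∧ m + c - r = c' - r' := by
  rw [posZ_eq, posZ_eq]
  have h : P.q ^ a * P.κ ^ m * (P.q ^ (-c - r) * P.κ ^ (c - r) * P.u) =
      P.q ^ (-c' - r') * P.κ ^ (c' - r') * P.u ↔
      P.q ^ (a - c - r - (-c' - r')) * P.κ ^ (m + c - r - (c' - r')) = 1 := by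
    have e1 : P.q ^ (a - c - r - (-c' - r')) =
        P.q ^ a * P.q ^ (-c - r) / P.q ^ (-c' - r') := by
      rw [← zpow_add₀ P.hq, ← zpow_sub₀ P.hq]; congr 1; ring
    have e2 : P.κ ^ (m + c - r - (c' - r')) = P.κ ^ m * P.κ ^ (c - r) / P.κ ^ (c' - r') := by
      rw [← zpow_add₀ P.hκ, ← zpow_sub₀ P.hκ]; congr 1; ring
    rw [e1, e2, div_mul_div_comm, div_eq_one_iff_eq (mul_ne_zero (zpow_ne_zero _ P.hq)
      (zpow_ne_zero _ P.hκ))]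
    constructor
    · intro h
      exact mul_right_cancel₀ P.hu (by linear_combination h)
    · intro h
      linear_combination P.u * h
  rw [h]
  constructor
  · intro h
    have := P.hgen _ _ h
    omega
  · rintro ⟨h1, h2⟩
    rw [h1, h2, sub_self, sub_self, zpow_zero, zpow_zero, one_mul]

theorem posZ_inj {r c r' c' : ℤ} : P.posZ r c = P.posZ r' c' ↔ r = r' ∧ c = c' := by
  have h := P.q_pow_mul_posZ 0 0 r c r' c'
  rw [zpow_zero, zpow_zero, one_mul, one_mul] at h
  rw [h]
  omega

theorem pos_injective : Function.Injective P.pos := by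
  intro b b' h
  rw [pos, pos, posZ_inj] at h
  exact Prod.ext (by exact_mod_cast h.1) (by exact_mod_cast h.2)

theorem q_sq_ne_one : P.q ^ 2 ≠ 1 := by
  intro h
  have := P.hgen 2 0 (by simpa using h)
  omega

theorem q_sub_inv_ne_zero : P.q - P.q⁻¹ ≠ 0 := by
  intro h
  apply P.q_sq_ne_one
  have := P.hq
  field_simp at h
  linear_combination h

theorem posZ_succ_row (r c : ℤ) : P.posZ (r + 1) c = q3 P.q P.κ * P.posZ r c := by
  rw [posZ, posZ, zpow_add_one₀ P.q3_ne_zero]; ring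

theorem posZ_pred_col (r c : ℤ) : P.posZ r (c - 1) = (q1 P.q P.κ)⁻¹ * P.posZ r c := by
  rw [posZ, posZ, zpow_sub_one₀ P.q1_ne_zero]; ring

/-- A diagonal step multiplies the position by q₁q₃ = q^{-2}. -/
theorem posZ_succ_succ (r c : ℤ) : P.posZ (r + 1) (c + 1) = P.q ^ (-2 : ℤ) * P.posZ r c := by
  have := (P.q_pow_mul_posZ (-2) 0 r c (r + 1) (c + 1)).mpr (by omega)
  rw [← this, zpow_zero, mul_one]

theorem posZ_pred_pred (r c : ℤ) : P.posZ (r - 1) (c - 1) = P.q ^ (2 : ℤ) * P.posZ r c := by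
  have := (P.q_pow_mul_posZ 2 0 r c (r - 1) (c - 1)).mpr (by omega)
  rw [← this, zpow_zero, mul_one]

theorem posZ_pred_row (r c : ℤ) : P.posZ (r - 1) c = (q3 P.q P.κ)⁻¹ * P.posZ r c := by
  rw [posZ, posZ, zpow_sub_one₀ P.q3_ne_zero]; ring

theorem posZ_ne {r c r' c' : ℤ} (h : ¬(r = r' ∧ c = c')) : P.posZ r c / P.posZ r' c' ≠ 1 := by
  rw [Ne, div_eq_one_iff_eq (P.posZ_ne_zero _ _), posZ_inj]
  exact h

/-! ### Row functions -/

/-- The theta quotient of a row of type R with removable box `(r,c-1)`. -/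
def facR (r c : ℤ) (V : ℂ) : ℂ⟦X⟧ :=
  cst P.q * theta (P.posZ (r + 1) c / V) * (theta (P.posZ r (c - 1) / V))⁻¹

/-- The theta quotient of a row of type A with addable box `(r,c)`. -/
def facA (r c : ℤ) (V : ℂ) : ℂ⟦X⟧ :=
  cst P.q⁻¹ * theta (P.posZ (r - 1) (c - 1) / V) * (theta (P.posZ r c / V))⁻¹

/-- The factor of the row `s` of length `a` in the eigenvalue of `φ_j`. -/
def psi (j : ZMod N) (s a : ℕ) (V : ℂ) : ℂ⟦X⟧ :=
  (if (a : ZMod N) + j = s + 1 + P.k then P.facR s a V else 1) *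
    (if (a : ZMod N) + j + 1 = s + 1 + P.k then P.facA s a V else 1)

theorem condA_iff (j : ZMod N) (s a : ℕ) :
    (a : ZMod N) + j + 1 = s + 1 + P.k ↔ j = P.col (s, a) := by
  rw [col]
  constructor <;> intro h <;> linear_combination h

/-- Compare `condA_iff`: the condition names the colour of the last box of the row, which is one
more than the colour of the next free place. -/
theorem condR_iff (j : ZMod N) (s a : ℕ) :
    (a : ZMod N) + j = s + 1 + P.k ↔ j = P.col (s, a) + 1 := by
  rw [col]
  constructor <;> intro h <;> linear_combination h

theorem col_succ (s a : ℕ) : P.col (s, a + 1) + 1 = P.col (s, a) := by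
  simp only [col]; push_cast; ring

theorem condR_succ_iff (j : ZMod N) (s a : ℕ) :
    ((a + 1 : ℕ) : ZMod N) + j = s + 1 + P.k ↔ j = P.col (s, a) := by
  rw [condR_iff, col_succ]

/-- The effect of the addition of the box `(s,a)` on the factor of its row. -/
theorem psi_succ (j : ZMod N) (s a : ℕ) {r c : ℤ} (hr : r ≠ s) :
    theta (P.q ^ cartan N j (P.col (s, a)) *
        (P.κ ^ (-mMat N j (P.col (s, a))) * P.posZ s a / P.posZ r c)) *
      P.psi j s (a + 1) (P.posZ r c) =
    cst (P.q ^ cartan N j (P.col (s, a))) * theta (P.q ^ (-cartan N j (P.col (s, a))) *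
        (P.κ ^ (-mMat N j (P.col (s, a))) * P.posZ s a / P.posZ r c)) *
      P.psi j s a (P.posZ r c) := by
  have hN := P.hN
  have hk : ∀ a' m r' c' : ℤ, a' - a - s = -c' - r' → m + a - s = c' - r' →
      P.q ^ a' * (P.κ ^ m * P.posZ s a / P.posZ r c) = P.posZ r' c' / P.posZ r c := by
    intro a' m r' c' h1 h2
    rw [← (P.q_pow_mul_posZ a' m s a r' c').mpr ⟨h1, h2⟩]
    ring
  have hone : ∀ c', theta (P.posZ s c' / P.posZ r c) * (theta (P.posZ s c' / P.posZ r c))⁻¹ = 1 :=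
    fun c' => theta_mul_inv (P.posZ_ne fun h => hr h.1.symm)
  have hcq : cst P.q * cst P.q⁻¹ = 1 := by rw [← cst_mul, mul_inv_cancel₀ P.hq, cst_one]
  simp only [psi, condA_iff, condR_iff, col_succ]
  set i := P.col (s, a) with hi
  have hA : j = P.col (s, a + 1) ↔ j + 1 = i := by
    rw [hi, ← col_succ P s a, add_left_inj]
  simp only [hA]
  by_cases h0 : j = i
  -- Colour of the new box: the addable end becomes a removable end. Both factors have the same
  -- denominator, so only numerators change.
  · subst h0
    rw [if_pos rfl, if_neg (add_one_ne hN _), if_neg (add_one_ne hN _).symm, if_pos rfl,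
      cartan_self hN, mMat_self, facR, facA, hk 2 (-0) (s - 1) (a - 1) (by omega) (by omega),
      hk (-2) (-0) (s + 1) (a + 1) (by omega) (by omega)]
    push_cast
    rw [add_sub_cancel_right, zpow_ofNat, pow_two, cst_mul]
    linear_combination (-cst P.q * theta (P.posZ (s + 1) (a + 1) / P.posZ r c) *
      theta (P.posZ (s - 1) (a - 1) / P.posZ r c) * (theta (P.posZ s a / P.posZ r c))⁻¹) * hcq
  · by_cases h1 : j = i + 1
    -- Colour i + 1: the row loses its removable end.
    · have h2 : ¬(j + 1 = i) := by rw [h1]; exact add_one_add_one_ne hN _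
      rw [if_neg h0, if_neg h2, if_pos h1, if_neg h0, h1, cartan_succ hN, mMat_succ hN, facR,
        hk (-1) (-1) (s + 1) a (by omega) (by omega), hk (- -1) (-1) s (a - 1) (by omega) (by omega),
        zpow_neg_one]
      linear_combination (-theta (P.posZ (s + 1) a / P.posZ r c)) * (hone (a - 1)) -
        (theta (P.posZ (s + 1) a / P.posZ r c) * theta (P.posZ s (a - 1) / P.posZ r c) *
          (theta (P.posZ s (a - 1) / P.posZ r c))⁻¹) * hcq
    · by_cases h2 : j + 1 = i
      -- Colour i - 1: the row gains an addable end, one place further to the right.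
      · rw [if_neg h0, if_pos h2, if_neg h1, if_neg h0, ← h2, cartan_pred hN, mMat_pred hN, facA,
          hk (-1) (- -1) s (a + 1) (by omega) (by omega),
          hk (- -1) (- -1) (s - 1) a (by omega) (by omega), zpow_neg_one]
        push_cast
        rw [add_sub_cancel_right]
        linear_combination (cst P.q⁻¹ * theta (P.posZ (s - 1) a / P.posZ r c)) * hone (a + 1)
      · rw [if_neg h0, if_neg h2, if_neg h1, if_neg h0, cartan_of_ne h0 h1 (Ne.symm h2),
          mMat_of_ne h1 (Ne.symm h2)]
        simp [cst_one]

end FockData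

/-! ### Addable and removable boxes -/

section Boxes

/-- The length of a row of a set of boxes. -/
def rl (S : Finset (ℕ × ℕ)) (s : ℕ) : ℕ := (S.filter fun b => b.1 = s).card

/-- The number of rows of a set of boxes. -/
def rows (S : Finset (ℕ × ℕ)) : ℕ := (S.filter fun b => b.2 = 0).card

theorem rl_cells (y : YoungDiagram) (s : ℕ) : rl y.cells s = y.rowLen s := by
  rw [YoungDiagram.rowLen_eq_card]; rfl

theorem rows_cells (y : YoungDiagram) : rows y.cells = y.colLen 0 := by
  rw [YoungDiagram.colLen_eq_card]; rfl

theorem mem_iff_lt_rl {S : Finset (ℕ × ℕ)} (hS : IsLowerSet (S : Set (ℕ × ℕ))) (b : ℕ × ℕ) :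
    b ∈ S ↔ b.2 < rl S b.1 := by
  have h := (YoungDiagram.mem_iff_lt_rowLen (μ := ⟨S, hS⟩) (i := b.1) (j := b.2))
  rw [← rl_cells] at h
  exact h

theorem rl_eq_zero {S : Finset (ℕ × ℕ)} (hS : IsLowerSet (S : Set (ℕ × ℕ))) {s : ℕ} :
    rl S s = 0 ↔ rows S ≤ s := by
  have h := (YoungDiagram.mem_iff_lt_colLen (μ := ⟨S, hS⟩) (i := s) (j := 0))
  have h' := mem_iff_lt_rl hS (s, 0)
  rw [← rows_cells] at h
  have h2 : 0 < rl S s ↔ s < rows S := h'.symm.trans h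
  omega

theorem fst_lt_rows {S : Finset (ℕ × ℕ)} (hS : IsLowerSet (S : Set (ℕ × ℕ))) {b : ℕ × ℕ}
    (hb : b ∈ S) : b.1 < rows S := by
  rw [mem_iff_lt_rl hS] at hb
  by_contra! h
  rw [← rl_eq_zero hS] at h
  omega

theorem rl_insert {S : Finset (ℕ × ℕ)} {b : ℕ × ℕ} (hb : b ∉ S) (s : ℕ) :
    rl (insert b S) s = rl S s + if s = b.1 then 1 else 0 := by
  rw [rl, rl, Finset.filter_insert]
  by_cases h : b.1 = s
  · rw [if_pos h, if_pos h.symm, Finset.card_insert_of_notMem (by simp [hb])]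
  · rw [if_neg h, if_neg (Ne.symm h), add_zero]

/-- A diagram contains all boxes above and to the left of `b` in its column and row, so their
numbers bound the coordinates. -/
theorem mem_boxes_card {S : Finset (ℕ × ℕ)} (hS : IsLowerSet (S : Set (ℕ × ℕ))) {b : ℕ × ℕ}
    (hb : b ∈ S) : b ∈ boxes S.card := by
  have h1 : b.1 < S.card := by
    have : (Finset.range (b.1 + 1)).card ≤ S.card := by
      refine Finset.card_le_card_of_injOn (fun i => (i, b.2)) (fun i hi => ?_)
        (fun i _ j _ h => (Prod.ext_iff.mp h).1)
      exact hS (show (i, b.2) ≤ b from ⟨by simpa [Nat.lt_succ_iff] using hi, le_refl _⟩) hb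
    simpa [Nat.succ_le_iff] using this
  have h2 : b.2 < S.card := by
    have : (Finset.range (b.2 + 1)).card ≤ S.card := by
      refine Finset.card_le_card_of_injOn (fun i => (b.1, i)) (fun i hi => ?_)
        (fun i _ j _ h => (Prod.ext_iff.mp h).2)
      exact hS (show (b.1, i) ≤ b from ⟨le_refl _, by simpa [Nat.lt_succ_iff] using hi⟩) hb
    simpa [Nat.succ_le_iff] using this
  simp [boxes, h1, h2]

/-- The box `b` can be added to the diagram `S`. -/
def Addable (S : Finset (ℕ × ℕ)) (b : ℕ × ℕ) : Prop :=
  IsLowerSet (S : Set (ℕ × ℕ)) ∧ b ∉ S ∧ IsLowerSet ((insert b S : Finset (ℕ × ℕ)) : Set (ℕ × ℕ))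

/-- The box `b` can be removed from the diagram `S`. -/
def Removable (S : Finset (ℕ × ℕ)) (b : ℕ × ℕ) : Prop := b ∈ S ∧ Addable (S.erase b) b

theorem Removable.lower {S : Finset (ℕ × ℕ)} {b : ℕ × ℕ} (h : Removable S b) :
    IsLowerSet (S : Set (ℕ × ℕ)) := by
  have := h.2.2.2
  rwa [Finset.insert_erase h.1] at this

theorem Addable.removable {S : Finset (ℕ × ℕ)} {b : ℕ × ℕ} (h : Addable S b) :
    Removable (insert b S) b :=
  ⟨Finset.mem_insert_self _ _, by rwa [Finset.erase_insert h.2.1]⟩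

theorem Addable.snd_eq {S : Finset (ℕ × ℕ)} {b : ℕ × ℕ} (h : Addable S b) :
    b.2 = rl S b.1 := by
  obtain ⟨hS, hb, hi⟩ := h
  have h1 : ¬b.2 < rl S b.1 := by rwa [← mem_iff_lt_rl hS]
  have h2 := (mem_iff_lt_rl hi b).mp (Finset.mem_insert_self _ _)
  rw [rl_insert hb, if_pos rfl] at h2
  omega

theorem Removable.rl_eq {S : Finset (ℕ × ℕ)} {b : ℕ × ℕ} (h : Removable S b) :
    rl S b.1 = b.2 + 1 := by
  have h1 := h.2.snd_eq
  have h2 := rl_insert (Finset.notMem_erase b S) b.1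
  rw [Finset.insert_erase h.1, if_pos rfl] at h2
  omega

/-- `z` lies directly below or to the right of `w`. -/
def Covers (z w : ℕ × ℕ) : Prop := z = (w.1 + 1, w.2) ∨ z = (w.1, w.2 + 1)

/-- If w ≤ z, every box between them lies in the final diagram but, apart from w, only z can be
there, so they are neighbours. If not, z does not rely on w and the order may be reversed. -/
theorem Addable.swap_or_covers {S : Finset (ℕ × ℕ)} {w z : ℕ × ℕ} (hw : Addable S w)
    (hz : Addable (insert w S) z) :
    (Addable S z ∧ Addable (insert z S) w ∧ z.1 ≠ w.1) ∨ Covers z w := by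
  obtain ⟨hS, hwS, hSw⟩ := hw
  obtain ⟨-, hzS, hSz⟩ := hz
  rw [Finset.mem_insert, not_or] at hzS
  by_cases hle : w ≤ z
  · right
    have key : ∀ x : ℕ × ℕ, w ≤ x → x ≠ w → x ≤ z → x = z := by
      intro x h1 h2 h3
      have hx : x ∈ insert z (insert w S) := hSz h3 (Finset.mem_insert_self _ _)
      rw [Finset.mem_insert, Finset.mem_insert] at hx
      rcases hx with hx | hx | hx
      · exact hx
      · exact absurd hx h2
      · exact absurd (hS h1 hx) hwS
    by_cases h1 : w.1 < z.1
    · exact Or.inl (key (w.1 + 1, w.2) ⟨by simp, le_refl _⟩ (fun h => by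
        have := congrArg Prod.fst h; simp at this) ⟨h1, hle.2⟩).symm
    · have h2 : w.2 < z.2 := by
        by_contra h2
        exact hzS.1 (Prod.ext (by have := hle.1; omega) (by have := hle.2; omega))
      exact Or.inr (key (w.1, w.2 + 1) ⟨le_refl _, by simp⟩ (fun h => by
        have := congrArg Prod.snd h; simp at this) ⟨hle.1, h2⟩).symm
  · left
    have hz : Addable S z := by
      refine ⟨hS, hzS.2, fun x y hyx hx => ?_⟩
      rw [Finset.mem_coe, Finset.mem_insert] at hx ⊢
      rcases hx with rfl | hx
      · have hy : y ∈ insert x (insert w S) := hSz hyx (Finset.mem_insert_self _ _)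
        rw [Finset.mem_insert, Finset.mem_insert] at hy
        rcases hy with hy | rfl | hy
        · exact Or.inl hy
        · exact absurd hyx hle
        · exact Or.inr hy
      · exact Or.inr (hS hyx hx)
    have hw : Addable (insert z S) w := by
      refine ⟨hz.2.2, ?_, by rwa [Finset.insert_comm]⟩
      rw [Finset.mem_insert, not_or]
      exact ⟨fun h => hzS.1 h.symm, hwS⟩
    refine ⟨hz, hw, fun h => hzS.1 (Prod.ext h ?_)⟩
    rw [hz.snd_eq, h, (show Addable S w from ⟨hS, hwS, hSw⟩).snd_eq]

/-- The interval between a box and its diagonal successor has four elements, all of which would have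
to be among the three changed boxes. -/
theorem not_diagonal_of_three {S T : Finset (ℕ × ℕ)} (hS : IsLowerSet (S : Set (ℕ × ℕ)))
    (hT : IsLowerSet (T : Set (ℕ × ℕ))) {x y z : ℕ × ℕ} (hTS : T ⊆ insert x (insert y (insert z S)))
    {a b : ℕ × ℕ} (ha : a ∉ S) (hb : b ∈ T) (hab : b = (a.1 + 1, a.2 + 1)) : False := by
  have h1 : ∀ c, a ≤ c → c ≤ b → c ∈ ({x, y, z} : Finset (ℕ × ℕ)) := by
    intro c hac hcb
    have := hTS (hT hcb hb)
    simp only [Finset.mem_insert, Finset.mem_singleton] at this ⊢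
    rcases this with h | h | h | h
    · exact Or.inl h
    · exact Or.inr (Or.inl h)
    · exact Or.inr (Or.inr h)
    · exact absurd (hS hac h) ha
  have h2 : ({a, (a.1 + 1, a.2), (a.1, a.2 + 1), b} : Finset (ℕ × ℕ)) ⊆ {x, y, z} := by
    intro c hc
    simp only [Finset.mem_insert, Finset.mem_singleton] at hc
    rcases hc with rfl | rfl | rfl | rfl
    · exact h1 _ le_rfl (by rw [hab]; exact ⟨by simp, by simp⟩)
    · exact h1 _ ⟨by simp, le_rfl⟩ (by rw [hab]; exact ⟨le_rfl, by simp⟩)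
    · exact h1 _ ⟨le_rfl, by simp⟩ (by rw [hab]; exact ⟨by simp, le_rfl⟩)
    · exact h1 _ (by rw [hab]; exact ⟨by simp, by simp⟩) le_rfl
  have h3 := Finset.card_le_card h2
  have h4 : ({x, y, z} : Finset (ℕ × ℕ)).card ≤ 3 := Finset.card_le_three
  obtain ⟨a1, a2⟩ := a
  rw [hab, Finset.card_insert_of_notMem (by simp), Finset.card_insert_of_notMem (by simp),
    Finset.card_insert_of_notMem (by simp), Finset.card_singleton] at h3
  omega

end Boxes

/-! ### The matrix coefficients of the currents `x^±` -/

section ThetaExchange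

/-- By θ(1/x) = -x⁻¹θ(x), the relation is symmetric under exchange of the two boxes. It therefore
suffices to treat the case that z lies above w. -/
theorem theta_exchange_swap {q : ℂ} (hq : q ≠ 0) (b : ℤ) {y : ℂ} (hy : y ≠ 0) {F G : ℂ⟦X⟧}
    (h : theta (q ^ b * y) * F = cst (q ^ b) * theta (q ^ (-b) * y) * G) :
    theta (q ^ b * y⁻¹) * G = cst (q ^ b) * theta (q ^ (-b) * y⁻¹) * F := by
  have hqb : q ^ b ≠ 0 := zpow_ne_zero _ hq
  have e1 : (q ^ b * y)⁻¹ = q ^ (-b) * y⁻¹ := by rw [mul_inv, zpow_neg]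
  have e2 : (q ^ (-b) * y)⁻¹ = q ^ b * y⁻¹ := by rw [mul_inv, ← zpow_neg, neg_neg]
  have h1 := theta_inv (mul_ne_zero hqb hy)
  have h2 := theta_inv (mul_ne_zero (zpow_ne_zero (-b) hq) hy)
  rw [e1] at h1
  rw [e2] at h2
  rw [h1, h2, ← cst, ← cst, cst_mul, cst_mul]
  have h3 : cst (q ^ b) * cst (q ^ (-b)) = 1 := by
    rw [← cst_mul, ← zpow_add₀ hq, add_neg_cancel, zpow_zero, cst_one]
  linear_combination cst y⁻¹ * h + (cst y⁻¹ * theta (q ^ b * y) * F) * h3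

theorem StepData.exchange_of_theta {N : ℕ} {D : StepData N} {q κ : ℂ} (hq : q ≠ 0) (hκ : κ ≠ 0)
    {ε : ℤ} (h : ∀ S z w, theta (q ^ (ε * cartan N (D.col z) (D.col w)) *
          (κ ^ (-mMat N (D.col z) (D.col w)) * D.pos w / D.pos z)) *
        (D.c S w * D.c (D.st S w) z) =
      cst (q ^ (ε * cartan N (D.col z) (D.col w))) *
        theta (q ^ (-(ε * cartan N (D.col z) (D.col w))) *
          (κ ^ (-mMat N (D.col z) (D.col w)) * D.pos w / D.pos z)) *
        (D.c S z * D.c (D.st S z) w)) : D.Exchange q κ ε := by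
  intro S z w
  have h1 := gVal_exchange hq _ (h S z w)
  set m := mMat N (D.col z) (D.col w)
  set b := ε * cartan N (D.col z) (D.col w)
  have hz := D.pos_ne_zero z
  have hw := D.pos_ne_zero w
  have hm : κ ^ m ≠ 0 := zpow_ne_zero _ hκ
  have e : (κ ^ (-m) * D.pos w / D.pos z)⁻¹ = κ ^ m * D.pos z / D.pos w := by
    rw [zpow_neg]; field_simp
  rw [e] at h1
  have e1 : κ ^ m * D.pos z - q ^ b * D.pos w =
      κ ^ m * D.pos z * (1 - q ^ b * (κ ^ (-m) * D.pos w / D.pos z)) := by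
    rw [zpow_neg]; field_simp
  have e2 : κ ^ m * q ^ b * D.pos z - D.pos w =
      κ ^ m * D.pos z * (q ^ b - κ ^ (-m) * D.pos w / D.pos z) := by
    rw [zpow_neg]; field_simp
  rw [e1, e2, cst_mul, cst_mul (κ ^ m * D.pos z)]
  linear_combination cst (κ ^ m * D.pos z) * h1

end ThetaExchange

/-! ### Coefficients of adding and removing a box, and the quadratic relations -/

namespace FockData

variable {N : ℕ} (P : FockData N)

open Classical in
/-- The matrix coefficient of `x^+` for the addition of a box. -/
def addCoeff (S : Finset (ℕ × ℕ)) (b : ℕ × ℕ) : ℂ⟦X⟧ :=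
  if Addable S b then
    constC P.q 1 * ∏ s ∈ Finset.range b.1, P.psi (P.col b) s (rl S s) (P.pos b)
  else 0

/-- The product of the row factors below the row `r`, for rows up to `L`. -/
def tail (j : ZMod N) (S : Finset (ℕ × ℕ)) (r : ℕ) (V : ℂ) (L : ℕ) : ℂ⟦X⟧ :=
  (∏ s ∈ Finset.Ico (r + 1) L, P.psi j s (rl S s) V) *
    if j = P.col (L, 0) then P.facA L 0 V else 1

open Classical in
/-- The matrix coefficient of `x^-` for the removal of a box. -/
def remCoeff (S : Finset (ℕ × ℕ)) (b : ℕ × ℕ) : ℂ⟦X⟧ :=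
  if Removable S b then
    constC P.q (-1) * P.tail (P.col b) S b.1 (P.pos b) (rows S)
  else 0

/-- The removable factor of an empty row cancels the addable factor of the next row. This is why the
product over the rows below does not depend on where it is cut off. -/
theorem psi_zero_mul (j : ZMod N) (s : ℕ) {r c : ℤ} (h : r ≠ s) (h' : r ≠ s + 1) :
    P.psi j s 0 (P.posZ r c) *
      (if j = P.col (s + 1, 0) then P.facA (s + 1) 0 (P.posZ r c) else 1) =
    if j = P.col (s, 0) then P.facA s 0 (P.posZ r c) else 1 := by
  have hc : P.col (s + 1, 0) = P.col (s, 0) + 1 := by simp only [col]; push_cast; abel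
  simp only [psi, condA_iff, condR_iff, hc]
  have e : P.facR s (0 : ℕ) (P.posZ r c) * P.facA (s + 1) 0 (P.posZ r c) = 1 := by
    rw [facR, facA]
    push_cast
    rw [add_sub_cancel_right]
    have h1 := theta_mul_inv (P.posZ_ne (r := s) (c := 0 - 1) (r' := r) (c' := c) (by omega))
    have h2 := theta_mul_inv (P.posZ_ne (r := s + 1) (c := 0) (r' := r) (c' := c) (by omega))
    have hcq : cst P.q * cst P.q⁻¹ = 1 := by rw [← cst_mul, mul_inv_cancel₀ P.hq, cst_one]
    calc _ = (cst P.q * cst P.q⁻¹) * (theta (P.posZ s (0 - 1) / P.posZ r c) *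
          (theta (P.posZ s (0 - 1) / P.posZ r c))⁻¹) * (theta (P.posZ (s + 1) 0 / P.posZ r c) *
          (theta (P.posZ (s + 1) 0 / P.posZ r c))⁻¹) := by ring_nf
      _ = 1 := by rw [hcq, h1, h2, one_mul, one_mul]
  by_cases h1 : j = P.col (s, 0) + 1
  · have h2 : j ≠ P.col (s, 0) := by rw [h1]; exact add_one_ne P.hN _
    simp only [if_pos h1, if_neg h2, mul_one]
    exact e
  · simp [h1]

theorem tail_succ (j : ZMod N) {S : Finset (ℕ × ℕ)} (hS : IsLowerSet (S : Set (ℕ × ℕ))) {r : ℕ}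
    (c : ℤ) {L : ℕ} (hL : rows S ≤ L) (hr : r < L) :
    P.tail j S r (P.posZ r c) (L + 1) = P.tail j S r (P.posZ r c) L := by
  rw [tail, tail, Finset.prod_Ico_succ_top (by omega), (rl_eq_zero hS).mpr hL, mul_assoc]
  have := P.psi_zero_mul j L (r := r) (c := c) (by omega) (by omega)
  push_cast
  rw [this]

theorem tail_eq (j : ZMod N) {S : Finset (ℕ × ℕ)} (hS : IsLowerSet (S : Set (ℕ × ℕ))) {r : ℕ}
    (c : ℤ) {L : ℕ} (hL : rows S ≤ L) (hr : r < rows S) :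
    P.tail j S r (P.posZ r c) L = P.tail j S r (P.posZ r c) (rows S) := by
  induction L, hL using Nat.le_induction with
  | base => rfl
  | succ L hL ih => rw [P.tail_succ j hS c hL (by omega), ih]

theorem tail_congr (j : ZMod N) {S S' : Finset (ℕ × ℕ)} {r : ℕ} (V : ℂ) (L : ℕ)
    (h : ∀ s, r < s → rl S s = rl S' s) : P.tail j S r V L = P.tail j S' r V L := by
  rw [tail, tail]
  congr 1
  refine Finset.prod_congr rfl fun s hs => ?_
  rw [h s (by simp only [Finset.mem_Ico] at hs; omega)]

/-- A free cut-off makes the coefficients of two diagrams with different numbers of rows comparable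
factor by factor. -/
theorem remCoeff_eq {S : Finset (ℕ × ℕ)} {b : ℕ × ℕ} (h : Removable S b) {L : ℕ}
    (hL : rows S ≤ L) :
    P.remCoeff S b = constC P.q (-1) * P.tail (P.col b) S b.1 (P.pos b) L := by
  rw [remCoeff, if_pos h, pos, P.tail_eq _ h.lower _ hL (fst_lt_rows h.lower h.1)]

/-- One new box changes the factor of a single row. -/
theorem mul_prod_of_mul {ι R : Type*} [CommRing R] [DecidableEq ι] {I : Finset ι} {i : ι}
    (hi : i ∈ I) {f g : ι → R} (hfg : ∀ l ∈ I, l ≠ i → f l = g l) {α β : R}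
    (h : α * f i = β * g i) : α * ∏ l ∈ I, f l = β * ∏ l ∈ I, g l := by
  rw [← Finset.mul_prod_erase I f hi, ← Finset.mul_prod_erase I g hi, ← mul_assoc, h, mul_assoc,
    Finset.prod_congr rfl fun l hl => hfg l (Finset.mem_of_mem_erase hl) (Finset.ne_of_mem_erase hl)]

/-- Adding the box `b` in the row `b.1` changes the product of row factors. -/
theorem prod_psi_insert (j : ZMod N) {S : Finset (ℕ × ℕ)} {b : ℕ × ℕ} (hb : Addable S b) {r c : ℤ}
    (hr : r ≠ b.1) {I : Finset ℕ} (hI : b.1 ∈ I) :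
    theta (P.q ^ cartan N j (P.col b) * (P.κ ^ (-mMat N j (P.col b)) * P.pos b / P.posZ r c)) *
      ∏ s ∈ I, P.psi j s (rl (insert b S) s) (P.posZ r c) =
    cst (P.q ^ cartan N j (P.col b)) * theta (P.q ^ (-cartan N j (P.col b)) *
        (P.κ ^ (-mMat N j (P.col b)) * P.pos b / P.posZ r c)) *
      ∏ s ∈ I, P.psi j s (rl S s) (P.posZ r c) := by
  refine mul_prod_of_mul hI (fun s _ hs => ?_) ?_
  · rw [rl_insert hb.2.1, if_neg hs, add_zero]
  · rw [rl_insert hb.2.1, if_pos rfl, ← hb.snd_eq]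
    exact P.psi_succ j b.1 b.2 hr

theorem tail_insert (j : ZMod N) {S : Finset (ℕ × ℕ)} {b : ℕ × ℕ} (hb : Addable S b) {r : ℕ} (c : ℤ)
    (hr : r < b.1) {L : ℕ} (hL : b.1 < L) :
    theta (P.q ^ cartan N j (P.col b) * (P.κ ^ (-mMat N j (P.col b)) * P.pos b / P.posZ r c)) *
      P.tail j (insert b S) r (P.posZ r c) L =
    cst (P.q ^ cartan N j (P.col b)) * theta (P.q ^ (-cartan N j (P.col b)) *
        (P.κ ^ (-mMat N j (P.col b)) * P.pos b / P.posZ r c)) *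
      P.tail j S r (P.posZ r c) L := by
  rw [tail, tail, ← mul_assoc, ← mul_assoc, P.prod_psi_insert j hb (by omega)
    (Finset.mem_Ico.mpr ⟨hr, hL⟩)]

theorem addable_of_addCoeff {S : Finset (ℕ × ℕ)} {b : ℕ × ℕ} (h : P.addCoeff S b ≠ 0) :
    Addable S b := by
  by_contra h'
  exact h (by rw [addCoeff, if_neg h'])

theorem removable_of_remCoeff {S : Finset (ℕ × ℕ)} {b : ℕ × ℕ} (h : P.remCoeff S b ≠ 0) :
    Removable S b := by
  by_contra h'
  exact h (by rw [remCoeff, if_neg h'])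

/-- The data of `x^+`. -/
def addData : StepData N where
  col := P.col
  pos := P.pos
  st S b := insert b S
  c := P.addCoeff
  pos_ne_zero := P.pos_ne_zero
  st_comm S b b' := Finset.insert_comm _ _ _
  card_st S b := Finset.card_insert_le _ _
  lower S b h := (P.addable_of_addCoeff h).1
  lower_st S b h := (P.addable_of_addCoeff h).2.2
  mem_boxes S b h := by
    have h := P.addable_of_addCoeff h
    rw [← Finset.card_insert_of_notMem h.2.1]
    exact mem_boxes_card h.2.2 (Finset.mem_insert_self _ _)

/-- The data of `x^-`. -/
def remData : StepData N where
  col := P.col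
  pos := P.pos
  st S b := S.erase b
  c := P.remCoeff
  pos_ne_zero := P.pos_ne_zero
  st_comm S b b' := Finset.erase_right_comm
  card_st S b := (Finset.card_erase_le).trans (Nat.le_succ _)
  lower S b h := (P.removable_of_remCoeff h).lower
  lower_st S b h := (P.removable_of_remCoeff h).2.1
  mem_boxes S b h := by
    have h := P.removable_of_remCoeff h
    exact StepData.boxes_mono (Nat.le_succ _) (mem_boxes_card h.lower h.1)

/-- For neighbours, the κ- and q-powers compensate the ratio of the positions exactly, so the theta
in front of the only possible order is θ(1) = 0. -/
theorem covers_theta {z w : ℕ × ℕ} (h : Covers z w) :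
    P.q ^ cartan N (P.col z) (P.col w) *
      (P.κ ^ (-mMat N (P.col z) (P.col w)) * P.pos w / P.pos z) = 1 ∧
    P.q ^ cartan N (P.col w) (P.col z) *
      (P.κ ^ mMat N (P.col w) (P.col z) * P.pos w / P.pos z) = 1 := by
  have e : ∀ m a : ℤ, P.q ^ a * (P.κ ^ m * P.pos w / P.pos z) = 1 ↔
      P.q ^ a * P.κ ^ m * P.pos w = P.pos z := by
    intro m a
    rw [← mul_div_assoc, div_eq_one_iff_eq (P.pos_ne_zero _), mul_assoc]
  rw [e, e, pos, pos, q_pow_mul_posZ, q_pow_mul_posZ]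
  rcases h with h | h
  · have hc : P.col z = P.col w + 1 := by rw [h]; simp only [col]; push_cast; abel
    rw [hc, cartan_succ P.hN, mMat_succ P.hN, cartan_pred P.hN, mMat_pred P.hN, h]
    push_cast
    omega
  · have hc : P.col w = P.col z + 1 := by rw [h, col_succ]
    rw [hc, cartan_succ P.hN, mMat_succ P.hN, cartan_pred P.hN, mMat_pred P.hN, h]
    push_cast
    omega

/-- The exchange relation follows from the case of independent boxes, `z` above `w`. -/
theorem exchange_of_above {D : StepData N} (hcol : D.col = P.col) (hpos : D.pos = P.pos) {ε : ℤ}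
    {valid : Finset (ℕ × ℕ) → ℕ × ℕ → Prop} (hvalid : ∀ S z, ¬valid S z → D.c S z = 0)
    (hcov : ∀ S z w, valid S w → valid (D.st S w) z →
      (valid S z ∧ valid (D.st S z) w ∧ z.1 ≠ w.1) ∨
      (ε = 1 ∧ Covers z w) ∨ (ε = -1 ∧ Covers w z))
    (habove : ∀ S z w, z.1 < w.1 → valid S w → valid (D.st S w) z → valid S z →
      valid (D.st S z) w →
      theta (P.q ^ (ε * cartan N (P.col z) (P.col w)) *
          (P.κ ^ (-mMat N (P.col z) (P.col w)) * P.pos w / P.pos z)) *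
        (D.c S w * D.c (D.st S w) z) =
      cst (P.q ^ (ε * cartan N (P.col z) (P.col w))) *
        theta (P.q ^ (-(ε * cartan N (P.col z) (P.col w))) *
          (P.κ ^ (-mMat N (P.col z) (P.col w)) * P.pos w / P.pos z)) *
        (D.c S z * D.c (D.st S z) w)) : D.Exchange P.q P.κ ε := by
  refine StepData.exchange_of_theta P.hq P.hκ fun S z w => ?_
  rw [hcol, hpos]
  have hinv : ∀ z w : ℕ × ℕ, (P.κ ^ (-mMat N (P.col w) (P.col z)) * P.pos z / P.pos w)⁻¹ =
      P.κ ^ (-mMat N (P.col z) (P.col w)) * P.pos w / P.pos z := by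
    intro z w
    have := zpow_ne_zero (mMat N (P.col w) (P.col z)) P.hκ
    rw [mMat_symm (P.col z) (P.col w), neg_neg, inv_div, zpow_neg]
    field_simp
  have hy : ∀ z w : ℕ × ℕ, P.κ ^ (-mMat N (P.col w) (P.col z)) * P.pos z / P.pos w ≠ 0 :=
    fun z w => div_ne_zero (mul_ne_zero (zpow_ne_zero _ P.hκ) (P.pos_ne_zero _)) (P.pos_ne_zero _)
  have swap := fun h => theta_exchange_swap P.hq (ε * cartan N (P.col z) (P.col w)) (hy z w)
    (F := D.c S z * D.c (D.st S z) w) (G := D.c S w * D.c (D.st S w) z) h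
  rw [hinv] at swap
  have hzero : ∀ z w, ¬(valid S w ∧ valid (D.st S w) z) → D.c S w * D.c (D.st S w) z = 0 := by
    intro z w h
    rw [not_and_or] at h
    rcases h with h | h <;> simp [hvalid _ _ h]
  -- If just one order is possible, the boxes are neighbours and the side of the identity that could
  -- survive has a vanishing prefactor.
  have hvan : ∀ z w, ¬(valid S z ∧ valid (D.st S z) w) → valid S w ∧ valid (D.st S w) z →
      theta (P.q ^ (ε * cartan N (P.col z) (P.col w)) *
          (P.κ ^ (-mMat N (P.col z) (P.col w)) * P.pos w / P.pos z)) = 0 := by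
    intro z w h0 h1
    rcases hcov S z w h1.1 h1.2 with h | h | h
    · exact absurd ⟨h.1, h.2.1⟩ h0
    · rw [h.1, one_mul, (P.covers_theta h.2).1, theta_one]
    · have h2 := (P.covers_theta h.2).2
      have h3 : P.q ^ (-1 * cartan N (P.col z) (P.col w)) *
          (P.κ ^ (-mMat N (P.col z) (P.col w)) * P.pos w / P.pos z) = 1 := by
        rw [← inv_inj, mul_inv, inv_one, ← zpow_neg, neg_mul, one_mul, neg_neg, ← hinv, inv_inv,
          mMat_symm, neg_neg]
        exact h2
      rw [h.1, h3, theta_one]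
  by_cases h1 : valid S w ∧ valid (D.st S w) z
  · by_cases h2 : valid S z ∧ valid (D.st S z) w
    -- If both orders are possible, being neighbours is excluded, since it would have to hold in
    -- both directions.
    · have hr : z.1 ≠ w.1 := by
        rcases hcov S z w h1.1 h1.2 with h | h | h
        · exact h.2.2
        all_goals
          rcases hcov S w z h2.1 h2.2 with h' | h' | h'
          · exact h'.2.2.symm
          all_goals
            rcases h.2 with h3 | h3 <;> rcases h'.2 with h4 | h4 <;>
              simp only [Prod.ext_iff] at h3 h4 <;> omega
      rcases lt_or_gt_of_ne hr with hlt | hlt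
      · exact habove S z w hlt h1.1 h1.2 h2.1 h2.2
      · refine swap ?_
        rw [cartan_symm]
        exact habove S w z hlt h2.1 h2.2 h1.1 h1.2
    · rw [hvan z w h2 h1, hzero w z h2, zero_mul, mul_zero]
  · by_cases h2 : valid S z ∧ valid (D.st S z) w
    · refine swap ?_
      rw [cartan_symm, hvan w z h1 h2, hzero z w h1, zero_mul, mul_zero]
    · rw [hzero _ _ h1, hzero _ _ h2, mul_zero, mul_zero]

/-- The coefficient of x^+ sees only the rows above the added box. -/
theorem addCoeff_insert_of_above {S : Finset (ℕ × ℕ)} {z w : ℕ × ℕ} (h : z.1 < w.1)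
    (hw : w ∉ S) (h1 : Addable S z) (h2 : Addable (insert w S) z) :
    P.addCoeff (insert w S) z = P.addCoeff S z := by
  rw [addCoeff, addCoeff, if_pos h1, if_pos h2]
  congr 1
  refine Finset.prod_congr rfl fun s hs => ?_
  rw [rl_insert hw, if_neg (by simp only [Finset.mem_range] at hs; omega), add_zero]

/-- The change of the coefficient of `x^+` at `w` when a box `z` above is added. -/
theorem addCoeff_insert {S : Finset (ℕ × ℕ)} {z w : ℕ × ℕ} (h : z.1 < w.1)
    (hz : Addable S z) (h1 : Addable S w) (h2 : Addable (insert z S) w) :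
    theta (P.q ^ cartan N (P.col w) (P.col z) *
        (P.κ ^ (-mMat N (P.col w) (P.col z)) * P.pos z / P.pos w)) * P.addCoeff (insert z S) w =
    cst (P.q ^ cartan N (P.col w) (P.col z)) * theta (P.q ^ (-cartan N (P.col w) (P.col z)) *
        (P.κ ^ (-mMat N (P.col w) (P.col z)) * P.pos z / P.pos w)) * P.addCoeff S w := by
  rw [addCoeff, addCoeff, if_pos h1, if_pos h2]
  have := P.prod_psi_insert (P.col w) hz (r := w.1) (c := w.2) (by omega)
    (Finset.mem_range.mpr h)
  rw [← pos] at this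
  linear_combination constC P.q 1 * this

/-- For z above w, the coefficient of z ignores w, while that of w is changed by z through one row
factor. This ratio of thetas is the exchange identity. -/
theorem exchange_add : P.addData.Exchange P.q P.κ 1 := by
  refine P.exchange_of_above (D := P.addData) rfl rfl (valid := Addable)
    (fun S z h => if_neg h)
    (fun S z w h1 h2 => (h1.swap_or_covers h2).imp id fun h => Or.inl ⟨rfl, h⟩) ?_
  intro S z w hlt a1 a2 a3 a4
  change Addable (insert w S) z at a2
  change Addable (insert z S) w at a4
  change _ * (P.addCoeff S w * P.addCoeff (insert w S) z) =
    _ * (P.addCoeff S z * P.addCoeff (insert z S) w)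
  rw [P.addCoeff_insert_of_above hlt a1.2.1 a3 a2]
  have h := P.addCoeff_insert hlt a3 a1 a4
  have hy : P.κ ^ (-mMat N (P.col w) (P.col z)) * P.pos z / P.pos w ≠ 0 :=
    div_ne_zero (mul_ne_zero (zpow_ne_zero _ P.hκ) (P.pos_ne_zero _)) (P.pos_ne_zero _)
  have h' := theta_exchange_swap P.hq _ hy h
  have hinv : (P.κ ^ (-mMat N (P.col w) (P.col z)) * P.pos z / P.pos w)⁻¹ =
      P.κ ^ (-mMat N (P.col z) (P.col w)) * P.pos w / P.pos z := by
    have := zpow_ne_zero (mMat N (P.col w) (P.col z)) P.hκ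
    rw [mMat_symm (P.col z) (P.col w), neg_neg, inv_div, zpow_neg]
    field_simp
  rw [hinv, cartan_symm] at h'
  rw [one_mul]
  linear_combination P.addCoeff S z * h'

/-- Read backwards, removing w and then z means adding z and then w to the diagram without both. -/
theorem _root_.EllTor.Removable.swap_or_covers {S : Finset (ℕ × ℕ)} {w z : ℕ × ℕ}
    (hw : Removable S w) (hz : Removable (S.erase w) z) :
    (Removable S z ∧ Removable (S.erase z) w ∧ z.1 ≠ w.1) ∨ Covers w z := by
  obtain ⟨hw1, hw2⟩ := hw
  obtain ⟨hz1, hz2⟩ := hz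
  have hne : z ≠ w := Finset.ne_of_mem_erase hz1
  have hw2' : Addable (insert z ((S.erase w).erase z)) w := by rwa [Finset.insert_erase hz1]
  rcases hz2.swap_or_covers hw2' with h | h
  · have e : insert w ((S.erase w).erase z) = S.erase z := by
      rw [Finset.erase_right_comm, Finset.insert_erase (Finset.mem_erase.mpr ⟨hne.symm, hw1⟩)]
    rw [e] at h
    left
    refine ⟨⟨Finset.mem_of_mem_erase hz1, h.2.1⟩, ⟨Finset.mem_erase.mpr ⟨hne.symm, hw1⟩, ?_⟩,
      h.2.2.symm⟩
    rw [Finset.erase_right_comm]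
    exact h.1
  · exact Or.inr h

/-- The change of the coefficient of `x^-` at `z` when a box `w` below is removed. -/
theorem remCoeff_erase {S : Finset (ℕ × ℕ)} {z w : ℕ × ℕ} (h : z.1 < w.1)
    (hw : Removable S w) (h1 : Removable S z) (h2 : Removable (S.erase w) z) :
    theta (P.q ^ cartan N (P.col z) (P.col w) *
        (P.κ ^ (-mMat N (P.col z) (P.col w)) * P.pos w / P.pos z)) * P.remCoeff S z =
    cst (P.q ^ cartan N (P.col z) (P.col w)) * theta (P.q ^ (-cartan N (P.col z) (P.col w)) *
        (P.κ ^ (-mMat N (P.col z) (P.col w)) * P.pos w / P.pos z)) * P.remCoeff (S.erase w) z := by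
  have hrows : rows (S.erase w) ≤ rows S :=
    Finset.card_le_card (Finset.filter_subset_filter _ (Finset.erase_subset _ _))
  rw [P.remCoeff_eq h1 le_rfl, P.remCoeff_eq h2 hrows]
  have := P.tail_insert (P.col z) hw.2 z.2 h (fst_lt_rows hw.lower hw.1)
  rw [Finset.insert_erase hw.1, ← pos] at this
  linear_combination constC P.q (-1) * this

theorem remCoeff_erase_of_below {S : Finset (ℕ × ℕ)} {z w : ℕ × ℕ} (h : z.1 < w.1)
    (hz : Removable S z) (h1 : Removable S w) (h2 : Removable (S.erase z) w) :
    P.remCoeff (S.erase z) w = P.remCoeff S w := by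
  have hrows : rows (S.erase z) ≤ rows S :=
    Finset.card_le_card (Finset.filter_subset_filter _ (Finset.erase_subset _ _))
  rw [P.remCoeff_eq h1 le_rfl, P.remCoeff_eq h2 hrows, P.tail_congr]
  intro s hs
  conv_rhs => rw [← Finset.insert_erase hz.1, rl_insert (Finset.notMem_erase _ _),
    if_neg (by omega), add_zero]

/-- For z above w, now the coefficient of w ignores z and that of z is changed by w. The ratio is
the inverse of the one for x^+, hence the sign -1. -/
theorem exchange_rem : P.remData.Exchange P.q P.κ (-1) := by
  refine P.exchange_of_above (D := P.remData) rfl rfl (valid := Removable)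
    (fun S z h => if_neg h)
    (fun S z w h1 h2 => (h1.swap_or_covers h2).imp id fun h => Or.inr ⟨rfl, h⟩) ?_
  intro S z w hlt a1 a2 a3 a4
  change Removable (S.erase w) z at a2
  change Removable (S.erase z) w at a4
  change _ * (P.remCoeff S w * P.remCoeff (S.erase w) z) =
    _ * (P.remCoeff S z * P.remCoeff (S.erase z) w)
  rw [P.remCoeff_erase_of_below hlt a3 a1 a4]
  have h := P.remCoeff_erase hlt a1 a3 a2
  have hc : cst (P.q ^ (-cartan N (P.col z) (P.col w))) *
      cst (P.q ^ cartan N (P.col z) (P.col w)) = 1 := by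
    rw [← cst_mul, ← zpow_add₀ P.hq, neg_add_cancel, zpow_zero, cst_one]
  rw [neg_one_mul, neg_neg]
  linear_combination -(cst (P.q ^ (-cartan N (P.col z) (P.col w))) * P.remCoeff S w) * h -
    (theta (P.q ^ (-cartan N (P.col z) (P.col w)) *
      (P.κ ^ (-mMat N (P.col z) (P.col w)) * P.pos w / P.pos z)) * P.remCoeff S w *
        P.remCoeff (S.erase w) z) * hc

/-- Positions with ratio q² occur only for a box and its diagonal successor, so
`not_diagonal_of_three` excludes them among three successive boxes. -/
theorem pos_eq_q_sq_mul {a b : ℕ × ℕ} (h : P.pos a = P.q ^ 2 * P.pos b) :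
    b = (a.1 + 1, a.2 + 1) := by
  have h2 := (P.q_pow_mul_posZ 2 0 b.1 b.2 a.1 a.2).mp (by
    rw [zpow_zero, mul_one, zpow_ofNat]; exact h.symm)
  exact Prod.ext (by simp only; omega) (by simp only; omega)

theorem separated_add : P.addData.Separated P.q := by
  intro S x y z h a ha b hb hab
  have h1 : Addable S x := P.addable_of_addCoeff (left_ne_zero_of_mul (left_ne_zero_of_mul h))
  have h2 : Addable (insert x S) y :=
    P.addable_of_addCoeff (right_ne_zero_of_mul (left_ne_zero_of_mul h))
  have h3 : Addable (insert y (insert x S)) z :=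
    P.addable_of_addCoeff (right_ne_zero_of_mul h)
  have e1 := h1.2.1
  have e2 := h2.2.1
  have e3 := h3.2.1
  simp only [Finset.mem_insert, not_or] at e2 e3
  refine not_diagonal_of_three (x := z) (y := y) (z := x) h1.1 h3.2.2 subset_rfl
    (a := a) ?_ (b := b) ?_ (P.pos_eq_q_sq_mul hab)
  · rcases ha with rfl | rfl | rfl
    exacts [e1, e2.2, e3.2.2]
  · simp only [Finset.mem_insert]
    rcases hb with rfl | rfl | rfl <;> simp

theorem separated_rem : P.remData.Separated P.q := by
  intro S x y z h a ha b hb hab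
  have h1 : Removable S x := P.removable_of_remCoeff (left_ne_zero_of_mul (left_ne_zero_of_mul h))
  have h2 : Removable (S.erase x) y :=
    P.removable_of_remCoeff (right_ne_zero_of_mul (left_ne_zero_of_mul h))
  have h3 : Removable ((S.erase x).erase y) z :=
    P.removable_of_remCoeff (right_ne_zero_of_mul h)
  have e3 := h3.1
  have e2 := h2.1
  simp only [Finset.mem_erase] at e2 e3
  refine not_diagonal_of_three (x := x) (y := y) (z := z) h3.2.1 h1.lower
    (S := ((S.erase x).erase y).erase z) (fun c hc => ?_)
    (a := a) ?_ (b := b) ?_ (P.pos_eq_q_sq_mul hab)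
  · simp only [Finset.mem_insert, Finset.mem_erase]
    tauto
  · rcases ha with rfl | rfl | rfl <;> simp
  · rcases hb with rfl | rfl | rfl
    exacts [h1.1, e2.2, e3.2.2]

end FockData

/-! ### The action on the basis vectors -/

theorem theta_inv_mul_inv {x y : ℂ} (hx : x ≠ 0) (hy : y ≠ 0) :
    theta x⁻¹ * (theta y⁻¹)⁻¹ = cst (y / x) * theta x * (theta y)⁻¹ := by
  rw [theta_inv hx, theta_inv hy, ← cst, ← cst, inv_mul', div_eq_mul_inv, cst_mul]
  have h : (-cst y⁻¹)⁻¹ = -cst y := by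
    rw [PowerSeries.inv_eq_iff_mul_eq_one (by simp [cst, hy]), neg_mul_neg, ← cst_mul,
      mul_inv_cancel₀ hy, cst_one]
  rw [h]
  ring

namespace FockData

variable {N : ℕ} (P : FockData N)

theorem rowU_eq (lam : YoungDiagram) (s : ℕ) : rowU P.q P.κ P.u lam s = P.posZ s (lam.rowLen s) := by
  rw [rowU, posZ, zpow_natCast, zpow_natCast]

/-- Reflecting both thetas turns V/pos into pos/V and costs the ratio of the arguments, which is q²
and changes the prefactor q⁻¹ into q. -/
theorem facR_eq (r c : ℤ) {V : ℂ} (hV : V ≠ 0) :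
    P.facR r c V = cst P.q⁻¹ * theta ((q3 P.q P.κ)⁻¹ * (V / P.posZ r c)) *
      (theta (q1 P.q P.κ * (V / P.posZ r c)))⁻¹ := by
  have hp := P.posZ_ne_zero r c
  have h1 := P.q1_ne_zero
  have h3 := P.q3_ne_zero
  have e1 : (q3 P.q P.κ)⁻¹ * (V / P.posZ r c) = (P.posZ (r + 1) c / V)⁻¹ := by
    rw [posZ_succ_row]; field_simp
  have e2 : q1 P.q P.κ * (V / P.posZ r c) = (P.posZ r (c - 1) / V)⁻¹ := by
    rw [posZ_pred_col]; field_simp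
  rw [e1, e2, mul_assoc, theta_inv_mul_inv (div_ne_zero (P.posZ_ne_zero _ _) hV)
    (div_ne_zero (P.posZ_ne_zero _ _) hV), facR, ← mul_assoc, ← mul_assoc, ← cst_mul]
  congr 3
  have hq := P.hq
  have hκ := P.hκ
  rw [posZ_succ_row, posZ_pred_col, q1, q3]
  field_simp

theorem facA_eq (r c : ℤ) {V : ℂ} (hV : V ≠ 0) :
    P.facA r c V = cst P.q * theta (q1 P.q P.κ * q3 P.q P.κ * (V / P.posZ r c)) *
      (theta (V / P.posZ r c))⁻¹ := by
  have hp := P.posZ_ne_zero r c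
  have h1 := P.q1_ne_zero
  have h3 := P.q3_ne_zero
  have e1 : q1 P.q P.κ * q3 P.q P.κ * (V / P.posZ r c) = (P.posZ (r - 1) (c - 1) / V)⁻¹ := by
    rw [posZ_pred_row, posZ_pred_col]; field_simp
  have e2 : V / P.posZ r c = (P.posZ r c / V)⁻¹ := by
    rw [inv_div]
  rw [e1, e2, mul_assoc, theta_inv_mul_inv (div_ne_zero (P.posZ_ne_zero _ _) hV)
    (div_ne_zero (P.posZ_ne_zero _ _) hV), facA, ← mul_assoc, ← mul_assoc, ← cst_mul]
  congr 3
  have hq := P.hq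
  have hκ := P.hκ
  rw [posZ_pred_row, posZ_pred_col, q1, q3]
  field_simp

theorem coeffAPlus_eq (j : ZMod N) (lam : YoungDiagram) (i : ℕ) :
    coeffAPlus P.q P.κ P.u P.k j lam i =
      ∏ s ∈ Finset.range i, P.psi j s (lam.rowLen s) (P.posZ i (lam.rowLen i)) := by
  classical
  rw [coeffAPlus, Finset.prod_filter, Finset.prod_filter, ← Finset.prod_mul_distrib]
  refine Finset.prod_congr rfl fun s _ => ?_
  rw [psi, rowU_eq, rowU_eq, P.facR_eq _ _ (P.posZ_ne_zero _ _), P.facA_eq _ _ (P.posZ_ne_zero _ _)]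
  simp only [condR, condA]
  congr

/-- The formula is written relative to u_i, whereas the removed box has position q₁⁻¹u_i; shifting
every argument by q₁ identifies the factors. -/
theorem coeffAMinus_eq (j : ZMod N) (lam : YoungDiagram) {i : ℕ} (hi : i < lam.colLen 0) :
    coeffAMinus P.q P.κ P.u P.k j lam i =
      P.tail j lam.cells i (P.posZ i (lam.rowLen i - 1)) (lam.colLen 0) := by
  classical
  have e : ∀ r c, P.posZ r c / P.posZ i (lam.rowLen i) * q1 P.q P.κ =
      P.posZ r c / P.posZ i (lam.rowLen i - 1) := by
    intro r c
    have h1 := P.q1_ne_zero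
    rw [posZ_pred_col]
    field_simp
  have e1 : ∀ r c, q1 P.q P.κ * q3 P.q P.κ * (P.posZ r c / P.posZ i (lam.rowLen i)) =
      P.posZ (r + 1) c / P.posZ i (lam.rowLen i - 1) := by
    intro r c
    rw [← e, posZ_succ_row]; ring
  have e2 : ∀ r c, P.posZ r c / P.posZ i (lam.rowLen i) =
      P.posZ r (c - 1) / P.posZ i (lam.rowLen i - 1) := by
    intro r c
    have h1 := P.q1_ne_zero
    rw [← e, posZ_pred_col]; field_simp
  have e3 : ∀ r c, (q3 P.q P.κ)⁻¹ * (P.posZ r c / P.posZ i (lam.rowLen i)) =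
      P.posZ (r - 1) (c - 1) / P.posZ i (lam.rowLen i - 1) := by
    intro r c
    have h1 := P.q1_ne_zero
    rw [← e, posZ_pred_row, posZ_pred_col]; field_simp
  have e4 : ∀ r c, q1 P.q P.κ * (P.posZ r c / P.posZ i (lam.rowLen i)) =
      P.posZ r c / P.posZ i (lam.rowLen i - 1) := by
    intro r c
    rw [← e]; ring
  have hL : lam.rowLen (lam.colLen 0) = 0 := by
    rw [← rl_cells, rl_eq_zero lam.isLowerSet, rows_cells]
  -- The second product has one more row than the first, the first empty row. It is split off and
  -- becomes the boundary factor of `tail`.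
  rw [coeffAMinus, Finset.prod_filter, Finset.prod_filter, Finset.prod_Ico_succ_top (by omega),
    ← mul_assoc, ← Finset.prod_mul_distrib, tail]
  congr 1
  · refine Finset.prod_congr rfl fun s _ => ?_
    rw [psi, rl_cells, rowU_eq, rowU_eq, e1, e3, e4, e2, facR, facA]
    simp only [condR, condA]
    congr
  · have hiff : condA P.k j lam (lam.colLen 0) ↔ j = P.col (lam.colLen 0, 0) := by
      rw [condA, condA_iff, hL]
    rw [rowU_eq, rowU_eq, e3, e4, hL]
    by_cases h : j = P.col (lam.colLen 0, 0)
    · rw [if_pos h, if_pos (hiff.mpr h), facA]; rfl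
    · rw [if_neg h, if_neg (mt hiff.mp h)]

variable [NeZero N]

theorem ketAdd_eq (lam : YoungDiagram) (i : ℕ) :
    ketAdd N lam i = ketS (MerField N)⟦X⟧ (insert (i, lam.rowLen i) lam.cells) := by
  classical
  unfold ketAdd ketS
  simp only [Finset.coe_insert]
  rfl

/-- Each row offers at most one box where the summand is nonzero, so a sum over boxes is a sum over
rows. -/
theorem sum_boxes_eq_sum_rows {M : Type*} [AddCommMonoid M] {n m : ℕ}
    (f : ℕ × ℕ → M) (g : ℕ → ℕ) (p : ℕ → Prop) [DecidablePred p]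
    (hg : ∀ i, i < n → p i → (i, g i) ∈ boxes m)
    (hf : ∀ b, f b ≠ 0 → b.1 < n ∧ p b.1 ∧ b.2 = g b.1) :
    ∑ b ∈ boxes m, f b = ∑ i ∈ (Finset.range n).filter p, f (i, g i) := by
  classical
  have hinj : Set.InjOn (fun i => (i, g i)) ((Finset.range n).filter p : Finset ℕ) :=
    fun i _ i' _ h => (Prod.ext_iff.mp h).1
  rw [← Finset.sum_image (f := f) hinj]
  refine (Finset.sum_subset (fun b hb => ?_) fun b _ hb => ?_).symm
  · rw [Finset.mem_image] at hb
    obtain ⟨i, hi, rfl⟩ := hb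
    rw [Finset.mem_filter, Finset.mem_range] at hi
    exact hg i hi.1 hi.2
  · by_contra h
    obtain ⟨h1, h2, h3⟩ := hf b h
    refine hb (Finset.mem_image.mpr ⟨b.1, by simp [h1, h2], ?_⟩)
    rw [← h3]

theorem rl_le_card (S : Finset (ℕ × ℕ)) (s : ℕ) : rl S s ≤ S.card :=
  Finset.card_le_card (Finset.filter_subset _ _)

theorem rows_le_card (S : Finset (ℕ × ℕ)) : rows S ≤ S.card :=
  Finset.card_le_card (Finset.filter_subset _ _)

open Classical in
theorem op_add_ket (σ : (MerField N)⟦X⟧ →ₐ[ℂ⟦X⟧] (MerField N)⟦X⟧) (j : ZMod N) (n : ℤ)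
    (lam : YoungDiagram) :
    P.addData.op σ j n (ket N lam) =
      ∑ i ∈ (Finset.range (lam.colLen 0 + 1)).filter (condA P.k j lam),
        (constC P.q 1 * cst (rowU P.q P.κ P.u lam i ^ n) *
          coeffAPlus P.q P.κ P.u P.k j lam i) • ketAdd N lam i := by
  have h := P.addData.op_ketS σ j n lam.cells (Nat.lt_succ_self _)
  rw [ketS_cells] at h
  rw [ket, h, sum_boxes_eq_sum_rows (n := lam.colLen 0 + 1) _ lam.rowLen (condA P.k j lam)]
  · refine Finset.sum_congr rfl fun i hi => ?_
    rw [Finset.mem_filter] at hi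
    have hc : P.col (i, lam.rowLen i) = j := ((P.condA_iff _ _ _).mp hi.2).symm
    rw [StepData.wt, if_pos (show P.addData.col (i, lam.rowLen i) = j from hc), ketAdd_eq]
    change (cst (P.pos (i, lam.rowLen i) ^ n) * P.addCoeff lam.cells (i, lam.rowLen i)) •
      ketS _ (insert (i, lam.rowLen i) lam.cells) = _
    by_cases hl : IsLowerSet ((insert (i, lam.rowLen i) lam.cells : Finset (ℕ × ℕ)) : Set (ℕ × ℕ))
    · have ha : Addable lam.cells (i, lam.rowLen i) :=
        ⟨lam.isLowerSet, by rw [mem_iff_lt_rl lam.isLowerSet, rl_cells]; simp, hl⟩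
      rw [addCoeff, if_pos ha, coeffAPlus_eq, rowU_eq, hc]
      simp only [rl_cells]
      congr 1
      rw [pos]
      ring
    · rw [ketS_of_not hl, smul_zero, smul_zero]
  · intro i hi _
    have h1 := rows_le_card lam.cells
    have h2 := rl_le_card lam.cells i
    rw [rows_cells] at h1
    rw [rl_cells] at h2
    simp only [boxes, Finset.mem_product, Finset.mem_range]
    omega
  · intro b hb
    have h1 : P.addData.wt j n lam.cells b ≠ 0 := fun h0 => hb (by rw [h0, zero_smul])
    have hcol : P.col b = j := by
      by_contra h0
      exact h1 (by rw [StepData.wt, if_neg (show ¬P.addData.col b = j from h0)])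
    have ha : Addable lam.cells b :=
      P.addable_of_addCoeff fun h0 => h1 (P.addData.wt_eq_zero h0)
    have hsnd := ha.snd_eq
    rw [rl_cells] at hsnd
    refine ⟨?_, ?_, hsnd⟩
    · rw [← rows_cells]
      -- A box below the first empty row cannot be added: the box directly above it would be
      -- missing.
      by_contra! hlt
      have hm : (b.1 - 1, b.2) ∈ insert b lam.cells :=
        ha.2.2 (show (b.1 - 1, b.2) ≤ b from ⟨Nat.sub_le _ _, le_rfl⟩)
          (Finset.mem_insert_self _ _)
      rw [Finset.mem_insert] at hm
      rcases hm with hm | hm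
      · have := congrArg Prod.fst hm
        simp only at this
        omega
      · have := fst_lt_rows lam.isLowerSet hm
        simp only at this
        omega
    · rw [condA, condA_iff, ← hsnd]
      exact hcol.symm

open Classical in
theorem op_rem_ket (σ : (MerField N)⟦X⟧ →ₐ[ℂ⟦X⟧] (MerField N)⟦X⟧) (j : ZMod N) (n : ℤ)
    (lam : YoungDiagram) :
    P.remData.op σ j n (ket N lam) =
      ∑ i ∈ (Finset.range (lam.colLen 0)).filter (condR P.k j lam),
        (constC P.q (-1) * cst (((q1 P.q P.κ)⁻¹ * rowU P.q P.κ P.u lam i) ^ n) *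
          coeffAMinus P.q P.κ P.u P.k j lam i) • ketSub N lam i := by
  have h := P.remData.op_ketS σ j n lam.cells (Nat.lt_succ_self _)
  rw [ketS_cells] at h
  have hpos : ∀ i, i < lam.colLen 0 → 0 < lam.rowLen i := by
    intro i hi
    rw [← rl_cells, Nat.pos_iff_ne_zero, Ne, rl_eq_zero lam.isLowerSet, rows_cells]
    omega
  rw [ket, h, sum_boxes_eq_sum_rows (n := lam.colLen 0) _ (fun i => lam.rowLen i - 1)
    (condR P.k j lam)]
  · refine Finset.sum_congr rfl fun i hi => ?_
    rw [Finset.mem_filter, Finset.mem_range] at hi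
    have hp := hpos i hi.1
    obtain ⟨a, ha⟩ : ∃ a, lam.rowLen i = a + 1 := ⟨lam.rowLen i - 1, by omega⟩
    have hc : P.col (i, a) = j := by
      have := hi.2
      rw [condR, ha, condR_succ_iff] at this
      exact this.symm
    have hmem : (i, a) ∈ lam.cells := by
      rw [mem_iff_lt_rl lam.isLowerSet, rl_cells, ha]; simp
    simp only [ha, Nat.add_sub_cancel]
    rw [StepData.wt, if_pos (show P.remData.col (i, a) = j from hc)]
    change (cst (P.pos (i, a) ^ n) * P.remCoeff lam.cells (i, a)) •
      ketS _ (lam.cells.erase (i, a)) = _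
    by_cases hl : IsLowerSet ((lam.cells.erase (i, a) : Finset (ℕ × ℕ)) : Set (ℕ × ℕ))
    · have hr : Removable lam.cells (i, a) :=
        ⟨hmem, hl, Finset.notMem_erase _ _, by rw [Finset.insert_erase hmem]; exact lam.isLowerSet⟩
      have hk : ketSub N lam i = ketS (MerField N)⟦X⟧ (lam.cells.erase (i, a)) := by
        have hl' : 0 < lam.rowLen i ∧
            IsLowerSet (lam.cells \ {(i, lam.rowLen i - 1)} : Set (ℕ × ℕ)) := by
          refine ⟨hp, ?_⟩
          rw [ha, Nat.add_sub_cancel]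
          rwa [Finset.coe_erase] at hl
        unfold ketSub ketS
        rw [dif_pos hl', dif_pos hl, ket]
        congr
        rw [ha, Nat.add_sub_cancel]
      rw [hk, P.remCoeff_eq hr (L := lam.colLen 0) (by rw [rows_cells]), P.coeffAMinus_eq j lam hi.1,
        rowU_eq, ← posZ_pred_col, ha, hc]
      congr 1
      rw [pos]
      push_cast
      rw [add_sub_cancel_right]
      ring
    · have hk : ketSub N lam i = 0 := by
        unfold ketSub
        rw [dif_neg]
        rintro ⟨-, h2⟩
        rw [ha, Nat.add_sub_cancel] at h2
        rw [Finset.coe_erase] at hl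
        exact hl h2
      rw [ketS_of_not hl, hk, smul_zero, smul_zero]
  · intro i hi _
    have h1 := rows_le_card lam.cells
    have h2 := rl_le_card lam.cells i
    rw [rows_cells] at h1
    rw [rl_cells] at h2
    simp only [boxes, Finset.mem_product, Finset.mem_range]
    omega
  · intro b hb
    have h1 : P.remData.wt j n lam.cells b ≠ 0 := fun h0 => hb (by rw [h0, zero_smul])
    have hcol : P.col b = j := by
      by_contra h0
      exact h1 (by rw [StepData.wt, if_neg (show ¬P.remData.col b = j from h0)])
    have ha : Removable lam.cells b :=
      P.removable_of_remCoeff fun h0 => h1 (P.remData.wt_eq_zero h0)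
    have hrl := ha.rl_eq
    rw [rl_cells] at hrl
    refine ⟨?_, ?_, by omega⟩
    · rw [← rows_cells]
      exact fst_lt_rows lam.isLowerSet ha.1
    · rw [condR, hrl, condR_succ_iff]
      exact hcol.symm

end FockData

/-! ### The eigenvalues of `α^∨`, `K^±` and `φ^±` -/

section ThetaQuot

/-- The logarithm of a quotient of infinite products has the power sums of its parameters as
coefficients. This is where the eigenvalues of α^∨ come from. -/
theorem qQuot_eq {ι : Type*} (I : Finset ι) (a b : ι → ℂ) :
    qQuot I a b = formalExp (posSeries fun m =>
      cst ((∑ i ∈ I, (b i ^ m - a i ^ m)) / m) * (1 - nome ^ m)⁻¹) := by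
  have h : (posSeries fun m => cst ((∑ i ∈ I, (b i ^ m - a i ^ m)) / m) * (1 - nome ^ m)⁻¹) =
      ∑ i ∈ I, (PowerSeries.rescale (cst (a i)) logQ + -PowerSeries.rescale (cst (b i)) logQ) := by
    ext1 m
    simp only [logQ, rescale_posSeries, map_sum, map_add, map_neg]
    simp only [posSeries, PowerSeries.coeff_mk]
    by_cases hm : m = 0
    · simp [hm]
    · simp only [if_neg hm]
      rw [Finset.sum_div, cst_sum, Finset.sum_mul]
      refine Finset.sum_congr rfl fun i _ => ?_
      rw [sub_div, cst_sub, div_eq_mul_one_div, cst_mul, div_eq_mul_one_div (a i ^ m), cst_mul,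
        cst_pow, cst_pow]
      ring
  rw [h, formalExp_sum _ _ fun i _ => by
    rw [map_add, map_neg, constantCoeff_rescale_logQ, constantCoeff_rescale_logQ, neg_zero, add_zero]]
  refine Finset.prod_congr rfl fun i _ => ?_
  rw [formalExp_add (constantCoeff_rescale_logQ _)
    (by rw [map_neg, constantCoeff_rescale_logQ, neg_zero])]
  rfl

theorem theta_inv_eq_C_mul {L : Type*} [Field L] {x c : L} (hx : x ≠ 0) (hc : c = -1) :
    theta x⁻¹ = PowerSeries.C (c * x⁻¹) * theta x := by
  rw [theta_inv hx, hc, neg_one_mul, map_neg]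

theorem theta_laurent_symm {a : ℂ} (ha : a ≠ 0) :
    theta (laurentC a * HahnSeries.single (-1 : ℤ) (1 : ℂ)) =
      PowerSeries.C (laurentC (-a) * HahnSeries.single (-1 : ℤ) (1 : ℂ)) *
        theta (laurentC a⁻¹ * HahnSeries.single (1 : ℤ) (1 : ℂ)) := by
  have hs : (HahnSeries.single (-1 : ℤ) (1 : ℂ))⁻¹ = HahnSeries.single (1 : ℤ) (1 : ℂ) := by
    rw [HahnSeries.inv_single]; simp
  have hne : laurentC a⁻¹ * HahnSeries.single (1 : ℤ) (1 : ℂ) ≠ 0 :=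
    mul_ne_zero (by rw [map_inv₀]; exact inv_ne_zero ((map_ne_zero laurentC).mpr ha)) (by simp)
  have e : laurentC a * HahnSeries.single (-1 : ℤ) (1 : ℂ) =
      (laurentC a⁻¹ * HahnSeries.single (1 : ℤ) (1 : ℂ))⁻¹ := by
    rw [mul_inv, map_inv₀, inv_inv, ← hs, inv_inv]
  have hc : laurentC (-1) = -1 := (map_neg laurentC 1).trans (congrArg _ (map_one laurentC))
  rw [e, theta_inv_eq_C_mul hne hc, ← e, ← mul_assoc, ← map_mul, neg_one_mul]

/-- Reflection of every theta turns the expansion in T⁻¹ into one in T with inverted parameters, at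
the cost of a constant. That constant is the quotient of the eigenvalues of K^- and K^+. -/
theorem thetaQuot_symm {ι : Type*} (I : Finset ι) {a b : ι → ℂ} (ha : ∀ i, a i ≠ 0)
    (hb : ∀ i, b i ≠ 0) :
    thetaQuot I a b (HahnSeries.single (-1 : ℤ) (1 : ℂ)) =
      PowerSeries.C (laurentC (∏ i ∈ I, a i / b i)) *
        thetaQuot I (fun i => (a i)⁻¹) (fun i => (b i)⁻¹) (HahnSeries.single (1 : ℤ) (1 : ℂ)) := by
  rw [thetaQuot, thetaQuot, map_prod, map_prod, ← Finset.prod_mul_distrib]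
  refine Finset.prod_congr rfl fun i _ => ?_
  have hs : (HahnSeries.single (-1 : ℤ) (1 : ℂ) : LaurentSeries ℂ) ≠ 0 := by simp
  have hb' : laurentC (-b i) ≠ 0 := (map_ne_zero laurentC).mpr (neg_ne_zero.mpr (hb i))
  rw [theta_laurent_symm (ha i), theta_laurent_symm (hb i), inv_mul']
  set x := laurentC (-a i) * HahnSeries.single (-1 : ℤ) (1 : ℂ) with hx
  set y := laurentC (-b i) * HahnSeries.single (-1 : ℤ) (1 : ℂ) with hy
  have hy0 : y ≠ 0 := mul_ne_zero hb' hs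
  have h : (PowerSeries.C y)⁻¹ = PowerSeries.C y⁻¹ := by
    rw [PowerSeries.inv_eq_iff_mul_eq_one (by simpa using hy0), ← map_mul,
      inv_mul_cancel₀ hy0, map_one]
  have e : laurentC (a i / b i) = x * y⁻¹ := by
    rw [← neg_div_neg_eq (a i), map_div₀, ← div_eq_mul_inv, hx, hy, mul_div_mul_right _ _ hs]
  rw [h, mul_mul_mul_comm, e, ← map_mul]

/-- The truncation needed for `φ^+`. -/
theorem nome_pow_dvd_expandPlus {ι : Type*} (I : Finset ι) (a b : ι → ℂ) {q : ℂ}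
    (hq : q - q⁻¹ ≠ 0) (K : ℂ) {e : ℤ → ℂ}
    (he : ∀ l, e l = (∑ i ∈ I, (b i ^ l - a i ^ l)) / (l * (q - q⁻¹))) (n : ℤ) (M : ℕ) :
    nome ^ M ∣ coeffT n (PowerSeries.C (laurentC K) *
        thetaQuot I a b (HahnSeries.single (1 : ℤ) (1 : ℂ))) -
      cst K * ∑ r ∈ Finset.range M,
      PowerSeries.coeff r (formalExp (posSeries fun m =>
        -(cst (q - q⁻¹) * nome ^ m * (1 - nome ^ m)⁻¹) * cst (e (-m)))) *
      coeffZ (r + n) (formalExp (posSeries fun m =>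
        cst (q - q⁻¹) * (1 - nome ^ m)⁻¹ * cst (e m))) := by
  have h1 : (fun m : ℕ => cst (q - q⁻¹) * (1 - nome ^ m)⁻¹ * cst (e m)) = fun m : ℕ =>
      cst ((∑ i ∈ I, (b i ^ m - a i ^ m)) / m) * (1 - nome ^ m)⁻¹ := by
    funext m
    rw [he, mul_right_comm, ← cst_mul, Int.cast_natCast, mul_comm (m : ℂ), ← div_div]
    simp only [zpow_natCast]
    rw [← mul_div_assoc, mul_div_cancel₀ _ hq]
  have h2 : (fun m : ℕ => -(cst (q - q⁻¹) * nome ^ m * (1 - nome ^ m)⁻¹) * cst (e (-m))) =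
      fun m : ℕ => nome ^ m * (cst ((∑ i ∈ I, ((b i)⁻¹ ^ m - (a i)⁻¹ ^ m)) / m) *
        (1 - nome ^ m)⁻¹) := by
    funext m
    have : -((q - q⁻¹) * e (-m)) = (∑ i ∈ I, ((b i)⁻¹ ^ m - (a i)⁻¹ ^ m)) / m := by
      rw [he, mul_comm ((-(m : ℤ) : ℤ) : ℂ), ← div_div]
      push_cast
      simp only [zpow_neg, zpow_natCast, inv_pow]
      rw [← mul_div_assoc, mul_div_cancel₀ _ hq, div_neg, neg_neg]
    rw [← this, cst_neg, cst_mul]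
    ring
  rw [h1, h2, ← rescale_posSeries, ← rescale_formalExp, ← qQuot_eq, ← qQuot_eq, coeffT_C_mul,
    ← mul_sub]
  exact Dvd.dvd.mul_left (X_pow_dvd_coeffT_thetaQuot I a b n M) _

/-- The truncation needed for `φ^-`. -/
theorem nome_pow_dvd_expandMinus {ι : Type*} (I : Finset ι) {a b : ι → ℂ} (ha : ∀ i, a i ≠ 0)
    (hb : ∀ i, b i ≠ 0) {q : ℂ} (hq : q - q⁻¹ ≠ 0) {K K' : ℂ} (hK : K * ∏ i ∈ I, a i / b i = K')
    {e : ℤ → ℂ} (he : ∀ l, e l = (∑ i ∈ I, (b i ^ l - a i ^ l)) / (l * (q - q⁻¹))) (n : ℤ) (M : ℕ) :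
    nome ^ M ∣ coeffT (-n) (PowerSeries.C (laurentC K) *
        thetaQuot I a b (HahnSeries.single (-1 : ℤ) (1 : ℂ))) -
      cst K' * ∑ r ∈ Finset.range M,
      coeffZ (r - n) (formalExp (posSeries fun m =>
        -(cst (q - q⁻¹) * (1 - nome ^ m)⁻¹) * cst (e (-m)))) *
      PowerSeries.coeff r (formalExp (posSeries fun m =>
        cst (q - q⁻¹) * nome ^ m * (1 - nome ^ m)⁻¹ * cst (e m))) := by
  rw [thetaQuot_symm I ha hb, ← mul_assoc, ← map_mul, ← map_mul, hK]
  -- Inverting the parameters replaces the power sum e(l) by -e(-l) and the index n by -n, which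
  -- turns the formula for φ^+ into that for φ^-.
  have h := nome_pow_dvd_expandPlus I (fun i => (a i)⁻¹) (fun i => (b i)⁻¹) hq K'
    (e := fun l => -e (-l)) (fun l => ?_) (-n) M
  · have e1 : (fun m : ℕ => -(cst (q - q⁻¹) * nome ^ m * (1 - nome ^ m)⁻¹) *
        cst (-e (- -(m : ℤ)))) =
        fun m : ℕ => cst (q - q⁻¹) * nome ^ m * (1 - nome ^ m)⁻¹ * cst (e m) := by
      funext m
      rw [neg_neg, cst_neg, neg_mul_neg]
    have e2 : (fun m : ℕ => cst (q - q⁻¹) * (1 - nome ^ m)⁻¹ * cst (-e (-(m : ℤ)))) =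
        fun m : ℕ => -(cst (q - q⁻¹) * (1 - nome ^ m)⁻¹) * cst (e (-m)) := by
      funext m
      rw [cst_neg, mul_neg, neg_mul]
    rw [e1, e2] at h
    simp only [← sub_eq_add_neg] at h
    simpa only [mul_comm (coeffZ _ _)] using h
  · simp only [he, inv_zpow']
    push_cast
    rw [neg_mul, div_neg, neg_neg]

end ThetaQuot

namespace FockData

variable {N : ℕ} (P : FockData N)

/-! #### Sums over rows -/

section RowSum

variable {M : Type*} [AddCommGroup M] (fR fA : ℤ → ℤ → M)

/-- The contribution of a row of length `a`. -/
def rowTerm (j : ZMod N) (s a : ℕ) : M :=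
  (if j = P.col (s, a) + 1 then fR s a else 0) + if j = P.col (s, a) then fA s a else 0

/-- The sum of the contributions of the removable ends of rows (the first `L` rows) and of the
addable ends (the first `L + 1` rows). -/
def rowSum (j : ZMod N) (S : Finset (ℕ × ℕ)) (L : ℕ) : M :=
  ∑ s ∈ Finset.range L, P.rowTerm fR fA j s (rl S s) +
    if j = P.col (L, rl S L) then fA L (rl S L) else 0

variable {fR fA}

/-- The additive counterpart of `tail_eq`: an empty row and the next one cancel, so the cut-off is
free. -/
theorem rowSum_eq (hf : ∀ s : ℤ, fR s 0 + fA (s + 1) 0 = 0) (j : ZMod N) {S : Finset (ℕ × ℕ)}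
    (hS : IsLowerSet (S : Set (ℕ × ℕ))) {L : ℕ} (hL : rows S ≤ L) :
    P.rowSum fR fA j S L = P.rowSum fR fA j S (rows S) := by
  induction L, hL using Nat.le_induction with
  | base => rfl
  | succ L hL ih =>
    rw [← ih, rowSum, rowSum, Finset.sum_range_succ, rowTerm, (rl_eq_zero hS).mpr hL,
      (rl_eq_zero hS).mpr (hL.trans (Nat.le_succ L))]
    have hc : P.col (L + 1, 0) = P.col (L, 0) + 1 := by simp only [col]; push_cast; ring
    rw [hc]
    have := hf L
    push_cast
    by_cases h : j = P.col (L, 0) + 1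
    · rw [if_pos h, if_pos h, add_assoc, add_right_comm, this, zero_add]
    · rw [if_neg h, if_neg h, zero_add, add_zero]

/-- Using the same cut-off before and after, only the row of the new box contributes to the
difference. -/
theorem rowSum_insert (hf : ∀ s : ℤ, fR s 0 + fA (s + 1) 0 = 0) (j : ZMod N)
    {S : Finset (ℕ × ℕ)} {b : ℕ × ℕ} (hb : Addable S b) :
    P.rowSum fR fA j (insert b S) (rows (insert b S)) = P.rowSum fR fA j S (rows S) +
      (P.rowTerm fR fA j b.1 (b.2 + 1) - P.rowTerm fR fA j b.1 b.2) := by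
  have h1 : rows S ≤ rows (insert b S) :=
    Finset.card_le_card (Finset.filter_subset_filter _ (Finset.subset_insert _ _))
  have h2 := fst_lt_rows hb.2.2 (Finset.mem_insert_self b S)
  rw [← P.rowSum_eq hf j hb.1 h1, rowSum, rowSum, rl_insert hb.2.1 (rows _), if_neg h2.ne', add_zero,
    add_right_comm]
  congr 1
  rw [← sub_eq_iff_eq_add', ← Finset.sum_sub_distrib,
    Finset.sum_eq_single_of_mem _ (Finset.mem_range.mpr h2)]
  · rw [rl_insert hb.2.1, if_pos rfl, ← hb.snd_eq]
  · intro s _ hs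
    rw [rl_insert hb.2.1, if_neg hs, add_zero, sub_self]

theorem rowTerm_succ_sub (j : ZMod N) (b : ℕ × ℕ) :
    P.rowTerm fR fA j b.1 (b.2 + 1) - P.rowTerm fR fA j b.1 b.2 =
      (if j = P.col b then fR b.1 (b.2 + 1) - fA b.1 b.2 else 0) -
      (if j = P.col b + 1 then fR b.1 b.2 else 0) +
      (if j + 1 = P.col b then fA b.1 (b.2 + 1) else 0) := by
  have hA : j = P.col (b.1, b.2 + 1) ↔ j + 1 = P.col b := by
    rw [← col_succ P b.1 b.2, add_left_inj]
  simp only [rowTerm, col_succ, hA]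
  push_cast
  split_ifs <;> abel

end RowSum

end FockData

/-! ### Eigenvalues as sums and products over the ends of rows -/

namespace FockData

variable {N : ℕ} (P : FockData N)

/-- The index set of the theta quotients in the eigenvalue of `φ_j`. -/
def idx (j : ZMod N) (S : Finset (ℕ × ℕ)) : Finset (ℕ ⊕ ℕ) :=
  ((Finset.range (rows S)).filter fun s => j = P.col (s, rl S s) + 1).disjSum
    ((Finset.range (rows S + 1)).filter fun s => j = P.col (s, rl S s))

/-- The numerators of the theta quotients. -/
def num (S : Finset (ℕ × ℕ)) : ℕ ⊕ ℕ → ℂ :=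
  Sum.elim (fun s => P.posZ (s + 1) (rl S s)) fun s => P.posZ (s - 1) (rl S s - 1)

/-- The denominators of the theta quotients. -/
def den (S : Finset (ℕ × ℕ)) : ℕ ⊕ ℕ → ℂ :=
  Sum.elim (fun s => P.posZ s (rl S s - 1)) fun s => P.posZ s (rl S s)

theorem num_ne_zero (S : Finset (ℕ × ℕ)) (i : ℕ ⊕ ℕ) : P.num S i ≠ 0 := by
  rcases i with s | s <;> exact P.posZ_ne_zero _ _

theorem den_ne_zero (S : Finset (ℕ × ℕ)) (i : ℕ ⊕ ℕ) : P.den S i ≠ 0 := by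
  rcases i with s | s <;> exact P.posZ_ne_zero _ _

theorem sum_idx {M : Type*} [AddCommGroup M] (fR fA : ℤ → ℤ → M) (j : ZMod N)
    (S : Finset (ℕ × ℕ)) :
    ∑ i ∈ P.idx j S, Sum.elim (fun s : ℕ => fR s (rl S s)) (fun s : ℕ => fA s (rl S s)) i =
      P.rowSum fR fA j S (rows S) := by
  rw [idx, Finset.sum_disjSum, Finset.sum_filter, Finset.sum_filter, Finset.sum_range_succ,
    ← add_assoc, ← Finset.sum_add_distrib]
  rfl

/-- The exponent of `q` in the eigenvalue of `K_j^+`. -/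
def kExp (j : ZMod N) (S : Finset (ℕ × ℕ)) : ℤ :=
  P.rowSum (fun _ _ => 1) (fun _ _ => -1) j S (rows S)

/-- The power sums of the zeros and poles of the eigenvalue of `φ_j`. -/
def powSum (l : ℤ) (j : ZMod N) (S : Finset (ℕ × ℕ)) (L : ℕ) : ℂ :=
  P.rowSum (fun r c => P.posZ r (c - 1) ^ l - P.posZ (r + 1) c ^ l)
    (fun r c => P.posZ r c ^ l - P.posZ (r - 1) (c - 1) ^ l) j S L

/-- The eigenvalue of `α^∨_{j,l}`. -/
def alphaEig (j : ZMod N) (l : ℤ) (S : Finset (ℕ × ℕ)) : ℂ :=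
  P.powSum l j S (rows S) / (l * (P.q - P.q⁻¹))

theorem alphaEig_eq (j : ZMod N) (l : ℤ) (S : Finset (ℕ × ℕ)) :
    P.alphaEig j l S = (∑ i ∈ P.idx j S, (P.den S i ^ l - P.num S i ^ l)) /
      (l * (P.q - P.q⁻¹)) := by
  rw [alphaEig, powSum, ← sum_idx]
  congr 1
  refine Finset.sum_congr rfl fun i _ => ?_
  rcases i with s | s <;> rfl

theorem powSum_cancel (l s : ℤ) :
    (P.posZ s (0 - 1) ^ l - P.posZ (s + 1) 0 ^ l) +
      (P.posZ (s + 1) 0 ^ l - P.posZ (s + 1 - 1) (0 - 1) ^ l) = 0 := by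
  rw [add_sub_cancel_right]; ring

/-- For the colour of b, an end of weight -1 becomes one of weight 1, a change by 2. For the
neighbouring colours, an end of weight 1 is lost or one of weight -1 is gained. -/
theorem kExp_insert (j : ZMod N) {S : Finset (ℕ × ℕ)} {b : ℕ × ℕ} (hb : Addable S b) :
    P.kExp j (insert b S) = P.kExp j S + cartan N j (P.col b) := by
  rw [kExp, P.rowSum_insert (fun _ => by norm_num) j hb, rowTerm_succ_sub, kExp]
  congr 1
  have hN := P.hN
  by_cases h0 : j = P.col b
  · rw [if_pos h0, if_neg (by rw [h0]; exact (add_one_ne hN _).symm),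
      if_neg (by rw [h0]; exact add_one_ne hN _), h0, cartan_self hN]; norm_num
  · by_cases h1 : j = P.col b + 1
    · rw [if_neg h0, if_pos h1, if_neg (by rw [h1]; exact add_one_add_one_ne hN _), h1,
        cartan_succ hN]; norm_num
    · by_cases h2 : j + 1 = P.col b
      · rw [if_neg h0, if_neg h1, if_pos h2, ← h2, cartan_pred hN]; norm_num
      · rw [if_neg h0, if_neg h1, if_neg h2, cartan_of_ne h0 h1 (Ne.symm h2)]; norm_num

theorem posZ_zpow (a m r c l r' c' : ℤ) (h : a - c - r = -c' - r' ∧ m + c - r = c' - r') :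
    P.posZ r' c' ^ l = P.q ^ (a * l) * P.κ ^ (m * l) * P.posZ r c ^ l := by
  rw [← (P.q_pow_mul_posZ a m r c r' c').mpr h, mul_zpow, mul_zpow, ← zpow_mul, ← zpow_mul]

/-- The ends that appear or disappear have positions that differ from that of b by monomials in q
and κ; their l-th powers combine to the q-number and the power of κ. -/
theorem alphaEig_insert (j : ZMod N) {l : ℤ} (hl : l ≠ 0) {S : Finset (ℕ × ℕ)} {b : ℕ × ℕ}
    (hb : Addable S b) :
    P.alphaEig j l (insert b S) = P.alphaEig j l S +
      qnum P.q (cartan N j (P.col b) * l) / l * P.κ ^ (-(l * mMat N j (P.col b))) *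
        P.pos b ^ l := by
  have hl' : (l : ℂ) ≠ 0 := Int.cast_ne_zero.mpr hl
  have hq := P.q_sub_inv_ne_zero
  rw [alphaEig, powSum, P.rowSum_insert (P.powSum_cancel l) j hb, rowTerm_succ_sub, ← powSum,
    add_div, ← alphaEig]
  congr 1
  rw [div_eq_iff (mul_ne_zero hl' hq), qnum, pos]
  have hR : ∀ x k p : ℂ, x / (P.q - P.q⁻¹) / l * k * p * (l * (P.q - P.q⁻¹)) = x * k * p := by
    intro x k p
    generalize P.q - P.q⁻¹ = d at hq
    field_simp
  rw [hR]
  have hN := P.hN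
  by_cases h0 : j = P.col b
  · rw [if_pos h0, if_neg (by rw [h0]; exact (add_one_ne hN _).symm),
      if_neg (by rw [h0]; exact add_one_ne hN _), h0, cartan_self hN, mMat_self,
      P.posZ_zpow 2 0 b.1 b.2 l (b.1 - 1) (b.2 - 1) (by omega),
      P.posZ_zpow (-2) 0 b.1 b.2 l (b.1 + 1) (b.2 + 1) (by omega)]
    simp only [zero_mul, mul_zero, neg_zero, zpow_zero, neg_mul]
    ring_nf
  · by_cases h1 : j = P.col b + 1
    · rw [if_neg h0, if_pos h1, if_neg (by rw [h1]; exact add_one_add_one_ne hN _), h1,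
        cartan_succ hN, mMat_succ hN,
        P.posZ_zpow 1 (-1) b.1 b.2 l b.1 (b.2 - 1) (by omega),
        P.posZ_zpow (-1) (-1) b.1 b.2 l (b.1 + 1) b.2 (by omega)]
      simp only [one_mul, mul_one, neg_mul, neg_neg]
      ring
    · by_cases h2 : j + 1 = P.col b
      · rw [if_neg h0, if_neg h1, if_pos h2, ← h2, cartan_pred hN, mMat_pred hN,
          add_sub_cancel_right, P.posZ_zpow (-1) 1 b.1 b.2 l b.1 (b.2 + 1) (by omega),
          P.posZ_zpow 1 1 b.1 b.2 l (b.1 - 1) b.2 (by omega)]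
        simp only [one_mul, mul_neg, mul_one, neg_mul, neg_neg]
        ring
      · rw [if_neg h0, if_neg h1, if_neg h2, cartan_of_ne h0 h1 (Ne.symm h2)]
        simp

theorem _root_.EllTor.prod_zpow_eq {ι : Type*} {q : ℂ} (hq : q ≠ 0) (I : Finset ι) (f : ι → ℤ) :
    ∏ i ∈ I, q ^ f i = q ^ ∑ i ∈ I, f i := by
  classical
  induction I using Finset.induction_on with
  | empty => simp
  | insert a s ha ih => rw [Finset.prod_insert ha, Finset.sum_insert ha, ih, zpow_add₀ hq]

/-- The product of the elliptic quotients `num/den`. -/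
theorem prod_num_div_den (j : ZMod N) (S : Finset (ℕ × ℕ)) :
    P.q ^ P.kExp j S * ∏ i ∈ P.idx j S, P.num S i / P.den S i = P.q ^ (-P.kExp j S) := by
  -- Zero and pole of each factor are one diagonal step apart, so their ratio is q^{-2} at a
  -- removable end and q² at an addable end.
  have h : ∀ i, P.num S i / P.den S i =
      P.q ^ (-2 * Sum.elim (fun _ : ℕ => (1 : ℤ)) (fun _ : ℕ => -1) i) := by
    intro i
    rcases i with s | s
    · rw [div_eq_iff (P.den_ne_zero S _)]
      have := P.posZ_succ_succ s (rl S s - 1)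
      rw [sub_add_cancel] at this
      exact this
    · rw [div_eq_iff (P.den_ne_zero S _)]
      exact P.posZ_pred_pred s (rl S s)
  rw [Finset.prod_congr rfl fun i _ => h i, prod_zpow_eq P.hq, ← Finset.mul_sum,
    P.sum_idx (fun _ _ => (1 : ℤ)) (fun _ _ => -1), ← kExp, ← zpow_add₀ P.hq]
  congr 1
  ring

theorem q_zpow_kExp (j : ZMod N) (S : Finset (ℕ × ℕ)) :
    P.q ^ P.kExp j S = ∏ i ∈ P.idx j S, Sum.elim (fun _ : ℕ => P.q) (fun _ : ℕ => P.q⁻¹) i := by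
  rw [kExp, ← sum_idx, ← prod_zpow_eq P.hq]
  refine Finset.prod_congr rfl fun i _ => ?_
  rcases i with s | s <;> simp

theorem phiEigen_eq (j : ZMod N) (lam : YoungDiagram) (T : LaurentSeries ℂ) :
    phiEigen laurentC P.q P.κ P.u P.k j lam T =
      PowerSeries.C (laurentC (P.q ^ P.kExp j lam.cells)) *
        thetaQuot (P.idx j lam.cells) (P.num lam.cells) (P.den lam.cells) T := by
  classical
  rw [q_zpow_kExp, map_prod, map_prod, thetaQuot, ← Finset.prod_mul_distrib, idx,
    Finset.prod_disjSum, phiEigen, rows_cells]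
  refine congrArg₂ (· * ·) ?_ ?_
  · refine Finset.prod_congr ?_ fun s _ => ?_
    · ext s
      rw [Finset.mem_filter, Finset.mem_filter, rl_cells, ← condR_iff]
      rfl
    · rw [mul_assoc, rowU_eq, ← posZ_succ_row, ← posZ_pred_col, num, den, Sum.elim_inl, Sum.elim_inl,
        Sum.elim_inl, rl_cells]
  · refine Finset.prod_congr ?_ fun s _ => ?_
    · ext s
      rw [Finset.mem_filter, Finset.mem_filter, rl_cells, ← condA_iff]
      rfl
    · rw [mul_assoc, rowU_eq, mul_assoc ((q1 P.q P.κ)⁻¹), ← posZ_pred_row, ← posZ_pred_col, num, den,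
        Sum.elim_inr, Sum.elim_inr, Sum.elim_inr, rl_cells]

/-- Summed over all colours, every row contributes 1 - 1 = 0, and the first empty row leaves -1.
This is the level. -/
theorem sum_kExp (S : Finset (ℕ × ℕ)) [NeZero N] : ∑ j : ZMod N, P.kExp j S = -1 := by
  simp only [kExp, rowSum, rowTerm]
  rw [Finset.sum_add_distrib, Finset.sum_comm]
  simp only [Finset.sum_add_distrib, Finset.sum_ite_eq', Finset.mem_univ, if_true]
  simp

end FockData

/-! ### The commutator of `x^+` and `x^-` -/

/-- The union of two lower sets is a lower set. -/
theorem Addable.insert_of_ne {S : Finset (ℕ × ℕ)} {z w : ℕ × ℕ} (hz : Addable S z) (hw : Addable S w)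
    (h : z ≠ w) : Addable (insert w S) z := by
  refine ⟨hw.2.2, by simp [h, hz.2.1], ?_⟩
  have e : ((insert z (insert w S) : Finset (ℕ × ℕ)) : Set (ℕ × ℕ)) =
      ((insert z S : Finset (ℕ × ℕ)) : Set (ℕ × ℕ)) ∪
        ((insert w S : Finset (ℕ × ℕ)) : Set (ℕ × ℕ)) := by
    ext x
    simp only [Finset.mem_coe, Finset.mem_insert, Set.mem_union]
    tauto
  rw [e]
  exact hz.2.2.union hw.2.2

/-- The intersection of two lower sets is a lower set. -/
theorem Addable.of_insert {S : Finset (ℕ × ℕ)} {z w : ℕ × ℕ} (hz : Addable S z)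
    (hw : Removable (insert z S) w) (h : z ≠ w) : Removable S w ∧ Addable (S.erase w) z := by
  have hwS : w ∈ S := Finset.mem_of_mem_insert_of_ne hw.1 h.symm
  have hlow : IsLowerSet ((S.erase w : Finset (ℕ × ℕ)) : Set (ℕ × ℕ)) := by
    have e : ((S.erase w : Finset (ℕ × ℕ)) : Set (ℕ × ℕ)) =
        (((insert z S).erase w : Finset (ℕ × ℕ)) : Set (ℕ × ℕ)) ∩ (S : Set (ℕ × ℕ)) := by
      ext x
      simp only [Finset.mem_coe, Finset.mem_insert, Finset.mem_erase, Set.mem_inter_iff]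
      tauto
    rw [e]
    exact hw.2.1.inter hz.1
  refine ⟨⟨hwS, hlow, Finset.notMem_erase _ _, by rw [Finset.insert_erase hwS]; exact hz.1⟩, hlow,
    fun h' => hz.2.1 (Finset.mem_of_mem_erase h'), ?_⟩
  rw [← Finset.erase_insert_of_ne h]
  exact hw.2.1

theorem rows_insert_le (S : Finset (ℕ × ℕ)) (b : ℕ × ℕ) : rows (insert b S) ≤ rows S + 1 := by
  rw [rows, rows, Finset.filter_insert]
  split_ifs
  · exact Finset.card_insert_le _ _
  · omega

namespace FockData

variable {N : ℕ} (P : FockData N)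

/-- Only rows below `w` enter, and these are the same in `S`; the strict bound leaves space for a
new row. -/
theorem remCoeff_insert {S : Finset (ℕ × ℕ)} {w : ℕ × ℕ} (hw : Addable S w) {L : ℕ}
    (hL : rows S < L) :
    P.remCoeff (insert w S) w = constC P.q (-1) * P.tail (P.col w) S w.1 (P.pos w) L := by
  rw [P.remCoeff_eq hw.removable ((rows_insert_le S w).trans hL)]
  congr 1
  refine P.tail_congr _ _ _ fun s hs => ?_
  rw [rl_insert hw.2.1, if_neg (by omega), add_zero]

theorem inv_kappa_mul (z w : ℕ × ℕ) :
    (P.κ ^ (-mMat N (P.col w) (P.col z)) * P.pos z / P.pos w)⁻¹ =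
      P.κ ^ (-mMat N (P.col z) (P.col w)) * P.pos w / P.pos z := by
  have := zpow_ne_zero (mMat N (P.col w) (P.col z)) P.hκ
  rw [mMat_symm (P.col z) (P.col w), neg_neg, inv_div, zpow_neg]
  field_simp

theorem kappa_mul_ne_zero (z w : ℕ × ℕ) :
    P.κ ^ (-mMat N (P.col w) (P.col z)) * P.pos z / P.pos w ≠ 0 :=
  div_ne_zero (mul_ne_zero (zpow_ne_zero _ P.hκ) (P.pos_ne_zero _)) (P.pos_ne_zero _)

/-- Adding `z` commutes with removing `w`. -/
theorem remCoeff_mul_addCoeff {S : Finset (ℕ × ℕ)} {z w : ℕ × ℕ} (h : z ≠ w) :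
    P.remCoeff S w * P.addCoeff (S.erase w) z = P.addCoeff S z * P.remCoeff (insert z S) w := by
  by_cases hv : Removable S w ∧ Addable (S.erase w) z
  · obtain ⟨hw, hz⟩ := hv
    obtain ⟨S₀, rfl⟩ : ∃ S₀, S = insert w S₀ := ⟨S.erase w, (Finset.insert_erase hw.1).symm⟩
    by_cases hmem : w ∈ S₀
    · rw [Finset.insert_eq_of_mem hmem] at hw hz ⊢
      obtain ⟨S₁, hS₁, rfl⟩ : ∃ S₁, w ∉ S₁ ∧ S₀ = insert w S₁ :=
        ⟨S₀.erase w, Finset.notMem_erase _ _, (Finset.insert_erase hw.1).symm⟩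
      exact aux hS₁ hw hz
    · exact aux hmem hw hz
  · have h1 : P.remCoeff S w * P.addCoeff (S.erase w) z = 0 := by
      rw [not_and_or] at hv
      rcases hv with hv | hv
      · rw [remCoeff, if_neg hv, zero_mul]
      · rw [addCoeff, if_neg hv, mul_zero]
    have h2 : P.addCoeff S z * P.remCoeff (insert z S) w = 0 := by
      by_cases ha : Addable S z
      · by_cases hr : Removable (insert z S) w
        · exact absurd (ha.of_insert hr h) hv
        · rw [remCoeff, if_neg hr, mul_zero]
      · rw [addCoeff, if_neg ha, zero_mul]
    rw [h1, h2]
where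
  aux {S : Finset (ℕ × ℕ)} (hmem : w ∉ S) (hw : Removable (insert w S) w)
      (hz : Addable ((insert w S).erase w) z) :
      P.remCoeff (insert w S) w * P.addCoeff ((insert w S).erase w) z =
        P.addCoeff (insert w S) z * P.remCoeff (insert z (insert w S)) w := by
    have hw' := hw.2
    rw [Finset.erase_insert hmem] at hz hw' ⊢
    have hzw := hz.insert_of_ne hw' h
    have hwz := hw'.insert_of_ne hz h.symm
    -- A row has only one addable box.
    have hrow : z.1 ≠ w.1 := fun hr => h (Prod.ext hr (by rw [hz.snd_eq, hw'.snd_eq, hr]))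
    have hL1 : rows S < rows S + 2 := by omega
    have hL2 : rows (insert z S) < rows S + 2 := by have := rows_insert_le S z; omega
    rw [Finset.insert_comm z w S, P.remCoeff_insert hw' hL1, P.remCoeff_insert hwz hL2]
    -- If z is above w, neither coefficient notices the other box. If z is below w, both
    -- coefficients change, and by the same ratio of thetas.
    rcases lt_or_gt_of_ne hrow with hlt | hlt
    · rw [P.addCoeff_insert_of_above hlt hmem hz hzw, P.tail_congr (P.col w) (S := insert z S) (S' := S)]
      · ring
      · intro s hs
        rw [rl_insert hz.2.1, if_neg (by omega), add_zero]
    · have h1 := theta_exchange_swap P.hq _ (P.kappa_mul_ne_zero w z) (P.addCoeff_insert hlt hw' hz hzw)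
      rw [inv_kappa_mul, cartan_symm] at h1
      have h2 := P.tail_insert (P.col w) hz w.2 hlt (L := rows S + 2) (by
        have := fst_lt_rows hz.2.2 (Finset.mem_insert_self z S)
        omega)
      rw [← pos] at h2
      -- As w lies in a higher row, the argument could be 1 only if w were the diagonal predecessor
      -- of z. Then w would belong to the diagram without w.
      have hα : theta (P.q ^ cartan N (P.col w) (P.col z) *
          (P.κ ^ (-mMat N (P.col w) (P.col z)) * P.pos z / P.pos w)) ≠ 0 := by
        refine theta_ne_zero fun h1 => ?_
        rw [← mul_div_assoc, div_eq_one_iff_eq (P.pos_ne_zero _), ← mul_assoc, pos, pos,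
          q_pow_mul_posZ] at h1
        have hle : ¬w ≤ z := fun hle =>
          hmem (by
            have := hz.2.2 hle (Finset.mem_insert_self z S)
            rw [Finset.mem_coe, Finset.mem_insert] at this
            exact this.resolve_left h.symm)
        apply hle
        have := cartan_mMat_cases P.hN (P.col w) (P.col z)
        constructor <;> omega
      refine mul_left_cancel₀ hα ?_
      linear_combination constC P.q (-1) * P.tail (P.col w) S w.1 (P.pos w) (rows S + 2) * h1 -
        constC P.q (-1) * P.addCoeff (insert w S) z * h2

/-! #### Residues -/

/-- The theta quotients with their prefactors. -/
def facI (S : Finset (ℕ × ℕ)) (V : ℂ) : ℕ ⊕ ℕ → ℂ⟦X⟧ :=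
  Sum.elim (fun s => P.facR s (rl S s) V) fun s => P.facA s (rl S s) V

theorem facI_eq (S : Finset (ℕ × ℕ)) (V : ℂ) (i : ℕ ⊕ ℕ) :
    P.facI S V i = cst (Sum.elim (fun _ : ℕ => P.q) (fun _ : ℕ => P.q⁻¹) i) *
      (theta (P.num S i / V) * (theta (P.den S i / V))⁻¹) := by
  rcases i with s | s
  · simp only [facI, num, den, Sum.elim_inl, facR, mul_assoc]
  · simp only [facI, num, den, Sum.elim_inr, facA, mul_assoc]

theorem cst_mul_thetaRes {j : ZMod N} {S : Finset (ℕ × ℕ)} {i : ℕ ⊕ ℕ} (hi : i ∈ P.idx j S) :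
    cst (P.q ^ P.kExp j S) * thetaRes (P.idx j S) (P.num S) (P.den S) i =
      cst (Sum.elim (fun _ : ℕ => P.q) (fun _ : ℕ => P.q⁻¹) i) * theta (P.num S i / P.den S i) *
        thetaRInv 1 1 * ∏ l ∈ (P.idx j S).erase i, P.facI S (P.den S i) l := by
  rw [q_zpow_kExp, ← Finset.mul_prod_erase _ _ hi, thetaRes, cst_mul, cst_prod]
  simp only [facI_eq, Finset.prod_mul_distrib]
  ring

/-- By θ(x) = (1-x)(px;p)_∞(p/x;p)_∞, the normalization C_+C_- is what the factor of the pole itself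
leaves in the residue, with θ(q^{-2}) at removable and θ(q²) at addable ends. -/
theorem constC_mul_constC : constC P.q 1 * constC P.q (-1) =
    cst (P.q - P.q⁻¹)⁻¹ * (cst P.q * theta (P.q ^ (-2 : ℤ)) * thetaRInv 1 1) ∧
    constC P.q 1 * constC P.q (-1) =
    -(cst (P.q - P.q⁻¹)⁻¹ * (cst P.q⁻¹ * theta (P.q ^ (2 : ℤ)) * thetaRInv 1 1)) := by
  have hq := P.hq
  have hd := P.q_sub_inv_ne_zero
  have h1 := thetaR_mul_inv (1 : ℂ) 1
  have hinv : (qPoch nome)⁻¹ * (qPoch nome)⁻¹ = thetaRInv (1 : ℂ) 1 := by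
    have e : thetaR (1 : ℂ) 1 = qPoch nome * qPoch nome := by
      rw [thetaR, map_one, one_mul, qPoch_eq_qPochR]; rfl
    have hne : qPoch nome * qPoch nome ≠ 0 := by
      intro h0
      rw [e, h0, zero_mul] at h1
      exact zero_ne_one h1
    have hc : PowerSeries.constantCoeff (qPoch nome) ≠ 0 := by
      rw [qPoch_eq_qPochR, constantCoeff_qPochR]
      simp [nome]
    have hi := PowerSeries.mul_inv_cancel _ hc
    refine mul_left_cancel₀ hne ?_
    rw [← e, h1, e]
    linear_combination (qPoch nome * (qPoch nome)⁻¹ + 1) * hi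
  have e2 : ∀ x : ℂ, theta x = cst (1 - x) * (qPoch (cst x * nome) * qPoch (cst x⁻¹ * nome)) := by
    intro x
    rw [theta_eq, thetaR, qPoch_eq_qPochR, qPoch_eq_qPochR]; rfl
  have e3 : (P.q ^ (-2 : ℤ))⁻¹ = P.q ^ (2 : ℤ) := by rw [zpow_neg, inv_inv]
  have e4 : (P.q ^ (2 : ℤ))⁻¹ = P.q ^ (-2 : ℤ) := by rw [zpow_neg]
  have k1 : cst (P.q - P.q⁻¹)⁻¹ * (cst P.q * cst (1 - P.q ^ (-2 : ℤ))) = 1 := by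
    rw [← cst_mul, ← cst_mul, ← cst_one, inv_mul_eq_div, div_eq_one_iff_eq hd |>.mpr]
    rw [zpow_neg, zpow_ofNat]
    field_simp
  have k2 : cst (P.q - P.q⁻¹)⁻¹ * (cst P.q⁻¹ * cst (1 - P.q ^ (2 : ℤ))) = -1 := by
    rw [← cst_mul, ← cst_mul, ← cst_one, ← cst_neg, inv_mul_eq_div, div_eq_iff hd |>.mpr]
    rw [zpow_ofNat]
    field_simp
    ring
  rw [e2, e2, e3, e4, constC, constC, ← hinv]
  simp only [mul_one, mul_neg]
  constructor
  · linear_combination (-(qPoch (cst (P.q ^ (2 : ℤ)) * nome) * qPoch (cst (P.q ^ (-2 : ℤ)) * nome) *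
      ((qPoch nome)⁻¹ * (qPoch nome)⁻¹))) * k1
  · linear_combination (qPoch (cst (P.q ^ (2 : ℤ)) * nome) * qPoch (cst (P.q ^ (-2 : ℤ)) * nome) *
      ((qPoch nome)⁻¹ * (qPoch nome)⁻¹)) * k2

end FockData

namespace FockData

variable {N : ℕ} (P : FockData N)

/-- The product over the index set without one index. -/
theorem prod_facI_erase (j : ZMod N) (S : Finset (ℕ × ℕ)) (V : ℂ) (i : ℕ ⊕ ℕ) :
    ∏ l ∈ (P.idx j S).erase i, P.facI S V l =
      (∏ s ∈ Finset.range (rows S),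
        (if j = P.col (s, rl S s) + 1 ∧ Sum.inl s ≠ i then P.facR s (rl S s) V else 1) *
        (if j = P.col (s, rl S s) ∧ Sum.inr s ≠ i then P.facA s (rl S s) V else 1)) *
      if j = P.col (rows S, rl S (rows S)) ∧ Sum.inr (rows S) ≠ i then
        P.facA (rows S) (rl S (rows S)) V else 1 := by
  have h : (P.idx j S).erase i = (P.idx j S).filter fun l => l ≠ i := by
    ext l; simp [and_comm]
  rw [h, Finset.prod_filter, idx, Finset.prod_disjSum, Finset.prod_filter, Finset.prod_filter,
    Finset.prod_range_succ, ← mul_assoc, ← Finset.prod_mul_distrib]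
  simp only [ite_and]
  rfl

/-- Without the pole of row s, the eigenvalue of φ_j splits into the rows above, which form the
coefficient of x^+, and the rows below, which form that of x^-. -/
theorem prod_facI_erase_row (j : ZMod N) (S : Finset (ℕ × ℕ)) (V : ℂ) {s : ℕ} (hs : s < rows S)
    {i : ℕ ⊕ ℕ} (hi : (i = Sum.inl s ∧ j = P.col (s, rl S s) + 1) ∨
      (i = Sum.inr s ∧ j = P.col (s, rl S s))) (h0 : rl S (rows S) = 0) :
    ∏ l ∈ (P.idx j S).erase i, P.facI S V l =
      (∏ t ∈ Finset.range s, P.psi j t (rl S t) V) * P.tail j S s V (rows S) := by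
  have hi' : ∀ t, t ≠ s → Sum.inl t ≠ i ∧ Sum.inr t ≠ i := by
    intro t ht
    rcases hi with hi | hi <;> rw [hi.1] <;> simp [ht]
  have hpsi : ∀ t, t ≠ s →
      (if j = P.col (t, rl S t) + 1 ∧ Sum.inl t ≠ i then P.facR t (rl S t) V else 1) *
        (if j = P.col (t, rl S t) ∧ Sum.inr t ≠ i then P.facA t (rl S t) V else 1) =
      P.psi j t (rl S t) V := by
    intro t ht
    simp only [psi, condA_iff, condR_iff, (hi' t ht).1, (hi' t ht).2, ne_eq, not_false_eq_true,
      and_true]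
  -- For one colour a row has a removable or an addable end, never both, so nothing else of row s is
  -- left.
  have hs1 : (if j = P.col (s, rl S s) + 1 ∧ Sum.inl s ≠ i then P.facR s (rl S s) V else 1) *
        (if j = P.col (s, rl S s) ∧ Sum.inr s ≠ i then P.facA s (rl S s) V else 1) = 1 := by
    rcases hi with ⟨rfl, hj⟩ | ⟨rfl, hj⟩
    · rw [if_neg (by simp), if_neg (by rw [hj]; simpa using fun h => (one_ne_zero_zmod P.hN h).elim),
        one_mul]
    · rw [if_neg (by rw [hj]; simpa using fun h => (one_ne_zero_zmod P.hN h).elim), if_neg (by simp),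
        one_mul]
  rw [prod_facI_erase, tail, ← Finset.prod_range_mul_prod_Ico _ hs.le,
    Finset.prod_eq_prod_Ico_succ_bot hs, hs1, one_mul, mul_assoc, h0]
  congr 1
  · exact Finset.prod_congr rfl fun t ht => hpsi t (by simp only [Finset.mem_range] at ht; omega)
  · congr 1
    · exact Finset.prod_congr rfl fun t ht => hpsi t (by simp only [Finset.mem_Ico] at ht; omega)
    · simp only [(hi' (rows S) hs.ne').2, ne_eq, not_false_eq_true, and_true]
      rfl

theorem prod_facI_erase_last (j : ZMod N) (S : Finset (ℕ × ℕ)) (V : ℂ) :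
    ∏ l ∈ (P.idx j S).erase (Sum.inr (rows S)), P.facI S V l =
      ∏ t ∈ Finset.range (rows S), P.psi j t (rl S t) V := by
  rw [prod_facI_erase, if_neg (by simp), mul_one]
  refine Finset.prod_congr rfl fun t ht => ?_
  have ht' : t ≠ rows S := by simp only [Finset.mem_range] at ht; omega
  simp [psi, condA_iff, condR_iff, ht']

theorem rl_succ_le {S : Finset (ℕ × ℕ)} (hS : IsLowerSet (S : Set (ℕ × ℕ))) (s : ℕ) :
    rl S (s + 1) ≤ rl S s := by
  by_contra! h
  have h1 := (mem_iff_lt_rl hS (s + 1, rl S s)).mpr h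
  have h2 := hS (show (s, rl S s) ≤ (s + 1, rl S s) from ⟨Nat.le_succ _, le_rfl⟩) h1
  have := (mem_iff_lt_rl hS _).mp h2
  simp only at this
  omega

theorem removable_of_rl_lt {S : Finset (ℕ × ℕ)} (hS : IsLowerSet (S : Set (ℕ × ℕ))) {s a : ℕ}
    (ha : rl S s = a + 1) (h : rl S (s + 1) < rl S s) : Removable S (s, a) := by
  have hmem : (s, a) ∈ S := (mem_iff_lt_rl hS _).mpr (by simp only; omega)
  refine ⟨hmem, fun x y hyx hx => ?_, Finset.notMem_erase _ _, by rwa [Finset.insert_erase hmem]⟩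
  rw [Finset.mem_coe, Finset.mem_erase] at hx ⊢
  refine ⟨?_, hS hyx hx.2⟩
  rintro rfl
  have hxr := (mem_iff_lt_rl hS x).mp hx.2
  have h1 : s ≤ x.1 := hyx.1
  have h2 : a ≤ x.2 := hyx.2
  rcases Nat.eq_or_lt_of_le h1 with h3 | h3
  · rw [← h3] at hxr
    exact hx.1 (Prod.ext h3.symm (by simp only; omega))
  · have h4 := hS (show (s + 1, a) ≤ x from ⟨h3, h2⟩) hx.2
    have := (mem_iff_lt_rl hS _).mp h4
    simp only at this
    omega

theorem addable_of_rl_lt {S : Finset (ℕ × ℕ)} (hS : IsLowerSet (S : Set (ℕ × ℕ))) {s : ℕ}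
    (h : ∀ t, s = t + 1 → rl S s < rl S t) : Addable S (s, rl S s) := by
  refine ⟨hS, fun h' => ?_, fun x y hyx hx => ?_⟩
  · have := (mem_iff_lt_rl hS _).mp h'
    simp only at this
    omega
  rw [Finset.mem_coe, Finset.mem_insert] at hx ⊢
  rcases hx with rfl | hx
  · have h1 : y.1 ≤ s := hyx.1
    have h2 : y.2 ≤ rl S s := hyx.2
    rcases Nat.eq_or_lt_of_le h1 with h3 | h3
    · rcases Nat.eq_or_lt_of_le h2 with h4 | h4
      · exact Or.inl (Prod.ext h3 h4)
      · exact Or.inr ((mem_iff_lt_rl hS _).mpr (by rw [h3]; exact h4))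
    · obtain ⟨t, rfl⟩ : ∃ t, s = t + 1 := ⟨s - 1, by omega⟩
      have := h t rfl
      have hm : (t, y.2) ∈ S := (mem_iff_lt_rl hS _).mpr (by simp only; omega)
      exact Or.inr (hS (show y ≤ (t, y.2) from ⟨by simp only; omega, le_rfl⟩) hm)
  · exact Or.inr (hS hyx hx)

/-- The residues at the removable ends. -/
theorem residue_inl {j : ZMod N} {S : Finset (ℕ × ℕ)} (hS : IsLowerSet (S : Set (ℕ × ℕ))) {s a : ℕ}
    (ha : rl S s = a + 1) (hj : j = P.col (s, a)) :
    cst (P.q - P.q⁻¹)⁻¹ * (cst (P.q ^ P.kExp j S) *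
      thetaRes (P.idx j S) (P.num S) (P.den S) (Sum.inl s)) =
      P.remCoeff S (s, a) * P.addCoeff (S.erase (s, a)) (s, a) := by
  have hs : s < rows S := by
    by_contra! h
    rw [← rl_eq_zero hS] at h
    omega
  have hj' : j = P.col (s, rl S s) + 1 := by rw [ha, col_succ, hj]
  have hi : Sum.inl s ∈ P.idx j S := by simp [idx, hs, hj']
  have hL : rl S (rows S) = 0 := (rl_eq_zero hS).mpr le_rfl
  have hden : P.den S (Sum.inl s) = P.pos (s, a) := by
    simp only [den, Sum.elim_inl, pos]
    rw [ha]
    push_cast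
    rw [add_sub_cancel_right]
  have hnum : P.num S (Sum.inl s) / P.den S (Sum.inl s) = P.q ^ (-2 : ℤ) := by
    rw [div_eq_iff (P.den_ne_zero _ _), hden, pos, ← posZ_succ_succ]
    simp only [num, Sum.elim_inl, ha]
    push_cast
    rfl
  rw [P.cst_mul_thetaRes hi, hnum, hden]
  by_cases hr : Removable S (s, a)
  · rw [P.prod_facI_erase_row j S _ hs (Or.inl ⟨rfl, hj'⟩) hL, remCoeff, if_pos hr, addCoeff,
      if_pos hr.2, ← hj]
    have hprod : ∏ t ∈ Finset.range s, P.psi j t (rl (S.erase (s, a)) t) (P.pos (s, a)) =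
        ∏ t ∈ Finset.range s, P.psi j t (rl S t) (P.pos (s, a)) := by
      refine Finset.prod_congr rfl fun t ht => ?_
      have : rl S t = rl (S.erase (s, a)) t := by
        conv_lhs => rw [← Finset.insert_erase hr.1, rl_insert (Finset.notMem_erase _ _),
          if_neg (by simp only [Finset.mem_range] at ht; simp only; omega), add_zero]
      rw [this]
    rw [hprod]
    simp only [Sum.elim_inl]
    linear_combination (-(∏ t ∈ Finset.range s, P.psi j t (rl S t) (P.pos (s, a))) *
      P.tail j S s (P.pos (s, a)) (rows S)) * P.constC_mul_constC.1
  -- The last box is blocked by a row of equal length underneath. The addable factor of that row has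
  -- the same colour and a numerator θ(1).
  · have heq : rl S (s + 1) = rl S s := by
      by_contra h
      exact hr (removable_of_rl_lt hS ha (lt_of_le_of_ne (rl_succ_le hS s) h))
    have hzero : ∏ l ∈ (P.idx j S).erase (Sum.inl s), P.facI S (P.pos (s, a)) l = 0 := by
      refine Finset.prod_eq_zero (i := Sum.inr (s + 1)) ?_ ?_
      · rw [Finset.mem_erase]
        refine ⟨by simp, ?_⟩
        have hc : j = P.col (s + 1, rl S (s + 1)) := by
          rw [heq, hj']; simp only [col]; push_cast; ring
        simp [idx, hs, ← hc]
      · simp only [facI, Sum.elim_inr, facA]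
        have e : P.posZ (((s + 1 : ℕ) : ℤ) - 1) ((rl S (s + 1) : ℤ) - 1) = P.pos (s, a) := by
          rw [heq, ha, pos]; push_cast; rw [add_sub_cancel_right, add_sub_cancel_right]
        rw [e, div_self (P.pos_ne_zero _), theta_one, mul_zero, zero_mul]
    rw [hzero, remCoeff, if_neg hr, mul_zero, mul_zero, zero_mul]

/-- The residues at the addable ends. -/
theorem residue_inr {j : ZMod N} {S : Finset (ℕ × ℕ)} (hS : IsLowerSet (S : Set (ℕ × ℕ))) {s : ℕ}
    (hs : s ≤ rows S) (hj : j = P.col (s, rl S s)) :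
    cst (P.q - P.q⁻¹)⁻¹ * (cst (P.q ^ P.kExp j S) *
      thetaRes (P.idx j S) (P.num S) (P.den S) (Sum.inr s)) =
      -(P.addCoeff S (s, rl S s) * P.remCoeff (insert (s, rl S s) S) (s, rl S s)) := by
  have hi : Sum.inr s ∈ P.idx j S := by simp [idx, hj]; omega
  have hL : rl S (rows S) = 0 := (rl_eq_zero hS).mpr le_rfl
  have hden : P.den S (Sum.inr s) = P.pos (s, rl S s) := rfl
  have hnum : P.num S (Sum.inr s) / P.den S (Sum.inr s) = P.q ^ (2 : ℤ) := by
    rw [div_eq_iff (P.den_ne_zero _ _), hden, pos, ← posZ_pred_pred]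
    rfl
  rw [P.cst_mul_thetaRes hi, hnum, hden]
  by_cases ha : Addable S (s, rl S s)
  · rw [P.remCoeff_insert ha (Nat.lt_succ_self (rows S)), addCoeff, if_pos ha, ← hj]
    have hprod : ∏ l ∈ (P.idx j S).erase (Sum.inr s), P.facI S (P.pos (s, rl S s)) l =
        (∏ t ∈ Finset.range s, P.psi j t (rl S t) (P.pos (s, rl S s))) *
          P.tail j S s (P.pos (s, rl S s)) (rows S).succ := by
      -- In the first empty row there are no rows below; the boundary factor in row s + 1 has
      -- another colour, so the tail is 1.
      rcases Nat.eq_or_lt_of_le hs with h | h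
      · have ht : P.tail j S s (P.pos (s, rl S s)) (rows S).succ = 1 := by
          rw [tail, h, Finset.Ico_self, Finset.prod_empty, one_mul, if_neg]
          rw [hj, h, hL]
          simp only [col]
          push_cast
          intro h'
          exact one_ne_zero_zmod P.hN (by linear_combination -h')
        rw [ht, mul_one, h, prod_facI_erase_last]
      · rw [P.prod_facI_erase_row j S _ h (Or.inr ⟨rfl, hj⟩) hL, pos,
          P.tail_succ j hS _ le_rfl h]
    rw [hprod]
    simp only [Sum.elim_inr]
    linear_combination ((∏ t ∈ Finset.range s, P.psi j t (rl S t) (P.pos (s, rl S s))) *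
      P.tail j S s (P.pos (s, rl S s)) (rows S).succ) * P.constC_mul_constC.2
  -- The place is blocked by a row of equal length above, whose removable factor has the same colour
  -- and a numerator θ(1).
  · obtain ⟨t, rfl, heq⟩ : ∃ t, s = t + 1 ∧ rl S s = rl S t := by
      by_contra! h
      refine ha (addable_of_rl_lt hS fun t ht => lt_of_le_of_ne ?_ (h t ht))
      rw [ht]
      exact rl_succ_le hS t
    have hzero : ∏ l ∈ (P.idx j S).erase (Sum.inr (t + 1)),
        P.facI S (P.pos (t + 1, rl S (t + 1))) l = 0 := by
      refine Finset.prod_eq_zero (i := Sum.inl t) ?_ ?_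
      · rw [Finset.mem_erase]
        refine ⟨by simp, ?_⟩
        have hc : j = P.col (t, rl S t) + 1 := by
          rw [hj, heq]; simp only [col]; push_cast; ring
        simp only [idx, Finset.inl_mem_disjSum, Finset.mem_filter, Finset.mem_range]
        exact ⟨by omega, hc⟩
      · simp only [facI, Sum.elim_inl, facR]
        have e : P.posZ ((t : ℤ) + 1) (rl S t) = P.pos (t + 1, rl S (t + 1)) := by
          rw [heq, pos]; push_cast; rfl
        rw [e, div_self (P.pos_ne_zero _), theta_one, mul_zero, zero_mul]
    rw [hzero, addCoeff, if_neg ha, mul_zero, mul_zero, zero_mul, neg_zero]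

/-- The poles are positions of distinct places, one or both ends of distinct rows, hence simple. -/
theorem den_injOn (j : ZMod N) {S : Finset (ℕ × ℕ)} : Set.InjOn (P.den S) (P.idx j S) := by
  intro i hi i' hi' h
  rcases i with s | s <;> rcases i' with s' | s' <;>
    simp only [den, Sum.elim_inl, Sum.elim_inr, posZ_inj, Nat.cast_inj] at h
  · rw [h.1]
  · exfalso
    rw [← h.1] at h
    omega
  · exfalso
    rw [h.1] at h
    omega
  · rw [h.1]

theorem expandPlus_sub_expandMinus (j : ZMod N) (lam : YoungDiagram) (n : ℤ) :
    cst (P.q - P.q⁻¹)⁻¹ * (expandPlus (phiEigen laurentC P.q P.κ P.u P.k j lam) n -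
      expandMinus (phiEigen laurentC P.q P.κ P.u P.k j lam) n) =
    ∑ b ∈ boxes (lam.cells.card + 1), if P.col b = j then cst (P.pos b ^ n) *
      (P.remCoeff lam.cells b * P.addCoeff (lam.cells.erase b) b -
        P.addCoeff lam.cells b * P.remCoeff (insert b lam.cells) b) else 0 := by
  have hS := lam.isLowerSet
  have h1 : expandPlus (phiEigen laurentC P.q P.κ P.u P.k j lam) n -
      expandMinus (phiEigen laurentC P.q P.κ P.u P.k j lam) n =
      ∑ i ∈ P.idx j lam.cells, cst (P.den lam.cells i ^ n) * (cst (P.q ^ P.kExp j lam.cells) *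
        thetaRes (P.idx j lam.cells) (P.num lam.cells) (P.den lam.cells) i) := by
    have h := coeffT_thetaQuot_sub (P.idx j lam.cells) (P.num lam.cells)
      (P.den_ne_zero lam.cells) (P.den_injOn j) n
    have e1 : expandPlus (phiEigen laurentC P.q P.κ P.u P.k j lam) n =
        coeffT n (phiEigen laurentC P.q P.κ P.u P.k j lam (HahnSeries.single (1 : ℤ) (1 : ℂ))) :=
      rfl
    have e2 : expandMinus (phiEigen laurentC P.q P.κ P.u P.k j lam) n =
        coeffT (-n) (phiEigen laurentC P.q P.κ P.u P.k j lam
          (HahnSeries.single (-1 : ℤ) (1 : ℂ))) := rfl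
    rw [e1, e2, phiEigen_eq, phiEigen_eq, coeffT_C_mul, coeffT_C_mul, ← mul_sub, h, Finset.mul_sum]
    exact Finset.sum_congr rfl fun i _ => mul_left_comm _ _ _
  have hsplit : ∀ b, (if P.col b = j then cst (P.pos b ^ n) *
      (P.remCoeff lam.cells b * P.addCoeff (lam.cells.erase b) b -
        P.addCoeff lam.cells b * P.remCoeff (insert b lam.cells) b) else 0) =
      (if P.col b = j then cst (P.pos b ^ n) *
        (P.remCoeff lam.cells b * P.addCoeff (lam.cells.erase b) b) else 0) -
      (if P.col b = j then cst (P.pos b ^ n) *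
        (P.addCoeff lam.cells b * P.remCoeff (insert b lam.cells) b) else 0) := by
    intro b
    split_ifs
    · rw [mul_sub]
    · rw [sub_zero]
  have hbd : ∀ s, s ≤ rows lam.cells → ∀ a, a ≤ rl lam.cells s →
      (s, a) ∈ boxes (lam.cells.card + 1) := by
    intro s hs a ha
    have h1 := rows_le_card lam.cells
    have h2 := rl_le_card lam.cells s
    simp only [boxes, Finset.mem_product, Finset.mem_range]
    omega
  rw [h1, Finset.mul_sum, Finset.sum_congr rfl fun b _ => hsplit b, Finset.sum_sub_distrib, idx,
    Finset.sum_disjSum, ← idx]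
  -- Poles at removable ends give the products for removing and adding back, those at addable ends
  -- the products for adding and removing again, with the minus sign of the commutator.
  refine (congrArg₂ (· + ·) ?_ ?_).trans (sub_eq_add_neg _ _).symm
  · rw [sum_boxes_eq_sum_rows (M := ℂ⟦X⟧) (n := rows lam.cells) _ (fun s => rl lam.cells s - 1)
      (fun s => j = P.col (s, rl lam.cells s) + 1)]
    · refine Finset.sum_congr rfl fun s hs => ?_
      rw [Finset.mem_filter, Finset.mem_range] at hs
      obtain ⟨a, ha⟩ : ∃ a, rl lam.cells s = a + 1 := by
        refine ⟨rl lam.cells s - 1, ?_⟩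
        have : rl lam.cells s ≠ 0 := fun h => by rw [rl_eq_zero hS] at h; omega
        omega
      have hj : j = P.col (s, a) := by rw [hs.2, ha, col_succ]
      rw [mul_left_comm, P.residue_inl hS ha hj]
      simp only [ha, Nat.add_sub_cancel, hj, if_true]
      congr 3
      simp only [den, Sum.elim_inl, pos, ha]
      push_cast
      rw [add_sub_cancel_right]
    · intro s hs _
      exact hbd s hs.le _ (Nat.sub_le _ _)
    · intro b hb
      have hcol : P.col b = j := by
        by_contra h
        exact hb (if_neg h)
      have hr : Removable lam.cells b := P.removable_of_remCoeff fun h => hb (by simp [h])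
      have hrl := hr.rl_eq
      exact ⟨fst_lt_rows hS hr.1, by rw [hrl, col_succ]; exact hcol.symm, by omega⟩
  · rw [sum_boxes_eq_sum_rows (M := ℂ⟦X⟧) (n := rows lam.cells + 1) _ (fun s => rl lam.cells s)
      (fun s => j = P.col (s, rl lam.cells s)), ← Finset.sum_neg_distrib]
    · refine Finset.sum_congr rfl fun s hs => ?_
      rw [Finset.mem_filter, Finset.mem_range] at hs
      rw [mul_left_comm, P.residue_inr hS (by omega) hs.2, if_pos hs.2.symm, mul_neg]
      rfl
    · intro s hs _
      exact hbd s (by omega) _ le_rfl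
    · intro b hb
      have hcol : P.col b = j := by
        by_contra h
        exact hb (if_neg h)
      have ha : Addable lam.cells b := P.addable_of_addCoeff fun h => hb (by simp [h])
      have hsnd := ha.snd_eq
      have hlt := fst_lt_rows ha.2.2 (Finset.mem_insert_self b lam.cells)
      have hle := rows_insert_le lam.cells b
      exact ⟨by omega, by rw [← hsnd]; exact hcol.symm, hsnd⟩

variable {A : Type*} [CommRing A] [Algebra ℂ⟦X⟧ A]

/-- Terms with two different boxes cancel. The others return to λ, and their sum is the difference
of the two expansions of the eigenvalue of φ. -/
theorem commutator_ket (σ τ : A →ₐ[ℂ⟦X⟧] A) (i j : ZMod N) (m n : ℤ) (lam : YoungDiagram) :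
    P.addData.op σ i m (P.remData.op τ j n (ketS A lam.cells)) -
      P.remData.op τ j n (P.addData.op σ i m (ketS A lam.cells)) =
    if i = j then (cst (P.q - P.q⁻¹)⁻¹ *
      (expandPlus (phiEigen laurentC P.q P.κ P.u P.k i lam) (m + n) -
      expandMinus (phiEigen laurentC P.q P.κ P.u P.k i lam) (m + n))) • ketS A lam.cells
    else 0 := by
  set S := lam.cells with hSdef
  set B := S.card + 2 with hB
  have hadd : ∀ T : Finset (ℕ × ℕ), T.card < B → P.addData.op σ i m (ketS A T) =
      ∑ z ∈ boxes B, P.addData.wt i m T z • ketS A (insert z T) := fun T hT =>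
    P.addData.op_ketS σ i m T hT
  have hrem : ∀ T : Finset (ℕ × ℕ), T.card < B → P.remData.op τ j n (ketS A T) =
      ∑ w ∈ boxes B, P.remData.wt j n T w • ketS A (T.erase w) := fun T hT =>
    P.remData.op_ketS τ j n T hT
  rw [hrem S (by omega), hadd S (by omega), map_sum, map_sum]
  have e1 : ∀ w ∈ boxes B, P.addData.op σ i m (P.remData.wt j n S w • ketS A (S.erase w)) =
      ∑ z ∈ boxes B, (P.remData.wt j n S w * P.addData.wt i m (S.erase w) z) •
        ketS A (insert z (S.erase w)) := by
    intro w _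
    rw [map_smul, hadd _ (lt_of_le_of_lt Finset.card_erase_le (by omega)), Finset.smul_sum]
    simp only [smul_smul]
  have e2 : ∀ z ∈ boxes B, P.remData.op τ j n (P.addData.wt i m S z • ketS A (insert z S)) =
      ∑ w ∈ boxes B, (P.addData.wt i m S z * P.remData.wt j n (insert z S) w) •
        ketS A ((insert z S).erase w) := by
    intro z _
    rw [map_smul, hrem _ (lt_of_le_of_lt (Finset.card_insert_le _ _) (by omega)), Finset.smul_sum]
    simp only [smul_smul]
  rw [Finset.sum_congr rfl e1, Finset.sum_congr rfl e2,
    Finset.sum_comm (s := boxes B) (t := boxes B) (f := fun z w =>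
      (P.addData.wt i m S z * P.remData.wt j n (insert z S) w) • ketS A ((insert z S).erase w)),
    ← Finset.sum_sub_distrib]
  have hoff : ∀ w ∈ boxes B, (∑ z ∈ boxes B, (P.remData.wt j n S w *
        P.addData.wt i m (S.erase w) z) • ketS A (insert z (S.erase w))) -
      ∑ z ∈ boxes B, (P.addData.wt i m S z * P.remData.wt j n (insert z S) w) •
        ketS A ((insert z S).erase w) =
      (if i = j then if P.col w = i then cst (P.pos w ^ (m + n)) *
      (P.remCoeff S w * P.addCoeff (S.erase w) w -
        P.addCoeff S w * P.remCoeff (insert w S) w) else 0 else 0) • ketS A S := by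
    intro w hw
    rw [← Finset.sum_sub_distrib, Finset.sum_eq_single_of_mem w hw]
    · have k1 : P.remCoeff S w • ketS A (insert w (S.erase w)) = P.remCoeff S w • ketS A S := by
        by_cases h : Removable S w
        · rw [Finset.insert_erase h.1]
        · rw [remCoeff, if_neg h, zero_smul, zero_smul]
      have k2 : P.addCoeff S w • ketS A ((insert w S).erase w) = P.addCoeff S w • ketS A S := by
        by_cases h : Addable S w
        · rw [Finset.erase_insert h.2.1]
        · rw [addCoeff, if_neg h, zero_smul, zero_smul]
      simp only [StepData.wt]
      change ((if P.col w = j then cst (P.pos w ^ n) * P.remCoeff S w else 0) *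
        (if P.col w = i then cst (P.pos w ^ m) * P.addCoeff (S.erase w) w else 0)) • _ -
        ((if P.col w = i then cst (P.pos w ^ m) * P.addCoeff S w else 0) *
        (if P.col w = j then cst (P.pos w ^ n) * P.remCoeff (insert w S) w else 0)) • _ = _
      by_cases hi : P.col w = i
      · by_cases hj : P.col w = j
        · have hij : i = j := hi.symm.trans hj
          simp only [if_pos hi, if_pos hj, if_pos hij]
          have c1 : cst (P.pos w ^ n) * P.remCoeff S w * (cst (P.pos w ^ m) *
              P.addCoeff (S.erase w) w) = (cst (P.pos w ^ (m + n)) * P.addCoeff (S.erase w) w) *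
              P.remCoeff S w := by
            rw [zpow_add₀ (P.pos_ne_zero w), cst_mul]; ring
          have c2 : cst (P.pos w ^ m) * P.addCoeff S w * (cst (P.pos w ^ n) *
              P.remCoeff (insert w S) w) = (cst (P.pos w ^ (m + n)) * P.remCoeff (insert w S) w) *
              P.addCoeff S w := by
            rw [zpow_add₀ (P.pos_ne_zero w), cst_mul]; ring
          rw [c1, c2, mul_smul (cst _ * P.addCoeff _ _), mul_smul (cst _ * P.remCoeff (insert w S) w),
            k1, k2, smul_smul, smul_smul, ← sub_smul]
          congr 1
          ring
        · have hij : i ≠ j := fun h => hj (hi.trans h)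
          simp [hj, hij]
      · simp [hi]
    · intro z _ hzw
      rw [Finset.erase_insert_of_ne hzw, ← sub_smul]
      have h := P.remCoeff_mul_addCoeff (S := S) hzw
      have h0 : P.remData.wt j n S w * P.addData.wt i m (S.erase w) z -
          P.addData.wt i m S z * P.remData.wt j n (insert z S) w = 0 := by
        simp only [StepData.wt]
        change ((if P.col w = j then cst (P.pos w ^ n) * P.remCoeff S w else 0) *
          (if P.col z = i then cst (P.pos z ^ m) * P.addCoeff (S.erase w) z else 0)) -
          ((if P.col z = i then cst (P.pos z ^ m) * P.addCoeff S z else 0) *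
          (if P.col w = j then cst (P.pos w ^ n) * P.remCoeff (insert z S) w else 0)) = 0
        by_cases hi : P.col z = i
        · by_cases hj : P.col w = j
          · simp only [if_pos hi, if_pos hj]
            linear_combination cst (P.pos w ^ n) * cst (P.pos z ^ m) * h
          · simp [hj]
        · simp [hi]
      rw [h0, zero_smul]
  rw [Finset.sum_congr rfl hoff, ← Finset.sum_smul]
  by_cases hij : i = j
  · simp only [if_pos hij]
    congr 1
    rw [expandPlus_sub_expandMinus]
    -- The additional boxes of the larger range are neither removable nor addable.
    refine (Finset.sum_subset (StepData.boxes_mono (Nat.le_succ _)) fun b _ hb => ?_).symm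
    have h1 : ¬Removable S b := fun h =>
      hb (StepData.boxes_mono (Nat.le_succ _) (mem_boxes_card lam.isLowerSet h.1))
    have h2 : ¬Addable S b := fun h => hb (by
      have := mem_boxes_card h.2.2 (Finset.mem_insert_self b S)
      rwa [Finset.card_insert_of_notMem h.2.1] at this)
    have h3 : P.remCoeff S b = 0 := if_neg h1
    have h4 : P.addCoeff S b = 0 := if_neg h2
    rw [h3, h4, zero_mul, zero_mul, sub_zero, mul_zero, ite_self]
  · simp [hij]

end FockData

/-- The cast of `List.range N` to a list over `ZMod N` inside `prodI` is a `flatMap`; it is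
rewritten as a `map`. -/
theorem prodI_eq (N : ℕ) {V : Type*} [AddCommGroup V] [Module ℂ⟦X⟧ V] (T : ZMod N → Op V) :
    prodI N T = (((List.range N).map fun i : ℕ => (i : ZMod N)).map T).prod := by
  exact congrArg (fun l : List (ZMod N) => (l.map T).prod) List.map_eq_flatMap.symm

/-! ### Translations on 𝔽[[p]] -/

section Shift

variable (N : ℕ) [NeZero N]

theorem shift_algebraMap (β : HStar N) (f : Entire N) :
    shift N β (algebraMap (Entire N) (MerField N) f) =
      algebraMap (Entire N) (MerField N) (shiftEntire N β f) :=
  IsLocalization.map_eq (nonZeroDivisors_le_comap_nonZeroDivisors_of_injective _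
    (shiftEntire_injective N β)) f

theorem shift_comp (β β' : HStar N) : (shift N β).comp (shift N β') = shift N (β + β') := by
  refine IsLocalization.ringHom_ext (nonZeroDivisors (Entire N)) (RingHom.ext fun f => ?_)
  simp only [RingHom.comp_apply, shift_algebraMap]
  refine congrArg _ (Subtype.ext (funext fun μ => ?_))
  change f.1 (μ + β + β') = f.1 (μ + (β + β'))
  rw [add_assoc]

theorem shift_zero : shift N 0 = RingHom.id _ := by
  refine IsLocalization.ringHom_ext (nonZeroDivisors (Entire N)) (RingHom.ext fun f => ?_)
  simp only [RingHom.comp_apply, shift_algebraMap, RingHom.id_apply]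
  refine congrArg _ (Subtype.ext (funext fun μ => ?_))
  change f.1 (μ + 0) = f.1 μ
  rw [add_zero]

theorem shift_algebraMap_complex (β : HStar N) (c : ℂ) :
    shift N β (algebraMap ℂ (MerField N) c) = algebraMap ℂ (MerField N) c := by
  rw [IsScalarTower.algebraMap_apply ℂ (Entire N) (MerField N), shift_algebraMap]
  rfl

/-- The coefficientwise translation as a homomorphism of `ℂ⟦X⟧`-algebras. -/
def shiftA (β : HStar N) : (MerField N)⟦X⟧ →ₐ[ℂ⟦X⟧] (MerField N)⟦X⟧ where
  toRingHom := shiftP N β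
  commutes' c := by
    change PowerSeries.map (shift N β) (PowerSeries.map (algebraMap ℂ (MerField N)) c) =
      PowerSeries.map (algebraMap ℂ (MerField N)) c
    ext n
    simp only [PowerSeries.coeff_map, shift_algebraMap_complex]

theorem shiftA_apply (β : HStar N) (g : (MerField N)⟦X⟧) : shiftA N β g = shiftP N β g := rfl

theorem shiftA_comp (β β' : HStar N) : (shiftA N β).comp (shiftA N β') = shiftA N (β + β') := by
  ext g n
  simp only [AlgHom.comp_apply, shiftA_apply, shiftP, PowerSeries.coeff_map, ← shift_comp,
    RingHom.comp_apply]

theorem shiftA_zero : shiftA N 0 = AlgHom.id _ _ := by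
  ext g n
  simp only [shiftA_apply, shiftP, PowerSeries.coeff_map, shift_zero, RingHom.id_apply,
    AlgHom.id_apply]

theorem sum_cartan_left (i : ZMod N) : ∑ j : ZMod N, cartan N j i = 0 := by
  simp only [cartan, Finset.sum_sub_distrib, Finset.sum_ite_eq', Finset.mem_univ, if_true]
  have : ∀ x : ZMod N, i = x + 1 ↔ x = i - 1 := fun x => by
    rw [eq_comm, eq_sub_iff_add_eq]
  simp only [this, Finset.sum_ite_eq', Finset.mem_univ, if_true]
  norm_num

/-- The columns of the affine Cartan matrix sum to zero. Hence the translations in ∏ K_i^± cancel,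
and this product is an honest scalar. -/
theorem sum_rootQ : ∑ j : ZMod N, rootQ N j = 0 := by
  have h : ∀ i : ZMod N, ∑ j : ZMod N, (cartan N j i : ℂ) = 0 := fun i => by
    rw [← Int.cast_sum, sum_cartan_left, Int.cast_zero]
  refine Prod.ext ?_ (Prod.ext ?_ ?_)
  · simp [rootQ, Prod.fst_sum]
  · simp [rootQ, Prod.fst_sum, Prod.snd_sum]
  · rw [Prod.snd_sum, Prod.snd_sum]
    funext i
    rw [Finset.sum_apply]
    exact h i

theorem sum_range_cast {M : Type*} [AddCommMonoid M] (f : ZMod N → M) :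
    ((List.range N).map fun i : ℕ => f (i : ZMod N)).sum = ∑ j : ZMod N, f j := by
  rw [← List.sum_toFinset _ List.nodup_range, List.toFinset_range]
  refine Finset.sum_bij (fun i _ => (i : ZMod N)) (fun _ _ => Finset.mem_univ _) ?_ ?_
    fun _ _ => rfl
  · intro a ha b hb h
    rw [Finset.mem_range] at ha hb
    rw [← ZMod.val_cast_of_lt ha, ← ZMod.val_cast_of_lt hb, h]
  · intro j _
    exact ⟨j.val, Finset.mem_range.mpr (ZMod.val_lt j), ZMod.natCast_zmod_val j⟩

end Shift

/-- Commuting translations by `H^*` on a `ℂ⟦X⟧`-algebra. -/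
structure ShiftAction (N : ℕ) (A : Type*) [CommRing A] [Algebra ℂ⟦X⟧ A] where
  sh : HStar N → A →ₐ[ℂ⟦X⟧] A
  zero : sh 0 = AlgHom.id _ _
  comp : ∀ β β', (sh β).comp (sh β') = sh (β + β')

/-- Translations acting on `𝔽⟦X⟧`. -/
def merShift (N : ℕ) [NeZero N] : ShiftAction N (MerField N)⟦X⟧ :=
  ⟨shiftA N, shiftA_zero N, shiftA_comp N⟩

namespace ShiftAction

variable {N : ℕ} {A : Type*} [CommRing A] [Algebra ℂ⟦X⟧ A] (s : ShiftAction N A)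

theorem comm (β β' : HStar N) : (s.sh β).comp (s.sh β') = (s.sh β').comp (s.sh β) := by
  rw [s.comp, s.comp, add_comm]

theorem list_prod_diagOp {Y : Type*} (β : ZMod N → HStar N) (e : ZMod N → Y → ℂ⟦X⟧)
    (l : List (ZMod N)) :
    (l.map fun i => diagOp (s.sh (β i)) (e i)).prod =
      diagOp (s.sh (l.map β).sum) fun y => (l.map fun i => e i y).prod := by
  induction l with
  | nil =>
    simp only [List.map_nil, List.prod_nil, List.sum_nil, s.zero]
    rw [diagOp_id_const, one_smul]
  | cons i l ih =>
    simp only [List.map_cons, List.prod_cons, List.sum_cons]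
    rw [ih, diagOp_mul, s.comp]

end ShiftAction



/-! ### Diagonal operators against operators that change one box -/

section DiagStep

variable {A : Type*} [CommRing A] [Algebra ℂ⟦X⟧ A]

theorem diagOp_ketS (τ : A →ₐ[ℂ⟦X⟧] A) (e : Finset (ℕ × ℕ) → ℂ⟦X⟧) (S : Finset (ℕ × ℕ)) :
    diagOp τ (fun y : YoungDiagram => e y.cells) (ketS A S) = e S • ketS A S := by
  by_cases h : IsLowerSet (S : Set (ℕ × ℕ))
  · have h1 : ketS A S = Finsupp.single ⟨S, h⟩ 1 := ketS_cells (A := A) ⟨S, h⟩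
    rw [h1, diagOp_single_one]
  · rw [ketS_of_not h, map_zero, smul_zero]

theorem diagOp_commute {Y : Type*} {σ τ : A →ₐ[ℂ⟦X⟧] A} (h : σ.comp τ = τ.comp σ)
    (e e' : Y → ℂ⟦X⟧) : Commute (diagOp σ e) (diagOp τ e') := by
  rw [Commute, SemiconjBy, diagOp_mul, diagOp_mul, h]
  congr 1
  funext y
  rw [mul_comm]

variable {N : ℕ} {D : StepData N}

theorem StepData.diagOp_op_ketS (σ τ : A →ₐ[ℂ⟦X⟧] A) (j : ZMod N) (n : ℤ)
    (e : Finset (ℕ × ℕ) → ℂ⟦X⟧) (S : Finset (ℕ × ℕ)) {m : ℕ} (hm : S.card < m) :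
    diagOp τ (fun y : YoungDiagram => e y.cells) (D.op σ j n (ketS A S)) =
      ∑ b ∈ boxes m, (D.wt j n S b * e (D.st S b)) • ketS A (D.st S b) := by
  rw [D.op_ketS σ j n S hm, map_sum]
  refine Finset.sum_congr rfl fun b _ => ?_
  rw [map_smul, diagOp_ketS, smul_smul]

/-- If every step of colour j multiplies the eigenvalue by the same constant, the operators commute
up to that constant; this gives the relations of K^±. -/
theorem StepData.diagOp_mul_op {σ τ : A →ₐ[ℂ⟦X⟧] A} (hστ : σ.comp τ = τ.comp σ) (j : ZMod N)
    (n : ℤ) {e : Finset (ℕ × ℕ) → ℂ⟦X⟧} {c : ℂ⟦X⟧}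
    (h : ∀ S b, D.c S b ≠ 0 → D.col b = j → e (D.st S b) = c * e S) :
    diagOp τ (fun y : YoungDiagram => e y.cells) * D.op σ j n =
      c • (D.op σ j n * diagOp τ (fun y : YoungDiagram => e y.cells)) := by
  refine IsSemi.ext ((isSemi_diagOp τ _).mul (D.isSemi_op σ j n)) (IsSemi.smul c ?_) fun y => ?_
  · rw [← hστ]
    exact (D.isSemi_op σ j n).mul (isSemi_diagOp τ _)
  · rw [← ketS_cells, LinearMap.smul_apply, Module.End.mul_apply, Module.End.mul_apply,
      StepData.diagOp_op_ketS σ τ j n e _ (Nat.lt_succ_self _), diagOp_ketS, map_smul,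
      D.op_ketS σ j n _ (Nat.lt_succ_self _), Finset.smul_sum, Finset.smul_sum]
    refine Finset.sum_congr rfl fun b _ => ?_
    rw [smul_smul, smul_smul]
    by_cases hc : D.c y.cells b = 0
    · rw [D.wt_eq_zero hc]; simp
    · by_cases hj : D.col b = j
      · rw [h _ b hc hj]; congr 1; ring
      · simp [StepData.wt, hj]

/-- If a step at b increases the eigenvalue by c·pos(b)^l, the commutator multiplies the coefficient
by that amount, which raises the mode by l; this gives the relations of α^∨. -/
theorem StepData.diagOp_op_sub {σ : A →ₐ[ℂ⟦X⟧] A} (j : ZMod N) (n l : ℤ)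
    {e : Finset (ℕ × ℕ) → ℂ⟦X⟧} {c : ℂ⟦X⟧}
    (h : ∀ S b, D.c S b ≠ 0 → D.col b = j → e (D.st S b) = e S + c * cst (D.pos b ^ l)) :
    diagOp (AlgHom.id _ _) (fun y : YoungDiagram => e y.cells) * D.op σ j n -
      D.op σ j n * diagOp (AlgHom.id _ _) (fun y : YoungDiagram => e y.cells) =
      c • D.op σ j (n + l) := by
  refine IsSemi.ext (IsSemi.sub ((isSemi_diagOp _ _).mul (D.isSemi_op σ j n))
    ((D.isSemi_op σ j n).mul (isSemi_diagOp _ _))) ((D.isSemi_op σ j (n + l)).smul c) fun y => ?_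
  rw [← ketS_cells, LinearMap.smul_apply, LinearMap.sub_apply, Module.End.mul_apply,
    Module.End.mul_apply, StepData.diagOp_op_ketS σ _ j n e _ (Nat.lt_succ_self _), diagOp_ketS,
    map_smul, D.op_ketS σ j n _ (Nat.lt_succ_self _), D.op_ketS σ j (n + l) _ (Nat.lt_succ_self _),
    Finset.smul_sum, Finset.smul_sum, ← Finset.sum_sub_distrib]
  refine Finset.sum_congr rfl fun b _ => ?_
  rw [smul_smul, smul_smul, ← sub_smul]
  congr 1
  by_cases hc : D.c y.cells b = 0
  · rw [D.wt_eq_zero hc, D.wt_eq_zero hc]; simp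
  · by_cases hj : D.col b = j
    · rw [h _ b hc hj]
      simp only [StepData.wt, if_pos hj]
      rw [zpow_add₀ (D.pos_ne_zero b), cst_mul]
      ring
    · simp [StepData.wt, hj]

end DiagStep

section Generic

variable {A : Type*} [CommRing A] [Algebra ℂ⟦X⟧ A] {Y : Type*}

theorem commute_smul_one (c : ℂ⟦X⟧) (T : Op (Y →₀ A)) : Commute (c • (1 : Op (Y →₀ A))) T :=
  (Commute.one_left T).smul_left c

theorem smul_one_apply_smul (c : ℂ⟦X⟧) (g : A) (v : Y →₀ A) :
    (c • (1 : Op (Y →₀ A))) (g • v) = g • (c • (1 : Op (Y →₀ A))) v :=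
  smul_comm c g v

theorem IsSemi.smul_sub {σ : A →ₐ[ℂ⟦X⟧] A} {S T : Op (Y →₀ A)} (hS : IsSemi σ S)
    (hT : IsSemi σ T) (c : ℂ⟦X⟧) : IsSemi σ (c • (S - T)) :=
  (hS.sub hT).smul c

theorem commutator_eq_smul {S T : Op (Y →₀ A)} (h : Commute S T) {c : ℂ⟦X⟧} (hc : c = 0) :
    S * T - T * S = c • (1 : Op (Y →₀ A)) := by
  rw [h.eq, hc, zero_smul]
  exact sub_self (T * S)

end Generic

/-! ### The generators and their relations over a ring with translations -/

namespace FockData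

variable {N : ℕ} (P : FockData N) {A : Type*} [CommRing A] [Algebra ℂ⟦X⟧ A] (s : ShiftAction N A)

/-- The action of the generators over a coefficient ring with translations. -/
def ops : ToroidalOps N (YoungDiagram →₀ A) where
  alpha j l := diagOp (AlgHom.id _ _) fun y => cst (P.alphaEig j l y.cells)
  -- The relation g x = x τ_β g says that x is semilinear for τ_{-β}; this explains the signs of the
  -- translations here and below.
  xPlus j n := P.addData.op (s.sh (rootQ N j - rootA N j)) j n
  xMinus j n := P.remData.op (s.sh (rootA N j)) j n
  KPlus j := diagOp (s.sh (rootQ N j)) fun y => cst (P.q ^ P.kExp j y.cells)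
  KMinus j := diagOp (s.sh (rootQ N j)) fun y => cst (P.q ^ (-P.kExp j y.cells))
  phiPlus j n := diagOp (s.sh (rootQ N j)) fun y =>
    expandPlus (phiEigen laurentC P.q P.κ P.u P.k j y) n
  phiMinus j n := diagOp (s.sh (rootQ N j)) fun y =>
    expandMinus (phiEigen laurentC P.q P.κ P.u P.k j y) n

theorem diagOp_shift_bijective {Y : Type*} (β : HStar N) {e : Y → ℂ} (he : ∀ y, e y ≠ 0) :
    Function.Bijective (diagOp (Y := Y) (s.sh β) fun y => cst (e y)) := by
  have key : ∀ (β : HStar N) (e : Y → ℂ), (∀ y, e y ≠ 0) →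
      diagOp (s.sh β) (fun y => cst (e y)) * diagOp (s.sh (-β)) (fun y => cst (e y)⁻¹) =
        1 := by
    intro β e he
    rw [diagOp_mul, s.comp, add_neg_cancel, s.zero]
    have h : (fun y => cst (e y) * cst (e y)⁻¹) = fun _ => (1 : ℂ⟦X⟧) := by
      funext y
      rw [← cst_mul, mul_inv_cancel₀ (he y), cst_one]
    rw [h, diagOp_id_const, one_smul]
  have h1 := key β e he
  have h2 := key (-β) (fun y => (e y)⁻¹) fun y => inv_ne_zero (he y)
  simp only [inv_inv, neg_neg] at h2
  exact Function.bijective_iff_has_inverse.mpr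
    ⟨_, fun v => LinearMap.congr_fun h2 v, fun v => LinearMap.congr_fun h1 v⟩

theorem prodI_diagOp [NeZero N] {Y : Type*} (f : ZMod N → Y → ℤ) {q : ℂ} (hq : q ≠ 0) {m : ℤ}
    (h : ∀ y, ∑ j, f j y = m) :
    prodI N (fun j => diagOp (s.sh (rootQ N j)) fun y => cst (q ^ f j y)) =
      cst (q ^ m) • (1 : Op (Y →₀ A)) := by
  rw [prodI_eq, s.list_prod_diagOp, List.map_map, ← diagOp_id_const]
  have h1 : (List.map ((rootQ N) ∘ fun i : ℕ => (i : ZMod N)) (List.range N)).sum = 0 :=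
    (sum_range_cast N (rootQ N)).trans (sum_rootQ N)
  rw [h1, s.zero]
  congr 1
  funext y
  have h2 : ∀ l : List (ZMod N), (l.map fun i => cst (q ^ f i y)).prod =
      cst (q ^ (l.map fun i => f i y).sum) := by
    intro l
    induction l with
    | nil => simp [cst_one]
    | cons a l ih => simp only [List.map_cons, List.prod_cons, List.sum_cons, ih, zpow_add₀ hq,
        cst_mul]
  rw [h2, List.map_map]
  congr 2
  exact (sum_range_cast N fun j => f j y).trans (h y)

theorem prodI_KPlus [NeZero N] : prodI N (P.ops s).KPlus = cst (P.q ^ (-1 : ℤ)) • (1 : Op (YoungDiagram →₀ A)) :=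
  prodI_diagOp s _ P.hq fun y => P.sum_kExp y.cells

theorem prodI_KMinus [NeZero N] : prodI N (P.ops s).KMinus = cst (P.q ^ (1 : ℤ)) • (1 : Op (YoungDiagram →₀ A)) :=
  prodI_diagOp s _ P.hq fun y => by rw [Finset.sum_neg_distrib, P.sum_kExp y.cells, neg_neg]

theorem smul_apply_of_isSemi {Y : Type*} {β β' : HStar N} {T : Op (Y →₀ A)}
    (hT : IsSemi (s.sh β) T) (h : β + β' = 0) (g : A) (v : Y →₀ A) :
    g • T v = T (s.sh β' g • v) := by
  rw [hT, ← AlgHom.comp_apply, s.comp, h, s.zero, AlgHom.id_apply]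

/-- At q^{c/2} = 1 one has p^* = p. -/
theorem nomeRatio_one {l : ℤ} (hl : l ≠ 0) : nomeRatio 1 l = 1 := by
  have h : PowerSeries.constantCoeff (1 - nome ^ l.natAbs) ≠ 0 := by
    rw [map_sub, map_pow, nome, PowerSeries.constantCoeff_X,
      zero_pow (Int.natAbs_ne_zero.mpr hl)]
    simp
  rw [nomeRatio, pStar_one, PowerSeries.mul_inv_cancel _ h, one_zpow, cst_one, ite_self, mul_one]

theorem addData_alpha (i j : ZMod N) {l : ℤ} (hl : l ≠ 0) (S : Finset (ℕ × ℕ)) (b : ℕ × ℕ)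
    (hc : P.addData.c S b ≠ 0) (hj : P.addData.col b = j) :
    cst (P.alphaEig i l (P.addData.st S b)) = cst (P.alphaEig i l S) +
      cst (qnum P.q (cartan N i j * l) / l * P.κ ^ (-(l * mMat N i j))) *
        cst (P.addData.pos b ^ l) := by
  subst hj
  have ha : Addable S b := P.addable_of_addCoeff hc
  change cst (P.alphaEig i l (insert b S)) = _ +
    cst (qnum P.q (cartan N i (P.col b) * l) / l * P.κ ^ (-(l * mMat N i (P.col b)))) *
      cst (P.pos b ^ l)
  rw [P.alphaEig_insert i hl ha, cst_add, cst_mul _ (P.pos b ^ l)]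

theorem remData_alpha (i j : ZMod N) {l : ℤ} (hl : l ≠ 0) (S : Finset (ℕ × ℕ)) (b : ℕ × ℕ)
    (hc : P.remData.c S b ≠ 0) (hj : P.remData.col b = j) :
    cst (P.alphaEig i l (P.remData.st S b)) = cst (P.alphaEig i l S) +
      -cst (qnum P.q (cartan N i j * l) / l * P.κ ^ (-(l * mMat N i j))) *
        cst (P.remData.pos b ^ l) := by
  subst hj
  have ha : Removable S b := P.removable_of_remCoeff hc
  change cst (P.alphaEig i l (S.erase b)) = _ +
    -cst (qnum P.q (cartan N i (P.col b) * l) / l * P.κ ^ (-(l * mMat N i (P.col b)))) *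
      cst (P.pos b ^ l)
  have h := P.alphaEig_insert i hl ha.2
  rw [Finset.insert_erase ha.1] at h
  rw [h, cst_add, cst_mul _ (P.pos b ^ l)]
  ring

theorem addData_K (i j : ZMod N) (S : Finset (ℕ × ℕ)) (b : ℕ × ℕ)
    (hc : P.addData.c S b ≠ 0) (hj : P.addData.col b = j) :
    P.kExp i (P.addData.st S b) = cartan N i j + P.kExp i S := by
  subst hj
  rw [add_comm]
  exact P.kExp_insert i (P.addable_of_addCoeff hc)

theorem remData_K (i j : ZMod N) (S : Finset (ℕ × ℕ)) (b : ℕ × ℕ)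
    (hc : P.remData.c S b ≠ 0) (hj : P.remData.col b = j) :
    P.kExp i (P.remData.st S b) = -cartan N i j + P.kExp i S := by
  subst hj
  have ha : Removable S b := P.removable_of_remCoeff hc
  have h := P.kExp_insert i ha.2
  rw [Finset.insert_erase ha.1] at h
  change P.kExp i (S.erase b) = -cartan N i (P.col b) + _
  rw [h]
  ring

theorem phiPlusRel (i : ZMod N) :
    PhiPlusRel P.q 1 ((P.ops s).alpha i) ((P.ops s).KPlus i) ((P.ops s).phiPlus i) := by
  refine phiPlusRel_diagOp (fun n _ => isDiag_diagOp _) fun y n M => ?_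
  have h := nome_pow_dvd_expandPlus (P.idx i y.cells) (P.num y.cells) (P.den y.cells)
    P.q_sub_inv_ne_zero (P.q ^ P.kExp i y.cells) (fun l => P.alphaEig_eq i l y.cells) n M
  rwa [← phiEigen_eq] at h

theorem phiMinusRel (i : ZMod N) :
    PhiMinusRel P.q 1 ((P.ops s).alpha i) ((P.ops s).KMinus i) ((P.ops s).phiMinus i) := by
  refine phiMinusRel_diagOp (fun n _ => isDiag_diagOp _) fun y n M => ?_
  have h := nome_pow_dvd_expandMinus (P.idx i y.cells) (P.num_ne_zero y.cells)
    (P.den_ne_zero y.cells) P.q_sub_inv_ne_zero (P.prod_num_div_den i y.cells)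
    (fun l => P.alphaEig_eq i l y.cells) n M
  rwa [← phiEigen_eq] at h

theorem xPlus_mul_xMinus (i j : ZMod N) (m n : ℤ) :
    (P.ops s).xPlus i m * (P.ops s).xMinus j n - (P.ops s).xMinus j n * (P.ops s).xPlus i m =
      if i = j then cst ((P.q - P.q⁻¹)⁻¹) •
        ((P.ops s).phiPlus i (m + n) - (P.ops s).phiMinus i (m + n)) else 0 := by
  have hadd := P.addData.isSemi_op (s.sh (rootQ N i - rootA N i)) i m
  have hrem := P.remData.isSemi_op (s.sh (rootA N j)) j n
  refine IsSemi.ext (σ := s.sh (rootQ N i - rootA N i + rootA N j)) ?_ ?_ fun y => ?_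
  · rw [← s.comp]
    refine IsSemi.sub (hadd.mul hrem) ?_
    rw [s.comm]
    exact hrem.mul hadd
  · split_ifs with h
    · rw [h, sub_add_cancel]
      have h1 : IsSemi (s.sh (rootQ N j)) ((P.ops s).phiPlus j (m + n)) := isSemi_diagOp _ _
      have h2 : IsSemi (s.sh (rootQ N j)) ((P.ops s).phiMinus j (m + n)) := isSemi_diagOp _ _
      exact h1.smul_sub h2 _
    · exact IsSemi.zero _
  · rw [← ketS_cells]
    refine (P.commutator_ket _ _ i j m n y).trans ?_
    split_ifs with h
    · rw [LinearMap.smul_apply, LinearMap.sub_apply, ketS_cells]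
      simp only [ops]
      rw [diagOp_single_one, diagOp_single_one, ← sub_smul, smul_smul]
    · rfl

theorem K_xPlus (i j : ZMod N) (n : ℤ) :
    (P.ops s).KPlus i * (P.ops s).xPlus j n =
      cst (P.q ^ cartan N i j) • ((P.ops s).xPlus j n * (P.ops s).KPlus i) ∧
    (P.ops s).KMinus i * (P.ops s).xPlus j n =
      cst (P.q ^ (-cartan N i j)) • ((P.ops s).xPlus j n * (P.ops s).KMinus i) :=
  ⟨StepData.diagOp_mul_op (s.comm _ _) j n (e := fun S => cst (P.q ^ P.kExp i S))
    fun S b hc hj => by rw [P.addData_K i j S b hc hj, zpow_add₀ P.hq, cst_mul],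
  StepData.diagOp_mul_op (s.comm _ _) j n (e := fun S => cst (P.q ^ (-P.kExp i S)))
    fun S b hc hj => by rw [P.addData_K i j S b hc hj, neg_add, zpow_add₀ P.hq, cst_mul]⟩

theorem K_xMinus (i j : ZMod N) (n : ℤ) :
    (P.ops s).KPlus i * (P.ops s).xMinus j n =
      cst (P.q ^ (-cartan N i j)) • ((P.ops s).xMinus j n * (P.ops s).KPlus i) ∧
    (P.ops s).KMinus i * (P.ops s).xMinus j n =
      cst (P.q ^ cartan N i j) • ((P.ops s).xMinus j n * (P.ops s).KMinus i) :=
  ⟨StepData.diagOp_mul_op (s.comm _ _) j n (e := fun S => cst (P.q ^ P.kExp i S))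
    fun S b hc hj => by rw [P.remData_K i j S b hc hj, zpow_add₀ P.hq, cst_mul],
  StepData.diagOp_mul_op (s.comm _ _) j n (e := fun S => cst (P.q ^ (-P.kExp i S)))
    fun S b hc hj => by
      rw [P.remData_K i j S b hc hj, neg_add, neg_neg, zpow_add₀ P.hq, cst_mul]⟩

theorem alpha_xPlus (i j : ZMod N) {l : ℤ} (n : ℤ) (hl : l ≠ 0) :
    (P.ops s).alpha i l * (P.ops s).xPlus j n - (P.ops s).xPlus j n * (P.ops s).alpha i l =
      cst (qnum P.q (cartan N i j * l) / l * P.κ ^ (-(l * mMat N i j))) • (P.ops s).xPlus j (n + l) :=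
  StepData.diagOp_op_sub j n l (e := fun S => cst (P.alphaEig i l S)) (P.addData_alpha i j hl)

theorem alpha_xMinus (i j : ZMod N) {l : ℤ} (n : ℤ) (hl : l ≠ 0) :
    (P.ops s).alpha i l * (P.ops s).xMinus j n - (P.ops s).xMinus j n * (P.ops s).alpha i l =
      -(cst (qnum P.q (cartan N i j * l) / l * P.κ ^ (-(l * mMat N i j)))) •
        (P.ops s).xMinus j (n + l) :=
  StepData.diagOp_op_sub j n l (e := fun S => cst (P.alphaEig i l S)) (P.remData_alpha i j hl)

theorem exchange_xPlus (i j : ZMod N) : ExchangeRel P.q P.κ (mMat N i j) (cartan N i j)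
    (gSeries P.q (cartan N i j) nome) ((P.ops s).xPlus i) ((P.ops s).xPlus j) := by
  have h := StepData.exchangeRel (A := A) P.hκ P.exchange_add
    (σ := fun j => s.sh (rootQ N j - rootA N j)) (fun _ _ => s.comm _ _) i j
  rw [one_mul] at h
  exact h

theorem exchange_xMinus (i j : ZMod N) : ExchangeRel P.q P.κ (mMat N i j) (-cartan N i j)
    (gSeries P.q (-cartan N i j) nome) ((P.ops s).xMinus i) ((P.ops s).xMinus j) := by
  have h := StepData.exchangeRel (A := A) P.hκ P.exchange_rem
    (σ := fun j => s.sh (rootA N j)) (fun _ _ => s.comm _ _) i j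
  rw [neg_one_mul] at h
  exact h

theorem serre_zero (i j : ZMod N) (m n : ℤ) (hij : i ≠ j) (ha : cartan N i j = 0) :
    Commute ((P.ops s).xPlus i m) ((P.ops s).xPlus j n) ∧
      Commute ((P.ops s).xMinus i m) ((P.ops s).xMinus j n) := by
  have hm : mMat N i j = 0 := by
    rcases cartan_mMat_cases P.hN i j with h | h | h | h <;> omega
  exact ⟨StepData.commute_op P.exchange_add P.pos_injective
    (σ := fun j => s.sh (rootQ N j - rootA N j)) (fun _ _ => s.comm _ _) hij ha hm m n,
    StepData.commute_op P.exchange_rem P.pos_injective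
    (σ := fun j => s.sh (rootA N j)) (fun _ _ => s.comm _ _) hij ha hm m n⟩

theorem serre_xPlus {i j : ZMod N} (hij : cartan N i j = -1) : SerreRel P.q P.κ (mMat N i j)
    (gSeries P.q (cartan N i i) nome) (gSeries P.q (cartan N i j) nome)
    ((P.ops s).xPlus i) ((P.ops s).xPlus j) := by
  have h := StepData.serreRel (A := A) P.hq P.hκ P.q_sq_ne_one (Or.inl rfl)
    P.exchange_add P.separated_add (σ := fun j => s.sh (rootQ N j - rootA N j))
    (fun _ _ => s.comm _ _) (cartan_self P.hN i) hij
  rw [one_mul, one_mul] at h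
  exact h

theorem serre_xMinus {i j : ZMod N} (hij : cartan N i j = -1) : SerreRel P.q P.κ (mMat N i j)
    (gSeries P.q (-cartan N i i) nome) (gSeries P.q (-cartan N i j) nome)
    ((P.ops s).xMinus i) ((P.ops s).xMinus j) := by
  have h := StepData.serreRel (A := A) P.hq P.hκ P.q_sq_ne_one (Or.inr rfl)
    P.exchange_rem P.separated_rem (σ := fun j => s.sh (rootA N j))
    (fun _ _ => s.comm _ _) (cartan_self P.hN i) hij
  rw [neg_one_mul, neg_one_mul] at h
  exact h

theorem K_alpha (i j : ZMod N) (l : ℤ) : Commute ((P.ops s).KPlus i) ((P.ops s).alpha j l) ∧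
    Commute ((P.ops s).KMinus i) ((P.ops s).alpha j l) :=
  have h : (s.sh (rootQ N i)).comp (AlgHom.id _ _) = (AlgHom.id _ _).comp (s.sh (rootQ N i)) := by
    rw [AlgHom.comp_id, AlgHom.id_comp]
  ⟨diagOp_commute h _ _, diagOp_commute h _ _⟩

theorem xPlus_mul_xMinus_one (i j : ZMod N) (m n : ℤ) :
    (P.ops s).xPlus i m * (P.ops s).xMinus j n - (P.ops s).xMinus j n * (P.ops s).xPlus i m =
      if i = j then cst ((P.q - P.q⁻¹)⁻¹) •
        (cst 1 • (P.ops s).phiPlus i (m + n) - cst 1 • (P.ops s).phiMinus i (m + n)) else 0 := by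
  rw [cst_one, one_smul, one_smul]
  exact P.xPlus_mul_xMinus s i j m n

/-- The central term contains q^{lc} - q^{-lc} = 0, in accordance with the commutativity of diagonal
operators. -/
theorem alpha_alpha (i j : ZMod N) (l m : ℤ) :
    (P.ops s).alpha i l * (P.ops s).alpha j m - (P.ops s).alpha j m * (P.ops s).alpha i l =
      (if l + m = 0 then
        cst (qnum P.q (cartan N i j * l) / l *
          (((1 : ℂ) ^ (2 * l) - 1 ^ (-(2 * l))) / (P.q - P.q⁻¹)) *
          P.κ ^ (-(l * mMat N i j)) * 1 ^ (-(2 * l))) * nomeRatio 1 l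
      else 0) • (1 : Op (YoungDiagram →₀ A)) := by
  have h : Commute ((P.ops s).alpha i l) ((P.ops s).alpha j m) := diagOp_commute rfl _ _
  refine commutator_eq_smul h ?_
  rw [one_zpow, one_zpow, sub_self, zero_div, mul_zero, zero_mul, zero_mul, cst_zero, zero_mul,
    ite_self]

end FockData

/-! ### The representation on the q-Fock space -/

namespace FockData

variable {N : ℕ} (P : FockData N) [NeZero N]

/-- The action of the generators on the `q`-Fock space. -/
def fockOps : ToroidalOps N (Fock N) := P.ops (merShift N)

theorem isRep : IsRep P.q P.κ 1 P.fockOps where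
  KPlus_bij i := diagOp_shift_bijective (merShift N) _ fun y => zpow_ne_zero _ P.hq
  KMinus_bij i := diagOp_shift_bijective (merShift N) _ fun y => zpow_ne_zero _ P.hq
  prod_smul g v := by
    rw [fockOps, prodI_KPlus, prodI_KMinus]
    exact ⟨smul_one_apply_smul _ _ _, smul_one_apply_smul _ _ _⟩
  prod_x i n := by
    rw [fockOps, prodI_KPlus, prodI_KMinus]
    exact ⟨commute_smul_one _ _, commute_smul_one _ _, commute_smul_one _ _,
      commute_smul_one _ _⟩
  g_xPlus g j n v := smul_apply_of_isSemi (merShift N) (P.addData.isSemi_op _ j n) (by abel) g v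
  g_xMinus g j n v := smul_apply_of_isSemi (merShift N) (P.remData.isSemi_op _ j n) (by abel) g v
  g_KPlus g j v := smul_apply_of_isSemi (merShift N) (isSemi_diagOp _ _) (by abel) g v
  g_KMinus g j v := smul_apply_of_isSemi (merShift N) (isSemi_diagOp _ _) (by abel) g v
  g_alpha g j l v _ := (isSemi_diagOp (AlgHom.id _ _) _ g v).symm
  K_K i j := ⟨diagOp_commute ((merShift N).comm _ _) _ _,
    diagOp_commute ((merShift N).comm _ _) _ _, diagOp_commute ((merShift N).comm _ _) _ _⟩
  K_alpha i j l _ := P.K_alpha (merShift N) i j l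
  K_xPlus := P.K_xPlus (merShift N)
  K_xMinus := P.K_xMinus (merShift N)
  alpha_alpha i j l m _ _ := P.alpha_alpha (merShift N) i j l m
  alpha_xPlus i j l n hl := by
    rw [nomeRatio_one hl, one_zpow, mul_one, mul_one]
    exact P.alpha_xPlus (merShift N) i j n hl
  alpha_xMinus i j l n hl := P.alpha_xMinus (merShift N) i j n hl
  phiPlus_def := P.phiPlusRel (merShift N)
  phiMinus_def := P.phiMinusRel (merShift N)
  xPlus_xPlus i j := by
    rw [pStar_one]
    exact P.exchange_xPlus (merShift N) i j
  xMinus_xMinus i j := by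
    rw [gSeriesInv_nome]
    exact P.exchange_xMinus (merShift N) i j
  xPlus_xMinus i j m n := by
    rw [one_zpow, one_zpow]
    exact P.xPlus_mul_xMinus_one (merShift N) i j m n
  serre_zero := P.serre_zero (merShift N)
  serre_xPlus i j hij := by
    rw [pStar_one]
    exact P.serre_xPlus (merShift N) hij
  serre_xMinus i j hij := by
    rw [gSeriesInv_nome, gSeriesInv_nome]
    exact P.serre_xMinus (merShift N) hij

theorem fockFormulas : FockFormulas P.q P.κ P.u P.k P.fockOps where
  phiPlus_ket j n lam := diagOp_single_one _ _ lam
  phiMinus_ket j n lam := diagOp_single_one _ _ lam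
  xPlus_ket j n lam := by
    refine (P.op_add_ket _ j n lam).trans ?_
    congr!
  xMinus_ket j n lam := by
    refine (P.op_rem_ket _ j n lam).trans ?_
    congr!

theorem hasLevelZero : HasLevelZero P.q 1 1 P.fockOps := ⟨rfl, P.prodI_KPlus (merShift N)⟩

end FockData

/-! ### Induction over diagrams, and power sums -/

section Diagrams

/-- A maximal box can be removed. -/
theorem exists_removable {S : Finset (ℕ × ℕ)} (hS : IsLowerSet (S : Set (ℕ × ℕ)))
    (h : S.Nonempty) : ∃ b, Removable S b := by
  obtain ⟨b, hb⟩ := Finset.exists_maximal h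
  refine ⟨b, hb.1, ?_, Finset.notMem_erase b S, by rwa [Finset.insert_erase hb.1]⟩
  intro x y hyx hx
  rw [Finset.mem_coe, Finset.mem_erase] at hx ⊢
  refine ⟨?_, hS hyx hx.2⟩
  rintro rfl
  exact hx.1 (le_antisymm (hb.2 hx.2 hyx) hyx)

/-- Induction over Young diagrams, adding one box at a time. -/
theorem lowerSet_induction {motive : Finset (ℕ × ℕ) → Prop} (h0 : motive ∅)
    (h1 : ∀ S b, Addable S b → motive S → motive (insert b S)) :
    ∀ S : Finset (ℕ × ℕ), IsLowerSet (S : Set (ℕ × ℕ)) → motive S := by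
  intro S
  induction hn : S.card generalizing S with
  | zero =>
    intro _
    rw [Finset.card_eq_zero.mp hn]
    exact h0
  | succ n ih =>
    intro hS
    obtain ⟨b, hb⟩ := exists_removable hS (Finset.card_pos.mp (by omega))
    have h := h1 _ b hb.2 (ih _ (by rw [Finset.card_erase_of_mem hb.1, hn]; rfl) hb.2.1)
    rwa [Finset.insert_erase hb.1] at h

/-- A finite set of nonzero complex numbers is determined by its power sums. -/
theorem eq_of_sum_pow_eq {ι : Type*} [DecidableEq ι] {f : ι → ℂ} (hf : Function.Injective f)
    (h0 : ∀ i, f i ≠ 0) {S T : Finset ι}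
    (h : ∀ n : ℕ, ∑ i ∈ S, f i ^ (n + 1) = ∑ i ∈ T, f i ^ (n + 1)) : S = T := by
  have hp : ∀ r : Polynomial ℂ, ∑ i ∈ S, f i * r.eval (f i) = ∑ i ∈ T, f i * r.eval (f i) := by
    intro r
    induction r using Polynomial.induction_on' with
    | add p q hp hq => simp only [Polynomial.eval_add, mul_add, Finset.sum_add_distrib, hp, hq]
    | monomial n a =>
      have e : ∀ i, f i * (Polynomial.monomial n a).eval (f i) = a * f i ^ (n + 1) := fun i => by
        rw [Polynomial.eval_monomial]; ring
      simp only [e, ← Finset.mul_sum, h]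
  have key : ∀ S T : Finset ι, (∀ r : Polynomial ℂ, ∑ i ∈ S, f i * r.eval (f i) =
      ∑ i ∈ T, f i * r.eval (f i)) → S ⊆ T := by
    intro S T hp i hi
    by_contra hiT
    -- A polynomial that vanishes at all points except f i isolates i on the left and gives zero on
    -- the right.
    have hr := hp (∏ l ∈ (S ∪ T).erase i, (Polynomial.X - Polynomial.C (f l)))
    simp only [Polynomial.eval_prod, Polynomial.eval_sub, Polynomial.eval_X,
      Polynomial.eval_C] at hr
    rw [Finset.sum_eq_single_of_mem i hi, Finset.sum_eq_zero] at hr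
    · refine mul_ne_zero (h0 i) (Finset.prod_ne_zero_iff.mpr fun l hl => ?_) hr
      exact sub_ne_zero.mpr fun h => (Finset.mem_erase.mp hl).1 (hf h).symm
    · intro l hl
      rw [Finset.prod_eq_zero (i := l), mul_zero]
      · exact Finset.mem_erase.mpr ⟨fun h => hiT (h ▸ hl), Finset.mem_union_right _ hl⟩
      · exact sub_self _
    · intro l hl hli
      rw [Finset.prod_eq_zero (i := l), mul_zero]
      · exact Finset.mem_erase.mpr ⟨hli, Finset.mem_union_left _ hl⟩
      · exact sub_self _
  exact Finset.Subset.antisymm (key S T hp) (key T S fun r => (hp r).symm)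

end Diagrams

/-! ### Separation of diagrams, and coefficients that are units -/

namespace FockData

variable {N : ℕ} (P : FockData N)

section Separation

/-- The total change of the eigenvalues of degree `l` under adding a box at position `1`. -/
def boxFactor (l : ℤ) : ℂ :=
  (qnum P.q (2 * l) + qnum P.q (-l) * (P.κ ^ l + P.κ ^ (-l))) / l

/-- Up to l(q - q⁻¹) it equals (q^l - q^{-l})(q^l - κ^l)(1 - q^{-l}κ^{-l}), and no factor vanishes
for generic q and κ. -/
theorem boxFactor_ne_zero {l : ℤ} (hl : l ≠ 0) : P.boxFactor l ≠ 0 := by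
  have hq := P.hq
  have hκ := P.hκ
  have h1 : P.q ^ l - P.q ^ (-l) ≠ 0 := by
    intro h
    have : P.q ^ (2 * l) * P.κ ^ (0 : ℤ) = 1 := by
      rw [zpow_zero, mul_one, two_mul, zpow_add₀ hq]
      nth_rewrite 1 [sub_eq_zero.mp h]
      rw [← zpow_add₀ hq, neg_add_cancel, zpow_zero]
    have := (P.hgen _ _ this).1
    omega
  have h2 : P.q ^ l - P.κ ^ l ≠ 0 := by
    intro h
    have : P.q ^ l * P.κ ^ (-l) = 1 := by
      rw [sub_eq_zero.mp h, ← zpow_add₀ hκ, add_neg_cancel, zpow_zero]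
    exact hl (P.hgen _ _ this).1
  have h3 : 1 - P.q ^ (-l) * P.κ ^ (-l) ≠ 0 := by
    intro h
    have := (P.hgen _ _ (sub_eq_zero.mp h).symm).1
    omega
  have e : P.boxFactor l = (P.q ^ l - P.q ^ (-l)) * ((P.q ^ l - P.κ ^ l) *
      (1 - P.q ^ (-l) * P.κ ^ (-l))) / (P.q - P.q⁻¹) / l := by
    rw [boxFactor, qnum, qnum, neg_neg, two_mul, neg_add, zpow_add₀ hq, zpow_add₀ hq, div_mul_eq_mul_div,
      ← add_div]
    have a1 : P.q ^ l * P.q ^ (-l) = 1 := by rw [← zpow_add₀ hq, add_neg_cancel, zpow_zero]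
    have a2 : P.κ ^ l * P.κ ^ (-l) = 1 := by rw [← zpow_add₀ hκ, add_neg_cancel, zpow_zero]
    congr 2
    linear_combination (P.q ^ l - P.q ^ (-l)) * (P.κ ^ (-l) * a1 - P.q ^ (-l) * a2)
  rw [e]
  exact div_ne_zero (div_ne_zero (mul_ne_zero h1 (mul_ne_zero h2 h3)) P.q_sub_inv_ne_zero)
    (Int.cast_ne_zero.mpr hl)

/-- Only the colour of the box and its two neighbours contribute, and the total does not depend on
the colour. Summing over j thus removes the colours from the problem. -/
theorem sum_qnum_cartan [NeZero N] (l : ℤ) (c : ZMod N) :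
    ∑ j : ZMod N, qnum P.q (cartan N j c * l) / l * P.κ ^ (-(l * mMat N j c)) =
      P.boxFactor l := by
  have hN := P.hN
  have d1 : c ≠ c + 1 := (add_one_ne hN c).symm
  have d2 : c ≠ c - 1 := fun h => add_one_ne hN c (eq_sub_iff_add_eq.mp h)
  have d3 : c + 1 ≠ c - 1 := fun h => add_one_add_one_ne hN c (by rw [h]; ring)
  have hsub : ∑ j ∈ ({c, c + 1, c - 1} : Finset (ZMod N)),
      qnum P.q (cartan N j c * l) / l * P.κ ^ (-(l * mMat N j c)) =
      ∑ j : ZMod N, qnum P.q (cartan N j c * l) / l * P.κ ^ (-(l * mMat N j c)) := by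
    refine Finset.sum_subset (Finset.subset_univ _) fun j _ hj => ?_
    simp only [Finset.mem_insert, Finset.mem_singleton, not_or] at hj
    rw [cartan_of_ne hj.1 hj.2.1 fun h => hj.2.2 (by rw [h]; ring), zero_mul, qnum]
    simp
  have hpred : cartan N (c - 1) c = -1 := by
    have h := cartan_pred hN (c - 1)
    rwa [sub_add_cancel] at h
  have hmpred : mMat N (c - 1) c = -1 := by
    have h := mMat_pred hN (c - 1)
    rwa [sub_add_cancel] at h
  rw [← hsub, Finset.sum_insert (by simp [d1, d2]), Finset.sum_insert (by simpa using d3),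
    Finset.sum_singleton, cartan_self hN, mMat_self, cartan_succ hN, mMat_succ hN, hpred, hmpred,
    boxFactor]
  simp only [mul_zero, neg_zero, zpow_zero, mul_one, mul_neg, neg_neg, neg_mul, one_mul]
  ring

/-- Build the diagram box by box: each box adds the same multiple of the l-th power of its position.
-/
theorem sum_alphaEig [NeZero N] {l : ℤ} (hl : l ≠ 0) {S : Finset (ℕ × ℕ)}
    (hS : IsLowerSet (S : Set (ℕ × ℕ))) :
    ∑ j : ZMod N, P.alphaEig j l S =
      ∑ j : ZMod N, P.alphaEig j l ∅ + P.boxFactor l * ∑ b ∈ S, P.pos b ^ l := by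
  refine lowerSet_induction (motive := fun S => ∑ j : ZMod N, P.alphaEig j l S =
    ∑ j : ZMod N, P.alphaEig j l ∅ + P.boxFactor l * ∑ b ∈ S, P.pos b ^ l) ?_ ?_ S hS
  · simp
  · intro S b hb ih
    simp only [P.alphaEig_insert _ hl hb]
    rw [Finset.sum_add_distrib, ih, ← Finset.sum_mul, sum_qnum_cartan, Finset.sum_insert hb.2.1]
    ring

/-- The joint eigenvalues separate Young diagrams. -/
theorem exists_alphaEig_ne [NeZero N] {y y' : YoungDiagram} (h : y ≠ y') :
    ∃ j l, l ≠ 0 ∧ P.alphaEig j l y.cells ≠ P.alphaEig j l y'.cells := by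
  by_contra! hc
  refine h (YoungDiagram.ext (eq_of_sum_pow_eq P.pos_injective P.pos_ne_zero fun n => ?_))
  have hl : ((n + 1 : ℕ) : ℤ) ≠ 0 := by omega
  have e := Finset.sum_congr rfl fun (j : ZMod N) (_ : j ∈ Finset.univ) => hc j _ hl
  rw [P.sum_alphaEig hl y.isLowerSet, P.sum_alphaEig hl y'.isLowerSet] at e
  have e' := mul_left_cancel₀ (P.boxFactor_ne_zero hl) (add_left_cancel e)
  simpa only [zpow_natCast] using e'

end Separation

section Coefficients

theorem constantCoeff_facR_ne_zero {r c r' c' : ℤ} (h1 : ¬(r + 1 = r' ∧ c = c'))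
    (h2 : ¬(r = r' ∧ c - 1 = c')) :
    PowerSeries.constantCoeff (P.facR r c (P.posZ r' c')) ≠ 0 := by
  rw [facR, map_mul, map_mul, PowerSeries.constantCoeff_inv, constantCoeff_theta,
    constantCoeff_theta, cst, PowerSeries.constantCoeff_C]
  exact mul_ne_zero (mul_ne_zero P.hq (sub_ne_zero.mpr (P.posZ_ne h1).symm))
    (inv_ne_zero (sub_ne_zero.mpr (P.posZ_ne h2).symm))

theorem constantCoeff_facA_ne_zero {r c r' c' : ℤ} (h1 : ¬(r - 1 = r' ∧ c - 1 = c'))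
    (h2 : ¬(r = r' ∧ c = c')) :
    PowerSeries.constantCoeff (P.facA r c (P.posZ r' c')) ≠ 0 := by
  rw [facA, map_mul, map_mul, PowerSeries.constantCoeff_inv, constantCoeff_theta,
    constantCoeff_theta, cst, PowerSeries.constantCoeff_C]
  exact mul_ne_zero (mul_ne_zero (inv_ne_zero P.hq) (sub_ne_zero.mpr (P.posZ_ne h1).symm))
    (inv_ne_zero (sub_ne_zero.mpr (P.posZ_ne h2).symm))

theorem constantCoeff_psi_ne_zero (j : ZMod N) {s a : ℕ} {r c : ℤ} (hs : (s : ℤ) ≠ r)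
    (h1 : ¬((s : ℤ) + 1 = r ∧ (a : ℤ) = c)) (h2 : ¬((s : ℤ) - 1 = r ∧ (a : ℤ) - 1 = c)) :
    PowerSeries.constantCoeff (P.psi j s a (P.posZ r c)) ≠ 0 := by
  rw [psi, map_mul]
  refine mul_ne_zero ?_ ?_
  · split_ifs
    · exact P.constantCoeff_facR_ne_zero h1 fun h => hs h.1
    · simp
  · split_ifs
    · exact P.constantCoeff_facA_ne_zero h2 fun h => hs h.1
    · simp

theorem constantCoeff_constC (q : ℂ) (ε : ℤ) : PowerSeries.constantCoeff (constC q ε) = 1 := by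
  rw [constC, map_mul, PowerSeries.constantCoeff_inv, qPoch_eq_qPochR, qPoch_eq_qPochR,
    constantCoeff_qPochR, constantCoeff_qPochR, nome]
  simp

/-- At p = 0 a theta is 1 - x. The rows above an addable box reach beyond its column, so none of
their factors has its zero or pole at its position. -/
theorem constantCoeff_addCoeff_ne_zero {S : Finset (ℕ × ℕ)} {b : ℕ × ℕ} (hb : Addable S b) :
    PowerSeries.constantCoeff (P.addCoeff S b) ≠ 0 := by
  rw [addCoeff, if_pos hb, map_mul, constantCoeff_constC, one_mul, map_prod]
  refine Finset.prod_ne_zero_iff.mpr fun s hs => ?_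
  rw [Finset.mem_range] at hs
  have hlt : b.2 < rl S s := by
    have h : (s, b.2) ∈ insert b S :=
      hb.2.2 (Prod.mk_le_mk.mpr ⟨hs.le, le_rfl⟩) (Finset.mem_insert_self b S)
    have hne : (s, b.2) ≠ b := fun h => hs.ne (congrArg Prod.fst h)
    exact (mem_iff_lt_rl hb.1 (s, b.2)).mp ((Finset.mem_insert.mp h).resolve_left hne)
  exact P.constantCoeff_psi_ne_zero _ (by omega) (by omega) (by omega)

/-- The rows below a removable box end before or at its left edge, so again no factor has its zero
or pole at its position. -/
theorem constantCoeff_remCoeff_ne_zero {S : Finset (ℕ × ℕ)} {b : ℕ × ℕ} (hb : Removable S b) :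
    PowerSeries.constantCoeff (P.remCoeff S b) ≠ 0 := by
  have hS := hb.lower
  have hrow := fst_lt_rows hS hb.1
  rw [remCoeff, if_pos hb, map_mul, constantCoeff_constC, one_mul, tail, map_mul, map_prod]
  refine mul_ne_zero (Finset.prod_ne_zero_iff.mpr fun s hs => ?_) ?_
  · rw [Finset.mem_Ico] at hs
    have hle : rl S s ≤ b.2 := by
      by_contra h
      have hm : (s, b.2) ∈ S := (mem_iff_lt_rl hS (s, b.2)).mpr (by simpa using h)
      have hne : (s, b.2) ≠ b := fun h => by
        have := congrArg Prod.fst h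
        simp only at this
        omega
      have hb' : b ∈ S.erase b := hb.2.1
        (show b ≤ (s, b.2) from Prod.mk_le_mk.mpr ⟨by omega, le_rfl⟩) (Finset.mem_erase.mpr ⟨hne, hm⟩)
      exact Finset.notMem_erase b S hb'
    exact P.constantCoeff_psi_ne_zero _ (by omega) (by omega) (by omega)
  · split_ifs
    · exact P.constantCoeff_facA_ne_zero (by omega) (by omega)
    · simp

end Coefficients

end FockData

/-! ### Submodules stable under diagonal operators with separating eigenvalues -/

section Separate

variable {A : Type*} [CommRing A] [Algebra ℂ⟦X⟧ A] {Y : Type*}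

theorem diagOp_id_apply (e : Y → ℂ⟦X⟧) (v : Y →₀ A) (y : Y) :
    diagOp (AlgHom.id ℂ⟦X⟧ A) e v y = e y • v y := by
  classical
  induction v using Finsupp.induction_linear with
  | zero => simp
  | add v w hv hw => rw [map_add, Finsupp.add_apply, Finsupp.add_apply, hv, hw, smul_add]
  | single z g =>
    rw [isDiag_diagOp e z g, Finsupp.smul_apply]
    by_cases h : z = y
    · rw [h]
    · rw [Finsupp.single_eq_of_ne (Ne.symm h), smul_zero, smul_zero]

/-- A submodule stable under diagonal operators with separating eigenvalues contains the
components of its elements. -/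
theorem single_mem_of_diagOp {ι : Type*} {e : ι → Y → ℂ} (W : Submodule A (Y →₀ A))
    (hW : ∀ i, ∀ v ∈ W, diagOp (AlgHom.id ℂ⟦X⟧ A) (fun y => cst (e i y)) v ∈ W)
    (he : ∀ y y', y ≠ y' → ∃ i, e i y ≠ e i y') {v : Y →₀ A} (hv : v ∈ W) (y : Y) :
    Finsupp.single y (v y) ∈ W := by
  classical
  -- Coordinates are killed one at a time, keeping the coordinate y and never creating new nonzero
  -- ones.
  have key : ∀ s : Finset Y, y ∉ s → ∃ w ∈ W, w y = v y ∧ (∀ z ∈ s, w z = 0) ∧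
      ∀ z, v z = 0 → w z = 0 := by
    intro s
    induction s using Finset.induction_on with
    | empty => exact fun _ => ⟨v, hv, rfl, fun z hz => absurd hz (Finset.notMem_empty z),
        fun _ h => h⟩
    | insert t s _ ih =>
      intro hy
      rw [Finset.mem_insert, not_or] at hy
      obtain ⟨w, hw, h1, h2, h3⟩ := ih hy.2
      obtain ⟨i, hi⟩ := he y t hy.1
      have happ : ∀ z, (cst (e i y - e i t)⁻¹ •
          (diagOp (AlgHom.id ℂ⟦X⟧ A) (fun y => cst (e i y)) w - cst (e i t) • w)) z =
          cst ((e i y - e i t)⁻¹ * (e i z - e i t)) • w z := by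
        intro z
        rw [Finsupp.smul_apply, Finsupp.sub_apply, Finsupp.smul_apply, diagOp_id_apply, ← sub_smul,
          smul_smul, ← cst_sub, ← cst_mul]
      -- The Lagrange factor (T - e(t))/(e(y) - e(t)) for the operator T with eigenvalues e kills
      -- the coordinate t and fixes the coordinate y. Division is possible because the eigenvalues
      -- are complex numbers.
      refine ⟨_, W.smul_of_tower_mem (cst (e i y - e i t)⁻¹)
        (W.sub_mem (hW i w hw) (W.smul_of_tower_mem (cst (e i t)) hw)), ?_, ?_, ?_⟩
      · rw [happ, inv_mul_cancel₀ (sub_ne_zero.mpr hi), cst_one, one_smul, h1]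
      · intro z hz
        rw [happ]
        rcases Finset.mem_insert.mp hz with rfl | hz
        · rw [sub_self, mul_zero, cst_zero, zero_smul]
        · rw [h2 z hz, smul_zero]
      · intro z hz
        rw [happ, h3 z hz, smul_zero]
  obtain ⟨w, hw, h1, h2, h3⟩ := key (v.support.erase y) (Finset.notMem_erase _ _)
  have : Finsupp.single y (v y) = w := by
    ext z
    by_cases hz : y = z
    · rw [← hz, Finsupp.single_eq_same, h1]
    · rw [Finsupp.single_eq_of_ne (Ne.symm hz)]
      by_cases hv0 : v z = 0
      · exact (h3 z hv0).symm
      · exact (h2 z (Finset.mem_erase.mpr ⟨Ne.symm hz, Finsupp.mem_support_iff.mpr hv0⟩)).symm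
  rwa [this]

theorem ketS_apply {A : Type*} [CommRing A] (S : Finset (ℕ × ℕ)) (y : YoungDiagram) :
    ketS A S y = if S = y.cells then 1 else 0 := by
  split_ifs with h
  · rw [h, ketS_cells, Finsupp.single_eq_same]
  · by_cases hS : IsLowerSet (S : Set (ℕ × ℕ))
    · have h1 : ketS A S = Finsupp.single ⟨S, hS⟩ 1 := ketS_cells (A := A) ⟨S, hS⟩
      rw [h1, Finsupp.single_eq_of_ne]
      exact fun h2 => h (congrArg YoungDiagram.cells h2).symm
    · rw [ketS_of_not hS, Finsupp.zero_apply]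

end Separate

/-! ### Stable submodules: from any diagram to any other -/

namespace FockData

variable {N : ℕ} (P : FockData N) {A : Type*} [CommRing A] [Algebra ℂ⟦X⟧ A]
  (s : ShiftAction N A)

/-- The part of the stability under the generators that is needed for the irreducibility. -/
structure Stable (W : Submodule A (YoungDiagram →₀ A)) : Prop where
  alpha : ∀ v ∈ W, ∀ j l, l ≠ 0 → (P.ops s).alpha j l v ∈ W
  xPlus : ∀ v ∈ W, ∀ j, (P.ops s).xPlus j 0 v ∈ W
  xMinus : ∀ v ∈ W, ∀ j, (P.ops s).xMinus j 0 v ∈ W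

variable {P s} {W : Submodule A (YoungDiagram →₀ A)}

theorem Stable.single_mem [NeZero N] (hW : P.Stable s W) {v : YoungDiagram →₀ A} (hv : v ∈ W)
    (y : YoungDiagram) : Finsupp.single y (v y) ∈ W := by
  refine single_mem_of_diagOp (ι := ZMod N × {l : ℤ // l ≠ 0})
    (e := fun i y => P.alphaEig i.1 i.2.1 y.cells) W (fun i w hw => ?_) (fun y y' h => ?_) hv y
  · have h := hW.alpha w hw i.1 i.2.1 i.2.2
    simp only [ops] at h
    exact h
  obtain ⟨j, l, hl, h⟩ := P.exists_alphaEig_ne h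
  exact ⟨(j, ⟨l, hl⟩), h⟩

theorem mem_of_unit_smul {c : ℂ⟦X⟧} (hc : PowerSeries.constantCoeff c ≠ 0) {v : YoungDiagram →₀ A}
    (h : c • v ∈ W) : v ∈ W := by
  have h1 := W.smul_of_tower_mem c⁻¹ h
  rwa [smul_smul, PowerSeries.inv_mul_cancel _ hc, one_smul] at h1

/-- When no other box leads to the same diagram, the component there is a single coefficient; in
mode 0 the power of the position is 1. -/
theorem op_ketS_apply {D : StepData N} (σ : A →ₐ[ℂ⟦X⟧] A) (b : ℕ × ℕ) {S : Finset (ℕ × ℕ)}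
    {y : YoungDiagram} (hy : y.cells = D.st S b) (hb : D.c S b ≠ 0)
    (hinj : ∀ z, D.c S z ≠ 0 → D.st S z = D.st S b → z = b) :
    D.op σ (D.col b) 0 (ketS A S) y = D.c S b • (1 : A) := by
  rw [D.op_ketS σ _ 0 S (Nat.lt_succ_self _), Finsupp.finsetSum_apply,
    Finset.sum_eq_single_of_mem b (D.mem_boxes S b hb)]
  · rw [Finsupp.smul_apply, ketS_apply, if_pos hy.symm, StepData.wt, if_pos rfl, zpow_zero,
      cst_one, one_mul]
  · intro z _ hz
    rw [Finsupp.smul_apply, ketS_apply]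
    by_cases hc : D.c S z = 0
    · rw [D.wt_eq_zero hc, zero_smul]
    · rw [if_neg fun h => hz (hinj z hc (h.trans hy)), smul_zero]

/-- Apply the mode 0 of the current, project to the wanted diagram, and divide by the coefficient,
which is a unit of ℂ[[p]]. The power of p does not grow. -/
theorem smul_ketS_mem_step [NeZero N] (hW : P.Stable s W) {D : StepData N} {σ : A →ₐ[ℂ⟦X⟧] A}
    {b : ℕ × ℕ} (hD : ∀ v ∈ W, D.op σ (D.col b) 0 v ∈ W) {S : Finset (ℕ × ℕ)}
    (hc : PowerSeries.constantCoeff (D.c S b) ≠ 0)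
    (hinj : ∀ z, D.c S z ≠ 0 → D.st S z = D.st S b → z = b) {n : ℕ}
    (h : nome ^ n • ketS A S ∈ W) : nome ^ n • ketS A (D.st S b) ∈ W := by
  have hb : D.c S b ≠ 0 := fun h => hc (by rw [h, map_zero])
  have hlow := D.lower_st S b hb
  have hk : ketS A (D.st S b) = Finsupp.single ⟨D.st S b, hlow⟩ 1 :=
    ketS_cells (A := A) ⟨D.st S b, hlow⟩
  have h1 := hW.single_mem (hD _ h) ⟨D.st S b, hlow⟩
  rw [map_smul, Finsupp.smul_apply, op_ketS_apply σ b rfl hb hinj, ← Finsupp.smul_single,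
    ← Finsupp.smul_single, ← hk, smul_comm] at h1
  exact mem_of_unit_smul hc h1

theorem Stable.insert_mem [NeZero N] (hW : P.Stable s W) {S : Finset (ℕ × ℕ)} {b : ℕ × ℕ}
    (hb : Addable S b) {n : ℕ} (h : nome ^ n • ketS A S ∈ W) :
    nome ^ n • ketS A (insert b S) ∈ W := by
  refine smul_ketS_mem_step hW (D := P.addData) (fun v hv => hW.xPlus v hv (P.col b))
    (P.constantCoeff_addCoeff_ne_zero hb) (fun z hz hzb => ?_) h
  have hz' : Addable S z := P.addable_of_addCoeff hz
  have hmem : z ∈ insert b S := by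
    rw [← show insert z S = insert b S from hzb]
    exact Finset.mem_insert_self z S
  exact (Finset.mem_insert.mp hmem).resolve_right hz'.2.1

theorem Stable.erase_mem [NeZero N] (hW : P.Stable s W) {S : Finset (ℕ × ℕ)} {b : ℕ × ℕ}
    (hb : Removable S b) {n : ℕ} (h : nome ^ n • ketS A S ∈ W) :
    nome ^ n • ketS A (S.erase b) ∈ W := by
  refine smul_ketS_mem_step hW (D := P.remData) (fun v hv => hW.xMinus v hv (P.col b))
    (P.constantCoeff_remCoeff_ne_zero hb) (fun z hz hzb => ?_) h
  have hz' : Removable S z := P.removable_of_remCoeff hz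
  by_contra hne
  have hmem : z ∈ S.erase z := by
    rw [show S.erase z = S.erase b from hzb]
    exact Finset.mem_erase.mpr ⟨hne, hz'.1⟩
  exact Finset.notMem_erase z S hmem

theorem Stable.ketS_mem [NeZero N] (hW : P.Stable s W) {n : ℕ} (h : nome ^ n • ketS A ∅ ∈ W)
    {S : Finset (ℕ × ℕ)} (hS : IsLowerSet (S : Set (ℕ × ℕ))) : nome ^ n • ketS A S ∈ W :=
  lowerSet_induction (motive := fun S => nome ^ n • ketS A S ∈ W) h
    (fun _ _ hb ih => hW.insert_mem hb ih) S hS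

theorem Stable.ketS_empty_mem [NeZero N] (hW : P.Stable s W) {n : ℕ} {S : Finset (ℕ × ℕ)}
    (hS : IsLowerSet (S : Set (ℕ × ℕ))) (h : nome ^ n • ketS A S ∈ W) :
    nome ^ n • ketS A ∅ ∈ W := by
  refine lowerSet_induction (motive := fun S => nome ^ n • ketS A S ∈ W →
    nome ^ n • ketS A ∅ ∈ W) id (fun S b hb ih h => ih ?_) S hS h
  have h1 := hW.erase_mem hb.removable h
  rwa [Finset.erase_insert hb.2.1] at h1

theorem Stable.smul_mem [NeZero N] (hW : P.Stable s W) {n : ℕ} (h : nome ^ n • ketS A ∅ ∈ W)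
    (v : YoungDiagram →₀ A) : nome ^ n • v ∈ W := by
  induction v using Finsupp.induction_linear with
  | zero => rw [smul_zero]; exact W.zero_mem
  | add v w hv hw => rw [smul_add]; exact W.add_mem hv hw
  | single y g =>
    have h1 := W.smul_mem g (hW.ketS_mem h y.isLowerSet)
    rwa [ketS_cells, smul_comm, Finsupp.smul_single, smul_eq_mul, mul_one] at h1

/-- Take one nonzero component of an element of W, reduce its coefficient to a power of p, walk down
to the empty diagram and then up to every other one. -/
theorem Stable.exists_nome_pow_smul_mem [NeZero N] (hW : P.Stable s W) (h0 : W ≠ ⊥)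
    (hA : ∀ a : A, a ≠ 0 → ∃ (n : ℕ) (b : A), b * a = nome ^ n • (1 : A)) (v : YoungDiagram →₀ A) :
    ∃ n : ℕ, nome ^ n • v ∈ W := by
  obtain ⟨w, hw, hw0⟩ := W.ne_bot_iff.mp h0
  obtain ⟨y, hy⟩ := Finsupp.ne_iff.mp hw0
  obtain ⟨n, b, hb⟩ := hA (w y) hy
  have h1 := W.smul_mem b (hW.single_mem hw y)
  rw [Finsupp.smul_single, smul_eq_mul, hb, ← Finsupp.smul_single, ← ketS_cells] at h1
  exact ⟨n, hW.smul_mem (hW.ketS_empty_mem y.isLowerSet h1) v⟩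

theorem Stable.eq_top [NeZero N] (hW : P.Stable s W) (h : ketS A ∅ ∈ W) : W = ⊤ := by
  refine (Submodule.eq_top_iff').mpr fun v => ?_
  have h1 := hW.smul_mem (n := 0) (by rwa [pow_zero, one_smul]) v
  rwa [pow_zero, one_smul] at h1

end FockData

/-- A nonzero series over a field is a power of p times a unit. -/
theorem exists_mul_eq_nome_pow_smul {F : Type*} [Field F] [Algebra ℂ F] {a : F⟦X⟧} (ha : a ≠ 0) :
    ∃ (n : ℕ) (b : F⟦X⟧), b * a = nome ^ n • (1 : F⟦X⟧) := by
  obtain ⟨b, hb⟩ := (PowerSeries.isUnit_divided_by_X_pow_order ha).exists_left_inv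
  refine ⟨a.order.toNat, b, ?_⟩
  rw [Algebra.smul_def, map_pow, mul_one]
  have h1 : algebraMap ℂ⟦X⟧ F⟦X⟧ nome = PowerSeries.X := PowerSeries.map_X _
  rw [h1]
  nth_rewrite 1 [← PowerSeries.X_pow_order_mul_divXPowOrder (f := a)]
  rw [mul_left_comm, hb, mul_one]

/-- Only the addable end of row 0 contributes for the empty diagram, and q₁⁻¹q₃⁻¹ = q². -/
theorem phiEigen_bot {q κ : ℂ} (hκ : κ ≠ 0) (u : ℂ) {N : ℕ} (k j : ZMod N)
    (T : LaurentSeries ℂ) :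
    phiEigen laurentC q κ u k j ⊥ T = lowestEigen laurentC q u k j T := by
  classical
  have hcol : (⊥ : YoungDiagram).colLen 0 = 0 := by
    rw [← rows_cells]
    rfl
  have hrow : (⊥ : YoungDiagram).rowLen 0 = 0 := by
    rw [← rl_cells]
    rfl
  have hU : rowU q κ u ⊥ 0 = u := by rw [rowU, hrow, pow_zero, pow_zero, one_mul, one_mul]
  have hcond : condA k j ⊥ 0 ↔ j = k := by
    rw [condA, hrow, Nat.cast_zero, zero_add, zero_add, add_comm j 1, add_right_inj]
  have hq2 : (q1 q κ)⁻¹ * (q3 q κ)⁻¹ * u = q ^ 2 * u := by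
    rw [q1, q3, mul_inv, mul_inv, inv_inv, inv_inv]
    have : κ⁻¹ * q * (κ * q) = κ⁻¹ * κ * q ^ 2 := by ring
    rw [this, inv_mul_cancel₀ hκ, one_mul]
  rw [phiEigen, lowestEigen, hcol, Finset.range_zero, Finset.filter_empty, Finset.prod_empty,
    one_mul, zero_add, Finset.range_one, Finset.filter_singleton]
  by_cases h : j = k
  · rw [if_pos (hcond.mpr h), if_pos h, Finset.prod_singleton, hU, hq2]
  · rw [if_neg (mt hcond.mp h), if_neg h, Finset.prod_empty]

namespace FockData

variable {N : ℕ} (P : FockData N) [NeZero N]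

theorem stable_of_invariant {W : Submodule (MerField N)⟦X⟧ (Fock N)}
    (hW : Invariant P.fockOps W) : P.Stable (merShift N) W :=
  ⟨fun v hv j l hl => (hW v hv j).1 l hl, fun v hv j => ((hW v hv j).2.1 0).1,
    fun v hv j => ((hW v hv j).2.1 0).2⟩

theorem isIrreducible : IsIrreducible P.fockOps :=
  ⟨inferInstance, fun _ hW h0 v => (P.stable_of_invariant hW).exists_nome_pow_smul_mem h0
    (fun _ ha => exists_mul_eq_nome_pow_smul ha) v⟩

theorem isLowestWeight : IsLowestWeight P.fockOps (ket N ⊥)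
    (fun j => expandPlus (lowestEigen laurentC P.q P.u P.k j))
    (fun j => expandMinus (lowestEigen laurentC P.q P.u P.k j)) where
  ne_zero := Finsupp.single_ne_zero.mpr one_ne_zero
  xMinus_eq_zero j n := by
    rw [P.fockFormulas.xMinus_ket, ← rows_cells]
    rfl
  phiPlus_eq j n := by
    rw [P.fockFormulas.phiPlus_ket, funext (phiEigen_bot P.hκ P.u P.k j)]
  phiMinus_eq j n := by
    rw [P.fockFormulas.phiMinus_ket, funext (phiEigen_bot P.hκ P.u P.k j)]
  generates W hW h := by
    refine (P.stable_of_invariant hW).eq_top ?_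
    have h1 : ketS (MerField N)⟦X⟧ ∅ = ket N ⊥ := ketS_cells ⊥
    rwa [h1]

end FockData

end

end EllTor

theorem mainTheorem6 (N : ℕ) [NeZero N] (hN : 3 ≤ N) (q κ u : ℂ) (hq : q ≠ 0) (hκ : κ ≠ 0)
    (hu : u ≠ 0) (hgen : ∀ m n : ℤ, q ^ m * κ ^ n = 1 → m = 0 ∧ n = 0) (k : ZMod N) :
    ∃ ρ : EllTor.ToroidalOps N (EllTor.Fock N),
      EllTor.IsRep q κ 1 ρ ∧
      EllTor.FockFormulas q κ u k ρ ∧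
      EllTor.HasLevelZero q 1 1 ρ ∧
      EllTor.IsIrreducible ρ ∧
      EllTor.IsLowestWeight ρ (EllTor.ket N ⊥)
        (fun j => EllTor.expandPlus (EllTor.lowestEigen EllTor.laurentC q u k j))
        (fun j => EllTor.expandMinus (EllTor.lowestEigen EllTor.laurentC q u k j)) := by
  let P : EllTor.FockData N := ⟨q, κ, u, k, hN, hq, hκ, hu, hgen⟩
  exact ⟨P.fockOps, P.isRep, P.fockFormulas, P.hasLevelZero, P.isIrreducible, P.isLowestWeight⟩
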